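/- **Theorem 2.** Let $n\ge 2$ be even, $k\ge 3$ an integer, $A=i\,e^{-\pi i/(2k)}$ (so $A^{-4}=e^{2\pi i/k}$), and $d=-A^2-A^{-2}=2\cos(\pi/k)$. Let $B$ be an $n$-strand braid given as a word of $m\ge 0$ crossings $\sigma_i^{\pm1}$ ($1\le i\le n-1$), and let $B^{pl}$ be its plat closure, i.e. the link diagram obtained by joining, both at the top and at the bottom, the ends in positions $2a-1$ and $2a$ for $1\le a\le n/2$, with a given orientation. Its Jones polynomial is $$V_{B^{pl}}(A^{-4})=(-A)^{3w(B^{pl})}\sum_{\sigma}\Big(\prod_{c}A^{\pm1}\Big)d^{|\sigma|-1}.$$ The sum is over all states $\sigma$, which replace each crossing $c$ by a capcup (a cup above a cap) or by two vertical strands. A crossing $\sigma_i$ contributes $A$ for a capcup and $A^{-1}$ for vertical strands, a crossing $\sigma_i^{-1}$ contributes $A^{-1}$ and $A$ respectively. $|\sigma|$ is the number of closed loops of the state. The writhe $w$ is the sum of the signs of the crossings: $\sigma_i$ has sign $+1$ if its two strands run in the same vertical direction and $-1$ otherwise, and $\sigma_i^{-1}$ has the opposite sign. Put $\lambda_\ell=\sin(\pi\ell/k)$.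 Let $P_{n,k,\ell}$ be the set of $n$-step nearest-neighbour paths on the sites $1,\dots,k-1$ that start at $1$ and end at $\ell$, written as bit strings ($1$ = right, $0$ = left), let $\mathcal H_{n,k,\ell}\subseteq(\mathbb C^2)^{\otimes n}$ be the span of the corresponding computational basis states, and let $$N=\sum_{\ell=1}^{k-1}\lambda_\ell\dim\mathcal H_{n,k,\ell}.$$ Then for every inverse polynomial $\varepsilon=\varepsilon(n,m,k)>0$ and every polynomial $p$ with natural coefficients there is a quantum algorithm (a fixed program for a classical computer that controls a quantum computer by applying elementary gates and measuring qubits) which, on input $B$, the orientation and $k$, always halts in time polynomial in $n,m,k$, and which with probability at least $1-2^{-p(n,m,k)}$ outputs a complex number $r$ with $$\big|r-V_{B^{pl}}(e^{2\pi i/k})\big|<\varepsilon\,\frac{d^{3n/2}}{N}.$$ -/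

import Mathlib

section

open Complex

/-! ## Braids, plat closures, Kauffman bracket, Jones polynomial -/

/-- A crossing in an `n`-strand braid diagram: the generator `σ` (if `pos`) or its inverse, acting
on the adjacent positions `i` and `i + 1`, where positions are `0, …, n - 1` from left to right. -/
structure Crossing (n : ℕ) where
  i : ℕ
  hi : i + 1 < n
  pos : Bool

namespace Crossing

/-- Left position of a crossing. -/
def left {n : ℕ} (c : Crossing n) : Fin n := ⟨c.i, Nat.lt_of_succ_lt c.hi⟩

/-- Right position of a crossing. -/
def right {n : ℕ} (c : Crossing n) : Fin n := ⟨c.i + 1, c.hi⟩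

end Crossing

/-- A braid with `n` strands, given by its crossings from top to bottom. -/
abbrev BraidWord (n : ℕ) := List (Crossing n)

/-- The arcs of the diagram obtained from the plat closure of `B` when each crossing `j` is replaced
by a capcup (`s j = true`) or by two vertical strands (`s j = false`). The point `(j, p)` is the
point at position `p` just above crossing `j` (level `B.length` is the bottom bar). -/
inductive PlatArc {n : ℕ} (B : BraidWord n) (s : Fin B.length → Bool) :
    Fin (B.length + 1) × Fin n → Fin (B.length + 1) × Fin n → Prop
  | top (p q : Fin n) (hp : Even p.val) (hq : q.val = p.val + 1) : PlatArc B s (0, p) (0, q)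
  | bottom (p q : Fin n) (hp : Even p.val) (hq : q.val = p.val + 1) :
      PlatArc B s (Fin.last _, p) (Fin.last _, q)
  | strand (j : Fin B.length) (p : Fin n)
      (h : s j = false ∨ (p ≠ (B.get j).left ∧ p ≠ (B.get j).right)) :
      PlatArc B s (j.castSucc, p) (j.succ, p)
  | cup (j : Fin B.length) (h : s j = true) :
      PlatArc B s (j.castSucc, (B.get j).left) (j.castSucc, (B.get j).right)
  | cap (j : Fin B.length) (h : s j = true) :
      PlatArc B s (j.succ, (B.get j).left) (j.succ, (B.get j).right)

/-- The number of closed loops of a state: connected components of the union of its arcs. -/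
noncomputable def platLoops {n : ℕ} (B : BraidWord n) (s : Fin B.length → Bool) : ℕ :=
  Nat.card (Quot (PlatArc B s))

/-- The loop value `d = -A² - A⁻²`. -/
noncomputable def loopValue (A : ℂ) : ℂ := -A ^ 2 - A⁻¹ ^ 2

/-- The factor of one crossing in a state: a positive crossing is `A · capcup + A⁻¹ · id`, a negative
one is `A⁻¹ · capcup + A · id`. -/
noncomputable def crossingFactor (A : ℂ) (pos capcup : Bool) : ℂ := if pos = capcup then A else A⁻¹

/-- The Kauffman bracket (state sum) of the plat closure of `B`. -/
noncomputable def platBracket {n : ℕ} (B : BraidWord n) (A : ℂ) : ℂ :=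
  ∑ s : Fin B.length → Bool,
    (∏ j, crossingFactor A (B.get j).pos (s j)) * loopValue A ^ ((platLoops B s : ℤ) - 1)

/-- Directions (`true` = downwards) of the strands just below a crossing, given the directions just
above it: the two strands exchange positions. -/
def Crossing.push {n : ℕ} (c : Crossing n) (o : Fin n → Bool) : Fin n → Bool :=
  o ∘ Equiv.swap c.left c.right

/-- Directions of the strands at the bottom bar. -/
def bottomDirs {n : ℕ} : BraidWord n → (Fin n → Bool) → (Fin n → Bool)
  | [], o => o
  | c :: B, o => bottomDirs B (c.push o)

/-- Along each arc joining positions `2a` and `2a + 1`, one end points up and the other down. -/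
def PlatCompatible {n : ℕ} (o : Fin n → Bool) : Prop :=
  ∀ p q : Fin n, Even p.val → q.val = p.val + 1 → o p ≠ o q

/-- An orientation of the link `B^{pl}`: a direction for each strand of the braid (named by its
top peg) that is consistent along the closing arcs at the top and at the bottom. -/
def IsPlatOrientation {n : ℕ} (B : BraidWord n) (o : Fin n → Bool) : Prop :=
  PlatCompatible o ∧ PlatCompatible (bottomDirs B o)

/-- The sign of a crossing of the oriented diagram: `σ_i` is positive if its strands run in the same
vertical direction; reversing one strand, or passing to `σ_i⁻¹`, changes the sign. -/
def Crossing.sign {n : ℕ} (c : Crossing n) (o : Fin n → Bool) : ℤ :=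
  (if c.pos then 1 else -1) * (if o c.left = o c.right then 1 else -1)

/-- The writhe of the closure of `B`, with directions `o` at the top bar. -/
def writhe {n : ℕ} : BraidWord n → (Fin n → Bool) → ℤ
  | [], _ => 0
  | c :: B, o => c.sign o + writhe B (c.push o)

/-- The Jones polynomial `V_L(A⁻⁴) = (-A)^{3w(L)} ⟨L⟩` of the plat closure `L` of `B`, oriented by
`o`. -/
noncomputable def jonesPlat {n : ℕ} (B : BraidWord n) (o : Fin n → Bool) (A : ℂ) : ℂ :=
  (-A) ^ (3 * writhe B o) * platBracket B A

/-- The value `A = i e^{-πi/(2k)}`, for which `A⁻⁴ = e^{2πi/k}` and `d = 2 cos (π/k)`. -/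
noncomputable def rootA (k : ℕ) : ℂ := I * exp (-(Real.pi * I / (2 * k)))

/-- The real number `d = 2 cos (π/k)`; it is `loopValue (rootA k)`, see below. -/
noncomputable def dReal (k : ℕ) : ℝ := 2 * Real.cos (Real.pi / k)

theorem rootA_pow (k : ℕ) : (rootA k)⁻¹ ^ 4 = exp (2 * Real.pi * I / k) := by
  rcases Nat.eq_zero_or_pos k with rfl | hk
  · simp [rootA, Even.neg_pow (show Even 4 by decide), I_pow_four]
  · have hk' : (k : ℂ) ≠ 0 := by exact_mod_cast hk.ne'
    rw [rootA, mul_inv, mul_pow, ← exp_neg, ← exp_nat_mul, inv_pow, I_pow_four, inv_one, one_mul]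
    congr 1
    push_cast
    field_simp
    ring

theorem loopValue_rootA (k : ℕ) : loopValue (rootA k) = dReal k := by
  have h : ((Real.pi / k : ℝ) : ℂ) = Real.pi / k := by push_cast; rfl
  rw [loopValue, rootA, dReal, mul_inv, mul_pow, mul_pow, ← exp_neg, ← exp_nat_mul, ← exp_nat_mul,
    inv_pow, I_sq]
  push_cast
  rw [Complex.cos]
  have e1 : (2 : ℂ) * -(Real.pi * I / (2 * k)) = -(Real.pi / k) * I := by
    rw [mul_comm (2 : ℂ) (k : ℂ), ← div_div]; ring
  have e2 : (2 : ℂ) * - -(Real.pi * I / (2 * k)) = (Real.pi / k) * I := by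
    rw [mul_comm (2 : ℂ) (k : ℂ), ← div_div]; ring
  rw [e1, e2]
  norm_num
  ring

/-! ## Paths and the normalisation -/

/-- The site reached by the path `p` after `j` steps: it starts at site `1`; `true` is a step to the
right and `false` a step to the left. -/
def siteAfter {n : ℕ} (p : Fin n → Bool) (j : ℕ) : ℤ :=
  1 + ∑ i : Fin n, if i.val < j then (if p i then 1 else -1) else 0

/-- The set `P_{n,k,ℓ}` of paths of `n` steps on the line graph with sites `1, …, k - 1` that
start at site `1` and end at site `ℓ`. -/
def pathSet (n k ℓ : ℕ) : Set (Fin n → Bool) :=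
  {p | (∀ j ≤ n, 1 ≤ siteAfter p j ∧ siteAfter p j ≤ (k : ℤ) - 1) ∧ siteAfter p n = ℓ}

/-- The space `H_{n,k,ℓ}`: the span of the computational basis states indexed by `P_{n,k,ℓ}`. -/
noncomputable def pathSpace (n k ℓ : ℕ) : Submodule ℂ ((Fin n → Bool) → ℂ) :=
  Submodule.span ℂ ((fun p => Pi.single p (1 : ℂ)) '' pathSet n k ℓ)

/-- The normalisation `N = ∑_ℓ λ_ℓ dim H_{n,k,ℓ}`, where `λ_ℓ = sin (π ℓ / k)`. -/
noncomputable def normN (n k : ℕ) : ℝ :=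
  ∑ ℓ ∈ Finset.Icc 1 (k - 1), Real.sin (Real.pi * ℓ / k) * Module.finrank ℂ (pathSpace n k ℓ)

/-! ## A classical computer that controls a quantum computer

The classical memory consists of arrays of natural numbers. The quantum memory consists of qubits
numbered by natural numbers, all initially in the state `|0⟩`. The running time is logarithmic-cost
time: each operation costs one unit plus the bit lengths of the numbers involved. -/

/-- Classical memory: the entry at index `i` of array number `a` is `M a i`. -/
abbrev Mem := ℕ → ℕ → ℕ

/-- Arithmetic expressions of the programming language. -/
inductive Expr where
  | const (c : ℕ)
  | read (a : ℕ) (i : Expr)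
  | add (x y : Expr)
  | sub (x y : Expr)
  | mul (x y : Expr)
  | div (x y : Expr)
  | mod (x y : Expr)
  | lt (x y : Expr)
  | eq (x y : Expr)

namespace Expr

/-- Value of an expression; subtraction is truncated, division rounds down (`x / 0 = 0`,
`x % 0 = x`), comparisons return `1` or `0`. -/
def val (M : Mem) : Expr → ℕ
  | const c => c
  | read a i => M a (i.val M)
  | add x y => x.val M + y.val M
  | sub x y => x.val M - y.val M
  | mul x y => x.val M * y.val M
  | div x y => x.val M / y.val M
  | mod x y => x.val M % y.val M
  | lt x y => if x.val M < y.val M then 1 else 0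
  | eq x y => if x.val M = y.val M then 1 else 0

/-- Time to evaluate an expression: every node costs one plus the bit length of its value. -/
def cost (M : Mem) : Expr → ℕ
  | const c => 1 + c.size
  | read a i => 1 + (M a (i.val M)).size + i.cost M
  | add x y => 1 + (x.val M + y.val M).size + x.cost M + y.cost M
  | sub x y => 1 + (x.val M - y.val M).size + x.cost M + y.cost M
  | mul x y => 1 + (x.val M * y.val M).size + x.cost M + y.cost M
  | div x y => 1 + (x.val M / y.val M).size + x.cost M + y.cost M
  | mod x y => 1 + (x.val M % y.val M).size + x.cost M + y.cost M
  | lt x y => 2 + x.cost M + y.cost M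
  | eq x y => 2 + x.cost M + y.cost M

end Expr

/-- Quantum states: finite superpositions of basis states; the basis state labelled by the finite
set `s` has the qubits in `s` equal to `1` and all others equal to `0`. -/
abbrev QState := Finset ℕ →₀ ℂ

namespace QState

/-- Hadamard gate on qubit `q`. -/
noncomputable def hadamard (q : ℕ) (ψ : QState) : QState :=
  Finsupp.linearCombination ℂ (fun s : Finset ℕ =>
    ((Real.sqrt 2 : ℂ)⁻¹) • (Finsupp.single (s.erase q) (1 : ℂ) +
      Finsupp.single (insert q s) (if q ∈ s then (-1 : ℂ) else 1))) ψ

/-- Phase gate `diag(1, e^{2πi a/b})` on qubit `q` (the identity if `b = 0`). -/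
noncomputable def phase (q a b : ℕ) (ψ : QState) : QState :=
  Finsupp.linearCombination ℂ (fun s : Finset ℕ =>
    Finsupp.single s (if q ∈ s then exp (2 * Real.pi * I * (a / b)) else 1)) ψ

/-- Toffoli gate with controls `c₁`, `c₂` and target `t`; it is the controlled-not gate if `c₁ = c₂`
and by convention the identity if the target is one of the controls. -/
noncomputable def toffoli (c₁ c₂ t : ℕ) (ψ : QState) : QState :=
  Finsupp.linearCombination ℂ (fun s : Finset ℕ =>
    Finsupp.single
      (if c₁ ∈ s ∧ c₂ ∈ s ∧ t ≠ c₁ ∧ t ≠ c₂ then symmDiff s {t} else s) (1 : ℂ)) ψ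

/-- Unnormalised state after qubit `q` has been measured with outcome `b`. -/
noncomputable def project (q : ℕ) (b : Bool) (ψ : QState) : QState :=
  ψ.filter (fun s => decide (q ∈ s) = b)

/-- Squared norm. -/
noncomputable def normSq (ψ : QState) : ℝ := ψ.sum fun _ z => ‖z‖ ^ 2

end QState

/-- Programs. Indices, qubit numbers and angles are computed from the classical memory. -/
inductive Prog where
  | skip
  /-- store the value of `x` at index `i` of array `a` -/
  | write (a : ℕ) (i x : Expr)
  | hadamard (q : Expr)
  | phase (q x y : Expr)
  | cnot (c t : Expr)
  | toffoli (c₁ c₂ t : Expr)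
  /-- measure qubit `q` and store the outcome at index `i` of array `a` -/
  | measure (q : Expr) (a : ℕ) (i : Expr)
  | seq (P Q : Prog)
  /-- run `P` if `x` is nonzero, otherwise `Q` -/
  | ite (x : Expr) (P Q : Prog)
  /-- repeat `P` as long as `x` is nonzero -/
  | loop (x : Expr) (P : Prog)

/-- One branch of a computation. The quantum state is not renormalised after measurements, so its
squared norm is the probability of the measurement outcomes that led to this branch. -/
structure Config where
  mem : Mem
  qstate : QState
  time : ℕ

namespace Config

/-- Let time pass. -/
def tick (c : Config) (t : ℕ) : Config := { c with time := c.time + t }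

/-- Value of an expression. -/
def val (c : Config) (x : Expr) : ℕ := x.val c.mem

/-- Cost of an expression. -/
def cost (c : Config) (x : Expr) : ℕ := x.cost c.mem

/-- Store a number in the classical memory. -/
def store (c : Config) (a i v : ℕ) : Config :=
  { c with mem := Function.update c.mem a (Function.update (c.mem a) i v) }

/-- Transform the quantum state. -/
noncomputable def gate (c : Config) (g : QState → QState) : Config := { c with qstate := g c.qstate }

/-- Measurement of qubit `q` with outcome `b`, stored at index `i` of array `a`. -/
noncomputable def outcome (c : Config) (q a i : ℕ) (b : Bool) : Config :=
  (c.gate (QState.project q b)).store a i b.toNat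

/-- Probability of the branch. -/
noncomputable def weight (c : Config) : ℝ := c.qstate.normSq

/-- The complex number that the branch outputs, in array `4`. -/
noncomputable def output (c : Config) : ℂ :=
  (((c.mem 4 0 : ℂ) - c.mem 4 1) + ((c.mem 4 2 : ℂ) - c.mem 4 3) * I) / c.mem 4 4

/-- Initial configuration on input `(B, o, k)`: array `0` holds the number of strands, the number of
crossings and `k`; array `1` the directions of the strands at the top; arrays `2` and `3` the
positions and the signs of the crossings. All other entries are `0`. -/
noncomputable def init {n : ℕ} (B : BraidWord n) (o : Fin n → Bool) (k : ℕ) : Config where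
  mem a i :=
    match a with
    | 0 => [n, B.length, k].getD i 0
    | 1 => (List.ofFn fun p => (o p).toNat).getD i 0
    | 2 => (B.map fun c => c.i).getD i 0
    | 3 => (B.map fun c => c.pos.toNat).getD i 0
    | _ => 0
  qstate := Finsupp.single ∅ 1
  time := 0

end Config

/-- `Exec P c L`: started in `c`, the program `P` halts for all measurement outcomes, and `L` is the
list of the resulting branches. -/
inductive Exec : Prog → Config → List Config → Prop
  | skip (c : Config) : Exec .skip c [c.tick 1]
  | write (a : ℕ) (i x : Expr) (c : Config) :
      Exec (.write a i x) c [(c.store a (c.val i) (c.val x)).tick (1 + c.cost i + c.cost x)]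
  | hadamard (q : Expr) (c : Config) :
      Exec (.hadamard q) c [(c.gate (QState.hadamard (c.val q))).tick (1 + c.cost q)]
  | phase (q x y : Expr) (c : Config) :
      Exec (.phase q x y) c
        [(c.gate (QState.phase (c.val q) (c.val x) (c.val y))).tick
          (1 + c.cost q + c.cost x + c.cost y)]
  | cnot (x t : Expr) (c : Config) :
      Exec (.cnot x t) c
        [(c.gate (QState.toffoli (c.val x) (c.val x) (c.val t))).tick (1 + c.cost x + c.cost t)]
  | toffoli (x y t : Expr) (c : Config) :
      Exec (.toffoli x y t) c
        [(c.gate (QState.toffoli (c.val x) (c.val y) (c.val t))).tick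
          (1 + c.cost x + c.cost y + c.cost t)]
  | measure (q : Expr) (a : ℕ) (i : Expr) (c : Config) :
      Exec (.measure q a i) c
        [(c.outcome (c.val q) a (c.val i) false).tick (1 + c.cost q + c.cost i),
         (c.outcome (c.val q) a (c.val i) true).tick (1 + c.cost q + c.cost i)]
  | seq (P Q : Prog) (c : Config) (L : List Config) (f : Config → List Config)
      (hP : Exec P c L) (hQ : ∀ c' ∈ L, Exec Q c' (f c')) : Exec (.seq P Q) c (L.flatMap f)
  | ite_true (x : Expr) (P Q : Prog) (c : Config) (L : List Config) (hx : c.val x ≠ 0)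
      (hP : Exec P (c.tick (1 + c.cost x)) L) : Exec (.ite x P Q) c L
  | ite_false (x : Expr) (P Q : Prog) (c : Config) (L : List Config) (hx : c.val x = 0)
      (hQ : Exec Q (c.tick (1 + c.cost x)) L) : Exec (.ite x P Q) c L
  | loop_stop (x : Expr) (P : Prog) (c : Config) (hx : c.val x = 0) :
      Exec (.loop x P) c [c.tick (1 + c.cost x)]
  | loop_step (x : Expr) (P : Prog) (c : Config) (L : List Config) (f : Config → List Config)
      (hx : c.val x ≠ 0) (hP : Exec P (c.tick (1 + c.cost x)) L)
      (hL : ∀ c' ∈ L, Exec (.loop x P) c' (f c')) : Exec (.loop x P) c (L.flatMap f)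

/-- Probability that the final branch satisfies `S`. -/
noncomputable def branchProb (L : List Config) (S : Config → Prop) : ℝ :=
  (L.map (Set.indicator {c | S c} Config.weight)).sum

/-! ## Polynomial bounds in the parameters `n, m, k` -/

/-- Value of a polynomial with natural coefficients at `(n, m, k)`. -/
noncomputable def polyAt (q : MvPolynomial (Fin 3) ℕ) (n m k : ℕ) : ℕ :=
  MvPolynomial.eval ![n, m, k] q

/-- `ε(n, m, k)` is at least the inverse of some polynomial in `n, m, k`. -/
def IsInversePolynomial (ε : ℕ → ℕ → ℕ → ℝ) : Prop :=
  ∃ q : MvPolynomial (Fin 3) ℕ, ∀ n m k : ℕ, 0 < n → 0 < k →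
    1 / ((polyAt q n m k : ℝ) + 1) ≤ ε n m k

end

/-! ## Planar matchings and loops -/

/-- Fixed-point-free involutions of `Fin n` whose arcs do not cross. -/
structure IsPlanarMatching {n : ℕ} (f : Fin n → Fin n) : Prop where
  invol : ∀ x, f (f x) = x
  ne : ∀ x, f x ≠ x
  nested : ∀ a b, a < b → b < f a → a < f b ∧ f b < f a

/-- The matching obtained by gluing a capcup at `i`, `j` to the bottom of the matching `f`. -/
def rewire {n : ℕ} (f : Fin n → Fin n) (i j : Fin n) (x : Fin n) : Fin n :=
  if x = i then j else if x = j then i else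
    if x = f i then f j else if x = f j then f i else f x

/-- This combines `nested` for the four choices of ends of two arcs. The symmetric form does not
depend on which end is the left one, so it applies to points whose mates are in unknown position. -/
theorem IsPlanarMatching.laminar {n : ℕ} {f : Fin n → Fin n} (hf : IsPlanarMatching f)
    (x y : Fin n) :
    ((x < y ∧ y < f x) ∨ (f x < y ∧ y < x)) ↔ ((x < f y ∧ f y < f x) ∨ (f x < f y ∧ f y < x)) := by
  have h1 := hf.nested x y
  have h2 := hf.nested (f x) y
  have h3 := hf.nested x (f y)
  have h4 := hf.nested (f x) (f y)
  simp only [hf.invol] at h1 h2 h3 h4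
  constructor
  · rintro (h | h)
    · exact Or.inl (h1 h.1 h.2)
    · exact Or.inr (h2 h.1 h.2)
  · rintro (h | h)
    · exact Or.inl (h3 h.1 h.2)
    · exact Or.inr (h4 h.1 h.2)

-- No point lies strictly between i and j, so any other arc has both on the same side; joining their
-- mates along i and j then crosses nothing. If i and j are already matched, the rewired matching is
-- `f` itself.
set_option maxHeartbeats 2000000 in
theorem IsPlanarMatching.rewire {n : ℕ} {f : Fin n → Fin n} (hf : IsPlanarMatching f)
    {i j : Fin n} (hij : j.val = i.val + 1) : IsPlanarMatching (rewire f i j) := by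
  have h1 := hf.invol
  have h2 := hf.ne
  have hne : i ≠ j := by rintro rfl; omega
  refine ⟨?_, ?_, ?_⟩
  · intro x
    unfold _root_.rewire
    grind
  · intro x
    unfold _root_.rewire
    grind
  · intro a b hab hb
    -- What remains concerns the order of the positions a, b, i, j and of their mates. Laminarity
    -- for all six pairs, and the involution property in arithmetic form, reduce it to a finite case
    -- check.
    have lam := hf.laminar
    have p1 := lam a b
    have p2 := lam a i
    have p3 := lam a j
    have p4 := lam b i
    have p5 := lam b j
    have p6 := lam i j
    have hfi : ∀ x y : Fin n, (f x).val = y.val ↔ x.val = (f y).val := fun x y => by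
      rw [← Fin.ext_iff, ← Fin.ext_iff]
      exact ⟨fun h => by rw [← h, h1], fun h => by rw [h, h1]⟩
    have hinj : ∀ x y : Fin n, (f x).val = (f y).val ↔ x.val = y.val := fun x y => by
      rw [hfi, h1]
    have q1 := hfi a b
    have q2 := hfi a i
    have q3 := hfi a j
    have q4 := hfi b i
    have q5 := hfi b j
    have q6 := hfi i j
    have r1 := hinj a b
    have r2 := hinj a i
    have r3 := hinj a j
    have r4 := hinj b i
    have r5 := hinj b j
    have r6 := hinj i j
    have n1 := h2 a
    have n2 := h2 b
    have n3 := h2 i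
    have n4 := h2 j
    clear lam hfi hinj h1 h2 hf
    unfold _root_.rewire at hb ⊢
    split_ifs at hb ⊢ <;> simp only [Fin.lt_def, Fin.ext_iff, ne_eq] at * <;>
      grind (splits := 30)

/-- The matching of the closing arcs: `2a` is joined with `2a + 1`. -/
def platMate {n : ℕ} (hn : Even n) (x : Fin n) : Fin n :=
  if h : Even x.val then ⟨x.val + 1, by rcases hn with ⟨a, rfl⟩; rcases h with ⟨b, hb⟩; omega⟩
  else ⟨x.val - 1, by omega⟩

theorem platMate_val_even {n : ℕ} (hn : Even n) {x : Fin n} (hx : Even x.val) :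
    (platMate hn x).val = x.val + 1 := by simp [platMate, hx]

theorem platMate_val_odd {n : ℕ} (hn : Even n) {x : Fin n} (hx : ¬ Even x.val) :
    (platMate hn x).val = x.val - 1 := by simp [platMate, hx]

theorem isPlanarMatching_platMate {n : ℕ} (hn : Even n) : IsPlanarMatching (platMate hn) := by
  have he := fun x => @platMate_val_even n hn x
  have ho := fun x => @platMate_val_odd n hn x
  refine ⟨?_, ?_, ?_⟩
  · intro x
    by_cases hx : Even x.val
    · have h1 := he x hx
      have h2 : ¬ Even (platMate hn x).val := by rw [h1]; simpa [Nat.even_add_one] using hx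
      have h3 := ho _ h2
      apply Fin.ext; omega
    · have h1 := ho x hx
      have h0 := Nat.not_even_iff_odd.1 hx
      have h2 : Even (platMate hn x).val := by
        rw [h1]; rcases h0 with ⟨a, ha⟩; exact ⟨a, by omega⟩
      have h3 := he _ h2
      rcases h0 with ⟨a, ha⟩
      apply Fin.ext; omega
  · intro x hx
    have := congrArg Fin.val hx
    by_cases h : Even x.val
    · have := he x h; omega
    · have := ho x h
      rcases Nat.not_even_iff_odd.1 h with ⟨a, ha⟩
      omega
  · intro a b hab hb
    rw [Fin.lt_def] at hab hb
    exfalso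
    by_cases h : Even a.val
    · have := he a h; omega
    · have := ho a h; omega

/-- As `PlatArc`, but with the points at the top joined by the matching `f`. -/
inductive CappedArc {n : ℕ} (hn : Even n) (f : Fin n → Fin n) (B : BraidWord n)
    (s : Fin B.length → Bool) :
    Fin (B.length + 1) × Fin n → Fin (B.length + 1) × Fin n → Prop
  | top (p : Fin n) : CappedArc hn f B s (0, p) (0, f p)
  | bottom (p : Fin n) : CappedArc hn f B s (Fin.last _, p) (Fin.last _, platMate hn p)
  | strand (j : Fin B.length) (p : Fin n)
      (h : s j = false ∨ (p ≠ (B.get j).left ∧ p ≠ (B.get j).right)) :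
      CappedArc hn f B s (j.castSucc, p) (j.succ, p)
  | cup (j : Fin B.length) (h : s j = true) :
      CappedArc hn f B s (j.castSucc, (B.get j).left) (j.castSucc, (B.get j).right)
  | cap (j : Fin B.length) (h : s j = true) :
      CappedArc hn f B s (j.succ, (B.get j).left) (j.succ, (B.get j).right)

/-- The number of closed loops when the top is closed by the matching `f`. -/
noncomputable def cappedLoops {n : ℕ} (hn : Even n) (f : Fin n → Fin n) (B : BraidWord n)
    (s : Fin B.length → Bool) : ℕ :=
  Nat.card (Quot (CappedArc hn f B s))

/-- Mutually inverse maps up to the relations identify the quotients. -/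
theorem card_quot_congr {α β : Type*} {r : α → α → Prop} {t : β → β → Prop}
    (F : α → Quot t) (G : β → Quot r)
    (hF : ∀ a b, r a b → F a = F b) (hG : ∀ a b, t a b → G a = G b)
    (hGF : ∀ a, Quot.lift G hG (F a) = Quot.mk r a)
    (hFG : ∀ b, Quot.lift F hF (G b) = Quot.mk t b) :
    Nat.card (Quot r) = Nat.card (Quot t) :=
  Nat.card_congr
    { toFun := Quot.lift F hF
      invFun := Quot.lift G hG
      left_inv := by rintro ⟨a⟩; exact hGF a
      right_inv := by rintro ⟨b⟩; exact hFG b }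

/-- As `card_quot_congr`, with one extra class on the left. -/
theorem card_quot_congr_add_one {α β : Type*} [Finite β] {r : α → α → Prop} {t : β → β → Prop}
    (F : α → Option (Quot t)) (G : β → Quot r) (g : Quot r)
    (hF : ∀ a b, r a b → F a = F b) (hG : ∀ a b, t a b → G a = G b)
    (hGF : ∀ a, Option.elim (F a) g (Quot.lift G hG) = Quot.mk r a)
    (hFG : ∀ b, Quot.lift F hF (G b) = some (Quot.mk t b)) (hg : Quot.lift F hF g = none) :
    Nat.card (Quot r) = Nat.card (Quot t) + 1 := by
  rw [← Finite.card_option]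
  exact Nat.card_congr
    { toFun := Quot.lift F hF
      invFun := fun o => Option.elim o g (Quot.lift G hG)
      left_inv := by rintro ⟨a⟩; exact hGF a
      right_inv := by
        rintro (_ | b)
        · exact hg
        · induction b using Quot.ind with
          | mk b => exact hFG b }

/-- The relations differ only in that a closing arc may also be traversed from its odd end, and a
quotient does not see directions. -/
theorem platLoops_eq_cappedLoops {n : ℕ} (hn : Even n) (B : BraidWord n)
    (s : Fin B.length → Bool) : platLoops B s = cappedLoops hn (platMate hn) B s := by
  refine card_quot_congr (fun a => Quot.mk _ a) (fun a => Quot.mk _ a) ?_ ?_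
    (fun _ => rfl) (fun _ => rfl)
  · rintro _ _ (⟨p, q, hp, hq⟩ | ⟨p, q, hp, hq⟩ | ⟨j, p, h⟩ | ⟨j, h⟩ | ⟨j, h⟩)
    · have : q = platMate hn p := Fin.ext (by rw [platMate_val_even hn hp, hq])
      subst this; exact Quot.sound (.top p)
    · have : q = platMate hn p := Fin.ext (by rw [platMate_val_even hn hp, hq])
      subst this; exact Quot.sound (.bottom p)
    · exact Quot.sound (.strand j p h)
    · exact Quot.sound (.cup j h)
    · exact Quot.sound (.cap j h)
  · have key : ∀ p : Fin n, ¬ Even p.val →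
        Even (platMate hn p).val ∧ p.val = (platMate hn p).val + 1 := by
      intro p hp
      rw [platMate_val_odd hn hp]
      rcases Nat.not_even_iff_odd.1 hp with ⟨a, ha⟩
      exact ⟨⟨a, by omega⟩, by omega⟩
    rintro _ _ (⟨p⟩ | ⟨p⟩ | ⟨j, p, h⟩ | ⟨j, h⟩ | ⟨j, h⟩)
    · by_cases hp : Even p.val
      · exact Quot.sound (.top _ _ hp (platMate_val_even hn hp))
      · exact (Quot.sound (.top _ _ (key p hp).1 (key p hp).2)).symm
    · by_cases hp : Even p.val
      · exact Quot.sound (.bottom _ _ hp (platMate_val_even hn hp))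
      · exact (Quot.sound (.bottom _ _ (key p hp).1 (key p hp).2)).symm
    · exact Quot.sound (.strand j p h)
    · exact Quot.sound (.cup j h)
    · exact Quot.sound (.cap j h)

/-! ### Removing the first crossing of a state: vertical strands -/

section peel

variable {n : ℕ} (hn : Even n) (f : Fin n → Fin n) (c : Crossing n) (B : BraidWord n)
  (s : Fin B.length → Bool)

/-- Each point above the crossing is identified with the point below it, so the top level can be
contracted. -/
theorem cappedLoops_cons_false :
    cappedLoops hn f (c :: B) (Fin.cons (α := fun _ => Bool) false s) = cappedLoops hn f B s := by
  have h0 : ∀ p : Fin n, Quot.mk (CappedArc hn f (c :: B) (Fin.cons (α := fun _ => Bool) false s))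
      (0, p) = Quot.mk _ (1, p) := fun p => Quot.sound (.strand 0 p (Or.inl rfl))
  refine card_quot_congr
    (fun a => Fin.cases (motive := fun _ => Quot (CappedArc hn f B s)) (Quot.mk _ (0, a.2))
      (fun j => Quot.mk _ (j, a.2)) a.1)
    (fun a => Quot.mk _ (a.1.succ, a.2)) ?_ ?_ ?_ ?_
  · rintro _ _ (⟨p⟩ | ⟨p⟩ | ⟨j, p, h⟩ | ⟨j, h⟩ | ⟨j, h⟩)
    · exact Quot.sound (.top p)
    · exact Quot.sound (.bottom p)
    · refine Fin.cases (fun _ => rfl) (fun j h => ?_) j h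
      exact Quot.sound (.strand j p h)
    · revert h
      refine Fin.cases (fun h => ?_) (fun j h => ?_) j
      · exact absurd h (by simp)
      · exact Quot.sound (.cup j h)
    · revert h
      refine Fin.cases (fun h => ?_) (fun j h => ?_) j
      · exact absurd h (by simp)
      · exact Quot.sound (.cap j h)
  · rintro _ _ (⟨p⟩ | ⟨p⟩ | ⟨j, p, h⟩ | ⟨j, h⟩ | ⟨j, h⟩)
    · exact (h0 p).symm.trans ((Quot.sound (.top p)).trans (h0 _))
    · exact Quot.sound (.bottom (B := c :: B) p)
    · exact Quot.sound (.strand (B := c :: B) j.succ p h)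
    · exact Quot.sound (.cup (B := c :: B) j.succ h)
    · exact Quot.sound (.cap (B := c :: B) j.succ h)
  · rintro ⟨j, p⟩
    refine Fin.cases ?_ (fun j => ?_) j
    · exact (h0 p).symm
    · rfl
  · rintro ⟨j, p⟩
    rfl

end peel


/-! ### Removing the first crossing of a state: capcups -/

section peel

variable {n : ℕ} (hn : Even n) {f : Fin n → Fin n} (c : Crossing n) (B : BraidWord n)
  (s : Fin B.length → Bool)

theorem Crossing.left_ne_right {n : ℕ} (c : Crossing n) : c.left ≠ c.right := by
  intro h
  have := congrArg Fin.val h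
  simp [Crossing.left, Crossing.right] at this

theorem rewire_left (f : Fin n → Fin n) : rewire f c.left c.right c.left = c.right := by
  simp [rewire]

theorem rewire_right (f : Fin n → Fin n) : rewire f c.left c.right c.right = c.left := by
  simp [rewire, c.left_ne_right.symm]

theorem rewire_mate_left (hf : IsPlanarMatching f) (c : Crossing n)
    (h : f c.left ≠ c.right) :
    rewire f c.left c.right (f c.left) = f c.right := by
  simp [rewire, hf.ne, h]

theorem IsPlanarMatching.mate_right_ne_left (hf : IsPlanarMatching f) (c : Crossing n)
    (h : f c.left ≠ c.right) : f c.right ≠ c.left := by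
  intro h'; apply h; rw [← h', hf.invol]

theorem rewire_mate_right (hf : IsPlanarMatching f) (c : Crossing n)
    (h : f c.left ≠ c.right) :
    rewire f c.left c.right (f c.right) = f c.left := by
  have h' := hf.mate_right_ne_left c h
  have h2 : f c.right ≠ f c.left := fun e => c.left_ne_right (by rw [← hf.invol c.left, ← e, hf.invol])
  simp [rewire, hf.ne, h', h2]

theorem rewire_other (f : Fin n → Fin n) {p : Fin n} (h1 : p ≠ c.left) (h2 : p ≠ c.right)
    (h3 : p ≠ f c.left) (h4 : p ≠ f c.right) : rewire f c.left c.right p = f p := by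
  simp [rewire, h1, h2, h3, h4]

/-- The cup fuses the two arcs that end at it, so their far ends become joined; the cap supplies the
new short arc. No loop is closed, because the ends of the cup belong to different arcs. -/
theorem cappedLoops_cons_true_of_ne (hf : IsPlanarMatching f) (c : Crossing n)
    (B : BraidWord n) (s : Fin B.length → Bool) (h : f c.left ≠ c.right) :
    cappedLoops hn f (c :: B) (Fin.cons (α := fun _ => Bool) true s) =
      cappedLoops hn (rewire f c.left c.right) B s := by
  have hlr := c.left_ne_right
  have h' := hf.mate_right_ne_left c h
  set s' : Fin (c :: B).length → Bool := Fin.cons (α := fun _ => Bool) true s with hs'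
  set f' := rewire f c.left c.right with hf'
  have h0 : ∀ p : Fin n, p ≠ c.left → p ≠ c.right → Quot.mk (CappedArc hn f (c :: B) s')
      (0, p) = Quot.mk _ (1, p) := fun p h1 h2 => Quot.sound (.strand 0 p (Or.inr ⟨h1, h2⟩))
  have hcup : Quot.mk (CappedArc hn f (c :: B) s') (0, c.left) = Quot.mk _ (0, c.right) :=
    Quot.sound (.cup 0 rfl)
  have hcap : Quot.mk (CappedArc hn f (c :: B) s') (1, c.left) = Quot.mk _ (1, c.right) :=
    Quot.sound (.cap 0 rfl)
  have htop : ∀ p, Quot.mk (CappedArc hn f (c :: B) s') (0, p) = Quot.mk _ (0, f p) :=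
    fun p => Quot.sound (.top p)
  have htop' : ∀ p, Quot.mk (CappedArc hn f' B s) (0, p) = Quot.mk _ (0, f' p) :=
    fun p => Quot.sound (.top p)
  have hl : Quot.mk (CappedArc hn f (c :: B) s') (0, c.left) = Quot.mk _ (1, f c.left) := by
    rw [htop, h0 _ (hf.ne _) h]
  have hr : Quot.mk (CappedArc hn f (c :: B) s') (0, c.right) = Quot.mk _ (1, f c.right) := by
    rw [htop, h0 _ h' (hf.ne _)]
  -- An end of the cup has no strand below it, so its class is represented by its mate, which does
  -- have one.
  let g : Fin n → Fin n := fun p => if p = c.left ∨ p = c.right then f p else p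
  have gl : g c.left = f c.left := by simp [g]
  have gr : g c.right = f c.right := by simp [g]
  have go : ∀ p, p ≠ c.left → p ≠ c.right → g p = p := fun p h1 h2 => by simp [g, h1, h2]
  refine card_quot_congr
    (fun a => Fin.cases (motive := fun _ => Quot (CappedArc hn f' B s)) (Quot.mk _ (0, g a.2))
      (fun j => Quot.mk _ (j, a.2)) a.1)
    (fun a => Quot.mk _ (a.1.succ, a.2)) ?_ ?_ ?_ ?_
  · rintro _ _ (⟨p⟩ | ⟨p⟩ | ⟨j, p, h⟩ | ⟨j, h⟩ | ⟨j, h⟩)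
    · change Quot.mk (CappedArc hn f' B s) (0, g p) = Quot.mk _ (0, g (f p))
      by_cases h1 : p = c.left
      · subst h1; rw [gl, go _ (hf.ne _) h]
      by_cases h2 : p = c.right
      · subst h2; rw [gr, go _ h' (hf.ne _)]
      rw [go p h1 h2]
      by_cases h3 : f p = c.left
      · rw [h3, gl, ← h3, hf.invol]
      by_cases h4 : f p = c.right
      · rw [h4, gr, ← h4, hf.invol]
      · rw [go _ h3 h4, htop', hf', rewire_other c f h1 h2]
        · rintro rfl; exact h3 (hf.invol _)
        · rintro rfl; exact h4 (hf.invol _)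
    · exact Quot.sound (.bottom p)
    · refine Fin.cases (fun h => ?_) (fun j h => ?_) j h
      · change Quot.mk (CappedArc hn f' B s) (0, g p) = Quot.mk _ (0, p)
        rcases h with h | h
        · simp [hs'] at h
        · rw [go p h.1 h.2]
      · exact Quot.sound (.strand j p h)
    · revert h
      refine Fin.cases (fun _ => ?_) (fun j h => ?_) j
      · change Quot.mk (CappedArc hn f' B s) (0, g c.left) = Quot.mk _ (0, g c.right)
        rw [gl, gr, htop', hf', rewire_mate_left hf c h]
      · exact Quot.sound (.cup j h)
    · revert h
      refine Fin.cases (fun _ => ?_) (fun j h => ?_) j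
      · change Quot.mk (CappedArc hn f' B s) (0, c.left) = Quot.mk _ (0, c.right)
        rw [htop', hf', rewire_left]
      · exact Quot.sound (.cap j h)
  · rintro _ _ (⟨p⟩ | ⟨p⟩ | ⟨j, p, h⟩ | ⟨j, h⟩ | ⟨j, h⟩)
    · change Quot.mk (CappedArc hn f (c :: B) s') (1, p) = Quot.mk _ (1, f' p)
      by_cases h1 : p = c.left
      · subst h1; rw [hcap, hf', rewire_left]
      by_cases h2 : p = c.right
      · subst h2; rw [← hcap, hf', rewire_right]
      by_cases h3 : p = f c.left
      · subst h3; rw [hf', rewire_mate_left hf c h, ← hl, ← hr, hcup]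
      by_cases h4 : p = f c.right
      · subst h4; rw [hf', rewire_mate_right hf c h, ← hl, ← hr, hcup]
      · rw [hf', rewire_other c f h1 h2 h3 h4, ← h0 p h1 h2, ← h0, htop]
        · intro e; exact h3 (by rw [← e, hf.invol])
        · intro e; exact h4 (by rw [← e, hf.invol])
    · exact Quot.sound (.bottom (B := c :: B) p)
    · exact Quot.sound (.strand (B := c :: B) j.succ p h)
    · exact Quot.sound (.cup (B := c :: B) j.succ h)
    · exact Quot.sound (.cap (B := c :: B) j.succ h)
  · rintro ⟨j, p⟩
    refine Fin.cases ?_ (fun j => ?_) j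
    · change Quot.mk (CappedArc hn f (c :: B) s') (1, g p) = Quot.mk _ (0, p)
      by_cases h1 : p = c.left
      · subst h1; rw [gl, hl]
      by_cases h2 : p = c.right
      · subst h2; rw [gr, hr]
      · rw [go p h1 h2, h0 p h1 h2]
    · rfl
  · rintro ⟨j, p⟩
    rfl

/-- The cup closes an arc of `f` to a separate loop, and the cap reproduces that arc below. The
separate loop is the class sent to `none`. -/
theorem cappedLoops_cons_true_of_eq (hf : IsPlanarMatching f) (c : Crossing n)
    (B : BraidWord n) (s : Fin B.length → Bool) (h : f c.left = c.right) :
    cappedLoops hn f (c :: B) (Fin.cons (α := fun _ => Bool) true s) = cappedLoops hn f B s + 1 := by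
  have hlr := c.left_ne_right
  have h' : f c.right = c.left := by rw [← h, hf.invol]
  set s' : Fin (c :: B).length → Bool := Fin.cons (α := fun _ => Bool) true s with hs'
  have h0 : ∀ p : Fin n, p ≠ c.left → p ≠ c.right → Quot.mk (CappedArc hn f (c :: B) s')
      (0, p) = Quot.mk _ (1, p) := fun p h1 h2 => Quot.sound (.strand 0 p (Or.inr ⟨h1, h2⟩))
  have hcup : Quot.mk (CappedArc hn f (c :: B) s') (0, c.left) = Quot.mk _ (0, c.right) :=
    Quot.sound (.cup 0 rfl)
  have hcap : Quot.mk (CappedArc hn f (c :: B) s') (1, c.left) = Quot.mk _ (1, c.right) :=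
    Quot.sound (.cap 0 rfl)
  have htop : ∀ p, Quot.mk (CappedArc hn f (c :: B) s') (0, p) = Quot.mk _ (0, f p) :=
    fun p => Quot.sound (.top p)
  have htop' : ∀ p, Quot.mk (CappedArc hn f B s) (0, p) = Quot.mk _ (0, f p) :=
    fun p => Quot.sound (.top p)
  have hother : ∀ p, p ≠ c.left → p ≠ c.right → f p ≠ c.left ∧ f p ≠ c.right := by
    intro p h1 h2
    exact ⟨fun e => h2 (by rw [← hf.invol p, e, h]), fun e => h1 (by rw [← hf.invol p, e, h'])⟩
  let g : Fin n → Option (Quot (CappedArc hn f B s)) :=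
    fun p => if p = c.left ∨ p = c.right then none else some (Quot.mk _ (0, p))
  have gl : g c.left = none := by simp [g]
  have gr : g c.right = none := by simp [g]
  have go : ∀ p, p ≠ c.left → p ≠ c.right → g p = some (Quot.mk _ (0, p)) :=
    fun p h1 h2 => by simp [g, h1, h2]
  refine card_quot_congr_add_one
    (fun a => Fin.cases (motive := fun _ => Option (Quot (CappedArc hn f B s))) (g a.2)
      (fun j => some (Quot.mk _ (j, a.2))) a.1)
    (fun a => Quot.mk _ (a.1.succ, a.2)) (Quot.mk _ (0, c.left)) ?_ ?_ ?_ ?_ ?_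
  · rintro _ _ (⟨p⟩ | ⟨p⟩ | ⟨j, p, h⟩ | ⟨j, h⟩ | ⟨j, h⟩)
    · change g p = g (f p)
      by_cases h1 : p = c.left
      · subst h1; rw [gl, h, gr]
      by_cases h2 : p = c.right
      · subst h2; rw [gr, h', gl]
      rw [go p h1 h2, go _ (hother p h1 h2).1 (hother p h1 h2).2, htop']
    · exact congrArg some (Quot.sound (.bottom p))
    · refine Fin.cases (fun h => ?_) (fun j h => ?_) j h
      · change g p = some (Quot.mk _ (0, p))
        rcases h with h | h
        · simp [hs'] at h
        · rw [go p h.1 h.2]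
      · exact congrArg some (Quot.sound (.strand j p h))
    · revert h
      refine Fin.cases (fun _ => ?_) (fun j h => ?_) j
      · change g c.left = g c.right
        rw [gl, gr]
      · exact congrArg some (Quot.sound (.cup j h))
    · revert h
      refine Fin.cases (fun _ => ?_) (fun j h => ?_) j
      · change some (Quot.mk (CappedArc hn f B s) (0, c.left)) = some (Quot.mk _ (0, c.right))
        rw [htop', h]
      · exact congrArg some (Quot.sound (.cap j h))
  · rintro _ _ (⟨p⟩ | ⟨p⟩ | ⟨j, p, h⟩ | ⟨j, h⟩ | ⟨j, h⟩)
    · change Quot.mk (CappedArc hn f (c :: B) s') (1, p) = Quot.mk _ (1, f p)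
      by_cases h1 : p = c.left
      · subst h1; rw [hcap, h]
      by_cases h2 : p = c.right
      · subst h2; rw [← hcap, h']
      rw [← h0 p h1 h2, ← h0 _ (hother p h1 h2).1 (hother p h1 h2).2, htop]
    · exact Quot.sound (.bottom (B := c :: B) p)
    · exact Quot.sound (.strand (B := c :: B) j.succ p h)
    · exact Quot.sound (.cup (B := c :: B) j.succ h)
    · exact Quot.sound (.cap (B := c :: B) j.succ h)
  · rintro ⟨j, p⟩
    refine Fin.cases ?_ (fun j => ?_) j
    · change Option.elim (g p) _ _ = Quot.mk _ (0, p)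
      by_cases h1 : p = c.left
      · subst h1; rw [gl]; rfl
      by_cases h2 : p = c.right
      · subst h2; rw [gr]; exact hcup
      · rw [go p h1 h2, h0 p h1 h2]; rfl
    · rfl
  · rintro ⟨j, p⟩
    rfl
  · exact gl

/-- Splitting off a closing arc at the bottom adds one loop. -/
theorem cappedLoops_nil_rewire (hf : IsPlanarMatching f) (c : Crossing n)
    (hc : platMate hn c.left = c.right) (h : f c.left ≠ c.right) :
    cappedLoops hn (rewire f c.left c.right) [] Fin.elim0 = cappedLoops hn f [] Fin.elim0 + 1 := by
  have hlr := c.left_ne_right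
  have hm := isPlanarMatching_platMate hn
  have hc' : platMate hn c.right = c.left := by rw [← hc, hm.invol]
  have h' := hf.mate_right_ne_left c h
  set f' := rewire f c.left c.right with hf'
  have hbot : ∀ p, Quot.mk (CappedArc hn f [] Fin.elim0) (0, p) = Quot.mk _ (0, platMate hn p) :=
    fun p => Quot.sound (.bottom (B := []) p)
  have hbot' : ∀ p, Quot.mk (CappedArc hn f' [] Fin.elim0) (0, p) = Quot.mk _ (0, platMate hn p) :=
    fun p => Quot.sound (.bottom (B := []) p)
  have htop : ∀ p, Quot.mk (CappedArc hn f [] Fin.elim0) (0, p) = Quot.mk _ (0, f p) :=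
    fun p => Quot.sound (.top p)
  have htop' : ∀ p, Quot.mk (CappedArc hn f' [] Fin.elim0) (0, p) = Quot.mk _ (0, f' p) :=
    fun p => Quot.sound (.top p)
  have hother : ∀ p, p ≠ c.left → p ≠ c.right →
      platMate hn p ≠ c.left ∧ platMate hn p ≠ c.right := by
    intro p h1 h2
    exact ⟨fun e => h2 (by rw [← hm.invol p, e, hc]), fun e => h1 (by rw [← hm.invol p, e, hc'])⟩
  let g : Fin n → Option (Quot (CappedArc hn f [] Fin.elim0)) :=
    fun p => if p = c.left ∨ p = c.right then none else some (Quot.mk _ (0, p))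
  have gl : g c.left = none := by simp [g]
  have gr : g c.right = none := by simp [g]
  have go : ∀ p, p ≠ c.left → p ≠ c.right → g p = some (Quot.mk _ (0, p)) :=
    fun p h1 h2 => by simp [g, h1, h2]
  -- `e` moves a point of the pair to its mate, which stays on the long loop when the pair is cut
  -- out as a loop of its own.
  let e : Fin n → Fin n := fun p => if p = c.left ∨ p = c.right then f p else p
  have el : e c.left = f c.left := by simp [e]
  have er : e c.right = f c.right := by simp [e]
  have eo : ∀ p, p ≠ c.left → p ≠ c.right → e p = p := fun p h1 h2 => by simp [e, h1, h2]
  have hlr' : Quot.mk (CappedArc hn f' [] Fin.elim0) (0, f c.left) = Quot.mk _ (0, f c.right) := by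
    rw [htop', hf', rewire_mate_left hf c h]
  have hff : Quot.mk (CappedArc hn f [] Fin.elim0) (0, f c.left) = Quot.mk _ (0, f c.right) := by
    rw [← htop, ← htop, hbot, hc]
  refine card_quot_congr_add_one (fun a => g a.2) (fun a => Quot.mk _ (0, e a.2))
    (Quot.mk _ (0, c.left)) ?_ ?_ ?_ ?_ ?_
  · have key : ∀ p, g p = g (f' p) := by
      intro p
      by_cases h1 : p = c.left
      · subst h1; rw [gl, hf', rewire_left, gr]
      by_cases h2 : p = c.right
      · subst h2; rw [gr, hf', rewire_right, gl]
      by_cases h3 : p = f c.left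
      · subst h3; rw [hf', rewire_mate_left hf c h, go _ h1 h2, go _ h' (hf.ne _), hff]
      by_cases h4 : p = f c.right
      · subst h4; rw [hf', rewire_mate_right hf c h, go _ h1 h2, go _ (hf.ne _) h, hff]
      · rw [hf', rewire_other c f h1 h2 h3 h4, go _ h1 h2, go, htop]
        · intro e; exact h3 (by rw [← e, hf.invol])
        · intro e; exact h4 (by rw [← e, hf.invol])
    have key2 : ∀ p, g p = g (platMate hn p) := by
      intro p
      by_cases h1 : p = c.left
      · subst h1; rw [gl, hc, gr]
      by_cases h2 : p = c.right
      · subst h2; rw [gr, hc', gl]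
      · rw [go p h1 h2, go _ (hother p h1 h2).1 (hother p h1 h2).2, hbot]
    rintro _ _ (⟨p⟩ | ⟨p⟩ | ⟨j, p, h⟩ | ⟨j, h⟩ | ⟨j, h⟩)
    · exact key p
    · exact key2 p
    all_goals exact j.elim0
  · have key : ∀ p, Quot.mk (CappedArc hn f' [] Fin.elim0) (0, e p) = Quot.mk _ (0, e (f p)) := by
      intro p
      by_cases h1 : p = c.left
      · subst h1; rw [el, eo _ (hf.ne _) h]
      by_cases h2 : p = c.right
      · subst h2; rw [er, eo _ h' (hf.ne _)]
      rw [eo p h1 h2]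
      by_cases h3 : f p = c.left
      · rw [h3, el, ← h3, hf.invol]
      by_cases h4 : f p = c.right
      · rw [h4, er, ← h4, hf.invol]
      · rw [eo _ h3 h4, htop', hf', rewire_other c f h1 h2]
        · rintro rfl; exact h3 (hf.invol _)
        · rintro rfl; exact h4 (hf.invol _)
    have key2 : ∀ p, Quot.mk (CappedArc hn f' [] Fin.elim0) (0, e p) =
        Quot.mk _ (0, e (platMate hn p)) := by
      intro p
      by_cases h1 : p = c.left
      · subst h1; rw [hc, el, er, hlr']
      by_cases h2 : p = c.right
      · subst h2; rw [hc', el, er, hlr']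
      · rw [eo p h1 h2, eo _ (hother p h1 h2).1 (hother p h1 h2).2, hbot']
    rintro _ _ (⟨p⟩ | ⟨p⟩ | ⟨j, p, h⟩ | ⟨j, h⟩ | ⟨j, h⟩)
    · exact key p
    · exact key2 p
    all_goals exact j.elim0
  · rintro ⟨j, p⟩
    obtain rfl : j = 0 := Fin.fin_one_eq_zero j
    change Option.elim (g p) _ _ = Quot.mk _ (0, p)
    by_cases h1 : p = c.left
    · subst h1; rw [gl]; rfl
    by_cases h2 : p = c.right
    · subst h2; rw [gr]; change Quot.mk _ (0, c.left) = _; rw [hbot', hc]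
    · rw [go p h1 h2]; change Quot.mk _ (0, e p) = _; rw [eo p h1 h2]
  · rintro ⟨j, p⟩
    obtain rfl : j = 0 := Fin.fin_one_eq_zero j
    change g (e p) = _
    by_cases h1 : p = c.left
    · subst h1; rw [el, go _ (hf.ne _) h, ← htop]
    by_cases h2 : p = c.right
    · subst h2; rw [er, go _ h' (hf.ne _), ← htop]
    · rw [eo p h1 h2, go p h1 h2]
  · exact gl

theorem cappedLoops_nil_platMate : cappedLoops hn (platMate hn) [] Fin.elim0 = n / 2 := by
  have key : ∀ p : Fin n, p.val / 2 = (platMate hn p).val / 2 := by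
    intro p
    by_cases hp : Even p.val
    · rw [platMate_val_even hn hp]; rcases hp with ⟨a, ha⟩; omega
    · rw [platMate_val_odd hn hp]; rcases Nat.not_even_iff_odd.1 hp with ⟨a, ha⟩; omega
  have hlt : ∀ p : Fin n, p.val / 2 < n / 2 := by
    intro p; rcases hn with ⟨a, ha⟩; have := p.2; omega
  have hlt' : ∀ q : Fin (n / 2), 2 * q.val < n := by intro q; have := q.2; omega
  have hF : ∀ a b, CappedArc hn (platMate hn) [] Fin.elim0 a b →
      (⟨a.2.val / 2, hlt a.2⟩ : Fin (n / 2)) = ⟨b.2.val / 2, hlt b.2⟩ := by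
    rintro _ _ (⟨p⟩ | ⟨p⟩ | ⟨j, p, h⟩ | ⟨j, h⟩ | ⟨j, h⟩)
    · exact Fin.ext (key p)
    · exact Fin.ext (key p)
    all_goals exact j.elim0
  have e : Quot (CappedArc hn (platMate hn) [] Fin.elim0) ≃ Fin (n / 2) :=
    { toFun := Quot.lift (fun a => ⟨a.2.val / 2, hlt a.2⟩) hF
      invFun := fun q => Quot.mk _ (0, ⟨2 * q.val, hlt' q⟩)
      left_inv := by
        rintro ⟨j, p⟩
        obtain rfl : j = 0 := Fin.fin_one_eq_zero j
        change Quot.mk _ (0, (⟨2 * (p.val / 2), _⟩ : Fin n)) = Quot.mk _ (0, p)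
        by_cases hp : Even p.val
        · congr 2; rcases hp with ⟨a, ha⟩; apply Fin.ext; simp; omega
        · have : (⟨2 * (p.val / 2), hlt' ⟨p.val / 2, hlt p⟩⟩ : Fin n) = platMate hn p := by
            apply Fin.ext
            rw [platMate_val_odd hn hp]; rcases Nat.not_even_iff_odd.1 hp with ⟨a, ha⟩; simp; omega
          exact (congrArg (fun x => Quot.mk _ (0, x)) this).trans (Quot.sound (.top p)).symm
      right_inv := by intro q; apply Fin.ext; change 2 * q.val / 2 = q.val; omega }
  rw [cappedLoops, Nat.card_congr e, Nat.card_fin]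

end peel


/-! ## The path model -/

/-- The change of the site in one step. -/
def stepSign (b : Bool) : ℤ := if b then 1 else -1

theorem siteAfter_zero {n : ℕ} (p : Fin n → Bool) : siteAfter p 0 = 1 := by simp [siteAfter]

theorem siteAfter_succ {n : ℕ} (p : Fin n → Bool) (a : Fin n) :
    siteAfter p (a.val + 1) = siteAfter p a.val + stepSign (p a) := by
  unfold siteAfter stepSign
  rw [add_assoc]
  congr 1
  rw [← Finset.sum_erase_add _ _ (Finset.mem_univ a), ← Finset.sum_erase_add _ _ (Finset.mem_univ a)]
  simp only [Nat.lt_succ_self, if_true, lt_irrefl, if_false, add_zero]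
  congr 1
  refine Finset.sum_congr rfl fun i hi => ?_
  have : i.val ≠ a.val := fun h => (Finset.ne_of_mem_erase hi) (Fin.ext h)
  congr 1
  simp only [eq_iff_iff]; omega

theorem siteAfter_right {n : ℕ} (c : Crossing n) (p : Fin n → Bool) :
    siteAfter p c.right.val = siteAfter p c.left.val + stepSign (p c.left) :=
  siteAfter_succ p c.left

/-- Exchange the steps at the positions of a crossing. -/
def flipPath {n : ℕ} (c : Crossing n) (p : Fin n → Bool) : Fin n → Bool :=
  p ∘ Equiv.swap c.left c.right

theorem flipPath_flipPath {n : ℕ} (c : Crossing n) (p : Fin n → Bool) :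
    flipPath c (flipPath c p) = p := by
  funext x; simp [flipPath]

theorem flipPath_left {n : ℕ} (c : Crossing n) (p : Fin n → Bool) :
    flipPath c p c.left = p c.right := by simp [flipPath]

theorem flipPath_right {n : ℕ} (c : Crossing n) (p : Fin n → Bool) :
    flipPath c p c.right = p c.left := by simp [flipPath]

/-- The sum that defines any other site contains both of the exchanged steps or neither. -/
theorem siteAfter_flipPath {n : ℕ} (c : Crossing n) (p : Fin n → Bool) {j : ℕ}
    (hj : j ≠ c.right.val) : siteAfter (flipPath c p) j = siteAfter p j := by
  unfold siteAfter flipPath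
  congr 1
  rw [← Equiv.sum_comp (Equiv.swap c.left c.right)]
  refine Finset.sum_congr rfl fun x _ => ?_
  simp only [Function.comp_apply, Equiv.swap_apply_self]
  congr 1
  have hr : c.right.val = c.left.val + 1 := rfl
  by_cases h1 : x = c.left
  · subst h1; rw [Equiv.swap_apply_left, eq_iff_iff]; omega
  by_cases h2 : x = c.right
  · subst h2; rw [Equiv.swap_apply_right, eq_iff_iff]; omega
  · rw [Equiv.swap_apply_of_ne_of_ne h1 h2]

theorem siteAfter_flipPath_right {n : ℕ} (c : Crossing n) (p : Fin n → Bool) :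
    siteAfter (flipPath c p) c.right.val = siteAfter p c.left.val + stepSign (p c.right) := by
  rw [siteAfter_right, siteAfter_flipPath, flipPath_left]
  exact Nat.ne_of_lt (Nat.lt_succ_self _)

/-- The rank-one local operator at a crossing defined by the local vectors `u z`, where `z` is the
site before the crossing. -/
noncomputable def localOp {n : ℕ} (u : ℤ → Bool → ℝ) (c : Crossing n) (f : (Fin n → Bool) → ℂ) :
    (Fin n → Bool) → ℂ := fun p =>
  if p c.left = p c.right then 0 else
    u (siteAfter p c.left) (p c.left) * (u (siteAfter p c.left) (p c.left) * f p +
      u (siteAfter p c.left) (p c.right) * f (flipPath c p))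

/-- The numbers `λ_z = sin (π z / k)`. -/
noncomputable def lam (k : ℕ) (z : ℤ) : ℝ := Real.sin (Real.pi * z / k)

/-- Weight of a step from `z` to `z'`. -/
noncomputable def stepWeight (k : ℕ) (z z' : ℤ) : ℝ :=
  if 1 ≤ z ∧ z ≤ (k : ℤ) - 1 then Real.sqrt (lam k z' / lam k z) else 0

/-- The local vectors of the Temperley-Lieb generators. -/
noncomputable def tlVec (k : ℕ) (z : ℤ) (b : Bool) : ℝ := stepWeight k z (z + stepSign b)

theorem lam_pos {k : ℕ} {z : ℤ} (h1 : 1 ≤ z) (h2 : z ≤ (k : ℤ) - 1) : 0 < lam k z := by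
  have hk : (0 : ℝ) < k := by exact_mod_cast (by omega : 0 < k)
  have h1' : (1 : ℝ) ≤ z := by exact_mod_cast h1
  have h2' : (z : ℝ) < k := by exact_mod_cast (by omega : z < (k : ℤ))
  apply Real.sin_pos_of_pos_of_lt_pi
  · have := Real.pi_pos; positivity
  · rw [div_lt_iff₀ hk]; exact mul_lt_mul_of_pos_left h2' Real.pi_pos

theorem lam_zero (k : ℕ) : lam k 0 = 0 := by simp [lam]

theorem lam_self {k : ℕ} (hk : k ≠ 0) : lam k k = 0 := by
  have : (k : ℝ) ≠ 0 := by exact_mod_cast hk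
  simp [lam, this]

theorem lam_nonneg {k : ℕ} {z : ℤ} (h1 : 0 ≤ z) (h2 : z ≤ (k : ℤ)) : 0 ≤ lam k z := by
  rcases Nat.eq_zero_or_pos k with rfl | hk
  · simp [lam]
  rcases h1.eq_or_lt with rfl | h1
  · rw [lam_zero]
  rcases h2.eq_or_lt with rfl | h2
  · rw [lam_self hk.ne']
  · exact (lam_pos (by omega) (by omega)).le

/-- λ is an eigenvector of the adjacency matrix of the line with eigenvalue d. The value of a loop,
the unitarity of the crossings and the formula for N all rest on this relation. -/
theorem lam_add_lam (k : ℕ) (z : ℤ) : lam k (z + 1) + lam k (z - 1) = dReal k * lam k z := by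
  unfold lam dReal
  push_cast
  rw [mul_add, mul_sub, add_div, sub_div, Real.sin_add, Real.sin_sub]
  ring_nf

/-- Steps in opposite directions have inverse weights. -/
theorem stepWeight_inv {k : ℕ} {z z' : ℤ} (h : z' = z + 1 ∨ z' = z - 1) :
    stepWeight k z z' * stepWeight k z' z = 1 ∨
      (stepWeight k z z' = 0 ∧ stepWeight k z' z = 0) := by
  by_cases hz : 1 ≤ z ∧ z ≤ (k : ℤ) - 1
  · by_cases hz' : 1 ≤ z' ∧ z' ≤ (k : ℤ) - 1
    · left
      have h1 := lam_pos hz.1 hz.2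
      have h2 := lam_pos hz'.1 hz'.2
      rw [stepWeight, stepWeight, if_pos hz, if_pos hz', ← Real.sqrt_mul (by positivity)]
      rw [div_mul_div_cancel₀ h1.ne', div_self h2.ne', Real.sqrt_one]
    · right
      refine ⟨?_, by rw [stepWeight, if_neg hz']⟩
      have : lam k z' = 0 := by
        have : z' = 0 ∨ z' = k := by omega
        rcases this with rfl | rfl
        · exact lam_zero k
        · exact lam_self (by omega)
      rw [stepWeight, if_pos hz, this]; simp
  · by_cases hz' : 1 ≤ z' ∧ z' ≤ (k : ℤ) - 1
    · right
      refine ⟨by rw [stepWeight, if_neg hz], ?_⟩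
      have : lam k z = 0 := by
        have : z = 0 ∨ z = k := by omega
        rcases this with rfl | rfl
        · exact lam_zero k
        · exact lam_self (by omega)
      rw [stepWeight, if_pos hz', this]; simp
    · right
      exact ⟨by rw [stepWeight, if_neg hz], by rw [stepWeight, if_neg hz']⟩

/-- This is the eigenvector relation divided by λ_z; it is the reason why a closed loop contributes
d. -/
theorem tlVec_sq_add {k : ℕ} {z : ℤ} (hz : 1 ≤ z ∧ z ≤ (k : ℤ) - 1) :
    tlVec k z true ^ 2 + tlVec k z false ^ 2 = dReal k := by
  have h := lam_pos hz.1 hz.2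
  rw [tlVec, tlVec, stepWeight, stepWeight, if_pos hz, if_pos hz, stepSign, stepSign]
  simp only [if_true, Bool.false_eq_true, if_false]
  rw [Real.sq_sqrt, Real.sq_sqrt, ← add_div, ← sub_eq_add_neg, lam_add_lam]
  · field_simp
  · exact div_nonneg (lam_nonneg (by omega) (by omega)) h.le
  · exact div_nonneg (lam_nonneg (by omega) (by omega)) h.le

/-- The condition on the sites of a path imposed by the arc from `a` to `f a`. -/
def ArcCond {n : ℕ} (f : Fin n → Fin n) (p : Fin n → Bool) (a : Fin n) : Prop :=
  siteAfter p a = siteAfter p ((f a).val + 1) ∧ siteAfter p (a.val + 1) = siteAfter p (f a)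

open Classical in
/-- Weight of the arc whose left end is `a`. -/
noncomputable def arcWeight {n : ℕ} (k : ℕ) (f : Fin n → Fin n) (p : Fin n → Bool) (a : Fin n) : ℝ :=
  if a < f a then
    if ArcCond f p a then stepWeight k (siteAfter p a) (siteAfter p (a.val + 1)) else 0
  else 1

/-- The vector of the path model that represents a planar matching. -/
noncomputable def matchingVec {n : ℕ} (k : ℕ) (f : Fin n → Fin n) (p : Fin n → Bool) : ℝ :=
  ∏ a, arcWeight k f p a

theorem arcWeight_of_gt {n k : ℕ} {f : Fin n → Fin n} {p : Fin n → Bool} {a : Fin n}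
    (h : f a < a) : arcWeight k f p a = 1 := by
  rw [arcWeight, if_neg h.asymm]

theorem arcWeight_of_lt {n k : ℕ} {f : Fin n → Fin n} {p : Fin n → Bool} {a : Fin n}
    (h : a < f a) (hc : ArcCond f p a) :
    arcWeight k f p a = stepWeight k (siteAfter p a) (siteAfter p (a.val + 1)) := by
  rw [arcWeight, if_pos h, if_pos hc]

theorem arcWeight_eq_zero {n k : ℕ} {f : Fin n → Fin n} {p : Fin n → Bool} {a : Fin n}
    (h : a < f a) (hc : ¬ ArcCond f p a) : arcWeight k f p a = 0 := by
  rw [arcWeight, if_pos h, if_neg hc]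

theorem arcCond_of_arcWeight_ne_zero {n k : ℕ} {f : Fin n → Fin n} {p : Fin n → Bool} {a : Fin n}
    (h : a < f a) (h0 : arcWeight k f p a ≠ 0) : ArcCond f p a :=
  not_not.1 fun hc => h0 (arcWeight_eq_zero h hc)

theorem arcWeight_flipPath {n k : ℕ} {f : Fin n → Fin n} (c : Crossing n) (p : Fin n → Bool)
    {a : Fin n} (h1 : a ≠ c.left) (h2 : a ≠ c.right) (h3 : f a ≠ c.left) (h4 : f a ≠ c.right) :
    arcWeight k f (flipPath c p) a = arcWeight k f p a := by
  have hr : c.right.val = c.left.val + 1 := rfl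
  have e1 : a.val ≠ c.right.val := fun h => h2 (Fin.ext h)
  have e2 : a.val + 1 ≠ c.right.val := fun h => h1 (Fin.ext (by omega))
  have e3 : (f a).val ≠ c.right.val := fun h => h4 (Fin.ext h)
  have e4 : (f a).val + 1 ≠ c.right.val := fun h => h3 (Fin.ext (by omega))
  have hc : ArcCond f (flipPath c p) a ↔ ArcCond f p a := by
    simp only [ArcCond, siteAfter_flipPath c p e1, siteAfter_flipPath c p e2,
      siteAfter_flipPath c p e3, siteAfter_flipPath c p e4]
  by_cases hlt : a < f a
  · by_cases h : ArcCond f p a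
    · rw [arcWeight_of_lt hlt (hc.2 h), arcWeight_of_lt hlt h, siteAfter_flipPath c p e1,
        siteAfter_flipPath c p e2]
    · rw [arcWeight_eq_zero hlt (fun h' => h (hc.1 h')), arcWeight_eq_zero hlt h]
  · rw [arcWeight, if_neg hlt, arcWeight, if_neg hlt]

/-- A path returns to the same site after an interval of steps matched among themselves. -/
theorem siteAfter_eq_of_closed {n : ℕ} {f : Fin n → Fin n} (hf : IsPlanarMatching f)
    (p : Fin n → Bool) (s t : ℕ) (hst : s ≤ t) (ht : t ≤ n)
    (hclosed : ∀ a : Fin n, s ≤ a.val → a.val < t → s ≤ (f a).val ∧ (f a).val < t)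
    (hcond : ∀ a : Fin n, s ≤ a.val → a.val < t → a < f a → ArcCond f p a) :
    siteAfter p s = siteAfter p t := by
  induction hm : t - s using Nat.strong_induction_on generalizing s with
  | _ m ih =>
    rcases hst.eq_or_lt with rfl | hlt
    · rfl
    -- The arc that starts at `s` brings the walk back to its site. The rest of the interval is
    -- again matched within itself, since by planarity a point beyond this arc cannot be matched
    -- into it.
    let a : Fin n := ⟨s, by omega⟩
    have ha := hclosed a le_rfl hlt
    have hne : (f a).val ≠ s := fun h => hf.ne a (Fin.ext h)
    have hafa : a < f a := by rw [Fin.lt_def]; change s < _; omega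
    have h1 := (hcond a le_rfl hlt hafa).1
    change siteAfter p s = _ at h1
    rw [h1]
    refine ih (t - ((f a).val + 1)) (by omega) _ (by omega) ?_ ?_ rfl
    · intro b hb1 hb2
      have hb := hclosed b (by omega) hb2
      refine ⟨?_, hb.2⟩
      by_contra hlt'
      have n1 : f b ≠ f a := fun h => by
        have : b = a := by rw [← hf.invol b, h, hf.invol]
        have := congrArg Fin.val this
        change b.val = s at this
        omega
      have n2 : f b ≠ a := fun h => by
        have : b = f a := by rw [← h, hf.invol]
        have := congrArg Fin.val this
        omega
      have n1' : (f b).val ≠ (f a).val := fun h => n1 (Fin.ext h)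
      have n2' : (f b).val ≠ s := fun h => n2 (Fin.ext h)
      have := hf.nested a (f b) (by rw [Fin.lt_def]; change s < _; omega)
        (by rw [Fin.lt_def]; omega)
      rw [hf.invol, Fin.lt_def, Fin.lt_def] at this
      omega
    · intro b hb1 hb2
      exact hcond b (by omega) hb2


/-! ### Capcups acting on the vectors of planar matchings -/

theorem stepSign_add_of_ne {a b : Bool} (h : a ≠ b) : stepSign a + stepSign b = 0 := by
  cases a <;> cases b <;> simp_all [stepSign]

theorem stepSign_cases (a : Bool) : stepSign a = 1 ∨ stepSign a = -1 := by
  cases a <;> simp [stepSign]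

theorem siteAfter_right_succ {n : ℕ} (c : Crossing n) (p : Fin n → Bool) :
    siteAfter p (c.right.val + 1) =
      siteAfter p c.left.val + stepSign (p c.left) + stepSign (p c.right) := by
  rw [siteAfter_succ, siteAfter_right]

/-- The weights at the four ends affected by a capcup. -/
theorem fourEnds_identity {k : ℕ} {z u u' v : ℤ} (hu : u = z + 1 ∨ u = z - 1) (huu : u + u' = 2 * z)
    (hv : v = u ∨ v = u') (X X' Y : ℝ)
    (hX : X = if v = u then Y else 0) (hX' : X' = if v = u' then Y else 0) :
    stepWeight k z u * (stepWeight k z u * X + stepWeight k z u' * X') =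
      stepWeight k z u * (stepWeight k z v * Y) := by
  have hne : u ≠ u' := by omega
  rcases hv with rfl | rfl
  · rw [hX, hX', if_pos rfl, if_neg hne]; ring
  · rw [hX, hX', if_pos rfl, if_neg (Ne.symm hne)]; ring

/-- The zigzag relation in coordinates. If the two weights are not inverse to each other, both
vanish and nothing is left to show. -/
theorem stepWeight_mul_mul {k : ℕ} {z v : ℤ} (h : v = z + 1 ∨ v = z - 1) :
    stepWeight k z v * (stepWeight k v z * stepWeight k v z) = stepWeight k v z := by
  rcases stepWeight_inv (k := k) h with h | h
  · rw [← mul_assoc, h, one_mul]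
  · rw [h.2]; ring

theorem stepWeight_mul_mul' {k : ℕ} {z v : ℤ} (h : v = z + 1 ∨ v = z - 1) :
    stepWeight k z v * (stepWeight k z v * stepWeight k v z) = stepWeight k z v := by
  rcases stepWeight_inv (k := k) h with h | h
  · rw [h, mul_one]
  · rw [h.1]; ring

/-- The factors of all other arcs are unchanged by the exchange of steps, and the arc at the
crossing contributes the local vector itself. The rank one operator thus multiplies by the squared
length d. -/
theorem localOp_matchingVec_of_eq {n k : ℕ} {f : Fin n → Fin n} (hf : IsPlanarMatching f)
    (c : Crossing n) (h : f c.left = c.right) :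
    localOp (tlVec k) c (fun p => (matchingVec k f p : ℂ)) =
      fun p => ((dReal k * matchingVec k f p : ℝ) : ℂ) := by
  have h' : f c.right = c.left := by rw [← h, hf.invol]
  have hlt : c.left < c.right := Fin.lt_def.2 (Nat.lt_succ_self _)
  have hrl : c.right.val = c.left.val + 1 := rfl
  funext p
  set R := ∏ a ∈ Finset.univ.erase c.left, arcWeight k f p a with hR
  have hprod : ∀ q, matchingVec k f q =
      (∏ a ∈ Finset.univ.erase c.left, arcWeight k f q a) * arcWeight k f q c.left := fun q =>
    (Finset.prod_erase_mul _ _ (Finset.mem_univ c.left)).symm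
  have hR' : ∏ a ∈ Finset.univ.erase c.left, arcWeight k f (flipPath c p) a = R := by
    refine Finset.prod_congr rfl fun a ha => ?_
    have h1 := Finset.ne_of_mem_erase ha
    by_cases h2 : a = c.right
    · subst h2
      rw [arcWeight_of_gt (by rw [h']; exact hlt), arcWeight_of_gt (by rw [h']; exact hlt)]
    · refine arcWeight_flipPath c p h1 h2 ?_ ?_
      · intro e; exact h2 (by rw [← hf.invol a, e, h])
      · intro e; exact h1 (by rw [← hf.invol a, e, h'])
  by_cases hp : p c.left = p c.right
  -- Two equal steps end two sites away, against the condition of the arc.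
  · have : matchingVec k f p = 0 := by
      rw [hprod, arcWeight_eq_zero (by rw [h]; exact hlt), mul_zero]
      rintro ⟨h1, -⟩
      rw [h, siteAfter_right_succ, ← hp] at h1
      rcases stepSign_cases (p c.left) with e | e <;> omega
    rw [localOp, if_pos hp, this]; simp
  · have hw : ∀ q : Fin n → Bool, q c.left ≠ q c.right →
        arcWeight k f q c.left = tlVec k (siteAfter q c.left) (q c.left) := by
      intro q hq
      rw [arcWeight_of_lt (by rw [h]; exact hlt), tlVec, ← siteAfter_right, hrl]
      refine ⟨?_, by rw [h, hrl]⟩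
      rw [h, siteAfter_right_succ]
      have := stepSign_add_of_ne hq
      omega
    have hq : flipPath c p c.left ≠ flipPath c p c.right := by
      rw [flipPath_left, flipPath_right]; exact fun e => hp e.symm
    rw [localOp, if_neg hp, hprod p, hprod (flipPath c p), hR', ← hR, hw p hp, hw _ hq, flipPath_left,
      siteAfter_flipPath c p (by omega)]
    set z := siteAfter p c.left.val
    by_cases hz : 1 ≤ z ∧ z ≤ (k : ℤ) - 1
    · rw [← tlVec_sq_add hz]
      cases hb : p c.left <;> cases hb' : p c.right <;> simp [hb, hb'] at hp ⊢ <;> ring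
    · have : ∀ b, tlVec k z b = 0 := fun b => by rw [tlVec, stepWeight, if_neg hz]
      simp [this]

theorem rewire_ne_fourEnds {n : ℕ} {f : Fin n → Fin n} (hf : IsPlanarMatching f) (c : Crossing n)
    {a : Fin n} (h1 : a ≠ c.left) (h2 : a ≠ c.right) (h3 : a ≠ f c.left) (h4 : a ≠ f c.right) :
    f a ≠ c.left ∧ f a ≠ c.right ∧ rewire f c.left c.right a = f a :=
  ⟨fun e => h3 (by rw [← e, hf.invol]), fun e => h4 (by rw [← e, hf.invol]),
    rewire_other c f h1 h2 h3 h4⟩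

/-- The possible positions of the mates of two adjacent points that are not matched. -/
theorem IsPlanarMatching.mate_order {n : ℕ} {f : Fin n → Fin n} (hf : IsPlanarMatching f)
    (c : Crossing n) (h : f c.left ≠ c.right) :
    ((f c.left).val < c.left.val ∧ c.right.val < (f c.right).val) ∨
      ((f c.right).val < (f c.left).val ∧ (f c.left).val < c.left.val) ∨
      (c.right.val < (f c.right).val ∧ (f c.right).val < (f c.left).val) := by
  have h' := hf.mate_right_ne_left c h
  have hrl : c.right.val = c.left.val + 1 := rfl
  have nj1 : (f c.left).val ≠ c.right.val := fun e => h (Fin.ext e)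
  have nj2 : (f c.left).val ≠ c.left.val := fun e => hf.ne _ (Fin.ext e)
  have nm1 : (f c.right).val ≠ c.left.val := fun e => h' (Fin.ext e)
  have nm2 : (f c.right).val ≠ c.right.val := fun e => hf.ne _ (Fin.ext e)
  have t1 := hf.nested c.left c.right (Fin.lt_def.2 (by omega))
  have t2 := hf.nested (f c.right) c.left
  rw [hf.invol] at t2
  simp only [Fin.lt_def] at t1 t2
  rcases lt_or_ge (f c.left).val c.left.val with h1 | h1
  · rcases lt_or_ge c.right.val (f c.right).val with h2 | h2
    · exact Or.inl ⟨h1, h2⟩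
    · exact Or.inr (Or.inl ⟨(t2 (by omega) (by omega)).1, h1⟩)
  · have := t1 (by omega)
    exact Or.inr (Or.inr ⟨by omega, by omega⟩)

-- Arcs away from the crossing contribute a factor common to both sides, so only the four ends
-- matter. If that factor is nonzero, the conditions of these arcs force the walk to return between
-- the crossing and the nearest mate on a side. Then at most one of the two exchanged walks
-- satisfies the conditions of the old arcs, and the weights combine by `stepWeight_mul_mul` or its
-- variant.
set_option maxHeartbeats 1000000 in
theorem localOp_matchingVec_of_ne {n k : ℕ} {f : Fin n → Fin n} (hf : IsPlanarMatching f)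
    (c : Crossing n) (h : f c.left ≠ c.right) :
    localOp (tlVec k) c (fun p => (matchingVec k f p : ℂ)) =
      fun p => (matchingVec k (rewire f c.left c.right) p : ℂ) := by
  have h' := hf.mate_right_ne_left c h
  have hlt : c.left < c.right := Fin.lt_def.2 (Nat.lt_succ_self _)
  have hrl : c.right.val = c.left.val + 1 := rfl
  have hlr := c.left_ne_right
  have hfne : f c.left ≠ f c.right := fun e => hlr (by rw [← hf.invol c.left, e, hf.invol])
  set f' := rewire f c.left c.right with hf'
  have fl' : f' c.left = c.right := rewire_left c f
  have fr' : f' c.right = c.left := rewire_right c f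
  have fj' : f' (f c.left) = f c.right := rewire_mate_left hf c h
  have fm' : f' (f c.right) = f c.left := rewire_mate_right hf c h
  let T : Finset (Fin n) := {c.left, c.right, f c.left, f c.right}
  have hT : ∀ a, a ∈ Tᶜ ↔ a ≠ c.left ∧ a ≠ c.right ∧ a ≠ f c.left ∧ a ≠ f c.right := by
    intro a; simp [T]
  have hTprod : ∀ w : Fin n → ℝ, ∏ a ∈ T, w a =
      w c.left * (w c.right * (w (f c.left) * w (f c.right))) := by
    intro w
    rw [Finset.prod_insert, Finset.prod_insert, Finset.prod_insert, Finset.prod_singleton]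
    · simpa using hfne
    · simp only [Finset.mem_insert, Finset.mem_singleton, not_or]
      exact ⟨h.symm, (hf.ne _).symm⟩
    · simp only [Finset.mem_insert, Finset.mem_singleton, not_or]
      exact ⟨hlr, (hf.ne _).symm, h'.symm⟩
  have hsplit : ∀ g q, matchingVec k g q =
      (∏ a ∈ Tᶜ, arcWeight k g q a) * ∏ a ∈ T, arcWeight k g q a := fun g q =>
    (Finset.prod_compl_mul_prod T _).symm
  funext p
  set R := ∏ a ∈ Tᶜ, arcWeight k f p a with hR
  have hRflip : ∏ a ∈ Tᶜ, arcWeight k f (flipPath c p) a = R := by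
    refine Finset.prod_congr rfl fun a ha => ?_
    obtain ⟨h1, h2, h3, h4⟩ := (hT a).1 ha
    obtain ⟨e1, e2, -⟩ := rewire_ne_fourEnds hf c h1 h2 h3 h4
    exact arcWeight_flipPath c p h1 h2 e1 e2
  have hR' : ∏ a ∈ Tᶜ, arcWeight k f' p a = R := by
    refine Finset.prod_congr rfl fun a ha => ?_
    obtain ⟨h1, h2, h3, h4⟩ := (hT a).1 ha
    obtain ⟨-, -, e⟩ := rewire_ne_fourEnds hf c h1 h2 h3 h4
    have hc : ArcCond f' p a ↔ ArcCond f p a := by rw [ArcCond, ArcCond, hf', e]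
    by_cases hlt : a < f a
    · have hlt' : a < f' a := by rw [hf', e]; exact hlt
      by_cases h : ArcCond f p a
      · rw [arcWeight_of_lt hlt' (hc.2 h), arcWeight_of_lt hlt h]
      · rw [arcWeight_eq_zero hlt' (fun h' => h (hc.1 h')), arcWeight_eq_zero hlt h]
    · rw [arcWeight, hf', e, if_neg hlt, arcWeight, if_neg hlt]
  by_cases hp : p c.left = p c.right
  · rw [localOp, if_pos hp, hsplit, hTprod, arcWeight_eq_zero (a := c.left) (by rw [fl']; exact hlt)]
    · simp
    · rintro ⟨h1, -⟩
      rw [fl', siteAfter_right_succ, ← hp] at h1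
      rcases stepSign_cases (p c.left) with e | e <;> omega
  rw [localOp, if_neg hp, hsplit f p, hsplit f (flipPath c p), hsplit f' p, hRflip, hR', ← hR]
  by_cases hR0 : R = 0
  · simp [hR0]
  have hcond : ∀ a, a ≠ c.left → a ≠ c.right → a ≠ f c.left → a ≠ f c.right → a < f a →
      ArcCond f p a := by
    intro a h1 h2 h3 h4 hlt
    have hne : arcWeight k f p a ≠ 0 := fun e =>
      hR0 (Finset.prod_eq_zero ((hT a).2 ⟨h1, h2, h3, h4⟩) e)
    exact arcCond_of_arcWeight_ne_zero hlt hne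
  -- `u` and `u'` are the sites between the two steps, for `p` and for the exchanged walk. `J0`,
  -- `J1` and `L0`, `L1` are the sites before and after the mates of left and right.
  set z := siteAfter p c.left.val with hz
  set u := siteAfter p c.right.val with hu
  set u' := siteAfter (flipPath c p) c.right.val with hu'
  have hz2 : siteAfter p (c.right.val + 1) = z := by
    rw [siteAfter_right_succ]; have := stepSign_add_of_ne hp; omega
  have hu1 : u = z + stepSign (p c.left) := siteAfter_right c p
  have hu1' : u' = z + stepSign (p c.right) := siteAfter_flipPath_right c p
  have hu2 : u = z + 1 ∨ u = z - 1 := by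
    rcases stepSign_cases (p c.left) with e | e <;> omega
  have huu : u + u' = 2 * z := by have := stepSign_add_of_ne hp; omega
  set J0 := siteAfter p (f c.left).val with hJ0
  set J1 := siteAfter p ((f c.left).val + 1) with hJ1
  set L0 := siteAfter p (f c.right).val with hL0
  set L1 := siteAfter p ((f c.right).val + 1) with hL1
  have hJ : J1 = J0 + 1 ∨ J1 = J0 - 1 := by
    have := siteAfter_succ p (f c.left)
    rcases stepSign_cases (p (f c.left)) with e | e <;> omega
  have hL : L1 = L0 + 1 ∨ L1 = L0 - 1 := by
    have := siteAfter_succ p (f c.right)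
    rcases stepSign_cases (p (f c.right)) with e | e <;> omega
  have nj1 : (f c.left).val ≠ c.right.val := fun e => h (Fin.ext e)
  have nj2 : (f c.left).val ≠ c.left.val := fun e => hf.ne _ (Fin.ext e)
  have nm1 : (f c.right).val ≠ c.left.val := fun e => h' (Fin.ext e)
  have nm2 : (f c.right).val ≠ c.right.val := fun e => hf.ne _ (Fin.ext e)
  have njm : (f c.left).val ≠ (f c.right).val := fun e => hfne (Fin.ext e)
  have flipz : siteAfter (flipPath c p) c.left.val = z := siteAfter_flipPath c p (by omega)
  have flipz2 : siteAfter (flipPath c p) (c.right.val + 1) = z := by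
    rw [siteAfter_flipPath c p (by omega), hz2]
  have flipJ0 : siteAfter (flipPath c p) (f c.left).val = J0 := siteAfter_flipPath c p nj1
  have flipJ1 : siteAfter (flipPath c p) ((f c.left).val + 1) = J1 :=
    siteAfter_flipPath c p (by omega)
  have flipL0 : siteAfter (flipPath c p) (f c.right).val = L0 := siteAfter_flipPath c p nm2
  have flipL1 : siteAfter (flipPath c p) ((f c.right).val + 1) = L1 :=
    siteAfter_flipPath c p (by omega)
  have tu : tlVec k z (p c.left) = stepWeight k z u := by rw [tlVec, hu1]
  have tu' : tlVec k z (p c.right) = stepWeight k z u' := by rw [tlVec, hu1']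
  have wl' : arcWeight k f' p c.left = stepWeight k z u := by
    rw [arcWeight_of_lt (by rw [fl']; exact hlt), ← hrl]
    exact ⟨by rw [fl', hz2], by rw [fl', hrl]⟩
  have wr' : arcWeight k f' p c.right = 1 := arcWeight_of_gt (by rw [fr']; exact hlt)
  suffices hmain : stepWeight k z u * (stepWeight k z u * (∏ a ∈ T, arcWeight k f p a) +
      stepWeight k z u' * (∏ a ∈ T, arcWeight k f (flipPath c p) a)) =
        ∏ a ∈ T, arcWeight k f' p a by
    rw [← hmain, tu, tu']
    simp only [Complex.ofReal_mul, Complex.ofReal_add]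
    ring
  have acl : ∀ q : Fin n → Bool, ArcCond f q c.left ↔ siteAfter q c.left.val =
      siteAfter q ((f c.left).val + 1) ∧ siteAfter q c.right.val = siteAfter q (f c.left).val :=
    fun q => Iff.rfl
  have acr : ∀ q : Fin n → Bool, ArcCond f q c.right ↔ siteAfter q c.right.val =
      siteAfter q ((f c.right).val + 1) ∧ siteAfter q (c.right.val + 1) =
        siteAfter q (f c.right).val := fun q => Iff.rfl
  have acj : ∀ q : Fin n → Bool, ArcCond f q (f c.left) ↔ siteAfter q (f c.left).val =
      siteAfter q c.right.val ∧ siteAfter q ((f c.left).val + 1) = siteAfter q c.left.val :=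
    fun q => by rw [ArcCond, hf.invol, ← hrl]
  have acm : ∀ q : Fin n → Bool, ArcCond f q (f c.right) ↔ siteAfter q (f c.right).val =
      siteAfter q (c.right.val + 1) ∧ siteAfter q ((f c.right).val + 1) =
        siteAfter q c.right.val := fun q => by rw [ArcCond, hf.invol]
  have acj' : ArcCond f' p (f c.left) ↔ J0 = L1 ∧ J1 = L0 := by rw [ArcCond, fj']
  have acm' : ArcCond f' p (f c.right) ↔ L0 = J1 ∧ L1 = J0 := by rw [ArcCond, fm']
  -- The points strictly between the mate and the crossing are matched among themselves, so
  -- `siteAfter_eq_of_closed` applies to them.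
  have inJ : (f c.left).val < c.left.val → J1 = z := by
    intro hlt
    have hcl : ∀ a : Fin n, (f c.left).val + 1 ≤ a.val → a.val < c.left.val →
        (f c.left).val + 1 ≤ (f a).val ∧ (f a).val < c.left.val := by
      intro a h1 h2
      have := hf.nested (f c.left) a (by rw [Fin.lt_def]; omega)
        (by rw [hf.invol, Fin.lt_def]; omega)
      rw [hf.invol, Fin.lt_def, Fin.lt_def] at this
      omega
    refine siteAfter_eq_of_closed hf p _ _ (by omega) c.left.2.le hcl ?_
    intro a h1 h2
    refine hcond a ?_ ?_ ?_ ?_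
    iterate 3 (rw [ne_eq, Fin.ext_iff]; omega)
    rintro rfl
    have := (hcl _ h1 h2).2
    rw [hf.invol] at this
    omega
  have inL : c.right.val < (f c.right).val → L0 = z := by
    intro hlt
    rw [← hz2]
    have hcl : ∀ a : Fin n, c.right.val + 1 ≤ a.val → a.val < (f c.right).val →
        c.right.val + 1 ≤ (f a).val ∧ (f a).val < (f c.right).val := by
      intro a h1 h2
      have := hf.nested c.right a (by rw [Fin.lt_def]; omega) (by rw [Fin.lt_def]; omega)
      rw [Fin.lt_def, Fin.lt_def] at this
      omega
    symm
    refine siteAfter_eq_of_closed hf p _ _ (by omega) (f c.right).2.le hcl ?_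
    intro a h1 h2
    refine hcond a ?_ ?_ ?_ ?_
    iterate 2 (rw [ne_eq, Fin.ext_iff]; omega)
    · rintro rfl
      have := (hcl _ h1 h2).1
      rw [hf.invol] at this
      omega
    · rw [ne_eq, Fin.ext_iff]; omega
  rw [hTprod, hTprod, hTprod, wl', wr']
  have hcases := hf.mate_order c h
  rcases hcases with ⟨o1, o2⟩ | ⟨o1, o2⟩ | ⟨o1, o2⟩
  -- Mates on opposite sides: both old arcs are weighted by the step from `J0` to `z`, hence
  -- `stepWeight_mul_mul`.
  · have e1 := inJ o1
    have e2 := inL o2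
    rw [arcWeight_of_gt (a := c.left) (Fin.lt_def.2 o1),
      arcWeight_of_gt (a := c.left) (Fin.lt_def.2 o1),
      arcWeight_of_gt (a := f c.right) (by rw [hf.invol]; exact Fin.lt_def.2 o2),
      arcWeight_of_gt (a := f c.right) (by rw [hf.invol]; exact Fin.lt_def.2 o2),
      arcWeight_of_gt (f := f') (a := f c.right) (by rw [fm', Fin.lt_def]; omega)]
    have ltj : f c.left < f (f c.left) := by rw [hf.invol]; exact Fin.lt_def.2 o1
    have ltr : c.right < f c.right := Fin.lt_def.2 o2
    have ltj' : f c.left < f' (f c.left) := by rw [fj', Fin.lt_def]; omega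
    by_cases hc : J0 = L1
    · have hv : J0 = z + 1 ∨ J0 = z - 1 := by omega
      rw [one_mul, one_mul, mul_one, mul_one, one_mul, mul_one,
        fourEnds_identity (v := J0) hu2 huu (by omega) _ _
        (stepWeight k J0 z * stepWeight k J0 z), stepWeight_mul_mul hv,
        arcWeight_of_lt ltj' (acj'.2 ⟨hc, by omega⟩), ← hJ0, ← hJ1, e1]
      · by_cases hJu : J0 = u
        · rw [if_pos hJu, arcWeight_of_lt ltj ((acj p).2 ⟨hJu, e1⟩),
            arcWeight_of_lt ltr ((acr p).2 ⟨by rw [← hu, ← hL1]; omega, by rw [hz2, ← hL0, e2]⟩),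
            ← hJ0, ← hJ1, ← hu, hz2, e1, hJu]
        · rw [if_neg hJu, arcWeight_eq_zero ltj, mul_zero]
          rw [acj]; exact fun e => hJu e.1
      · by_cases hJu : J0 = u'
        · rw [if_pos hJu, arcWeight_of_lt ltj
            ((acj _).2 ⟨by rw [flipJ0, hJu], by rw [flipJ1, flipz, e1]⟩),
            arcWeight_of_lt ltr ((acr _).2 ⟨by rw [← hu', flipL1]; omega, by rw [flipz2, flipL0, e2]⟩),
            flipJ0, flipJ1, ← hu', flipz2, e1, hJu]
        · rw [if_neg hJu, arcWeight_eq_zero ltj, mul_zero]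
          rw [acj, flipJ0]; exact fun e => hJu e.1
    · rw [arcWeight_eq_zero ltj' (fun e => hc (acj'.1 e).1)]
      have x1 : arcWeight k f p c.right * arcWeight k f p (f c.left) = 0 := by
        by_cases hJu : J0 = u
        · rw [arcWeight_eq_zero ltr, zero_mul]
          rw [acr]; rintro ⟨e, -⟩; apply hc; rw [hJu, hu, e]
        · rw [arcWeight_eq_zero ltj, mul_zero]
          rw [acj]; exact fun e => hJu e.1
      have x2 : arcWeight k f (flipPath c p) c.right * arcWeight k f (flipPath c p) (f c.left) = 0 := by
        by_cases hJu : J0 = u'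
        · rw [arcWeight_eq_zero ltr, zero_mul]
          rw [acr, flipL1]; rintro ⟨e, -⟩; apply hc; rw [hJu, hu', e]
        · rw [arcWeight_eq_zero ltj, mul_zero]
          rw [acj, flipJ0]; exact fun e => hJu e.1
      simp [x1, x2]
  -- Both mates on the left: the old arcs carry one step in each direction, hence
  -- `stepWeight_mul_mul'`. The last case, with both mates on the right, is analogous.
  · have e1 := inJ o2
    rw [arcWeight_of_gt (a := c.left) (Fin.lt_def.2 o2),
      arcWeight_of_gt (a := c.left) (Fin.lt_def.2 o2),
      arcWeight_of_gt (a := c.right) (by rw [Fin.lt_def]; omega),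
      arcWeight_of_gt (a := c.right) (by rw [Fin.lt_def]; omega),
      arcWeight_of_gt (f := f') (a := f c.left) (by rw [fj', Fin.lt_def]; omega)]
    have ltj : f c.left < f (f c.left) := by rw [hf.invol]; exact Fin.lt_def.2 o2
    have ltm : f c.right < f (f c.right) := by rw [hf.invol, Fin.lt_def]; omega
    have ltm' : f c.right < f' (f c.right) := by rw [fm', Fin.lt_def]; omega
    simp only [one_mul]
    by_cases hc : L0 = J1 ∧ L1 = J0
    · have hv : J0 = z + 1 ∨ J0 = z - 1 := by omega
      have e2 : L0 = z := by omega
      rw [fourEnds_identity (v := J0) hu2 huu (by omega) _ _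
        (stepWeight k z J0 * stepWeight k J0 z), stepWeight_mul_mul' hv,
        arcWeight_of_lt ltm' (acm'.2 hc), ← hL0, ← hL1, e2, hc.2]
      · by_cases hJu : J0 = u
        · rw [if_pos hJu, arcWeight_of_lt ltj ((acj p).2 ⟨hJu, e1⟩),
            arcWeight_of_lt ltm ((acm p).2 ⟨by rw [hz2]; exact e2, by rw [← hu, ← hL1]; omega⟩),
            ← hJ0, ← hJ1, ← hL0, ← hL1, e1, e2, hc.2, mul_comm]
        · rw [if_neg hJu, arcWeight_eq_zero ltj, zero_mul]
          rw [acj]; exact fun e => hJu e.1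
      · by_cases hJu : J0 = u'
        · rw [if_pos hJu, arcWeight_of_lt ltj
            ((acj _).2 ⟨by rw [flipJ0, hJu], by rw [flipJ1, flipz, e1]⟩),
            arcWeight_of_lt ltm ((acm _).2
              ⟨by rw [flipz2, flipL0, e2], by rw [← hu', flipL1]; omega⟩),
            flipJ0, flipJ1, flipL0, flipL1, e1, e2, hc.2, mul_comm]
        · rw [if_neg hJu, arcWeight_eq_zero ltj, zero_mul]
          rw [acj, flipJ0]; exact fun e => hJu e.1
    · rw [arcWeight_eq_zero ltm' (fun e => hc (acm'.1 e))]
      have x1 : arcWeight k f p (f c.left) * arcWeight k f p (f c.right) = 0 := by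
        by_cases hJu : ArcCond f p (f c.left)
        · rw [arcWeight_eq_zero ltm, mul_zero]
          rw [acm, hz2, ← hL0, ← hL1, ← hu]
          rw [acj, ← hJ0, ← hu] at hJu
          rintro ⟨ea, eb⟩; apply hc; omega
        · rw [arcWeight_eq_zero ltj hJu, zero_mul]
      have x2 : arcWeight k f (flipPath c p) (f c.left) *
          arcWeight k f (flipPath c p) (f c.right) = 0 := by
        by_cases hJu : ArcCond f (flipPath c p) (f c.left)
        · rw [arcWeight_eq_zero ltm, mul_zero]
          rw [acm, flipz2, flipL0, flipL1, ← hu']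
          rw [acj, flipJ0, ← hu'] at hJu
          rintro ⟨ea, eb⟩; apply hc; omega
        · rw [arcWeight_eq_zero ltj hJu, zero_mul]
      simp [x1, x2]
  · have e2 := inL o1
    rw [arcWeight_of_gt (a := f c.left) (by rw [hf.invol, Fin.lt_def]; omega),
      arcWeight_of_gt (a := f c.left) (by rw [hf.invol, Fin.lt_def]; omega),
      arcWeight_of_gt (a := f c.right) (by rw [hf.invol, Fin.lt_def]; omega),
      arcWeight_of_gt (a := f c.right) (by rw [hf.invol, Fin.lt_def]; omega),
      arcWeight_of_gt (f := f') (a := f c.left) (by rw [fj', Fin.lt_def]; omega)]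
    have ltl : c.left < f c.left := by rw [Fin.lt_def]; omega
    have ltr : c.right < f c.right := Fin.lt_def.2 o1
    have ltm' : f c.right < f' (f c.right) := by rw [fm', Fin.lt_def]; omega
    simp only [one_mul, mul_one]
    by_cases hc : L0 = J1 ∧ L1 = J0
    · have hv : J0 = z + 1 ∨ J0 = z - 1 := by omega
      have e1 : J1 = z := by omega
      rw [fourEnds_identity (v := J0) hu2 huu (by omega) _ _
        (stepWeight k z J0 * stepWeight k J0 z), stepWeight_mul_mul' hv,
        arcWeight_of_lt ltm' (acm'.2 hc), ← hL0, ← hL1, e2, hc.2]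
      · by_cases hJu : J0 = u
        · rw [if_pos hJu, arcWeight_of_lt ltl ((acl p).2 ⟨e1.symm, hJu.symm⟩),
            arcWeight_of_lt ltr ((acr p).2 ⟨by rw [← hu, ← hL1]; omega, by rw [hz2]; exact e2.symm⟩),
            ← hrl, ← hu, ← hz, hz2, hJu]
        · rw [if_neg hJu, arcWeight_eq_zero ltl, zero_mul]
          rw [acl]; exact fun e => hJu e.2.symm
      · by_cases hJu : J0 = u'
        · rw [if_pos hJu, arcWeight_of_lt ltl
            ((acl _).2 ⟨by rw [flipJ1, flipz, e1], by rw [flipJ0, hJu]⟩),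
            arcWeight_of_lt ltr ((acr _).2
              ⟨by rw [← hu', flipL1]; omega, by rw [flipz2, flipL0, e2]⟩),
            ← hrl, ← hu', flipz, flipz2, hJu]
        · rw [if_neg hJu, arcWeight_eq_zero ltl, zero_mul]
          rw [acl, flipJ0]; exact fun e => hJu e.2.symm
    · rw [arcWeight_eq_zero ltm' (fun e => hc (acm'.1 e))]
      have x1 : arcWeight k f p c.left * arcWeight k f p c.right = 0 := by
        by_cases hJu : ArcCond f p c.left
        · rw [arcWeight_eq_zero ltr, mul_zero]
          rw [acr, hz2, ← hL0, ← hL1, ← hu]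
          rw [acl, ← hJ0, ← hu, ← hJ1, ← hz] at hJu
          rintro ⟨ea, eb⟩; apply hc; omega
        · rw [arcWeight_eq_zero ltl hJu, zero_mul]
      have x2 : arcWeight k f (flipPath c p) c.left * arcWeight k f (flipPath c p) c.right = 0 := by
        by_cases hJu : ArcCond f (flipPath c p) c.left
        · rw [arcWeight_eq_zero ltr, mul_zero]
          rw [acr, flipz2, flipL0, flipL1, ← hu']
          rw [acl, flipJ0, ← hu', flipJ1, flipz] at hJu
          rintro ⟨ea, eb⟩; apply hc; omega
        · rw [arcWeight_eq_zero ltl hJu, zero_mul]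
      simp [x1, x2]


/-- The operator of a crossing in the path model. -/
noncomputable def crossingOp {n : ℕ} (A : ℂ) (k : ℕ) (c : Crossing n) (f : (Fin n → Bool) → ℂ) :
    (Fin n → Bool) → ℂ :=
  crossingFactor A c.pos true • localOp (tlVec k) c f + crossingFactor A c.pos false • f

/-- The operator of a braid in the path model. -/
noncomputable def braidOp {n : ℕ} (A : ℂ) (k : ℕ) :
    BraidWord n → ((Fin n → Bool) → ℂ) → ((Fin n → Bool) → ℂ)
  | [], f => f
  | c :: B, f => braidOp A k B (crossingOp A k c f)

theorem localOp_add {n : ℕ} (u : ℤ → Bool → ℝ) (c : Crossing n) (f g : (Fin n → Bool) → ℂ) :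
    localOp u c (f + g) = localOp u c f + localOp u c g := by
  funext p
  simp only [localOp, Pi.add_apply]
  split_ifs
  · simp
  · ring

theorem localOp_smul {n : ℕ} (u : ℤ → Bool → ℝ) (c : Crossing n) (a : ℂ)
    (f : (Fin n → Bool) → ℂ) : localOp u c (a • f) = a • localOp u c f := by
  funext p
  simp only [localOp, Pi.smul_apply, smul_eq_mul]
  split_ifs
  · simp
  · ring

theorem crossingOp_add {n : ℕ} (A : ℂ) (k : ℕ) (c : Crossing n) (f g : (Fin n → Bool) → ℂ) :
    crossingOp A k c (f + g) = crossingOp A k c f + crossingOp A k c g := by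
  rw [crossingOp, crossingOp, crossingOp, localOp_add]; module

theorem crossingOp_smul {n : ℕ} (A : ℂ) (k : ℕ) (c : Crossing n) (a : ℂ)
    (f : (Fin n → Bool) → ℂ) : crossingOp A k c (a • f) = a • crossingOp A k c f := by
  rw [crossingOp, crossingOp, localOp_smul]; module

theorem braidOp_add {n : ℕ} (A : ℂ) (k : ℕ) (B : BraidWord n) (f g : (Fin n → Bool) → ℂ) :
    braidOp A k B (f + g) = braidOp A k B f + braidOp A k B g := by
  induction B generalizing f g with
  | nil => rfl
  | cons c B ih => rw [braidOp, braidOp, braidOp, crossingOp_add, ih]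

theorem braidOp_smul {n : ℕ} (A : ℂ) (k : ℕ) (B : BraidWord n) (a : ℂ)
    (f : (Fin n → Bool) → ℂ) : braidOp A k B (a • f) = a • braidOp A k B f := by
  induction B generalizing f with
  | nil => rfl
  | cons c B ih => rw [braidOp, braidOp, crossingOp_smul, ih]

/-- The path that goes back and forth between the sites `1` and `2`. -/
def altPath (n : ℕ) (a : Fin n) : Bool := decide (Even a.val)

theorem siteAfter_altPath {n : ℕ} {j : ℕ} (hj : j ≤ n) :
    siteAfter (altPath n) j = 1 + (j % 2 : ℕ) := by
  induction j with
  | zero => simp [siteAfter_zero]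
  | succ j ih =>
    have := siteAfter_succ (altPath n) ⟨j, hj⟩
    simp only at this
    rw [this, ih (by omega)]
    rcases Nat.even_or_odd j with he | ho
    · rw [altPath, decide_eq_true he, stepSign]
      have := Nat.even_iff.1 he
      simp; omega
    · rw [altPath, decide_eq_false (Nat.not_even_iff_odd.2 ho), stepSign]
      have := Nat.odd_iff.1 ho
      simp; omega

/-! ### The Kauffman bracket as a matrix element -/

section
variable {k : ℕ}

theorem dReal_pos (hk : 3 ≤ k) : 0 < dReal k := by
  have h1 := lam_pos (k := k) (z := 1) le_rfl (by omega)
  have h2 := lam_pos (k := k) (z := 2) (by omega) (by omega)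
  have h := lam_add_lam k 1
  norm_num [lam_zero] at h
  nlinarith

theorem one_le_dReal (hk : 3 ≤ k) : 1 ≤ dReal k := by
  have hk' : (3 : ℝ) ≤ k := by exact_mod_cast hk
  have : Real.cos (Real.pi / 3) ≤ Real.cos (Real.pi / k) := by
    apply Real.cos_le_cos_of_nonneg_of_le_pi
    · have := Real.pi_pos; positivity
    · have := Real.pi_pos; linarith
    · exact div_le_div_of_nonneg_left Real.pi_pos.le (by norm_num) hk'
  rw [Real.cos_pi_div_three] at this
  unfold dReal
  linarith

theorem stepWeight_one_two (hk : 3 ≤ k) : stepWeight k 1 2 = Real.sqrt (dReal k) := by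
  have h1 := lam_pos (k := k) (z := 1) le_rfl (by omega)
  have h := lam_add_lam k 1
  norm_num [lam_zero] at h
  rw [stepWeight, if_pos ⟨le_rfl, by omega⟩, h, mul_div_cancel_right₀ _ h1.ne']

theorem stepWeight_one_zero : stepWeight k 1 0 = 0 := by
  simp [stepWeight, lam_zero]

/-- The arc conditions put the walk at site 1 before every step of even index. A step down from
there has weight √(λ_0/λ_1) = 0, so only the walk 1, 2, 1, 2, … survives, and each of its n/2 arcs
has weight √(λ_2/λ_1) = √d. -/
theorem matchingVec_platMate (hk : 3 ≤ k) {n : ℕ} (hn : Even n) (p : Fin n → Bool) :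
    matchingVec k (platMate hn) p =
      if p = altPath n then Real.sqrt (dReal k) ^ (n / 2) else 0 := by
  have hm := isPlanarMatching_platMate hn
  have hlt : ∀ a : Fin n, Even a.val → a < platMate hn a := fun a ha => by
    rw [Fin.lt_def, platMate_val_even hn ha]; omega
  have hgt : ∀ a : Fin n, ¬ Even a.val → platMate hn a < a := fun a ha => by
    rw [Fin.lt_def, platMate_val_odd hn ha]
    rcases Nat.not_even_iff_odd.1 ha with ⟨b, hb⟩; omega
  split_ifs with hp
  · subst hp
    have hw : ∀ a : Fin n, arcWeight k (platMate hn) (altPath n) a =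
        if Even a.val then Real.sqrt (dReal k) else 1 := by
      intro a
      split_ifs with ha
      · have hle : a.val + 2 ≤ n := by have := (platMate hn a).2; rw [platMate_val_even hn ha] at this; omega
        have h2 := Nat.even_iff.1 ha
        rw [arcWeight_of_lt (hlt a ha), siteAfter_altPath a.2.le, siteAfter_altPath (by omega),
          show (a.val + 1) % 2 = 1 by omega, h2]
        · exact stepWeight_one_two hk
        · rw [ArcCond, platMate_val_even hn ha, siteAfter_altPath a.2.le,
            siteAfter_altPath (by omega)]
          refine ⟨?_, rfl⟩
          congr 2; omega
      · exact arcWeight_of_gt (hgt a ha)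
    rw [matchingVec, Finset.prod_congr rfl fun a _ => hw a, Finset.prod_ite, Finset.prod_const,
      Finset.prod_const_one, mul_one]
    congr 1
    obtain ⟨r, rfl⟩ := hn
    rw [show (r + r) / 2 = r by omega]
    trans (Finset.univ.image (fun j : Fin r => (⟨2 * j.val, by omega⟩ : Fin (r + r)))).card
    · congr 1
      ext a
      simp only [Finset.mem_filter, Finset.mem_univ, true_and, Finset.mem_image]
      constructor
      · rintro ⟨b, hb⟩
        exact ⟨⟨b, by omega⟩, Fin.ext (by simp; omega)⟩
      · rintro ⟨b, rfl⟩
        exact ⟨b.val, by simp; omega⟩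
    · rw [Finset.card_image_of_injective, Finset.card_univ, Fintype.card_fin]
      intro x y hxy
      have := congrArg Fin.val hxy
      simp only at this
      exact Fin.ext (by omega)
  · by_contra h0
    apply hp
    have hne : ∀ a, arcWeight k (platMate hn) p a ≠ 0 := fun a e =>
      h0 (Finset.prod_eq_zero (Finset.mem_univ a) e)
    have hc : ∀ a : Fin n, Even a.val → ArcCond (platMate hn) p a := fun a ha =>
      arcCond_of_arcWeight_ne_zero (hlt a ha) (hne a)
    have hone : ∀ j, 2 * j ≤ n → siteAfter p (2 * j) = 1 := by
      intro j
      induction j with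
      | zero => intro _; exact siteAfter_zero p
      | succ j ih =>
        intro hj
        have he : Even (2 * j) := even_two_mul j
        have := (hc ⟨2 * j, by omega⟩ he).1
        rw [platMate_val_even hn (x := ⟨2 * j, by omega⟩) he] at this
        rw [show 2 * (j + 1) = 2 * j + 1 + 1 by ring, ← this]
        exact ih (by omega)
    have heven : ∀ a : Fin n, Even a.val → siteAfter p a = 1 ∧ p a = true := by
      intro a ha
      have h1 : siteAfter p a = 1 := by
        obtain ⟨b, hb⟩ := ha
        rw [show a.val = 2 * b by omega]
        exact hone b (by omega)
      refine ⟨h1, ?_⟩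
      by_contra hpa
      have hpa' : p a = false := by simpa using hpa
      apply hne a
      rw [arcWeight_of_lt (hlt a ha) (hc a ha), siteAfter_succ, h1, hpa', stepSign]
      exact stepWeight_one_zero
    funext a
    by_cases ha : Even a.val
    · rw [(heven a ha).2, altPath, decide_eq_true ha]
    · rw [altPath, decide_eq_false ha]
      rcases Nat.not_even_iff_odd.1 ha with ⟨b, hb⟩
      have h1 : siteAfter p (a.val + 1) = 1 := by
        rw [show a.val + 1 = 2 * (b + 1) by omega]
        exact hone _ (by omega)
      have h2 := heven ⟨2 * b, by omega⟩ (even_two_mul b)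
      have h3 := siteAfter_succ p ⟨2 * b, by omega⟩
      rw [h2.1, h2.2, stepSign] at h3
      simp only [if_true] at h3
      rw [siteAfter_succ, hb, h3, stepSign] at h1
      by_contra hpa
      have hpa' : p a = true := by simpa using hpa
      rw [hpa'] at h1
      norm_num at h1

/-- At site 1 the local vector is (√d, 0), so the exchanged walk does not contribute. -/
theorem localOp_tlVec_altPath (hk : 3 ≤ k) {n : ℕ} (c : Crossing n) (hc : Even c.left.val)
    (f : (Fin n → Bool) → ℂ) : localOp (tlVec k) c f (altPath n) = dReal k * f (altPath n) := by
  have hr : ¬ Even c.right.val := by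
    change ¬ Even (c.left.val + 1); rw [Nat.even_add_one]; exact not_not.2 hc
  have hl' : altPath n c.left = true := decide_eq_true hc
  have hr' : altPath n c.right = false := decide_eq_false hr
  have hs : siteAfter (altPath n) c.left = 1 := by
    rw [siteAfter_altPath c.left.2.le, Nat.even_iff.1 hc]; rfl
  rw [localOp, hl', hr', if_neg (by simp), hs]
  have e1 : tlVec k 1 true = Real.sqrt (dReal k) := stepWeight_one_two hk
  have e2 : tlVec k 1 false = 0 := stepWeight_one_zero
  rw [e1, e2, Complex.ofReal_zero, zero_mul, add_zero, ← mul_assoc, ← Complex.ofReal_mul,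
    Real.mul_self_sqrt (dReal_pos hk).le]

/-- Induction on the number of points where `f` differs from the plat matching. Gluing a capcup at
such a pair adds a loop (`cappedLoops_nil_rewire`) and multiplies the entry at `altPath` by d, so
both sides change alike. For the plat matching both sides equal d^{n/2}. -/
theorem pow_cappedLoops_nil (hk : 3 ≤ k) {n : ℕ} (hn : Even n) {f : Fin n → Fin n} (hf : IsPlanarMatching f) :
    dReal k ^ cappedLoops hn f [] Fin.elim0 =
      Real.sqrt (dReal k) ^ (n / 2) * matchingVec k f (altPath n) := by
  have hm := isPlanarMatching_platMate hn
  have hd := dReal_pos hk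
  induction hN : (Finset.univ.filter fun a => f a ≠ platMate hn a).card using
    Nat.strong_induction_on generalizing f with
  | _ N ih =>
    by_cases hall : ∀ a, f a = platMate hn a
    · obtain rfl : f = platMate hn := funext hall
      rw [cappedLoops_nil_platMate, matchingVec_platMate hk, if_pos rfl, ← mul_pow,
        Real.mul_self_sqrt hd.le]
    · push Not at hall
      obtain ⟨a, ha, hae⟩ : ∃ a : Fin n, f a ≠ platMate hn a ∧ Even a.val := by
        obtain ⟨a, ha⟩ := hall
        by_cases hae : Even a.val
        · exact ⟨a, ha, hae⟩
        · refine ⟨platMate hn a, ?_, ?_⟩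
          · rw [hm.invol]; intro e; apply ha
            have := congrArg f e
            rw [hf.invol] at this
            exact this.symm
          · rw [platMate_val_odd hn hae]
            rcases Nat.not_even_iff_odd.1 hae with ⟨b, hb⟩
            exact ⟨b, by omega⟩
      have hval := platMate_val_even hn hae
      let c : Crossing n := ⟨a.val, by have := (platMate hn a).2; omega, true⟩
      have hcl : c.left = a := rfl
      have hcr : c.right = platMate hn a := Fin.ext hval.symm
      have hne : f c.left ≠ c.right := by rw [hcl, hcr]; exact ha
      have hf' : IsPlanarMatching (rewire f c.left c.right) := hf.rewire rfl
      have hL := cappedLoops_nil_rewire hn hf c (by rw [hcl, hcr]) hne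
      have hlt : (Finset.univ.filter fun x =>
          rewire f c.left c.right x ≠ platMate hn x).card < N := by
        rw [← hN]
        apply Finset.card_lt_card
        rw [Finset.ssubset_iff_of_subset]
        · refine ⟨a, by simpa using ha, ?_⟩
          simp only [Finset.mem_filter, Finset.mem_univ, true_and, not_not]
          rw [← hcl, rewire_left, hcr, hcl]
        · intro x
          simp only [Finset.mem_filter, Finset.mem_univ, true_and]
          intro hx hfx
          apply hx
          by_cases h1 : x = c.left
          · exact absurd hfx (by rw [h1, hcl]; exact ha)
          by_cases h2 : x = c.right
          · exfalso; apply hne; rw [h2, hcr, hm.invol] at hfx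
            rw [hcl, hcr]; rw [← hfx, hf.invol, hfx]
          by_cases h3 : x = f c.left
          · exfalso; apply h2; rw [h3, hf.invol] at hfx
            rw [hcr, h3, ← hcl]; rw [hfx, hm.invol, ← hfx]
          by_cases h4 : x = f c.right
          · exfalso; apply h1; rw [h4, hf.invol, hcr] at hfx
            have := congrArg (platMate hn) hfx
            rw [hm.invol, hm.invol] at this
            rw [h4, hcr, hcl, ← this]
          · rw [rewire_other c f h1 h2 h3 h4, hfx]
      have h1 := ih _ hlt hf' rfl
      have h2 := congrFun (localOp_matchingVec_of_ne (k := k) hf c hne) (altPath n)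
      rw [localOp_tlVec_altPath hk c hae, ← Complex.ofReal_mul, Complex.ofReal_inj] at h2
      rw [hL, pow_succ, ← h2] at h1
      have := hd.ne'
      apply mul_right_cancel₀ this
      rw [h1]; ring

/-- Induction on the word, splitting the states by the first crossing. The matching at the top has
to be arbitrary for the recursion to close: a capcup either rewires it or splits off a loop, exactly
as the operator does with `matchingVec`. -/
theorem sum_states_cappedLoops (hk : 3 ≤ k) {n : ℕ} (hn : Even n) (A : ℂ) (B : BraidWord n) {f : Fin n → Fin n}
    (hf : IsPlanarMatching f) :
    ∑ s : Fin B.length → Bool, (∏ j, crossingFactor A (B.get j).pos (s j)) *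
        (dReal k : ℂ) ^ cappedLoops hn f B s =
      (Real.sqrt (dReal k) : ℂ) ^ (n / 2) *
        braidOp A k B (fun p => (matchingVec k f p : ℂ)) (altPath n) := by
  induction B generalizing f with
  | nil =>
    refine (Fintype.sum_eq_single (Fin.elim0 : Fin ([] : BraidWord n).length → Bool)
      (fun s hs => absurd (funext fun j => j.elim0) hs)).trans ?_
    have h := pow_cappedLoops_nil hk hn hf
    have : (dReal k : ℂ) ^ cappedLoops hn f [] Fin.elim0 =
      (Real.sqrt (dReal k) : ℂ) ^ (n / 2) * (matchingVec k f (altPath n) : ℂ) := by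
      exact_mod_cast h
    simpa [braidOp] using this
  | cons c B ih =>
    have hf' : IsPlanarMatching (rewire f c.left c.right) := hf.rewire rfl
    have hsum : ∀ F : (Fin (c :: B).length → Bool) → ℂ, ∑ s, F s =
        ∑ s : Fin B.length → Bool, F (Fin.cons (α := fun _ => Bool) true s) +
        ∑ s : Fin B.length → Bool, F (Fin.cons (α := fun _ => Bool) false s) := by
      intro F
      have := (Fin.consEquiv (n := B.length) (fun _ => Bool)).sum_comp F
      refine this.symm.trans ?_
      rw [Fintype.sum_prod_type, Fintype.sum_bool]
      rfl
    have hpr : ∀ (b : Bool) (s : Fin B.length → Bool),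
        ∏ j, crossingFactor A (((c :: B).get j)).pos (Fin.cons (α := fun _ => Bool) b s j) =
          crossingFactor A c.pos b * ∏ j, crossingFactor A (B.get j).pos (s j) := by
      intro b s
      exact Fin.prod_univ_succ (n := B.length) (fun j => crossingFactor A (((c :: B).get j)).pos
        (Fin.cons (α := fun _ => Bool) b s j))
    rw [hsum]
    simp only [hpr, cappedLoops_cons_false]
    rw [braidOp, crossingOp, braidOp_add, braidOp_smul, braidOp_smul]
    simp only [Pi.add_apply, Pi.smul_apply, smul_eq_mul, mul_assoc]
    rw [← Finset.mul_sum, ← Finset.mul_sum, ih hf]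
    by_cases h : f c.left = c.right
    · simp only [cappedLoops_cons_true_of_eq hn hf c B _ h, pow_succ]
      rw [localOp_matchingVec_of_eq hf c h,
        show (fun p => ((dReal k * matchingVec k f p : ℝ) : ℂ)) =
          (dReal k : ℂ) • (fun p => (matchingVec k f p : ℂ)) from by funext p; simp, braidOp_smul]
      simp only [← mul_assoc, ← Finset.sum_mul, ih hf, Pi.smul_apply, smul_eq_mul]
      ring
    · simp only [cappedLoops_cons_true_of_ne hn hf c B _ h]
      rw [ih hf', localOp_matchingVec_of_ne hf c h]
      ring

/-- The Kauffman bracket of a plat closure is a matrix element in the path model. -/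
theorem platBracket_eq (hk : 3 ≤ k) {n : ℕ} (hn : Even n) (hn0 : 0 < n) (B : BraidWord n) :
    platBracket B (rootA k) = (dReal k : ℂ) ^ (n / 2 - 1) *
      braidOp (rootA k) k B (Pi.single (altPath n) 1) (altPath n) := by
  have hd := dReal_pos hk
  have hd' : (dReal k : ℂ) ≠ 0 := by exact_mod_cast hd.ne'
  have h := sum_states_cappedLoops hk hn (rootA k) B (isPlanarMatching_platMate hn)
  have hv : (fun p => (matchingVec k (platMate hn) p : ℂ)) =
      ((Real.sqrt (dReal k) : ℂ) ^ (n / 2)) • (Pi.single (altPath n) 1 : (Fin n → Bool) → ℂ) := by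
    funext p
    rw [matchingVec_platMate hk]
    by_cases hp : p = altPath n
    · subst hp; simp
    · simp [hp]
  rw [hv, braidOp_smul, Pi.smul_apply, smul_eq_mul, ← mul_assoc, ← mul_pow, ← Complex.ofReal_mul,
    Real.mul_self_sqrt hd.le] at h
  -- One factor d is removed by the exponent |σ| − 1 of the bracket; as n ≥ 2, the truncated
  -- exponent is the true one.
  have hn2 : n / 2 = n / 2 - 1 + 1 := by rcases hn with ⟨a, rfl⟩; omega
  rw [platBracket, loopValue_rootA]
  simp only [zpow_sub₀ hd', zpow_natCast, zpow_one, platLoops_eq_cappedLoops hn, ← mul_div_assoc]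
  rw [← Finset.sum_div, h, hn2, pow_succ, Nat.add_sub_cancel]
  field_simp

end


/-! ## The normalisation -/

theorem finrank_pathSpace (n k ℓ : ℕ) :
    Module.finrank ℂ (pathSpace n k ℓ) = (pathSet n k ℓ).ncard := by
  classical
  have hli : LinearIndependent ℂ (fun p : Fin n → Bool => Pi.single (M := fun _ => ℂ) p (1 : ℂ)) := by
    have := (Pi.basisFun ℂ (Fin n → Bool)).linearIndependent
    convert this using 2 with p
    simp
  have hinj := hli.injective
  have hfin : (pathSet n k ℓ).Finite := Set.toFinite _
  rw [pathSpace, ← Set.ncard_image_of_injective _ hinj]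
  have hli' : LinearIndepOn ℂ id ((fun p : Fin n → Bool => Pi.single (M := fun _ => ℂ) p (1 : ℂ)) ''
      pathSet n k ℓ) := by
    have := (linearIndepOn_univ_iff.2 hli).mono (Set.subset_univ (pathSet n k ℓ))
    exact this.id_image
  let _ := (hfin.image (fun p : Fin n → Bool => Pi.single (M := fun _ => ℂ) p (1 : ℂ))).fintype
  rw [finrank_span_set_eq_card hli', Set.ncard_eq_toFinset_card']

/-- All sites of the path lie in `1, …, k - 1`. -/
def InnerPath {n : ℕ} (k : ℕ) (p : Fin n → Bool) : Prop :=
  ∀ j ≤ n, 1 ≤ siteAfter p j ∧ siteAfter p j ≤ (k : ℤ) - 1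

theorem siteAfter_snoc {n : ℕ} (p : Fin n → Bool) (b : Bool) {j : ℕ} (hj : j ≤ n) :
    siteAfter (Fin.snoc (α := fun _ => Bool) p b) j = siteAfter p j := by
  rw [siteAfter, Fin.sum_univ_castSucc]
  simp [siteAfter, Nat.not_lt.2 hj]

theorem siteAfter_snoc_last {n : ℕ} (p : Fin n → Bool) (b : Bool) :
    siteAfter (Fin.snoc (α := fun _ => Bool) p b) (n + 1) = siteAfter p n + stepSign b := by
  have := siteAfter_succ (Fin.snoc (α := fun _ => Bool) p b) (Fin.last n)
  rw [Fin.val_last, siteAfter_snoc _ _ le_rfl, Fin.snoc_last] at this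
  exact this

theorem innerPath_snoc {n k : ℕ} (p : Fin n → Bool) (b : Bool) :
    InnerPath k (Fin.snoc (α := fun _ => Bool) p b) ↔ InnerPath k p ∧
      1 ≤ siteAfter p n + stepSign b ∧ siteAfter p n + stepSign b ≤ (k : ℤ) - 1 := by
  constructor
  · intro h
    refine ⟨fun j hj => ?_, ?_⟩
    · rw [← siteAfter_snoc p b hj]; exact h j (by omega)
    · rw [← siteAfter_snoc_last]; exact h _ le_rfl
  · rintro ⟨h1, h2⟩ j hj
    rcases Nat.lt_or_ge n j with h | h
    · obtain rfl : j = n + 1 := by omega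
      rw [siteAfter_snoc_last]; exact h2
    · rw [siteAfter_snoc p b h]; exact h1 j h

-- Extending a walk by both possible steps replaces λ at its end by the sum over the neighbours,
-- which is dλ. Extensions that leave 1, …, k − 1 may be counted or not, as λ vanishes at 0 and k.
open Classical in
theorem sum_innerPath_lam {k : ℕ} (hk : 2 ≤ k) (n : ℕ) :
    ∑ p : Fin n → Bool, (if InnerPath k p then lam k (siteAfter p n) else 0) =
      dReal k ^ n * lam k 1 := by
  induction n with
  | zero =>
    rw [Fintype.sum_eq_single Fin.elim0 (fun s hs => absurd (Subsingleton.elim _ _) hs), if_pos]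
    · simp [siteAfter_zero]
    · intro j hj
      obtain rfl : j = 0 := by omega
      rw [siteAfter_zero]; omega
  | succ n ih =>
    rw [← (Fin.snocEquiv (n := n) (fun _ => Bool)).sum_comp, Fintype.sum_prod_type_right, pow_succ,
      mul_comm (dReal k ^ n), mul_assoc, ← ih, Finset.mul_sum]
    refine Finset.sum_congr rfl fun p _ => ?_
    change ∑ b : Bool, (if InnerPath k (Fin.snoc (α := fun _ => Bool) p b) then
      lam k (siteAfter (Fin.snoc (α := fun _ => Bool) p b) (n + 1)) else 0) = _
    by_cases hp : InnerPath k p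
    · have hr := hp n le_rfl
      rw [if_pos hp, ← lam_add_lam, Fintype.sum_bool]
      have key : ∀ b : Bool, (if InnerPath k (Fin.snoc (α := fun _ => Bool) p b) then
          lam k (siteAfter (Fin.snoc (α := fun _ => Bool) p b) (n + 1)) else 0) =
          lam k (siteAfter p n + stepSign b) := by
        intro b
        rw [siteAfter_snoc_last]
        split_ifs with h
        · rfl
        · have h' : ¬ (1 ≤ siteAfter p n + stepSign b ∧ siteAfter p n + stepSign b ≤ (k : ℤ) - 1) :=
            fun e => h ((innerPath_snoc p b).2 ⟨hp, e⟩)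
          have : siteAfter p n + stepSign b = 0 ∨ siteAfter p n + stepSign b = k := by
            rcases stepSign_cases b with e | e <;> omega
          rcases this with e | e <;> rw [e]
          · rw [lam_zero]
          · rw [lam_self (by omega)]
      rw [key, key]
      rfl
    · rw [if_neg hp, mul_zero]
      refine Finset.sum_eq_zero fun b _ => ?_
      rw [if_neg fun h => hp ((innerPath_snoc p b).1 h).1]

/-- Grouping the walks by their last site turns `sum_innerPath_lam` into N. It follows that
d^{3n/2}/N = d^{n/2}/sin(π/k) for even n. -/
theorem normN_eq {k : ℕ} (hk : 2 ≤ k) (n : ℕ) : normN n k = dReal k ^ n * Real.sin (Real.pi / k) := by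
  classical
  have h := sum_innerPath_lam hk n
  have h1 : lam k 1 = Real.sin (Real.pi / k) := by simp [lam]
  rw [← h1, ← h, normN]
  have h2 : ∀ ℓ ∈ Finset.Icc 1 (k - 1), Real.sin (Real.pi * ℓ / k) *
      Module.finrank ℂ (pathSpace n k ℓ) =
      ∑ p : Fin n → Bool, if InnerPath k p ∧ siteAfter p n = ℓ then lam k (siteAfter p n) else 0 := by
    intro ℓ _
    rw [finrank_pathSpace, ← Finset.sum_filter,
      Finset.sum_congr rfl (g := fun _ => lam k ℓ) (by
        intro p hp; rw [(Finset.mem_filter.1 hp).2.2]), Finset.sum_const, nsmul_eq_mul, mul_comm]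
    congr 2
    · rw [Set.ncard_eq_toFinset_card']
      congr 1
      ext p
      simp only [Set.mem_toFinset, Finset.mem_filter, Finset.mem_univ, true_and]
      rfl
  rw [Finset.sum_congr rfl h2, Finset.sum_comm]
  refine Finset.sum_congr rfl fun p _ => ?_
  by_cases hp : InnerPath k p
  · have hr := hp n le_rfl
    rw [if_pos hp, Finset.sum_eq_single (siteAfter p n).toNat]
    · rw [if_pos ⟨hp, by omega⟩]
    · intro ℓ _ hne
      rw [if_neg]; rintro ⟨-, e⟩; apply hne; omega
    · intro hn; exfalso; apply hn; rw [Finset.mem_Icc]; omega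
  · rw [if_neg hp]
    exact Finset.sum_eq_zero fun ℓ _ => if_neg fun e => hp e.1


/-! ## Reasoning about programs -/

namespace Expr

/-- Bound for the bit length of the value, relative to that of the memory entries. -/
def sizeFactor : Expr → ℕ
  | const c => 1 + c.size
  | read _ _ => 1
  | add x y => x.sizeFactor + y.sizeFactor
  | sub x y => x.sizeFactor + y.sizeFactor
  | mul x y => x.sizeFactor + y.sizeFactor
  | div x y => x.sizeFactor + y.sizeFactor
  | mod x y => x.sizeFactor + y.sizeFactor
  | lt _ _ => 1
  | eq _ _ => 1

/-- Bound for the cost, relative to the bit length of the memory entries. -/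
def costFactor : Expr → ℕ
  | const c => 1 + c.size
  | read _ i => 2 + i.costFactor
  | add x y => 1 + (x.sizeFactor + y.sizeFactor) + x.costFactor + y.costFactor
  | sub x y => 1 + (x.sizeFactor + y.sizeFactor) + x.costFactor + y.costFactor
  | mul x y => 1 + (x.sizeFactor + y.sizeFactor) + x.costFactor + y.costFactor
  | div x y => 1 + (x.sizeFactor + y.sizeFactor) + x.costFactor + y.costFactor
  | mod x y => 1 + (x.sizeFactor + y.sizeFactor) + x.costFactor + y.costFactor
  | lt x y => 2 + x.costFactor + y.costFactor
  | eq x y => 2 + x.costFactor + y.costFactor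

end Expr

/-- All memory entries have at most `S` bits. -/
def MemBd (S : ℕ) (M : Mem) : Prop := ∀ a i, M a i < 2 ^ S

theorem Expr.sizeFactor_pos (e : Expr) : 1 ≤ e.sizeFactor := by
  induction e <;> simp only [Expr.sizeFactor] <;> omega

/-- Sums and products of numbers with a and b bits have at most a + b bits; for sums this uses a, b
≥ 1, which is why S ≥ 1 and positive factors are needed. -/
theorem Expr.val_lt {S : ℕ} {M : Mem} (hS : 1 ≤ S) (hM : MemBd S M) (e : Expr) :
    e.val M < 2 ^ (e.sizeFactor * S) := by
  have hle : ∀ {a b : ℕ}, a ≤ b → (2 : ℕ) ^ a ≤ 2 ^ b := fun h => Nat.pow_le_pow_right (by norm_num) h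
  have hsz : ∀ e : Expr, 1 ≤ e.sizeFactor * S := fun e =>
    Nat.one_le_iff_ne_zero.2 (Nat.mul_ne_zero (by have := e.sizeFactor_pos; omega) (by omega))
  induction e with
  | const c =>
    refine lt_of_lt_of_le (Nat.lt_size_self c) (hle ?_)
    rw [Expr.sizeFactor]; nlinarith
  | read a i _ => rw [Expr.sizeFactor, one_mul]; exact hM _ _
  | add x y hx hy =>
    rw [Expr.val, Expr.sizeFactor, add_mul, pow_add]
    have h1 : 2 ≤ 2 ^ (x.sizeFactor * S) := by simpa using hle (hsz x)
    have h2 : 2 ≤ 2 ^ (y.sizeFactor * S) := by simpa using hle (hsz y)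
    nlinarith
  | sub x y hx hy =>
    exact lt_of_le_of_lt (Nat.sub_le _ _) (lt_of_lt_of_le hx (hle (Nat.mul_le_mul_right _
      (Nat.le_add_right _ _))))
  | mul x y hx hy =>
    rw [Expr.val, Expr.sizeFactor, add_mul, pow_add]
    exact Nat.mul_lt_mul'' hx hy
  | div x y hx hy =>
    exact lt_of_le_of_lt (Nat.div_le_self _ _) (lt_of_lt_of_le hx (hle (Nat.mul_le_mul_right _
      (Nat.le_add_right _ _))))
  | mod x y hx hy =>
    exact lt_of_le_of_lt (Nat.mod_le _ _) (lt_of_lt_of_le hx (hle (Nat.mul_le_mul_right _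
      (Nat.le_add_right _ _))))
  | lt x y _ _ =>
    have h1 : 2 ≤ 2 ^ ((Expr.lt x y).sizeFactor * S) := by simpa using hle (hsz (Expr.lt x y))
    rw [Expr.val]; split_ifs <;> omega
  | eq x y _ _ =>
    have h1 : 2 ≤ 2 ^ ((Expr.eq x y).sizeFactor * S) := by simpa using hle (hsz (Expr.eq x y))
    rw [Expr.val]; split_ifs <;> omega

theorem Expr.cost_le {S : ℕ} {M : Mem} (hS : 1 ≤ S) (hM : MemBd S M) (e : Expr) :
    e.cost M ≤ e.costFactor * S := by
  have hsz : ∀ e : Expr, (e.val M).size ≤ e.sizeFactor * S := fun e =>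
    Nat.size_le.2 (e.val_lt hS hM)
  induction e with
  | const c => rw [Expr.cost, Expr.costFactor]; nlinarith
  | read a i hi =>
    have := Nat.size_le.2 (hM a (i.val M))
    rw [Expr.cost, Expr.costFactor]; nlinarith
  | add x y hx hy =>
    have := hsz (.add x y)
    rw [Expr.val, Expr.sizeFactor] at this
    rw [Expr.cost, Expr.costFactor]; nlinarith
  | sub x y hx hy =>
    have := hsz (.sub x y)
    rw [Expr.val, Expr.sizeFactor] at this
    rw [Expr.cost, Expr.costFactor]; nlinarith
  | mul x y hx hy =>
    have := hsz (.mul x y)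
    rw [Expr.val, Expr.sizeFactor] at this
    rw [Expr.cost, Expr.costFactor]; nlinarith
  | div x y hx hy =>
    have := hsz (.div x y)
    rw [Expr.val, Expr.sizeFactor] at this
    rw [Expr.cost, Expr.costFactor]; nlinarith
  | mod x y hx hy =>
    have := hsz (.mod x y)
    rw [Expr.val, Expr.sizeFactor] at this
    rw [Expr.cost, Expr.costFactor]; nlinarith
  | lt x y hx hy => rw [Expr.cost, Expr.costFactor]; nlinarith
  | eq x y hx hy => rw [Expr.cost, Expr.costFactor]; nlinarith

/-! ### Time bounds and derived program constructs -/

namespace Prog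

/-- Time bound for a program whose memory entries have at most `S` bits and each of whose loops
is iterated at most `Y` times. -/
def timeBound (S Y : ℕ) : Prog → ℕ
  | skip => 1
  | write _ i x => 1 + i.costFactor * S + x.costFactor * S
  | hadamard q => 1 + q.costFactor * S
  | phase q x y => 1 + q.costFactor * S + x.costFactor * S + y.costFactor * S
  | cnot c t => 1 + c.costFactor * S + t.costFactor * S
  | toffoli c₁ c₂ t => 1 + c₁.costFactor * S + c₂.costFactor * S + t.costFactor * S
  | measure q _ i => 1 + q.costFactor * S + i.costFactor * S
  | seq P Q => P.timeBound S Y + Q.timeBound S Y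
  | ite x P Q => 1 + x.costFactor * S + P.timeBound S Y + Q.timeBound S Y
  | loop x P => (Y + 1) * (1 + x.costFactor * S + P.timeBound S Y)

/-- The arrays that a program may modify. -/
def writes : Prog → List ℕ
  | write a _ _ => [a]
  | measure _ a _ => [a]
  | seq P Q => P.writes ++ Q.writes
  | ite _ P Q => P.writes ++ Q.writes
  | loop _ P => P.writes
  | _ => []

/-- The sequential composition of a list of programs. -/
def block : List Prog → Prog
  | [] => skip
  | P :: L => seq P (block L)

/-- Set a scalar variable. -/
def set (a : ℕ) (x : Expr) : Prog := write a (.const 0) x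

/-- Repeat `P` with the variable `v` running from `0` to `N - 1`. -/
def forLoop (v : ℕ) (N : Expr) (P : Prog) : Prog :=
  seq (set v (.const 0)) (loop (.lt (.read v (.const 0)) N)
    (seq P (set v (.add (.read v (.const 0)) (.const 1)))))

end Prog

/-- A scalar variable. -/
def Expr.var (a : ℕ) : Expr := .read a (.const 0)

/-- Change one memory entry. -/
def memSet (M : Mem) (a i v : ℕ) : Mem := Function.update M a (Function.update (M a) i v)

theorem memSet_apply (M : Mem) (a i v b j : ℕ) :
    memSet M a i v b j = if b = a ∧ j = i then v else M b j := by
  unfold memSet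
  by_cases h : b = a
  · subst h
    by_cases h' : j = i
    · subst h'; simp
    · simp [h']
  · simp [h]

theorem memSet_of_ne (M : Mem) {a b : ℕ} (i v : ℕ) (h : b ≠ a) : memSet M a i v b = M b := by
  simp [memSet, h]

theorem MemBd.memSet {S : ℕ} {M : Mem} (hM : MemBd S M) (a i : ℕ) {v : ℕ} (hv : v < 2 ^ S) :
    MemBd S (memSet M a i v) := by
  intro b j
  rw [memSet_apply]
  split_ifs
  · exact hv
  · exact hM b j

/-! ### Weakest preconditions with bounds for time and memory -/

section
variable (S Y : ℕ)

/-- Weakest precondition of a program without measurements, with the bounds for the memory entries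
and for the running time built in. -/
def WP (P : Prog) (Q : Mem → QState → Prop) (M : Mem) (ψ : QState) : Prop :=
  MemBd S M → ∀ T, ∃ M' ψ' T', Exec P ⟨M, ψ, T⟩ [⟨M', ψ', T'⟩] ∧ T' ≤ T + P.timeBound S Y ∧
    MemBd S M' ∧ (∀ a ∉ P.writes, M' a = M a) ∧ Q M' ψ'

variable {S Y} {M : Mem} {ψ : QState} {Q : Mem → QState → Prop}

theorem WP.mono {P : Prog} {Q' : Mem → QState → Prop} (h : WP S Y P Q M ψ)
    (hQ : ∀ M' ψ', (∀ a ∉ P.writes, M' a = M a) → MemBd S M' → Q M' ψ' → Q' M' ψ') :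
    WP S Y P Q' M ψ := by
  intro hM T
  obtain ⟨M', ψ', T', h1, h2, h3, h4, h5⟩ := h hM T
  exact ⟨M', ψ', T', h1, h2, h3, h4, hQ _ _ h4 h3 h5⟩

theorem WP.skip (h : Q M ψ) : WP S Y .skip Q M ψ := by
  intro hM T
  exact ⟨M, ψ, T + 1, Exec.skip _, le_rfl, hM, fun _ _ => rfl, h⟩

theorem WP.write {a : ℕ} {i x : Expr} (hS : 1 ≤ S) (hx : x.val M < 2 ^ S)
    (h : Q (memSet M a (i.val M) (x.val M)) ψ) : WP S Y (.write a i x) Q M ψ := by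
  intro hM T
  refine ⟨_, ψ, _, Exec.write a i x ⟨M, ψ, T⟩, ?_, hM.memSet _ _ hx, ?_, h⟩
  · have h1 := i.cost_le hS hM
    have h2 := x.cost_le hS hM
    simp only [Config.store, Config.cost, Prog.timeBound]
    omega
  · intro b hb
    simp only [Prog.writes, List.mem_singleton] at hb
    exact memSet_of_ne M _ _ hb

theorem WP.set {a : ℕ} {x : Expr} (hS : 1 ≤ S) (hx : x.val M < 2 ^ S)
    (h : Q (memSet M a 0 (x.val M)) ψ) : WP S Y (.set a x) Q M ψ :=
  WP.write hS hx h

theorem WP.hadamard {q : Expr} (hS : 1 ≤ S) (h : Q M (QState.hadamard (q.val M) ψ)) :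
    WP S Y (.hadamard q) Q M ψ := by
  intro hM T
  refine ⟨M, _, _, Exec.hadamard q ⟨M, ψ, T⟩, ?_, hM, fun _ _ => rfl, h⟩
  have h1 := q.cost_le hS hM
  simp only [Config.gate, Config.cost, Prog.timeBound]
  omega

theorem WP.phase {q x y : Expr} (hS : 1 ≤ S)
    (h : Q M (QState.phase (q.val M) (x.val M) (y.val M) ψ)) : WP S Y (.phase q x y) Q M ψ := by
  intro hM T
  refine ⟨M, _, _, Exec.phase q x y ⟨M, ψ, T⟩, ?_, hM, fun _ _ => rfl, h⟩
  have h1 := q.cost_le hS hM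
  have h2 := x.cost_le hS hM
  have h3 := y.cost_le hS hM
  simp only [Config.gate, Config.cost, Prog.timeBound]
  omega

theorem WP.cnot {x t : Expr} (hS : 1 ≤ S)
    (h : Q M (QState.toffoli (x.val M) (x.val M) (t.val M) ψ)) : WP S Y (.cnot x t) Q M ψ := by
  intro hM T
  refine ⟨M, _, _, Exec.cnot x t ⟨M, ψ, T⟩, ?_, hM, fun _ _ => rfl, h⟩
  have h1 := x.cost_le hS hM
  have h2 := t.cost_le hS hM
  simp only [Config.gate, Config.cost, Prog.timeBound]
  omega

theorem WP.toffoli {x y t : Expr} (hS : 1 ≤ S)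
    (h : Q M (QState.toffoli (x.val M) (y.val M) (t.val M) ψ)) :
    WP S Y (.toffoli x y t) Q M ψ := by
  intro hM T
  refine ⟨M, _, _, Exec.toffoli x y t ⟨M, ψ, T⟩, ?_, hM, fun _ _ => rfl, h⟩
  have h1 := x.cost_le hS hM
  have h2 := y.cost_le hS hM
  have h3 := t.cost_le hS hM
  simp only [Config.gate, Config.cost, Prog.timeBound]
  omega

theorem WP.seq {P P' : Prog} (h : WP S Y P (WP S Y P' Q) M ψ) : WP S Y (.seq P P') Q M ψ := by
  intro hM T
  obtain ⟨M1, ψ1, T1, h1, h2, h3, h4, h5⟩ := h hM T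
  obtain ⟨M2, ψ2, T2, k1, k2, k3, k4, k5⟩ := h5 h3 T1
  refine ⟨M2, ψ2, T2, ?_, ?_, k3, ?_, k5⟩
  · have := Exec.seq P P' ⟨M, ψ, T⟩ [⟨M1, ψ1, T1⟩] (fun _ => [⟨M2, ψ2, T2⟩]) h1 (by
      intro c hc; rw [List.mem_singleton.1 hc]; exact k1)
    simpa using this
  · simp only [Prog.timeBound]; omega
  · intro a ha
    simp only [Prog.writes, List.mem_append, not_or] at ha
    rw [k4 a ha.2, h4 a ha.1]

theorem WP.block_nil (h : Q M ψ) : WP S Y (.block []) Q M ψ := WP.skip h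

theorem WP.block_cons {P : Prog} {L : List Prog} (h : WP S Y P (WP S Y (.block L) Q) M ψ) :
    WP S Y (.block (P :: L)) Q M ψ := WP.seq h

theorem WP.ite {x : Expr} {P P' : Prog} (hS : 1 ≤ S) (h1 : x.val M ≠ 0 → WP S Y P Q M ψ)
    (h2 : x.val M = 0 → WP S Y P' Q M ψ) : WP S Y (.ite x P P') Q M ψ := by
  intro hM T
  have hc := x.cost_le hS hM
  by_cases hx : x.val M = 0
  · obtain ⟨M', ψ', T', k1, k2, k3, k4, k5⟩ := h2 hx hM (T + (1 + x.cost M))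
    refine ⟨M', ψ', T', Exec.ite_false x P P' ⟨M, ψ, T⟩ _ hx k1, ?_, k3, ?_, k5⟩
    · simp only [Prog.timeBound]; omega
    · intro a ha
      simp only [Prog.writes, List.mem_append, not_or] at ha
      exact k4 a ha.2
  · obtain ⟨M', ψ', T', k1, k2, k3, k4, k5⟩ := h1 hx hM (T + (1 + x.cost M))
    refine ⟨M', ψ', T', Exec.ite_true x P P' ⟨M, ψ, T⟩ _ hx k1, ?_, k3, ?_, k5⟩
    · simp only [Prog.timeBound]; omega
    · intro a ha
      simp only [Prog.writes, List.mem_append, not_or] at ha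
      exact k4 a ha.1

/-- The counter is incremented after the body, so the body has to establish the invariant for the
memory in which the counter already has its new value. The final, failing test also costs time,
hence the factor Y + 1 in `timeBound`. -/
theorem WP.forLoop {v : ℕ} {N : Expr} {P : Prog} (hS : 1 ≤ S) (I : ℕ → Mem → QState → Prop)
    (Nv : ℕ) (hv : v ∉ P.writes) (hY : Nv ≤ Y) (hNS : Nv < 2 ^ S)
    (hN : ∀ j M ψ, I j M ψ → N.val M = Nv) (h0 : I 0 (memSet M v 0 0) ψ)
    (hstep : ∀ j < Nv, ∀ M ψ, M v 0 = j → I j M ψ →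
      WP S Y P (fun M' ψ' => I (j + 1) (memSet M' v 0 (j + 1)) ψ') M ψ)
    (hQ : ∀ M' ψ', M' v 0 = Nv → I Nv M' ψ' → Q M' ψ') : WP S Y (.forLoop v N P) Q M ψ := by
  apply WP.seq
  refine WP.set hS (by simp [Expr.val]) ?_
  set L := Prog.loop (.lt (.read v (.const 0)) N)
    (.seq P (.set v (.add (.read v (.const 0)) (.const 1)))) with hL
  set C := 1 + (Expr.lt (.read v (.const 0)) N).costFactor * S +
    (Prog.seq P (.set v (.add (.read v (.const 0)) (.const 1)))).timeBound S Y with hC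
  -- Induction on the number `r` of rounds that are left; the test is evaluated `r + 1` more times.
  have key : ∀ r, r ≤ Nv → ∀ M ψ T, MemBd S M → M v 0 = Nv - r → I (Nv - r) M ψ →
      ∃ M' ψ' T', Exec L ⟨M, ψ, T⟩ [⟨M', ψ', T'⟩] ∧ T' ≤ T + (r + 1) * C ∧
        MemBd S M' ∧ (∀ a ∉ L.writes, M' a = M a) ∧ M' v 0 = Nv ∧ I Nv M' ψ' := by
    intro r
    induction r with
    | zero =>
      intro _ M ψ T hM hv0 hI
      refine ⟨M, ψ, _, Exec.loop_stop _ _ ⟨M, ψ, T⟩ ?_, ?_, hM, fun _ _ => rfl, hv0, hI⟩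
      · simp only [Config.val, Expr.val, hN _ _ _ hI, hv0]; simp
      · have hc := (Expr.lt (.read v (.const 0)) N).cost_le hS hM
        simp only [Config.cost]; omega
    | succ r ih =>
      intro hr M ψ T hM hv0 hI
      have hc := (Expr.lt (.read v (.const 0)) N).cost_le hS hM
      have hstep' : WP S Y (.seq P (.set v (.add (.read v (.const 0)) (.const 1))))
          (fun M' ψ' => M' v 0 = Nv - r ∧ I (Nv - r) M' ψ') M ψ := by
        apply WP.seq
        refine (hstep (Nv - (r + 1)) (by omega) M ψ hv0 hI).mono ?_
        intro M' ψ' hfr hM' hI'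
        have hv1 : M' v 0 = Nv - (r + 1) := by rw [hfr v hv, hv0]
        have hval : (Expr.add (.read v (.const 0)) (.const 1)).val M' = Nv - r := by
          simp only [Expr.val, hv1]; omega
        refine WP.set hS (by rw [hval]; omega) ?_
        rw [hval]
        rw [show Nv - (r + 1) + 1 = Nv - r by omega] at hI'
        exact ⟨by rw [memSet_apply]; simp, hI'⟩
      obtain ⟨M1, ψ1, T1, h1, h2, h3, h4, h5, h6⟩ :=
        hstep' hM (T + (1 + (Expr.lt (.read v (.const 0)) N).cost M))
      obtain ⟨M2, ψ2, T2, k1, k2, k3, k4, k5, k6⟩ := ih (by omega) M1 ψ1 T1 h3 h5 h6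
      refine ⟨M2, ψ2, T2, ?_, ?_, k3, ?_, k5, k6⟩
      · have := Exec.loop_step (.lt (.read v (.const 0)) N)
          (.seq P (.set v (.add (.read v (.const 0)) (.const 1)))) ⟨M, ψ, T⟩ [⟨M1, ψ1, T1⟩]
          (fun _ => [⟨M2, ψ2, T2⟩]) (by
            simp only [Config.val, Expr.val, hN _ _ _ hI, hv0]
            rw [if_pos (by omega)]; norm_num) h1 (by
          intro c hc; rw [List.mem_singleton.1 hc]; exact k1)
        simpa using this
      · rw [show r + 1 + 1 = (r + 1) + 1 by rfl, add_mul (r + 1) 1, one_mul]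
        omega
      · intro a ha
        rw [k4 a ha, h4 a ha]
  intro hM T
  obtain ⟨M', ψ', T', h1, h2, h3, h4, h5, h6⟩ := key Nv le_rfl _ ψ T hM
    (by rw [memSet_apply]; simp [Expr.val]) (by rw [Nat.sub_self]; exact h0)
  refine ⟨M', ψ', T', h1, h2.trans ?_, h3, h4, hQ _ _ h5 h6⟩
  have : (Nv + 1) * C ≤ (Y + 1) * C := Nat.mul_le_mul_right _ (by omega)
  simp only [hL, Prog.timeBound] at this ⊢
  simp only [hC, Prog.timeBound] at this ⊢
  omega

end


/-! ## Polynomials of the input parameters -/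

theorem polyAt_add (p q : MvPolynomial (Fin 3) ℕ) (n m k : ℕ) :
    polyAt (p + q) n m k = polyAt p n m k + polyAt q n m k := by simp [polyAt]

theorem polyAt_mul (p q : MvPolynomial (Fin 3) ℕ) (n m k : ℕ) :
    polyAt (p * q) n m k = polyAt p n m k * polyAt q n m k := by simp [polyAt]

theorem polyAt_C (a n m k : ℕ) : polyAt (MvPolynomial.C a) n m k = a := by simp [polyAt]

theorem polyAt_one (n m k : ℕ) : polyAt 1 n m k = 1 := by simp [polyAt]

theorem polyAt_pow (p : MvPolynomial (Fin 3) ℕ) (e n m k : ℕ) :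
    polyAt (p ^ e) n m k = polyAt p n m k ^ e := by simp [polyAt]

theorem polyAt_X_zero (n m k : ℕ) : polyAt (MvPolynomial.X 0) n m k = n := by simp [polyAt]

theorem polyAt_X_one (n m k : ℕ) : polyAt (MvPolynomial.X 1) n m k = m := by simp [polyAt]

theorem polyAt_X_two (n m k : ℕ) : polyAt (MvPolynomial.X 2) n m k = k := by simp [polyAt]

/-- Every polynomial of the input parameters is computed by an expression. -/
theorem exists_expr_polyAt (q : MvPolynomial (Fin 3) ℕ) :
    ∃ e : Expr, ∀ M : Mem, e.val M = polyAt q (M 0 0) (M 0 1) (M 0 2) := by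
  induction q using MvPolynomial.induction_on with
  | C a => exact ⟨.const a, fun M => by rw [polyAt_C]; rfl⟩
  | add p q hp hq =>
    obtain ⟨e, he⟩ := hp
    obtain ⟨f, hf⟩ := hq
    exact ⟨.add e f, fun M => by rw [Expr.val, he, hf, polyAt_add]⟩
  | mul_X p i hp =>
    obtain ⟨e, he⟩ := hp
    refine ⟨.mul e (.read 0 (.const i.val)), fun M => ?_⟩
    rw [Expr.val, he, polyAt_mul]
    congr 1
    fin_cases i
    · exact (polyAt_X_zero _ _ _).symm
    · exact (polyAt_X_one _ _ _).symm
    · exact (polyAt_X_two _ _ _).symm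

/-- The time bound of a fixed program is polynomial if the bounds for its parameters are. -/
theorem exists_polyAt_timeBound (P : Prog) (s y : MvPolynomial (Fin 3) ℕ) :
    ∃ T : MvPolynomial (Fin 3) ℕ, ∀ n m k,
      P.timeBound (polyAt s n m k) (polyAt y n m k) = polyAt T n m k := by
  have hC : ∀ (a n m k : ℕ), a = polyAt (MvPolynomial.C a) n m k := fun a n m k =>
    (polyAt_C a n m k).symm
  have hm : ∀ (e : Expr) (n m k : ℕ), e.costFactor * polyAt s n m k =
      polyAt (MvPolynomial.C e.costFactor * s) n m k := fun e n m k => by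
    rw [polyAt_mul, polyAt_C]
  induction P with
  | skip => exact ⟨1, fun n m k => (polyAt_one n m k).symm⟩
  | write a i x =>
    exact ⟨1 + MvPolynomial.C i.costFactor * s + MvPolynomial.C x.costFactor * s, fun n m k => by
      simp only [Prog.timeBound, polyAt_add, polyAt_one, ← hm]⟩
  | hadamard q =>
    exact ⟨1 + MvPolynomial.C q.costFactor * s, fun n m k => by
      simp only [Prog.timeBound, polyAt_add, polyAt_one, ← hm]⟩
  | phase q x y =>
    exact ⟨1 + MvPolynomial.C q.costFactor * s + MvPolynomial.C x.costFactor * s +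
      MvPolynomial.C y.costFactor * s, fun n m k => by
      simp only [Prog.timeBound, polyAt_add, polyAt_one, ← hm]⟩
  | cnot x y =>
    exact ⟨1 + MvPolynomial.C x.costFactor * s + MvPolynomial.C y.costFactor * s, fun n m k => by
      simp only [Prog.timeBound, polyAt_add, polyAt_one, ← hm]⟩
  | toffoli q x y =>
    exact ⟨1 + MvPolynomial.C q.costFactor * s + MvPolynomial.C x.costFactor * s +
      MvPolynomial.C y.costFactor * s, fun n m k => by
      simp only [Prog.timeBound, polyAt_add, polyAt_one, ← hm]⟩
  | measure q a i =>
    exact ⟨1 + MvPolynomial.C q.costFactor * s + MvPolynomial.C i.costFactor * s, fun n m k => by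
      simp only [Prog.timeBound, polyAt_add, polyAt_one, ← hm]⟩
  | seq P Q hP hQ =>
    obtain ⟨T, hT⟩ := hP
    obtain ⟨T', hT'⟩ := hQ
    exact ⟨T + T', fun n m k => by simp only [Prog.timeBound, polyAt_add, hT, hT']⟩
  | ite x P Q hP hQ =>
    obtain ⟨T, hT⟩ := hP
    obtain ⟨T', hT'⟩ := hQ
    exact ⟨1 + MvPolynomial.C x.costFactor * s + T + T', fun n m k => by
      simp only [Prog.timeBound, polyAt_add, polyAt_one, ← hm, hT, hT']⟩
  | loop x P hP =>
    obtain ⟨T, hT⟩ := hP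
    exact ⟨(y + 1) * (1 + MvPolynomial.C x.costFactor * s + T), fun n m k => by
      simp only [Prog.timeBound, polyAt_add, polyAt_mul, polyAt_one, ← hm, hT]⟩


/-! ## Quantum gates on basis states -/

namespace QState

/-- Basis states. -/
noncomputable def ket (s : Finset ℕ) : QState := Finsupp.single s 1

theorem linearMap_ext {F G : QState →ₗ[ℂ] QState} (h : ∀ s, F (ket s) = G (ket s)) (ψ : QState) :
    F ψ = G ψ := by
  have : F = G := Finsupp.lhom_ext' fun s => LinearMap.ext_ring (h s)
  rw [this]

/-- The one-qubit gate on qubit `q` with matrix `U`. -/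
noncomputable def gateOne (q : ℕ) (U : Bool → Bool → ℂ) : QState →ₗ[ℂ] QState :=
  Finsupp.linearCombination ℂ (fun s : Finset ℕ =>
    U false (decide (q ∈ s)) • ket (s.erase q) + U true (decide (q ∈ s)) • ket (insert q s))

/-- Hadamard gate as a linear map. -/
noncomputable def hadamardₗ (q : ℕ) : QState →ₗ[ℂ] QState :=
  Finsupp.linearCombination ℂ (fun s : Finset ℕ =>
    ((Real.sqrt 2 : ℂ)⁻¹) • (Finsupp.single (s.erase q) (1 : ℂ) +
      Finsupp.single (insert q s) (if q ∈ s then (-1 : ℂ) else 1)))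

/-- Phase gate as a linear map. -/
noncomputable def phaseₗ (q a b : ℕ) : QState →ₗ[ℂ] QState :=
  Finsupp.linearCombination ℂ (fun s : Finset ℕ =>
    Finsupp.single s (if q ∈ s then Complex.exp (2 * Real.pi * Complex.I * (a / b)) else 1))

/-- Toffoli gate as a linear map. -/
noncomputable def toffoliₗ (c₁ c₂ t : ℕ) : QState →ₗ[ℂ] QState :=
  Finsupp.linearCombination ℂ (fun s : Finset ℕ =>
    Finsupp.single
      (if c₁ ∈ s ∧ c₂ ∈ s ∧ t ≠ c₁ ∧ t ≠ c₂ then symmDiff s {t} else s) (1 : ℂ))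

/-- Projection as a linear map. -/
noncomputable def projectₗ (q : ℕ) (b : Bool) : QState →ₗ[ℂ] QState where
  toFun := project q b
  map_add' _ _ := Finsupp.filter_add
  map_smul' _ _ := Finsupp.filter_smul

theorem hadamard_eq (q : ℕ) (ψ : QState) : hadamard q ψ = hadamardₗ q ψ := rfl

theorem phase_eq (q a b : ℕ) (ψ : QState) : phase q a b ψ = phaseₗ q a b ψ := rfl

theorem toffoli_eq (c₁ c₂ t : ℕ) (ψ : QState) : toffoli c₁ c₂ t ψ = toffoliₗ c₁ c₂ t ψ := rfl

theorem project_eq (q : ℕ) (b : Bool) (ψ : QState) : project q b ψ = projectₗ q b ψ := rfl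

/-- The number `exp (2πi a / b)`. -/
noncomputable def turn (a b : ℕ) : ℂ := Complex.exp (2 * Real.pi * Complex.I * (a / b))

/-- The Hadamard matrix. -/
noncomputable def hadamardMatrix (a b : Bool) : ℂ :=
  (Real.sqrt 2 : ℂ)⁻¹ * if a && b then -1 else 1

/-- Diagonal matrices with first entry `1`. -/
def diagMatrix (z : ℂ) (a b : Bool) : ℂ := if a = b then if a then z else 1 else 0

/-- Products of `2 × 2` matrices. -/
def mulMatrix (U V : Bool → Bool → ℂ) (a b : Bool) : ℂ := U a false * V false b + U a true * V true b

theorem gateOne_ket (q : ℕ) (U : Bool → Bool → ℂ) (s : Finset ℕ) :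
    gateOne q U (ket s) = U false (decide (q ∈ s)) • ket (s.erase q) +
      U true (decide (q ∈ s)) • ket (insert q s) := by
  simp [gateOne, ket, Finsupp.linearCombination_single]

theorem phaseₗ_ket (q a b : ℕ) (s : Finset ℕ) :
    phaseₗ q a b (ket s) = (if q ∈ s then turn a b else 1) • ket s := by
  simp only [phaseₗ, ket, Finsupp.linearCombination_single, turn, one_smul]
  split_ifs <;> simp

theorem toffoliₗ_ket (c₁ c₂ t : ℕ) (s : Finset ℕ) :
    toffoliₗ c₁ c₂ t (ket s) =
      ket (if c₁ ∈ s ∧ c₂ ∈ s ∧ t ≠ c₁ ∧ t ≠ c₂ then symmDiff s {t} else s) := by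
  simp [toffoliₗ, ket, Finsupp.linearCombination_single]

theorem projectₗ_ket (q : ℕ) (b : Bool) (s : Finset ℕ) :
    projectₗ q b (ket s) = (if decide (q ∈ s) = b then (1 : ℂ) else 0) • ket s := by
  change project q b (ket s) = _
  split_ifs with h
  · rw [one_smul, project, ket, Finsupp.filter_single_of_pos]; exact h
  · rw [zero_smul, project, ket, Finsupp.filter_single_of_neg]; exact h

theorem hadamardₗ_eq_gateOne (q : ℕ) : hadamardₗ q = gateOne q hadamardMatrix := by
  ext1 s
  refine LinearMap.ext_ring ?_
  simp only [LinearMap.comp_apply, Finsupp.lsingle_apply]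
  change hadamardₗ q (ket s) = gateOne q _ (ket s)
  rw [gateOne_ket]
  simp only [hadamardₗ, ket, Finsupp.linearCombination_single, hadamardMatrix, one_smul]
  by_cases h : q ∈ s <;> simp [h]

theorem phaseₗ_eq_gateOne (q a b : ℕ) : phaseₗ q a b = gateOne q (diagMatrix (turn a b)) := by
  ext1 s
  refine LinearMap.ext_ring ?_
  simp only [LinearMap.comp_apply, Finsupp.lsingle_apply]
  change phaseₗ q a b (ket s) = gateOne q _ (ket s)
  rw [gateOne_ket, phaseₗ_ket]
  by_cases h : q ∈ s <;> simp [h, diagMatrix]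

theorem gateOne_gateOne (q : ℕ) (U V : Bool → Bool → ℂ) (ψ : QState) :
    gateOne q U (gateOne q V ψ) = gateOne q (mulMatrix U V) ψ := by
  refine linearMap_ext (F := (gateOne q U).comp (gateOne q V)) (fun s => ?_) ψ
  rw [LinearMap.comp_apply, gateOne_ket, map_add, map_smul, map_smul, gateOne_ket, gateOne_ket,
    gateOne_ket]
  have hins : insert q (s.erase q) = insert q s := by ext x; by_cases h : x = q <;> simp [h]
  simp only [mulMatrix, Finset.mem_erase, Finset.mem_insert, true_or, decide_true, ne_eq,
    not_true_eq_false, false_and, decide_false, Finset.erase_idem, Finset.insert_idem,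
    Finset.erase_insert_eq_erase, hins]
  module

theorem gateOne_one (q : ℕ) (ψ : QState) : gateOne q (diagMatrix 1) ψ = ψ := by
  refine linearMap_ext (G := LinearMap.id) (fun s => ?_) ψ
  rw [gateOne_ket]
  by_cases h : q ∈ s <;> simp [h, diagMatrix]

end QState


/-! ### Rotations and two-level gates from Hadamard, phase and Toffoli gates -/

namespace QState

open Complex

theorem turn_one_four : turn 1 4 = I := by
  refine Eq.trans ?_ Complex.exp_pi_div_two_mul_I
  rw [turn]
  congr 1; push_cast; ring

theorem turn_three_four : turn 3 4 = -I := by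
  rw [turn, ← Complex.exp_neg_pi_div_two_mul_I, Complex.exp_eq_exp_iff_exists_int]
  exact ⟨1, by push_cast; ring⟩

theorem turn_one_two : turn 1 2 = -1 := by
  rw [turn, ← Complex.exp_pi_mul_I]
  congr 1; push_cast; ring

theorem turn_eq (x X : ℕ) : turn x X =
    ((Real.cos (Real.pi * x / X) : ℂ) + Real.sin (Real.pi * x / X) * I) ^ 2 := by
  rw [turn, Complex.ofReal_cos, Complex.ofReal_sin, ← Complex.exp_mul_I, ← Complex.exp_nat_mul]
  congr 1; push_cast; ring

theorem turn_sub_eq {x X : ℕ} (hx : x ≤ X) (hX : 0 < X) : turn (X - x) X =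
    ((Real.cos (Real.pi * x / X) : ℂ) - Real.sin (Real.pi * x / X) * I) ^ 2 := by
  have hX' : (X : ℂ) ≠ 0 := by exact_mod_cast hX.ne'
  rw [turn, Complex.ofReal_cos, Complex.ofReal_sin, sub_eq_add_neg, ← neg_mul, ← Complex.sin_neg,
    ← Complex.cos_neg, ← Complex.exp_mul_I, ← Complex.exp_nat_mul,
    Complex.exp_eq_exp_iff_exists_int]
  refine ⟨1, ?_⟩
  rw [Nat.cast_sub hx]
  push_cast
  field_simp
  ring

theorem norm_turn (a b : ℕ) : ‖turn a b‖ = 1 := by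
  rw [turn, show (2 * Real.pi * I * (a / b) : ℂ) = ((2 * Real.pi * (a / b) : ℝ) : ℂ) * I by
    push_cast; ring]
  exact Complex.norm_exp_ofReal_mul_I _

theorem inv_sqrt_two_mul_self : (Real.sqrt 2 : ℂ)⁻¹ * (Real.sqrt 2 : ℂ)⁻¹ = 1 / 2 := by
  rw [← mul_inv, ← Complex.ofReal_mul, Real.mul_self_sqrt (by norm_num)]
  norm_num

/-- The unit vector prepared by the rotation gates. -/
noncomputable def rotVec (x X : ℕ) (b : Bool) : ℝ :=
  if b then Real.cos (Real.pi * x / X) else Real.sin (Real.pi * x / X)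

theorem rotVec_sq_add (x X : ℕ) : rotVec x X true ^ 2 + rotVec x X false ^ 2 = 1 := by
  simp [rotVec]

/-- Rotation of the qubit `q` that maps `|1⟩` to a multiple of `rotVec x X`. -/
noncomputable def rotate (q x X : ℕ) (ψ : QState) : QState :=
  phase q 3 4 (hadamard q (phase q x X (hadamard q ψ)))

/-- The inverse of `rotate`. -/
noncomputable def unrotate (q x X : ℕ) (ψ : QState) : QState :=
  hadamard q (phase q (X - x) X (hadamard q (phase q 1 4 ψ)))

/-- The matrix of `rotate`. -/
noncomputable def rotMatrix (x X : ℕ) : Bool → Bool → ℂ :=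
  mulMatrix (diagMatrix (turn 3 4)) (mulMatrix hadamardMatrix (mulMatrix (diagMatrix (turn x X))
    hadamardMatrix))

/-- The matrix of `unrotate`. -/
noncomputable def unrotMatrix (x X : ℕ) : Bool → Bool → ℂ :=
  mulMatrix hadamardMatrix (mulMatrix (diagMatrix (turn (X - x) X)) (mulMatrix hadamardMatrix
    (diagMatrix (turn 1 4))))

theorem rotate_eq (q x X : ℕ) (ψ : QState) : rotate q x X ψ = gateOne q (rotMatrix x X) ψ := by
  simp only [rotate, hadamard_eq, phase_eq, hadamardₗ_eq_gateOne, phaseₗ_eq_gateOne,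
    gateOne_gateOne, rotMatrix]

theorem unrotate_eq (q x X : ℕ) (ψ : QState) :
    unrotate q x X ψ = gateOne q (unrotMatrix x X) ψ := by
  simp only [unrotate, hadamard_eq, phase_eq, hadamardₗ_eq_gateOne, phaseₗ_eq_gateOne,
    gateOne_gateOne, unrotMatrix]

/-- Hadamard gates turn a diagonal matrix into a circulant one. The further diagonal factor on the
right is there for `unrotMatrix`. -/
theorem hadamard_diag_hadamard (e y : ℂ) (a b : Bool) :
    mulMatrix hadamardMatrix (mulMatrix (diagMatrix e) (mulMatrix hadamardMatrix (diagMatrix y))) a b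
      = (if a = b then (1 + e) / 2 else (1 - e) / 2) * (if b then y else 1) := by
  have hr := inv_sqrt_two_mul_self
  simp only [mulMatrix, diagMatrix, hadamardMatrix]
  generalize (Real.sqrt 2 : ℂ)⁻¹ = r at *
  cases a <;> cases b <;> simp
  · linear_combination (1 + e) * hr
  · linear_combination (1 - e) * y * hr
  · linear_combination (1 - e) * hr
  · linear_combination (1 + e) * y * hr

theorem mulMatrix_one (U : Bool → Bool → ℂ) : mulMatrix U (diagMatrix 1) = U := by
  funext a b; cases b <;> simp [mulMatrix, diagMatrix]

/-- With θ = πx/X, conjugating the phase e^{2iθ} by Hadamard gates gives e^{iθ} times a matrix with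
entries cos θ and −i sin θ. The last phase gate −i makes each column real up to a unit factor, and
the column of `true` proportional to `rotVec`. -/
theorem rotMatrix_apply (x X : ℕ) (a b : Bool) : rotMatrix x X a b =
    ((Real.cos (Real.pi * x / X) : ℂ) + Real.sin (Real.pi * x / X) * I) *
      (if a then (if b then -I * Real.cos (Real.pi * x / X) else -Real.sin (Real.pi * x / X))
        else (if b then -I * Real.sin (Real.pi * x / X) else Real.cos (Real.pi * x / X))) := by
  have hcs : (Real.cos (Real.pi * x / X) : ℂ) ^ 2 + (Real.sin (Real.pi * x / X) : ℂ) ^ 2 = 1 := by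
    exact_mod_cast Real.cos_sq_add_sin_sq _
  have h := fun a b => hadamard_diag_hadamard (turn x X) 1 a b
  rw [mulMatrix_one] at h
  rw [rotMatrix, mulMatrix, h, h, turn_three_four, turn_eq]
  generalize (Real.cos (Real.pi * x / X) : ℂ) = c at *
  generalize (Real.sin (Real.pi * x / X) : ℂ) = s at *
  have hI := Complex.I_sq
  cases a <;> cases b <;> simp [diagMatrix]
  · linear_combination (-1 / 2 : ℂ) * hcs + (s ^ 2 / 2) * hI
  · linear_combination (-1 / 2 : ℂ) * hcs + (s ^ 2 / 2) * hI
  · linear_combination (-I / 2 : ℂ) * hcs - (c * s + s ^ 2 * I / 2) * hI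
  · linear_combination (-I / 2 : ℂ) * hcs + (s ^ 2 * I / 2) * hI

theorem unrotMatrix_apply {x X : ℕ} (hx : x ≤ X) (hX : 0 < X) (a b : Bool) : unrotMatrix x X a b =
    ((Real.cos (Real.pi * x / X) : ℂ) - Real.sin (Real.pi * x / X) * I) *
      (if a then (if b then I * Real.cos (Real.pi * x / X) else I * Real.sin (Real.pi * x / X))
        else (if b then -Real.sin (Real.pi * x / X) else Real.cos (Real.pi * x / X))) := by
  have hcs : (Real.cos (Real.pi * x / X) : ℂ) ^ 2 + (Real.sin (Real.pi * x / X) : ℂ) ^ 2 = 1 := by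
    exact_mod_cast Real.cos_sq_add_sin_sq _
  rw [unrotMatrix, hadamard_diag_hadamard, turn_one_four, turn_sub_eq hx hX]
  generalize (Real.cos (Real.pi * x / X) : ℂ) = c at *
  generalize (Real.sin (Real.pi * x / X) : ℂ) = s at *
  have hI := Complex.I_sq
  cases a <;> cases b <;> simp
  · linear_combination (-1 / 2 : ℂ) * hcs + (s ^ 2 / 2) * hI
  · linear_combination (-I / 2 : ℂ) * hcs + (c * s - s ^ 2 * I / 2) * hI
  · linear_combination (-1 / 2 : ℂ) * hcs + (s ^ 2 / 2) * hI
  · linear_combination (-I / 2 : ℂ) * hcs + (s ^ 2 * I / 2) * hI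

/-- Conjugating diag(1, ω) gives 1 + (ω − 1)vvᵀ, where v is the image of the second basis vector up
to a unit factor; that factor cancels against its inverse. -/
theorem rotMatrix_mul {x X : ℕ} (hx : x ≤ X) (hX : 0 < X) (ω : ℂ) (a b : Bool) :
    mulMatrix (rotMatrix x X) (mulMatrix (diagMatrix ω) (unrotMatrix x X)) a b =
      (if a = b then 1 else 0) + (ω - 1) * rotVec x X a * rotVec x X b := by
  have hcs : (Real.cos (Real.pi * x / X) : ℂ) ^ 2 + (Real.sin (Real.pi * x / X) : ℂ) ^ 2 = 1 := by
    exact_mod_cast Real.cos_sq_add_sin_sq _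
  simp only [mulMatrix, diagMatrix, rotMatrix_apply, unrotMatrix_apply hx hX, rotVec]
  generalize hc : (Real.cos (Real.pi * x / X)) = c at *
  generalize hs : (Real.sin (Real.pi * x / X)) = s at *
  have hI := Complex.I_sq
  have e5 : ((c : ℂ) + s * I) * (c - s * I) = 1 := by
    linear_combination hcs - (s : ℂ) ^ 2 * hI
  have key : ∀ y z : ℂ, ((c : ℂ) + s * I) * y * ((c - s * I) * z) = y * z := fun y z => by
    linear_combination y * z * e5
  have key2 : ∀ y z : ℂ, ((c : ℂ) + s * I) * y * (ω * ((c - s * I) * z)) = ω * (y * z) := fun y z => by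
    linear_combination ω * y * z * e5
  cases a <;> cases b <;> simp [key, key2]
  · linear_combination hcs - ω * s ^ 2 * hI
  · linear_combination -ω * s * c * hI
  · linear_combination -ω * s * c * hI
  · linear_combination hcs - ω * c ^ 2 * hI

theorem rotMatrix_mul_one {x X : ℕ} (hx : x ≤ X) (hX : 0 < X) :
    mulMatrix (rotMatrix x X) (unrotMatrix x X) = diagMatrix 1 := by
  funext a b
  have h := rotMatrix_mul hx hX 1 a b
  have e : mulMatrix (diagMatrix 1) (unrotMatrix x X) = unrotMatrix x X := by
    funext a b; cases a <;> simp [mulMatrix, diagMatrix]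
  rw [e] at h
  rw [h, diagMatrix]
  cases a <;> cases b <;> simp

/-- The two-level gate at one site; it is applied if `c₁`, `c₂` and `c` are set, and uses the
auxiliary qubits `f₁`, `f₂`, `f₃`. -/
noncomputable def siteGate (c₁ c₂ c a b f₁ f₂ f₃ x X y Z : ℕ) (ψ : QState) : QState :=
  toffoli c₁ c₂ f₁ (toffoli f₁ c f₂ (toffoli b b a (rotate b x X (toffoli f₂ b f₃ (phase f₃ y Z
    (toffoli f₂ b f₃ (unrotate b x X (toffoli b b a (toffoli f₁ c f₂ (toffoli c₁ c₂ f₁ ψ))))))))))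

/-- `siteGate` as a linear map. -/
noncomputable def siteGateₗ (c₁ c₂ c a b f₁ f₂ f₃ x X y Z : ℕ) : QState →ₗ[ℂ] QState :=
  toffoliₗ c₁ c₂ f₁ ∘ₗ toffoliₗ f₁ c f₂ ∘ₗ toffoliₗ b b a ∘ₗ gateOne b (rotMatrix x X) ∘ₗ
    toffoliₗ f₂ b f₃ ∘ₗ phaseₗ f₃ y Z ∘ₗ toffoliₗ f₂ b f₃ ∘ₗ gateOne b (unrotMatrix x X) ∘ₗ
    toffoliₗ b b a ∘ₗ toffoliₗ f₁ c f₂ ∘ₗ toffoliₗ c₁ c₂ f₁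

theorem siteGate_eq (c₁ c₂ c a b f₁ f₂ f₃ x X y Z : ℕ) (ψ : QState) :
    siteGate c₁ c₂ c a b f₁ f₂ f₃ x X y Z ψ = siteGateₗ c₁ c₂ c a b f₁ f₂ f₃ x X y Z ψ := by
  simp only [siteGate, siteGateₗ, rotate_eq, unrotate_eq, toffoli_eq, phase_eq,
    LinearMap.comp_apply]

/-- The conjunction of the controls is computed into the clean qubit `f₃`, the phase is applied
there, and the conjunction is erased. -/
theorem ccphase_ket {f₂ b f₃ y Z : ℕ} (h1 : f₃ ≠ f₂) (h2 : f₃ ≠ b) {s : Finset ℕ} (hs : f₃ ∉ s) :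
    toffoliₗ f₂ b f₃ (phaseₗ f₃ y Z (toffoliₗ f₂ b f₃ (ket s))) =
      (if f₂ ∈ s ∧ b ∈ s then turn y Z else 1) • ket s := by
  rw [toffoliₗ_ket]
  by_cases h : f₂ ∈ s ∧ b ∈ s
  · rw [if_pos ⟨h.1, h.2, h1, h2⟩, if_pos h, phaseₗ_ket, map_smul, toffoliₗ_ket]
    have e1 : f₃ ∈ symmDiff s {f₃} := by simp [Finset.mem_symmDiff, hs]
    have e2 : f₂ ∈ symmDiff s {f₃} := by simp [Finset.mem_symmDiff, h.1, Ne.symm h1]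
    have e3 : b ∈ symmDiff s {f₃} := by simp [Finset.mem_symmDiff, h.2, Ne.symm h2]
    rw [if_pos e1, if_pos ⟨e2, e3, h1, h2⟩, symmDiff_symmDiff_cancel_right]
  · rw [if_neg (fun e => h ⟨e.1, e.2.1⟩), if_neg h, phaseₗ_ket, if_neg hs, one_smul,
      toffoliₗ_ket, if_neg (fun e => h ⟨e.1, e.2.1⟩)]

/-- Only the phase in the middle needs a control: when it is off, the rotation cancels against its
inverse. -/
theorem controlled_rotation_ket {f₂ b f₃ x X y Z : ℕ} (hx : x ≤ X) (hX : 0 < X) (h1 : f₃ ≠ f₂)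
    (h2 : f₃ ≠ b) (h3 : f₂ ≠ b) {s : Finset ℕ} (hs : f₃ ∉ s) :
    gateOne b (rotMatrix x X) (toffoliₗ f₂ b f₃ (phaseₗ f₃ y Z (toffoliₗ f₂ b f₃
      (gateOne b (unrotMatrix x X) (ket s))))) =
      if f₂ ∈ s then gateOne b (fun p q => (if p = q then 1 else 0) +
        (turn y Z - 1) * rotVec x X p * rotVec x X q) (ket s) else ket s := by
  have n1 : f₃ ∉ s.erase b := fun e => hs (Finset.mem_of_mem_erase e)
  have n2 : f₃ ∉ insert b s := by simp [hs, h2]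
  have m1 : (f₂ ∈ s.erase b) ↔ f₂ ∈ s := by simp [h3]
  have m2 : (f₂ ∈ insert b s) ↔ f₂ ∈ s := by simp [h3]
  have b1 : b ∉ s.erase b := by simp
  have b2 : b ∈ insert b s := by simp
  split_ifs with h
  · have hstep : toffoliₗ f₂ b f₃ (phaseₗ f₃ y Z (toffoliₗ f₂ b f₃
        (gateOne b (unrotMatrix x X) (ket s)))) =
        gateOne b (diagMatrix (turn y Z)) (gateOne b (unrotMatrix x X) (ket s)) := by
      rw [gateOne_ket]
      simp only [map_add, map_smul]
      rw [ccphase_ket h1 h2 n1, ccphase_ket h1 h2 n2, if_neg (fun e => b1 e.2),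
        if_pos ⟨m2.2 h, b2⟩, ← phaseₗ_eq_gateOne, phaseₗ_ket, phaseₗ_ket, if_neg b1, if_pos b2]
    rw [hstep, gateOne_gateOne b (diagMatrix _), gateOne_gateOne]
    congr 2
    funext p q
    exact rotMatrix_mul hx hX _ p q
  · have hstep : toffoliₗ f₂ b f₃ (phaseₗ f₃ y Z (toffoliₗ f₂ b f₃
        (gateOne b (unrotMatrix x X) (ket s)))) = gateOne b (unrotMatrix x X) (ket s) := by
      rw [gateOne_ket]
      simp only [map_add, map_smul]
      rw [ccphase_ket h1 h2 n1, ccphase_ket h1 h2 n2, if_neg (fun e => h (m1.1 e.1)),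
        if_neg (fun e => h (m2.1 e.1)), one_smul, one_smul]
    rw [hstep, gateOne_gateOne, rotMatrix_mul_one hx hX, gateOne_one]

end QState


/-! ## Encoding of paths in qubits -/

namespace QState

theorem erase_symmDiff_insert {a b f₁ f₂ : ℕ} {K : Finset ℕ} (hab : a ≠ b) (h1 : a ≠ f₁)
    (h2 : a ≠ f₂) (h3 : b ≠ f₁) (h4 : b ≠ f₂) (ha : a ∉ K) (hb : b ∈ K) :
    (symmDiff (insert f₂ (insert f₁ K)) {a}).erase b =
      insert f₂ (insert f₁ (symmDiff K {a, b})) := by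
  ext q
  by_cases e1 : q = a
  · subst e1; simp [Finset.mem_symmDiff, hab, h1, h2, ha]
  by_cases e2 : q = b
  · subst e2; simp [Finset.mem_symmDiff, h3, h4, hb]
  · simp [Finset.mem_symmDiff, e1, e2]

theorem symmDiff_insert_symmDiff {a b : ℕ} {L : Finset ℕ} (hab : a ≠ b) (hb : b ∈ L) :
    symmDiff (insert b (symmDiff L {a})) {a} = L := by
  rw [Finset.insert_eq_of_mem (by simp [Finset.mem_symmDiff, hb, hab.symm]),
    symmDiff_symmDiff_cancel_right]

theorem symmDiff_insert_insert {a b f₁ f₂ : ℕ} {K : Finset ℕ} (hab : a ≠ b) (h1 : a ≠ f₁)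
    (h2 : a ≠ f₂) (h3 : b ≠ f₁) (h4 : b ≠ f₂) (ha : a ∈ K) (hb : b ∉ K) :
    symmDiff (insert b (insert f₂ (insert f₁ K))) {a} =
      insert f₂ (insert f₁ (symmDiff K {a, b})) := by
  ext q
  by_cases e1 : q = a
  · subst e1; simp [Finset.mem_symmDiff, h1, h2, ha]
  by_cases e2 : q = b
  · subst e2; simp [Finset.mem_symmDiff, hb, e1]
  · simp [Finset.mem_symmDiff, e1, e2]

/-- `c₁` and `c₂` mark that the walk is at the given site before and after the two steps; `a` and
`b` mark the lower and the upper site in between. If both controls are set, exactly one of `a`, `b`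
is set, and the first controlled-not gate makes `a` set in either case. The two basis states then
differ in `b` alone, a one-qubit gate on `b` mixes them, and the second controlled-not gate restores
the encoding. The flags `f₁` and `f₂` collect the three controls. -/
theorem siteGateₗ_ket {c₁ c₂ c a b f₁ f₂ f₃ x X y Z : ℕ} (hx : x ≤ X) (hX : 0 < X)
    (hd : [c₁, c₂, c, a, b, f₁, f₂, f₃].Nodup) {K : Finset ℕ} (h1 : f₁ ∉ K) (h2 : f₂ ∉ K)
    (h3 : f₃ ∉ K) (hab : c₁ ∈ K → c₂ ∈ K → (a ∈ K ↔ b ∉ K)) :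
    siteGateₗ c₁ c₂ c a b f₁ f₂ f₃ x X y Z (ket K) =
      if c₁ ∈ K ∧ c₂ ∈ K ∧ c ∈ K then
        (1 + (turn y Z - 1) * rotVec x X (decide (b ∈ K)) * rotVec x X (decide (b ∈ K))) • ket K +
        ((turn y Z - 1) * rotVec x X (!decide (b ∈ K)) * rotVec x X (decide (b ∈ K))) •
          ket (symmDiff K {a, b})
      else ket K := by
  simp only [List.nodup_cons, List.mem_cons, List.not_mem_nil, or_false, not_or, List.nodup_nil,
    and_true, not_false_eq_true] at hd
  obtain ⟨⟨d1, d2, d3, d4, d5, d6, d7⟩, ⟨d8, d9, d10, d11, d12, d13⟩, ⟨d14, d15, d16, d17, d18⟩,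
    ⟨d19, d20, d21, d22⟩, ⟨d23, d24, d25⟩, ⟨d26, d27⟩, d28⟩ := hd
  simp only [siteGateₗ, LinearMap.comp_apply]
  have tof : ∀ {u v w : ℕ} {L : Finset ℕ}, w ≠ u → w ≠ v →
      toffoliₗ u v w (ket L) = ket (if u ∈ L ∧ v ∈ L then symmDiff L {w} else L) := by
    intro u v w L h h'
    rw [toffoliₗ_ket]
    simp [h, h']
  -- When the controls are off, nothing happens between the two controlled-not gates and they
  -- cancel.
  have cc : ∀ V : Finset ℕ, (if b ∈ (if b ∈ V ∧ b ∈ V then symmDiff V {a} else V) ∧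
      b ∈ (if b ∈ V ∧ b ∈ V then symmDiff V {a} else V) then
      symmDiff (if b ∈ V ∧ b ∈ V then symmDiff V {a} else V) {a} else
      (if b ∈ V ∧ b ∈ V then symmDiff V {a} else V)) = V := by
    intro V
    by_cases hb : b ∈ V
    · have hb' : b ∈ symmDiff V {a} := by simp [Finset.mem_symmDiff, hb, Ne.symm d19]
      simp only [hb, and_self, if_true, hb', symmDiff_symmDiff_cancel_right]
    · simp only [hb, and_self, if_false]
  by_cases hF : c₁ ∈ K ∧ c₂ ∈ K
  · have hab := hab hF.1 hF.2
    rw [tof (Ne.symm d5) (Ne.symm d11), if_pos hF]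
    have e1 : symmDiff K {f₁} = insert f₁ K := by
      ext q; by_cases hq : q = f₁ <;> simp [Finset.mem_symmDiff, hq, h1]
    rw [e1]
    have mf : f₁ ∈ insert f₁ K := Finset.mem_insert_self _ _
    by_cases hc : c ∈ K
    · rw [if_pos ⟨hF.1, hF.2, hc⟩]
      have hc' : c ∈ insert f₁ K := Finset.mem_insert_of_mem hc
      rw [tof (Ne.symm d26) (Ne.symm d17), if_pos ⟨mf, hc'⟩]
      have e2 : symmDiff (insert f₁ K) {f₂} = insert f₂ (insert f₁ K) := by
        ext q; by_cases hq : q = f₂ <;> simp [Finset.mem_symmDiff, hq, h2, Ne.symm d26]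
      rw [e2, tof d19 d19]
      set L := insert f₂ (insert f₁ K) with hL
      have hbL : b ∈ L ↔ b ∈ K := by simp [hL, d23, d24]
      have hn3 : ∀ L' : Finset ℕ, L' = (if b ∈ L ∧ b ∈ L then symmDiff L {a} else L) → f₃ ∉ L' ∧
          f₂ ∈ L' ∧ (b ∈ L' ↔ b ∈ K) := by
        rintro _ rfl
        split_ifs <;> simp [Finset.mem_symmDiff, hL, h3, Ne.symm d27, Ne.symm d28, Ne.symm d22,
          Ne.symm d21, d23, d24, Ne.symm d19]
      obtain ⟨n3, n2, nb⟩ := hn3 _ rfl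
      rw [controlled_rotation_ket hx hX (Ne.symm d28) (Ne.symm d25) (Ne.symm d24) n3, if_pos n2,
        gateOne_ket]
      -- The last two Toffoli gates clear both flags, since the mixing leaves the three controls
      -- alone.
      have back : ∀ K' : Finset ℕ, f₁ ∉ K' → f₂ ∉ K' → c₁ ∈ K' → c₂ ∈ K' → c ∈ K' →
          toffoliₗ c₁ c₂ f₁ (toffoliₗ f₁ c f₂ (ket (insert f₂ (insert f₁ K')))) = ket K' := by
        intro K' k1 k2 k3 k4 k5
        rw [tof (Ne.symm d26) (Ne.symm d17), if_pos (by simp [k5])]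
        have : symmDiff (insert f₂ (insert f₁ K')) {f₂} = insert f₁ K' := by
          ext q; by_cases hq : q = f₂ <;> simp [Finset.mem_symmDiff, hq, k2, Ne.symm d26]
        rw [this, tof (Ne.symm d5) (Ne.symm d11), if_pos (by simp [k3, k4])]
        congr 1
        ext q; by_cases hq : q = f₁ <;> simp [Finset.mem_symmDiff, hq, k1]
      have hM1 : f₁ ∉ symmDiff K {a, b} := by
        simp [Finset.mem_symmDiff, h1, Ne.symm d20, Ne.symm d23]
      have hM2 : f₂ ∉ symmDiff K {a, b} := by
        simp [Finset.mem_symmDiff, h2, Ne.symm d21, Ne.symm d24]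
      have hM3 : c₁ ∈ symmDiff K {a, b} := by simp [Finset.mem_symmDiff, hF.1, d3, d4]
      have hM4 : c₂ ∈ symmDiff K {a, b} := by simp [Finset.mem_symmDiff, hF.2, d9, d10]
      have hM5 : c ∈ symmDiff K {a, b} := by simp [Finset.mem_symmDiff, hc, d14, d15]
      have bK := back K h1 h2 hF.1 hF.2 hc
      have bM := back _ hM1 hM2 hM3 hM4 hM5
      simp only [map_add, map_smul]
      have s1 : ∀ V : Finset ℕ, (if b ∈ V.erase b ∧ b ∈ V.erase b then symmDiff (V.erase b) {a}
          else V.erase b) = V.erase b := fun V => if_neg (by simp)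
      have s2 : ∀ V : Finset ℕ, (if b ∈ insert b V ∧ b ∈ insert b V then
          symmDiff (insert b V) {a} else insert b V) = symmDiff (insert b V) {a} :=
        fun V => if_pos (by simp)
      rw [tof d19 d19, tof d19 d19, s1, s2]
      by_cases hb : b ∈ K
      · have ha : a ∉ K := fun h => hab.1 h hb
        simp only [if_pos (And.intro (hbL.2 hb) (hbL.2 hb))]
        have g1 : (symmDiff L {a}).erase b = insert f₂ (insert f₁ (symmDiff K {a, b})) :=
          erase_symmDiff_insert d19 d20 d21 d23 d24 ha hb
        have g2 : symmDiff (insert b (symmDiff L {a})) {a} = insert f₂ (insert f₁ K) :=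
          symmDiff_insert_symmDiff d19 (hbL.2 hb)
        rw [g1, g2, bK, bM, show decide (b ∈ symmDiff L {a}) = true by
          simp [Finset.mem_symmDiff, hbL.2 hb, Ne.symm d19]]
        simp only [hb, decide_true, Bool.not_true, if_true, Bool.false_eq_true, if_false, zero_add]
        rw [add_comm]
      · have ha : a ∈ K := hab.2 hb
        simp only [if_neg (fun h : b ∈ L ∧ b ∈ L => hb (hbL.1 h.1))]
        have g1 : L.erase b = insert f₂ (insert f₁ K) :=
          Finset.erase_eq_of_notMem (fun h => hb (hbL.1 h))
        have g2 : symmDiff (insert b L) {a} = insert f₂ (insert f₁ (symmDiff K {a, b})) :=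
          symmDiff_insert_insert d19 d20 d21 d23 d24 ha hb
        rw [g1, g2, bK, bM, show decide (b ∈ L) = false by simp [hbL, hb]]
        simp only [hb, decide_false, Bool.not_false, if_true, Bool.true_eq_false, if_false,
          zero_add]
    · rw [if_neg (fun h => hc h.2.2)]
      have hc' : c ∉ insert f₁ K := by simp [hc, d16]
      rw [tof (Ne.symm d26) (Ne.symm d17), if_neg (fun h => hc' h.2), tof d19 d19]
      set L := insert f₁ K with hL
      set L' := if b ∈ L ∧ b ∈ L then symmDiff L {a} else L with hL'
      have n3 : f₃ ∉ L' := by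
        rw [hL']; split_ifs <;> simp [Finset.mem_symmDiff, hL, h3, Ne.symm d27, Ne.symm d22]
      have n2 : f₂ ∉ L' := by
        rw [hL']; split_ifs <;> simp [Finset.mem_symmDiff, hL, h2, Ne.symm d26, Ne.symm d21]
      rw [controlled_rotation_ket hx hX (Ne.symm d28) (Ne.symm d25) (Ne.symm d24) n3, if_neg n2,
        tof d19 d19]
      have e3 : (if b ∈ L' ∧ b ∈ L' then symmDiff L' {a} else L') = L := cc L
      rw [e3, tof (Ne.symm d26) (Ne.symm d17), if_neg (fun h => hc' h.2),
        tof (Ne.symm d5) (Ne.symm d11), if_pos (by simp [hL, hF.1, hF.2])]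
      congr 1
      ext q; by_cases hq : q = f₁ <;> simp [Finset.mem_symmDiff, hq, h1, hL]
  · rw [if_neg (fun h => hF ⟨h.1, h.2.1⟩), tof (Ne.symm d5) (Ne.symm d11), if_neg hF,
      tof (Ne.symm d26) (Ne.symm d17), if_neg (fun h => h1 h.1), tof d19 d19]
    set L' := if b ∈ K ∧ b ∈ K then symmDiff K {a} else K with hL'
    have n3 : f₃ ∉ L' := by
      rw [hL']; split_ifs <;> simp [Finset.mem_symmDiff, h3, Ne.symm d22]
    have n2 : f₂ ∉ L' := by
      rw [hL']; split_ifs <;> simp [Finset.mem_symmDiff, h2, Ne.symm d21]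
    rw [controlled_rotation_ket hx hX (Ne.symm d28) (Ne.symm d25) (Ne.symm d24) n3, if_neg n2,
      tof d19 d19]
    have e3 : (if b ∈ L' ∧ b ∈ L' then symmDiff L' {a} else L') = K := cc K
    rw [e3, tof (Ne.symm d26) (Ne.symm d17), if_neg (fun h => h1 h.1),
      tof (Ne.symm d5) (Ne.symm d11), if_neg hF]

end QState

/-- The number of the qubits for one step of a path. -/
def stepWidth (n k : ℕ) : ℕ := 2 * n + k + 4

/-- The first qubit used by trial `t`. -/
def qubitBase (n k t : ℕ) : ℕ := t * (n + 2) * stepWidth n k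

/-- The qubit `y` of step `j` in trial `t`. -/
def qubit (n k t j y : ℕ) : ℕ := (t * (n + 2) + j) * stepWidth n k + y

/-- The control qubit of trial `t`. -/
def ctrlQubit (n k t : ℕ) : ℕ := qubit n k t (n + 1) 0

theorem qubit_inj {n k t j y t' j' y' : ℕ} (hy : y < stepWidth n k) (hy' : y' < stepWidth n k)
    (h : qubit n k t j y = qubit n k t' j' y') : t * (n + 2) + j = t' * (n + 2) + j' ∧ y = y' := by
  have h0 : 0 < stepWidth n k := by unfold stepWidth; omega
  unfold qubit at h
  have hd := congrArg (· / stepWidth n k) h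
  have hm := congrArg (· % stepWidth n k) h
  simp only [Nat.mul_add_mod_self_right, Nat.mod_eq_of_lt hy, Nat.mod_eq_of_lt hy'] at hm
  simp only [mul_comm _ (stepWidth n k), Nat.mul_add_div h0, Nat.div_eq_of_lt hy,
    Nat.div_eq_of_lt hy', add_zero] at hd
  exact ⟨hd, hm⟩

theorem qubit_eq_iff {n k t j y j' y' : ℕ} (hy : y < stepWidth n k) (hy' : y' < stepWidth n k) :
    qubit n k t j y = qubit n k t j' y' ↔ j = j' ∧ y = y' := by
  refine ⟨fun h => ?_, fun h => by rw [h.1, h.2]⟩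
  have := qubit_inj hy hy' h
  exact ⟨by omega, this.2⟩

theorem qubitBase_le_qubit (n k t j y : ℕ) : qubitBase n k t ≤ qubit n k t j y := by
  unfold qubitBase qubit; rw [add_mul]; omega

theorem qubit_lt_qubitBase {n k t j y : ℕ} (hj : j < n + 2) (hy : y < stepWidth n k) :
    qubit n k t j y < qubitBase n k (t + 1) := by
  unfold qubitBase qubit
  have h1 : (t * (n + 2) + j + 1) * stepWidth n k ≤ (t + 1) * (n + 2) * stepWidth n k :=
    Nat.mul_le_mul_right _ (by rw [add_mul]; omega)
  rw [add_mul _ 1, one_mul] at h1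
  omega

/-- The site of a path, as a natural number. -/
def siteIdx {n : ℕ} (p : Fin n → Bool) (j : ℕ) : ℕ := (siteAfter p j + n).toNat

/-- A walk of n steps stays above −n, so after the shift by n the truncation to natural numbers
loses nothing. Walks that leave 1, …, k − 1 are encoded as well. -/
theorem siteIdx_cast {n : ℕ} (p : Fin n → Bool) (j : ℕ) :
    (siteIdx p j : ℤ) = siteAfter p j + n ∧ siteIdx p j ≤ 2 * n + 1 := by
  have h : |∑ i : Fin n, if i.val < j then (if p i then (1 : ℤ) else -1) else 0| ≤ n := by
    refine (Finset.abs_sum_le_sum_abs _ _).trans ?_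
    calc _ ≤ ∑ _i : Fin n, (1 : ℤ) := Finset.sum_le_sum fun i _ => by split_ifs <;> simp
      _ = n := by simp
  have h' := abs_le.1 h
  unfold siteIdx siteAfter
  omega

theorem siteIdx_lt {n : ℕ} (k : ℕ) (p : Fin n → Bool) (j : ℕ) : siteIdx p j < stepWidth n k := by
  have := (siteIdx_cast p j).2
  unfold stepWidth; omega

theorem siteIdx_eq_iff {n : ℕ} (p : Fin n → Bool) (j z : ℕ) :
    siteIdx p j = z + n ↔ siteAfter p j = z := by
  have := (siteIdx_cast p j).1
  omega

/-- The qubits that are set in the encoding of a path together with the control bit, when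
the qubits in `s` are set already. -/
def pathCode (n k t : ℕ) (s : Finset ℕ) (x : Bool × (Fin n → Bool)) : Finset ℕ :=
  (s ∪ (Finset.range (n + 1)).image fun j => qubit n k t j (siteIdx x.2 j)) ∪
    if x.1 then {ctrlQubit n k t} else ∅

section
variable {n k t : ℕ} {s : Finset ℕ} {x : Bool × (Fin n → Bool)}

theorem mem_pathCode {q : ℕ} : q ∈ pathCode n k t s x ↔
    q ∈ s ∨ (∃ j ≤ n, q = qubit n k t j (siteIdx x.2 j)) ∨ (x.1 = true ∧ q = ctrlQubit n k t) := by
  unfold pathCode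
  simp only [Finset.mem_union, Finset.mem_image, Finset.mem_range, Nat.lt_succ_iff]
  rcases x with ⟨c, p⟩
  cases c <;> simp [eq_comm, or_assoc]

/-- All qubits in use belong to trials before `t`. -/
def BelowBase (n k t : ℕ) (s : Finset ℕ) : Prop := ∀ q ∈ s, q < qubitBase n k t

theorem BelowBase.notMem (hs : BelowBase n k t s) (j y : ℕ) : qubit n k t j y ∉ s := fun h => by
  have := hs _ h
  have := qubitBase_le_qubit n k t j y
  omega

theorem stepWidth_pos (n k : ℕ) : 0 < stepWidth n k := by unfold stepWidth; omega

theorem qubit_mem_pathCode (hs : BelowBase n k t s) {j y : ℕ} (hj : j ≤ n)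
    (hy : y < stepWidth n k) : qubit n k t j y ∈ pathCode n k t s x ↔ siteIdx x.2 j = y := by
  rw [mem_pathCode]
  constructor
  · rintro (h | ⟨j', hj', h⟩ | ⟨_, h⟩)
    · exact absurd h (hs.notMem j y)
    · obtain ⟨rfl, h⟩ := (qubit_eq_iff hy (siteIdx_lt k _ _)).1 h
      exact h.symm
    · have := (qubit_eq_iff hy (stepWidth_pos n k)).1 h
      omega
  · rintro rfl
    exact Or.inr (Or.inl ⟨j, hj, rfl⟩)

theorem ctrl_mem_pathCode (hs : BelowBase n k t s) :
    ctrlQubit n k t ∈ pathCode n k t s x ↔ x.1 = true := by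
  rw [mem_pathCode]
  constructor
  · rintro (h | ⟨j', hj', h⟩ | ⟨h, _⟩)
    · exact absurd h (hs.notMem _ _)
    · have := (qubit_eq_iff (stepWidth_pos n k) (siteIdx_lt k _ _)).1 h
      omega
    · exact h
  · exact fun h => Or.inr (Or.inr ⟨h, rfl⟩)

theorem aux_notMem_pathCode (hs : BelowBase n k t s) {y : ℕ} (h0 : y ≠ 0) (hy : y < 4) :
    qubit n k t (n + 1) y ∉ pathCode n k t s x := by
  have hy' : y < stepWidth n k := by unfold stepWidth; omega
  rw [mem_pathCode]
  rintro (h | ⟨j', hj', h⟩ | ⟨_, h⟩)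
  · exact absurd h (hs.notMem _ _)
  · have := (qubit_eq_iff hy' (siteIdx_lt k _ _)).1 h
    omega
  · have := (qubit_eq_iff hy' (stepWidth_pos n k)).1 h
    omega

/-- Every trial works on fresh qubits: those of earlier trials may stay entangled with each other,
but no later gate touches them. -/
theorem BelowBase.pathCode (hs : BelowBase n k t s) (x : Bool × (Fin n → Bool)) :
    BelowBase n k (t + 1) (pathCode n k t s x) := by
  intro q hq
  rw [mem_pathCode] at hq
  rcases hq with h | ⟨j, hj, rfl⟩ | ⟨_, rfl⟩
  · have h1 := hs q h
    have h2 := qubit_lt_qubitBase (n := n) (k := k) (t := t) (j := 0) (y := 0) (by omega)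
      (stepWidth_pos n k)
    have h3 := qubitBase_le_qubit n k t 0 0
    omega
  · exact qubit_lt_qubitBase (by omega) (siteIdx_lt k _ _)
  · exact qubit_lt_qubitBase (by omega) (stepWidth_pos n k)

theorem siteAfter_injective {p p' : Fin n → Bool} (h : ∀ j ≤ n, siteAfter p j = siteAfter p' j) :
    p = p' := by
  funext a
  have h1 := siteAfter_succ p a
  have h2 := siteAfter_succ p' a
  rw [h _ (by omega), h _ (by omega)] at h1
  have h3 : stepSign (p a) = stepSign (p' a) := by omega
  revert h3
  cases p a <;> cases p' a <;> simp [stepSign]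

/-- The earlier qubits, the control bit and all sites can be read off from the code, and the sites
determine the steps. This is what makes encoded walks orthonormal. -/
theorem pathCode_injective {s' : Finset ℕ} {x' : Bool × (Fin n → Bool)} (hs : BelowBase n k t s)
    (hs' : BelowBase n k t s') (h : pathCode n k t s x = pathCode n k t s' x') :
    s = s' ∧ x = x' := by
  constructor
  · have aux : ∀ {s₁ s₂ : Finset ℕ} {x₁ x₂ : Bool × (Fin n → Bool)}, BelowBase n k t s₁ →
        pathCode n k t s₁ x₁ = pathCode n k t s₂ x₂ → ∀ q ∈ s₁, q ∈ s₂ := by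
      intro s₁ s₂ x₁ x₂ hb e q hq
      have hlt := hb q hq
      have h1 : q ∈ pathCode n k t s₂ x₂ := by rw [← e, mem_pathCode]; exact Or.inl hq
      rw [mem_pathCode] at h1
      rcases h1 with h1 | ⟨j, hj, rfl⟩ | ⟨_, rfl⟩
      · exact h1
      · have := qubitBase_le_qubit n k t j (siteIdx x₂.2 j); omega
      · have := qubitBase_le_qubit n k t (n + 1) 0
        unfold ctrlQubit at hlt; omega
    exact Finset.Subset.antisymm (aux hs h) (aux hs' h.symm)
  · refine Prod.ext ?_ (siteAfter_injective fun j hj => ?_)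
    · have h1 := ctrl_mem_pathCode (x := x) hs
      have h2 := ctrl_mem_pathCode (x := x') hs'
      rw [h, h2] at h1
      rcases x with ⟨c, p⟩; rcases x' with ⟨c', p'⟩
      cases c <;> cases c' <;> simp_all
    · have h1 := (qubit_mem_pathCode (x := x) hs hj (siteIdx_lt k x.2 j)).2 rfl
      rw [h, qubit_mem_pathCode hs' hj (siteIdx_lt k x.2 j)] at h1
      have e1 := (siteIdx_cast x.2 j).1
      have e2 := (siteIdx_cast x'.2 j).1
      omega

end


/-! ## Superpositions of encoded paths -/

open QState

/-- The superposition with amplitudes `g` of encoded paths, on top of the state `χ` of the qubits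
of earlier trials. -/
noncomputable def pathState (n k t : ℕ) (χ : QState) (g : Bool × (Fin n → Bool) → ℂ) : QState :=
  χ.sum fun s a => a • ∑ x, g x • ket (pathCode n k t s x)

section
variable {n k t : ℕ} {χ : QState}

/-- The state only involves the qubits of trials before `t`. -/
def StateBelow (n k t : ℕ) (χ : QState) : Prop := ∀ s ∈ χ.support, BelowBase n k t s

/-- The gate sequences applied to path states send a basis state to a combination of itself and one
partner under an involution. Such a rule for kets becomes a rule for amplitudes, whatever the state
of the earlier qubits. -/
theorem map_pathState (hχ : StateBelow n k t χ) (G : QState →ₗ[ℂ] QState)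
    (τ : Bool × (Fin n → Bool) → Bool × (Fin n → Bool)) (hτ : ∀ x, τ (τ x) = x)
    (α β : Bool × (Fin n → Bool) → ℂ)
    (hG : ∀ s, BelowBase n k t s → ∀ x, G (ket (pathCode n k t s x)) =
      α x • ket (pathCode n k t s x) + β x • ket (pathCode n k t s (τ x)))
    (g : Bool × (Fin n → Bool) → ℂ) :
    G (pathState n k t χ g) = pathState n k t χ fun x => α x * g x + β (τ x) * g (τ x) := by
  unfold pathState
  rw [Finsupp.sum, map_sum, Finsupp.sum]
  refine Finset.sum_congr rfl fun s hs => ?_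
  rw [map_smul, map_sum]
  congr 1
  simp only [map_smul, hG s (hχ s hs), smul_add, smul_smul, add_smul, Finset.sum_add_distrib]
  congr 1
  · exact Finset.sum_congr rfl fun x _ => by rw [mul_comm]
  · have e : Function.Involutive τ := hτ
    rw [← Equiv.sum_comp e.toPerm]
    exact Finset.sum_congr rfl fun x _ => by
      simp only [Function.Involutive.coe_toPerm, hτ]; rw [mul_comm]

theorem gateOne_pathState (hχ : StateBelow n k t χ) (U : Bool → Bool → ℂ)
    (g : Bool × (Fin n → Bool) → ℂ) :
    gateOne (ctrlQubit n k t) U (pathState n k t χ g) =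
      pathState n k t χ fun x => U x.1 false * g (false, x.2) + U x.1 true * g (true, x.2) := by
  rw [map_pathState hχ _ (fun x => (!x.1, x.2)) (by simp) (fun x => U x.1 x.1)
    (fun x => U (!x.1) x.1)]
  · congr 1
    funext ⟨c, p⟩
    cases c <;> simp [add_comm]
  · intro s hs ⟨c, p⟩
    rw [gateOne_ket]
    have hm := ctrl_mem_pathCode (x := (c, p)) hs
    have hn : ctrlQubit n k t ∉ pathCode n k t s (false, p) := fun h => by
      simpa using (ctrl_mem_pathCode hs).1 h
    have h1 : insert (ctrlQubit n k t) (pathCode n k t s (false, p)) =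
        pathCode n k t s (true, p) := by
      ext q; simp only [Finset.mem_insert, mem_pathCode]; simp only [Bool.false_eq_true, false_and,
        or_false, true_and]
      rw [or_comm, or_assoc]
    have h2 : (pathCode n k t s (true, p)).erase (ctrlQubit n k t) =
        pathCode n k t s (false, p) := by rw [← h1, Finset.erase_insert hn]
    cases c
    · simp only [hm, Bool.false_eq_true, decide_false, h1, Bool.not_false,
        Finset.erase_eq_of_notMem hn]
    · simp only [hm, decide_true, h2, Bool.not_true]
      rw [Finset.insert_eq_of_mem (hm.2 rfl), add_comm]

/-- Amplitudes after the site gate at crossing `c` and site `z`. -/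
noncomputable def siteAct (c : Crossing n) (z : ℤ) (u : Bool → ℝ) (w : ℂ)
    (g : Bool × (Fin n → Bool) → ℂ) (x : Bool × (Fin n → Bool)) : ℂ :=
  if x.1 = true ∧ siteAfter x.2 c.left.val = z ∧ x.2 c.left ≠ x.2 c.right then
    g x + w * (u (x.2 c.left) * (u (x.2 c.left) * g x + u (x.2 c.right) * g (true, flipPath c x.2)))
  else g x

/-- Exchanging different steps changes the code of a walk only in the register of the middle
position, where it toggles the qubits of z − 1 and z + 1. A walk at z has different steps exactly if
it is at z again afterwards, which is what the two site controls test. -/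
theorem siteGate_pathState (hχ : StateBelow n k t χ) (c : Crossing n) {z x X y Z : ℕ} (hz : 1 ≤ z)
    (hzk : z < k) (hx : x ≤ X) (hX : 0 < X) (g : Bool × (Fin n → Bool) → ℂ) :
    siteGate (qubit n k t c.i (z + n)) (qubit n k t (c.i + 2) (z + n)) (ctrlQubit n k t)
      (qubit n k t (c.i + 1) (z - 1 + n)) (qubit n k t (c.i + 1) (z + 1 + n))
      (qubit n k t (n + 1) 1) (qubit n k t (n + 1) 2) (qubit n k t (n + 1) 3) x X y Z
      (pathState n k t χ g) =
    pathState n k t χ (siteAct c z (rotVec x X) (turn y Z - 1) g) := by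
  classical
  have hi := c.hi
  have w0 : z + n < stepWidth n k := by unfold stepWidth; omega
  have w1 : z - 1 + n < stepWidth n k := by unfold stepWidth; omega
  have w2 : z + 1 + n < stepWidth n k := by unfold stepWidth; omega
  have w3 : 0 < stepWidth n k := by unfold stepWidth; omega
  have w4 : 1 < stepWidth n k := by unfold stepWidth; omega
  have w5 : 2 < stepWidth n k := by unfold stepWidth; omega
  have w6 : 3 < stepWidth n k := by unfold stepWidth; omega
  let act : Bool × (Fin n → Bool) → Prop := fun x =>
    x.1 = true ∧ siteAfter x.2 c.left.val = z ∧ x.2 c.left ≠ x.2 c.right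
  have hact : ∀ x, act (x.1, flipPath c x.2) ↔ act x := by
    rintro ⟨b, p⟩
    simp only [act, flipPath_left, flipPath_right]
    rw [siteAfter_flipPath c p (by change c.i ≠ c.i + 1; omega)]
    exact and_congr_right fun _ => and_congr_right fun _ => ⟨Ne.symm, Ne.symm⟩
  rw [siteGate_eq, map_pathState hχ _
    (fun x => if act x then (x.1, flipPath c x.2) else x) (fun x => by
      by_cases h : act x
      · simp only [h, if_true, (hact x).2 h, flipPath_flipPath]
      · simp only [h, if_false])
    (fun p => if act p then 1 + (turn y Z - 1) * rotVec x X (p.2 c.left) * rotVec x X (p.2 c.left)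
      else 1)
    (fun p => if act p then (turn y Z - 1) * rotVec x X (p.2 c.right) * rotVec x X (p.2 c.left)
      else 0)]
  · congr 1
    funext p
    by_cases h : act p
    · have h' := (hact p).2 h
      simp only [h, if_true, h', flipPath_left, flipPath_right]
      rw [siteAct, if_pos h]
      rcases p with ⟨b, p⟩
      obtain rfl : b = true := h.1
      ring
    · simp only [h, if_false]
      rw [siteAct, if_neg h]; ring
  · rintro s hs ⟨b, p⟩
    have m1 := qubit_mem_pathCode (x := (b, p)) hs (j := c.i) (by omega) w0
    have m2 := qubit_mem_pathCode (x := (b, p)) hs (j := c.i + 2) (by omega) w0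
    have m3 := qubit_mem_pathCode (x := (b, p)) hs (j := c.i + 1) (by omega) w1
    have m4 := qubit_mem_pathCode (x := (b, p)) hs (j := c.i + 1) (by omega) w2
    have m5 := ctrl_mem_pathCode (x := (b, p)) hs
    rw [siteIdx_eq_iff] at m1 m2 m3 m4
    simp only at m1 m2 m3 m4
    have st1 : siteAfter p (c.i + 1) = siteAfter p c.i + stepSign (p c.left) :=
      siteAfter_succ p c.left
    have st2 : siteAfter p (c.i + 2) = siteAfter p (c.i + 1) + stepSign (p c.right) :=
      siteAfter_succ p c.right
    have hz' : ((z - 1 : ℕ) : ℤ) = z - 1 := by omega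
    have hz'' : ((z + 1 : ℕ) : ℤ) = z + 1 := by omega
    rw [hz'] at m3
    rw [hz''] at m4
    have hne : ∀ h0 : siteAfter p c.i = z, (siteAfter p (c.i + 2) = z ↔ p c.left ≠ p c.right) := by
      intro h0
      rw [st2, st1, h0]
      cases p c.left <;> cases p c.right <;> simp [stepSign]
      all_goals omega
    have hmb : siteAfter p c.i = z → (siteAfter p (c.i + 1) = z + 1 ↔ p c.left = true) := by
      intro h0
      rw [st1, h0]
      cases p c.left <;> simp [stepSign]
    have hma : siteAfter p c.i = z → (siteAfter p (c.i + 1) = z - 1 ↔ ¬ p c.left = true) := by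
      intro h0
      rw [st1, h0]
      cases p c.left <;> simp [stepSign]
      all_goals omega
    rw [siteGateₗ_ket hx hX]
    · by_cases h : act (b, p)
      · have h0 : siteAfter p c.i = z := h.2.1
        rw [if_pos ⟨m1.2 h0, m2.2 ((hne h0).2 h.2.2), m5.2 h.1⟩]
        simp only [h, if_true]
        have hb : decide (qubit n k t (c.i + 1) (z + 1 + n) ∈ pathCode n k t s (b, p)) =
            p c.left := by
          rw [← Bool.coe_iff_coe, decide_eq_true_iff, m4, hmb h0]
        have hnot : (!(p c.left)) = p c.right := by
          have hd : p c.left ≠ p c.right := h.2.2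
          revert hd
          cases p c.left <;> cases p c.right <;> simp
        rw [hb, hnot]
        congr 3
        ext q
        rw [Finset.mem_symmDiff, Finset.mem_insert, Finset.mem_singleton]
        have hoth : ∀ j, j ≠ c.i + 1 → siteIdx (flipPath c p) j = siteIdx p j := fun j hj => by
          unfold siteIdx; rw [siteAfter_flipPath c p hj]
        have f1 : siteAfter (flipPath c p) (c.i + 1) = siteAfter p c.i + stepSign (p c.right) := by
          have e1 := siteAfter_succ (flipPath c p) c.left
          rw [flipPath_left, siteAfter_flipPath c p (j := c.left.val)
            (by change c.i ≠ c.i + 1; omega)] at e1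
          exact e1
        -- Only qubits in the register of the middle position can differ between the two codes.
        by_cases hq : ∃ y < stepWidth n k, q = qubit n k t (c.i + 1) y
        · obtain ⟨y, hy, rfl⟩ := hq
          rw [qubit_mem_pathCode hs (by omega) hy, qubit_mem_pathCode hs (by omega) hy,
            qubit_eq_iff hy w1, qubit_eq_iff hy w2]
          have e1 := (siteIdx_cast p (c.i + 1)).1
          have e2 := (siteIdx_cast (flipPath c p) (c.i + 1)).1
          have hd := h.2.2
          rw [st1, h0] at e1
          rw [f1, h0] at e2
          simp only at hd
          revert e1 e2 hd
          simp only [stepSign]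
          cases p c.left <;> cases p c.right <;> simp <;> intro e1 e2 <;> omega
        · have q1 : q ≠ qubit n k t (c.i + 1) (z - 1 + n) := fun e => hq ⟨_, w1, e⟩
          have q2 : q ≠ qubit n k t (c.i + 1) (z + 1 + n) := fun e => hq ⟨_, w2, e⟩
          simp only [q1, q2, or_self, not_false_eq_true, and_true, false_and, or_false]
          rw [mem_pathCode, mem_pathCode]
          have : ∀ j ≤ n, (q = qubit n k t j (siteIdx p j) ↔
              q = qubit n k t j (siteIdx (flipPath c p) j)) := by
            intro j _
            by_cases hj : j = c.i + 1
            · subst hj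
              exact ⟨fun e => absurd ⟨_, siteIdx_lt k _ _, e⟩ hq,
                fun e => absurd ⟨_, siteIdx_lt k _ _, e⟩ hq⟩
            · rw [hoth j hj]
          simp only
          constructor
          · rintro (h | ⟨j, hj, h⟩ | h)
            · exact Or.inl h
            · exact Or.inr (Or.inl ⟨j, hj, (this j hj).1 h⟩)
            · exact Or.inr (Or.inr h)
          · rintro (h | ⟨j, hj, h⟩ | h)
            · exact Or.inl h
            · exact Or.inr (Or.inl ⟨j, hj, (this j hj).2 h⟩)
            · exact Or.inr (Or.inr h)
      · rw [if_neg (fun h' => h ⟨m5.1 h'.2.2, m1.1 h'.1, (hne (m1.1 h'.1)).1 (m2.1 h'.2.1)⟩)]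
        simp only [h, if_false, one_smul, zero_smul, add_zero]
    · simp only [List.nodup_cons, List.mem_cons, List.not_mem_nil, or_false, not_or,
        List.nodup_nil, and_true, not_false_eq_true, ctrlQubit, qubit_eq_iff, w0, w1, w2, w3, w4,
        w5, w6]
      omega
    · exact aux_notMem_pathCode hs (by norm_num) (by norm_num)
    · exact aux_notMem_pathCode hs (by norm_num) (by norm_num)
    · exact aux_notMem_pathCode hs (by norm_num) (by norm_num)
    · intro h0 _
      have h0 := m1.1 h0
      rw [m3, m4, hmb h0, hma h0]

theorem project_pathState (hχ : StateBelow n k t χ) (b : Bool) (g : Bool × (Fin n → Bool) → ℂ) :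
    project (ctrlQubit n k t) b (pathState n k t χ g) =
      pathState n k t χ fun x => if x.1 = b then g x else 0 := by
  rw [project_eq, map_pathState hχ _ id (fun _ => rfl) (fun x => if x.1 = b then 1 else 0)
    (fun _ => 0)]
  · congr 1
    funext x
    split_ifs <;> simp
  · intro s hs x
    rw [projectₗ_ket]
    have : decide (ctrlQubit n k t ∈ pathCode n k t s x) = x.1 := by
      rw [← Bool.coe_iff_coe, decide_eq_true_iff, ctrl_mem_pathCode hs]
    rw [this]; simp

theorem pathState_apply (hχ : StateBelow n k t χ) (g : Bool × (Fin n → Bool) → ℂ) {s : Finset ℕ}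
    (hs : BelowBase n k t s) (x : Bool × (Fin n → Bool)) :
    pathState n k t χ g (pathCode n k t s x) = χ s * g x := by
  classical
  unfold pathState
  rw [Finsupp.sum, Finsupp.finsetSum_apply]
  simp only [Finsupp.smul_apply, Finsupp.finsetSum_apply, ket, Finsupp.single_apply, smul_eq_mul]
  have h1 : ∀ s' ∈ χ.support, χ s' * ∑ x', g x' *
      (if pathCode n k t s' x' = pathCode n k t s x then 1 else 0) =
      if s' = s then χ s * g x else 0 := by
    intro s' hs'
    by_cases h : s' = s
    · subst h
      rw [if_pos rfl, Finset.sum_eq_single x]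
      · simp
      · intro x' _ hx'
        rw [if_neg (fun e => hx' (pathCode_injective hs hs e).2), mul_zero]
      · simp
    · rw [if_neg h, Finset.sum_eq_zero, mul_zero]
      intro x' _
      rw [if_neg (fun e => h (pathCode_injective (hχ s' hs') hs e).1), mul_zero]
  rw [Finset.sum_congr rfl h1, Finset.sum_ite_eq']
  split_ifs with h
  · rfl
  · rw [Finsupp.notMem_support_iff.1 h, zero_mul]

theorem pathState_support (g : Bool × (Fin n → Bool) → ℂ) {r : Finset ℕ}
    (hr : r ∈ (pathState n k t χ g).support) : ∃ s ∈ χ.support, ∃ x, r = pathCode n k t s x := by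
  classical
  by_contra hcon
  push Not at hcon
  refine Finsupp.mem_support_iff.1 hr ?_
  unfold pathState
  rw [Finsupp.sum, Finsupp.finsetSum_apply]
  refine Finset.sum_eq_zero fun s hs => ?_
  simp only [Finsupp.smul_apply, Finsupp.finsetSum_apply, ket, Finsupp.single_apply, smul_eq_mul]
  rw [Finset.sum_eq_zero, mul_zero]
  intro x _
  rw [if_neg (Ne.symm (hcon s hs x)), mul_zero]

theorem StateBelow.pathState (hχ : StateBelow n k t χ) (g : Bool × (Fin n → Bool) → ℂ) :
    StateBelow n k (t + 1) (pathState n k t χ g) := by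
  intro r hr
  obtain ⟨s, hs, x, rfl⟩ := pathState_support g hr
  exact (hχ s hs).pathCode x

/-- As the codes are injective, amplitudes of the new trial multiply those of the earlier ones
without interference. The factorization makes the trials independent. -/
theorem normSq_pathState (hχ : StateBelow n k t χ) (g : Bool × (Fin n → Bool) → ℂ) :
    normSq (pathState n k t χ g) = normSq χ * ∑ x, ‖g x‖ ^ 2 := by
  classical
  unfold normSq
  rw [Finsupp.sum, Finsupp.sum, Finset.sum_mul_sum, ← Finset.sum_product']
  have hinj : Set.InjOn (fun y : Finset ℕ × (Bool × (Fin n → Bool)) => pathCode n k t y.1 y.2)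
      ↑(χ.support ×ˢ (Finset.univ : Finset (Bool × (Fin n → Bool)))) := by
    rintro ⟨s, x⟩ h ⟨s', x'⟩ h' e
    simp only [Finset.coe_product, Set.mem_prod, Finset.mem_coe] at h h'
    obtain ⟨rfl, rfl⟩ := pathCode_injective (hχ s h.1) (hχ s' h'.1) e
    rfl
  rw [Finset.sum_subset (s₂ := (χ.support ×ˢ (Finset.univ : Finset (Bool × (Fin n → Bool)))).image
    fun y => pathCode n k t y.1 y.2), Finset.sum_image hinj]
  · refine Finset.sum_congr rfl fun y hy => ?_
    have hy' := (Finset.mem_product.1 hy).1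
    rw [pathState_apply hχ g (hχ _ hy'), norm_mul, mul_pow]
  · intro r hr
    obtain ⟨s, hs, x, rfl⟩ := pathState_support g hr
    exact Finset.mem_image.2 ⟨(s, x), Finset.mem_product.2 ⟨hs, Finset.mem_univ _⟩, rfl⟩
  · intro r _ hr
    rw [Finsupp.notMem_support_iff.1 hr]; simp

/-- The not gate. -/
noncomputable def notGate (q : ℕ) (ψ : QState) : QState := hadamard q (phase q 1 2 (hadamard q ψ))

theorem notGate_eq (q : ℕ) (ψ : QState) :
    notGate q ψ = gateOne q (fun a b => if a = b then 0 else 1) ψ := by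
  rw [notGate]
  simp only [hadamard_eq, phase_eq, hadamardₗ_eq_gateOne, phaseₗ_eq_gateOne, gateOne_gateOne,
    turn_one_two]
  congr 2
  funext a b
  have := hadamard_diag_hadamard (-1) 1 a b
  rw [mulMatrix_one] at this
  rw [this]
  split_ifs <;> norm_num

/-- The state in which the qubits in `D` have been set. -/
noncomputable def setQubits (χ : QState) (D : Finset ℕ) : QState :=
  χ.sum fun s a => a • ket (s ∪ D)

theorem setQubits_empty : setQubits χ ∅ = χ := by
  simp only [setQubits, Finset.union_empty, ket, Finsupp.smul_single, smul_eq_mul, mul_one]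
  exact Finsupp.sum_single χ

theorem notGate_setQubits {D : Finset ℕ} {q : ℕ} (hD : q ∉ D) (hq : ∀ s ∈ χ.support, q ∉ s) :
    notGate q (setQubits χ D) = setQubits χ (insert q D) := by
  rw [notGate_eq, setQubits, setQubits, Finsupp.sum, map_sum, Finsupp.sum]
  refine Finset.sum_congr rfl fun s hs => ?_
  have : q ∉ s ∪ D := by simp [hD, hq s hs]
  rw [map_smul, gateOne_ket]
  simp [this]

theorem setQubits_eq_pathState (p : Fin n → Bool) :
    setQubits χ ((Finset.range (n + 1)).image fun j => qubit n k t j (siteIdx p j)) =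
      pathState n k t χ (Pi.single (false, p) 1) := by
  unfold setQubits pathState
  congr 1
  funext s a
  rw [Finset.sum_eq_single (false, p)]
  · simp [pathCode]
  · intro x _ hx
    rw [Pi.single_eq_of_ne hx, zero_smul]
  · simp

end


/-! ## Unitary path operators and their stability -/

open QState

section
variable {n : ℕ}

/-- The Euclidean norm of a vector of amplitudes. -/
noncomputable def l2 (f : (Fin n → Bool) → ℂ) : ℝ :=
  ‖(WithLp.toLp 2 f : EuclideanSpace ℂ (Fin n → Bool))‖

theorem l2_sq (f : (Fin n → Bool) → ℂ) : l2 f ^ 2 = ∑ p, ‖f p‖ ^ 2 := by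
  rw [l2, EuclideanSpace.norm_sq_eq]

theorem l2_nonneg (f : (Fin n → Bool) → ℂ) : 0 ≤ l2 f := norm_nonneg _

theorem l2_add_le (f g : (Fin n → Bool) → ℂ) : l2 (f + g) ≤ l2 f + l2 g := by
  unfold l2; rw [WithLp.toLp_add]; exact norm_add_le _ _

theorem norm_le_l2 (f : (Fin n → Bool) → ℂ) (p : Fin n → Bool) : ‖f p‖ ≤ l2 f :=
  PiLp.norm_apply_le (WithLp.toLp 2 f : EuclideanSpace ℂ (Fin n → Bool)) p

theorem l2_single (p : Fin n → Bool) : l2 (Pi.single p 1) = 1 := by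
  rw [← sq_eq_sq₀ (l2_nonneg _) zero_le_one, l2_sq, Finset.sum_eq_single p]
  · simp
  · intro q _ hq; rw [Pi.single_eq_of_ne hq]; simp
  · simp

/-- The operator `1 + w P`, where `P` is the operator with local vectors `u`. -/
noncomputable def pathGate (u : ℤ → Bool → ℝ) (w : ℂ) (c : Crossing n) (f : (Fin n → Bool) → ℂ) :
    (Fin n → Bool) → ℂ := f + w • localOp u c f

/-- The eigenvalue of a crossing. -/
noncomputable def crossingTurn (k : ℕ) (pos : Bool) : ℂ :=
  turn (if pos then k - 2 else k + 2) (2 * k)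

/-- The product of the path operators of a braid. -/
noncomputable def braidUnitary (u : ℤ → Bool → ℝ) (k : ℕ) :
    BraidWord n → ((Fin n → Bool) → ℂ) → ((Fin n → Bool) → ℂ)
  | [], f => f
  | c :: B, f => braidUnitary u k B (pathGate u (crossingTurn k c.pos - 1) c f)

/-- The local vectors are zero or unit vectors. -/
def IsUnitFamily (u : ℤ → Bool → ℝ) : Prop :=
  ∀ z, (∀ b, u z b = 0) ∨ u z true ^ 2 + u z false ^ 2 = 1

theorem IsUnitFamily.abs_le_one {u : ℤ → Bool → ℝ} (hu : IsUnitFamily u) (z : ℤ) (b : Bool) :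
    |u z b| ≤ 1 := by
  rcases hu z with h | h
  · rw [h]; simp
  · rw [abs_le_one_iff_mul_self_le_one]
    cases b <;> nlinarith [sq_nonneg (u z true), sq_nonneg (u z false)]

theorem sum_flipPath (c : Crossing n) (F : (Fin n → Bool) → ℝ) :
    ∑ p, F (flipPath c p) = ∑ p, F p :=
  Equiv.sum_comp (Function.Involutive.toPerm (flipPath c) (flipPath_flipPath c)) F

/-- For a unit vector v the matrix 1 + wvvᵀ is normal with eigenvalues 1 and 1 + w, so it preserves
the norm when |1 + w| = 1. -/
theorem two_level_norm {a b : ℝ} {w f g : ℂ} (hab : a ^ 2 + b ^ 2 = 1) (hw : ‖1 + w‖ = 1) :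
    ‖f + w * (a * (a * f + b * g))‖ ^ 2 + ‖g + w * (b * (b * g + a * f))‖ ^ 2 =
      ‖f‖ ^ 2 + ‖g‖ ^ 2 := by
  have hw' : ‖1 + w‖ ^ 2 = 1 := by rw [hw]; norm_num
  simp only [Complex.sq_norm, Complex.normSq_apply, Complex.add_re, Complex.add_im, Complex.mul_re,
    Complex.mul_im, Complex.ofReal_re, Complex.ofReal_im, Complex.one_re, Complex.one_im] at hw' ⊢
  linear_combination ((a * f.re + b * g.re) ^ 2 + (a * f.im + b * g.im) ^ 2) * hw' +
    (w.re ^ 2 + w.im ^ 2) * ((a * f.re + b * g.re) ^ 2 + (a * f.im + b * g.im) ^ 2) * hab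

/-- Walks are paired by exchanging the two steps. On each pair the operator is trivial or a
two-level unitary, and adding the identity for pairs over all walks counts everything twice on both
sides. -/
theorem l2_pathGate {u : ℤ → Bool → ℝ} (hu : IsUnitFamily u) {w : ℂ} (hw : ‖1 + w‖ = 1)
    (c : Crossing n) (f : (Fin n → Bool) → ℂ) : l2 (pathGate u w c f) = l2 f := by
  rw [← sq_eq_sq₀ (l2_nonneg _) (l2_nonneg _), l2_sq, l2_sq]
  have key : ∀ p, ‖pathGate u w c f p‖ ^ 2 + ‖pathGate u w c f (flipPath c p)‖ ^ 2 =
      ‖f p‖ ^ 2 + ‖f (flipPath c p)‖ ^ 2 := by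
    intro p
    simp only [pathGate, Pi.add_apply, Pi.smul_apply, smul_eq_mul, localOp, flipPath_left,
      flipPath_right, flipPath_flipPath]
    rw [siteAfter_flipPath c p (j := c.left.val) (by change c.i ≠ c.i + 1; omega)]
    by_cases hp : p c.left = p c.right
    · rw [if_pos hp, if_pos hp.symm]; simp
    · rw [if_neg hp, if_neg (Ne.symm hp)]
      rcases hu (siteAfter p c.left.val) with h | h
      · simp [h]
      · refine two_level_norm ?_ hw
        revert hp
        cases p c.left <;> cases p c.right <;> simp
        · linarith
        · linarith
  have h1 := sum_flipPath c fun p => ‖pathGate u w c f p‖ ^ 2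
  have h2 := sum_flipPath c fun p => ‖f p‖ ^ 2
  have h3 := Finset.sum_congr rfl fun p (_ : p ∈ Finset.univ) => key p
  rw [Finset.sum_add_distrib, Finset.sum_add_distrib, h1, h2] at h3
  linarith

theorem norm_crossingTurn (k : ℕ) (b : Bool) : ‖1 + (crossingTurn k b - 1)‖ = 1 := by
  rw [add_sub_cancel]; exact norm_turn _ _

theorem norm_crossingTurn_sub_one (k : ℕ) (b : Bool) : ‖crossingTurn k b - 1‖ ≤ 2 := by
  refine (norm_sub_le _ _).trans ?_
  rw [show ‖crossingTurn k b‖ = 1 from norm_turn _ _]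
  norm_num

theorem l2_braidUnitary {u : ℤ → Bool → ℝ} (hu : IsUnitFamily u) (k : ℕ) (B : BraidWord n)
    (f : (Fin n → Bool) → ℂ) : l2 (braidUnitary u k B f) = l2 f := by
  induction B generalizing f with
  | nil => rfl
  | cons c B ih => rw [braidUnitary, ih, l2_pathGate hu (norm_crossingTurn k _)]

theorem pathGate_sub (u : ℤ → Bool → ℝ) (w : ℂ) (c : Crossing n) (f g : (Fin n → Bool) → ℂ) :
    pathGate u w c (f - g) = pathGate u w c f - pathGate u w c g := by
  have : f - g = f + (-1 : ℂ) • g := by rw [neg_one_smul, sub_eq_add_neg]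
  rw [this, pathGate, pathGate, pathGate, localOp_add, localOp_smul]
  module

theorem braidUnitary_sub (u : ℤ → Bool → ℝ) (k : ℕ) (B : BraidWord n)
    (f g : (Fin n → Bool) → ℂ) :
    braidUnitary u k B (f - g) = braidUnitary u k B f - braidUnitary u k B g := by
  induction B generalizing f g with
  | nil => rfl
  | cons c B ih => rw [braidUnitary, pathGate_sub, ih, braidUnitary, braidUnitary]

theorem abs_mul_sub_mul_le {a b a' b' e : ℝ} (ha : |a| ≤ 1) (hb' : |b'| ≤ 1) (h1 : |a - a'| ≤ e)
    (h2 : |b - b'| ≤ e) : |a * b - a' * b'| ≤ 2 * e := by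
  have h0 : 0 ≤ e := (abs_nonneg _).trans h1
  rw [show a * b - a' * b' = a * (b - b') + (a - a') * b' by ring]
  refine (abs_add_le _ _).trans ?_
  rw [abs_mul, abs_mul]
  nlinarith [abs_nonneg a, abs_nonneg b', abs_nonneg (a - a'), abs_nonneg (b - b'),
    mul_le_mul ha h2 (abs_nonneg _) zero_le_one, mul_le_mul h1 hb' (abs_nonneg _) h0]

/-- Entries of the rank one blocks differ by at most 2e, which |w| ≤ 2 turns into 4e. A row has two
entries and every walk occurs in two rows, which costs a factor 4 for squares, that is 2 for norms.
-/
theorem l2_pathGate_sub_le {u v : ℤ → Bool → ℝ} (hu : IsUnitFamily u) (hv : IsUnitFamily v) {e : ℝ}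
    (he : ∀ z b, |u z b - v z b| ≤ e) {w : ℂ} (hw : ‖w‖ ≤ 2) (c : Crossing n)
    (f : (Fin n → Bool) → ℂ) : l2 (pathGate u w c f - pathGate v w c f) ≤ 8 * e * l2 f := by
  have he0 : 0 ≤ e := (abs_nonneg _).trans (he 0 true)
  rw [← sq_le_sq₀ (l2_nonneg _) (mul_nonneg (by positivity) (l2_nonneg _)), l2_sq, mul_pow, l2_sq]
  have key : ∀ p, ‖(pathGate u w c f - pathGate v w c f) p‖ ^ 2 ≤
      (4 * e) ^ 2 * (2 * (‖f p‖ ^ 2 + ‖f (flipPath c p)‖ ^ 2)) := by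
    intro p
    have h1 : ‖(pathGate u w c f - pathGate v w c f) p‖ ≤
        (4 * e) * (‖f p‖ + ‖f (flipPath c p)‖) := by
      simp only [pathGate, Pi.sub_apply, Pi.add_apply, Pi.smul_apply, smul_eq_mul, localOp]
      split_ifs
      · simp; positivity
      · set a := siteAfter p c.left.val
        have e1 := abs_mul_sub_mul_le (hu.abs_le_one a (p c.left)) (hv.abs_le_one a (p c.left))
          (he a (p c.left)) (he a (p c.left))
        have e2 := abs_mul_sub_mul_le (hu.abs_le_one a (p c.left)) (hv.abs_le_one a (p c.right))
          (he a (p c.left)) (he a (p c.right))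
        have hx : f p + w * (↑(u a (p c.left)) * (↑(u a (p c.left)) * f p +
            ↑(u a (p c.right)) * f (flipPath c p))) - (f p + w * (↑(v a (p c.left)) *
            (↑(v a (p c.left)) * f p + ↑(v a (p c.right)) * f (flipPath c p)))) =
          w * (((u a (p c.left) * u a (p c.left) - v a (p c.left) * v a (p c.left) : ℝ) : ℂ) * f p +
            ((u a (p c.left) * u a (p c.right) - v a (p c.left) * v a (p c.right) : ℝ) : ℂ) *
              f (flipPath c p)) := by push_cast; ring
        rw [hx, norm_mul]
        have h3 : ‖((u a (p c.left) * u a (p c.left) - v a (p c.left) * v a (p c.left) : ℝ) : ℂ) *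
            f p + ((u a (p c.left) * u a (p c.right) - v a (p c.left) * v a (p c.right) : ℝ) : ℂ) *
              f (flipPath c p)‖ ≤ 2 * e * (‖f p‖ + ‖f (flipPath c p)‖) := by
          refine (norm_add_le _ _).trans ?_
          rw [norm_mul, norm_mul, Complex.norm_real, Complex.norm_real, mul_add]
          exact add_le_add (mul_le_mul_of_nonneg_right e1 (norm_nonneg _))
            (mul_le_mul_of_nonneg_right e2 (norm_nonneg _))
        calc _ ≤ 2 * (2 * e * (‖f p‖ + ‖f (flipPath c p)‖)) :=
              mul_le_mul hw h3 (norm_nonneg _) (by norm_num)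
          _ = _ := by ring
    calc _ ≤ ((4 * e) * (‖f p‖ + ‖f (flipPath c p)‖)) ^ 2 :=
          pow_le_pow_left₀ (norm_nonneg _) h1 2
      _ ≤ _ := by
        rw [mul_pow]
        refine mul_le_mul_of_nonneg_left ?_ (sq_nonneg _)
        nlinarith [sq_nonneg (‖f p‖ - ‖f (flipPath c p)‖)]
  refine (Finset.sum_le_sum fun p _ => key p).trans ?_
  rw [← Finset.mul_sum, ← Finset.mul_sum, Finset.sum_add_distrib,
    sum_flipPath c fun p => ‖f p‖ ^ 2]
  apply le_of_eq; ring

/-- Hybrid argument: the gates are replaced one at a time, and since all of them preserve the norm,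
the errors add up. -/
theorem l2_braidUnitary_sub_le {u v : ℤ → Bool → ℝ} (hu : IsUnitFamily u) (hv : IsUnitFamily v)
    {e : ℝ} (he : ∀ z b, |u z b - v z b| ≤ e) (k : ℕ) (B : BraidWord n)
    (f : (Fin n → Bool) → ℂ) :
    l2 (braidUnitary u k B f - braidUnitary v k B f) ≤ 8 * e * B.length * l2 f := by
  induction B generalizing f with
  | nil => simp [braidUnitary, l2]
  | cons c B ih =>
    rw [braidUnitary, braidUnitary]
    set w := crossingTurn k c.pos - 1
    have h1 : braidUnitary u k B (pathGate u w c f) - braidUnitary v k B (pathGate v w c f) =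
        (braidUnitary u k B (pathGate u w c f) - braidUnitary v k B (pathGate u w c f)) +
        braidUnitary v k B (pathGate u w c f - pathGate v w c f) := by
      rw [braidUnitary_sub]; abel
    rw [h1]
    refine (l2_add_le _ _).trans ?_
    rw [l2_braidUnitary hv]
    have h2 := ih (pathGate u w c f)
    rw [l2_pathGate hu (norm_crossingTurn k _)] at h2
    have h3 := l2_pathGate_sub_le hu hv he (norm_crossingTurn_sub_one k c.pos) c f
    rw [List.length_cons]
    push_cast
    linarith

/-- The normalized local vectors. -/
noncomputable def unitVec (k : ℕ) (z : ℤ) (b : Bool) : ℝ := tlVec k z b / Real.sqrt (dReal k)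

theorem isUnitFamily_unitVec {k : ℕ} (hk : 3 ≤ k) : IsUnitFamily (unitVec k) := by
  intro z
  by_cases hz : 1 ≤ z ∧ z ≤ (k : ℤ) - 1
  · right
    have hd := dReal_pos hk
    simp only [unitVec]
    rw [div_pow, div_pow, ← add_div, tlVec_sq_add hz, Real.sq_sqrt hd.le, div_self hd.ne']
  · left
    intro b
    rw [unitVec, tlVec, stepWeight, if_neg hz, zero_div]

theorem localOp_tlVec {k : ℕ} (hk : 3 ≤ k) (c : Crossing n) (f : (Fin n → Bool) → ℂ) :
    localOp (tlVec k) c f = (dReal k : ℂ) • localOp (unitVec k) c f := by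
  have hd := dReal_pos hk
  have hs : Real.sqrt (dReal k) ≠ 0 := (Real.sqrt_pos.2 hd).ne'
  have he : ∀ z b, tlVec k z b = Real.sqrt (dReal k) * unitVec k z b := fun z b => by
    rw [unitVec]; field_simp
  funext p
  simp only [localOp, Pi.smul_apply, smul_eq_mul]
  split_ifs
  · simp
  · have h2 : (Real.sqrt (dReal k) : ℂ) * Real.sqrt (dReal k) = dReal k := by
      rw [← Complex.ofReal_mul, Real.mul_self_sqrt hd.le]
    simp only [he]
    push_cast
    rw [← h2]; ring

/-! ### Phases of the crossings and of the writhe factor -/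

theorem turn_mul (a a' b : ℕ) : turn a b * turn a' b = turn (a + a') b := by
  rw [turn, turn, turn, ← Complex.exp_add]
  congr 1; push_cast; ring

theorem rootA_eq_turn {k : ℕ} (hk : 3 ≤ k) : rootA k = turn (k - 1) (4 * k) := by
  have hk' : (k : ℂ) ≠ 0 := by exact_mod_cast (by omega : k ≠ 0)
  have h : rootA k = Complex.exp (Real.pi / 2 * Complex.I) *
      Complex.exp (-(Real.pi * Complex.I / (2 * k))) := by
    rw [Complex.exp_pi_div_two_mul_I, rootA]
  rw [h, ← Complex.exp_add, turn, Nat.cast_sub (by omega)]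
  congr 1
  push_cast
  field_simp
  ring

theorem rootA_ne_zero (k : ℕ) : rootA k ≠ 0 := by
  rw [rootA]; exact mul_ne_zero Complex.I_ne_zero (Complex.exp_ne_zero _)

theorem turn_self {b : ℕ} (hb : b ≠ 0) : turn b b = 1 := by
  have hb' : (b : ℂ) ≠ 0 := by exact_mod_cast hb
  rw [turn, div_self hb', mul_one]
  exact Complex.exp_two_pi_mul_I

theorem turn_mul_mul {r a b : ℕ} (hr : r ≠ 0) : turn (r * a) (r * b) = turn a b := by
  have hr' : (r : ℂ) ≠ 0 := by exact_mod_cast hr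
  rw [turn, turn]
  congr 2
  push_cast
  exact mul_div_mul_left _ _ hr'

theorem turn_pow (a b e : ℕ) : turn a b ^ e = turn (e * a) b := by
  rw [turn, turn, ← Complex.exp_nat_mul]
  congr 1; push_cast; ring

theorem rootA_inv {k : ℕ} (hk : 3 ≤ k) : (rootA k)⁻¹ = turn (3 * k + 1) (4 * k) := by
  refine inv_eq_of_mul_eq_one_left ?_
  rw [rootA_eq_turn hk, turn_mul, show 3 * k + 1 + (k - 1) = 4 * k by omega, turn_self (by omega)]

theorem turn_half {k : ℕ} (hk : k ≠ 0) : turn (2 * k) (4 * k) = -1 := by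
  rw [mul_comm 2, mul_comm 4, turn_mul_mul hk, show 2 = 2 * 1 from rfl, show 4 = 2 * 2 from rfl,
    turn_mul_mul (by norm_num), turn_one_two]

theorem turn_add_self {a b : ℕ} (hb : b ≠ 0) : turn (a + b) b = turn a b := by
  rw [← turn_mul, turn_self hb, mul_one]

theorem neg_rootA_pow_four {k : ℕ} (hk : 3 ≤ k) : -(rootA k) ^ 4 = crossingTurn k true := by
  rw [rootA_eq_turn hk, turn_pow, neg_eq_neg_one_mul, ← turn_half (by omega : k ≠ 0), turn_mul,
    crossingTurn, if_pos rfl]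
  rw [show 4 * k = 2 * (2 * k) by ring, show 2 * k + 4 * (k - 1) = 2 * (k - 2 + 2 * k) by omega,
    turn_mul_mul (by norm_num), turn_add_self (by omega)]

theorem neg_rootA_inv_pow_four {k : ℕ} (hk : 3 ≤ k) : -((rootA k)⁻¹) ^ 4 = crossingTurn k false := by
  rw [rootA_inv hk, turn_pow, neg_eq_neg_one_mul, ← turn_half (by omega : k ≠ 0), turn_mul,
    crossingTurn, if_neg (by simp)]
  rw [show 4 * k = 2 * (2 * k) by ring,
    show 2 * k + 4 * (3 * k + 1) = 2 * (k + 2 + 2 * k + 2 * k + 2 * k) by omega,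
    turn_mul_mul (by norm_num), turn_add_self (by omega), turn_add_self (by omega),
    turn_add_self (by omega)]

/-- The phase of a crossing in multiples of `2π / (4k)`. -/
def crossingPhase (k : ℕ) (pos : Bool) : ℕ := if pos then 3 * k + 1 else k - 1

/-- For a positive crossing the unit factor is A⁻¹, and A²d = −A⁴ − 1 is ω − 1 with ω = −A⁴. For a
negative crossing A and A⁻¹ change places. -/
theorem crossingOp_eq {k : ℕ} (hk : 3 ≤ k) (c : Crossing n) (f : (Fin n → Bool) → ℂ) :
    crossingOp (rootA k) k c f = turn (crossingPhase k c.pos) (4 * k) •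
      pathGate (unitVec k) (crossingTurn k c.pos - 1) c f := by
  have hA := rootA_ne_zero k
  have hd : (dReal k : ℂ) = -(rootA k) ^ 2 - (rootA k)⁻¹ ^ 2 := by rw [← loopValue_rootA]; rfl
  rw [crossingOp, localOp_tlVec hk, pathGate, hd, crossingPhase]
  cases c.pos
  · simp only [crossingFactor, Bool.false_eq_true, if_false, if_true]
    rw [← neg_rootA_inv_pow_four hk, ← rootA_eq_turn hk, smul_add, smul_smul, smul_smul, add_comm]
    congr 2
    field_simp
    ring
  · simp only [crossingFactor, Bool.true_eq_false, if_false, if_true]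
    rw [← neg_rootA_pow_four hk, ← rootA_inv hk, smul_add, smul_smul, smul_smul, add_comm]
    congr 2
    field_simp

/-- The phase of the writhe factor of a crossing in multiples of `2π / (4k)`. -/
def signPhase (k : ℕ) (same : Bool) : ℕ := if same then 9 * k - 3 else 3 * k + 3

/-- The total phase of an oriented braid in multiples of `2π / (4k)`. -/
def braidPhase (k : ℕ) : BraidWord n → (Fin n → Bool) → ℕ
  | [], _ => 0
  | c :: B, o => crossingPhase k c.pos + signPhase k (c.pos == (o c.left == o c.right)) +
      braidPhase k B (c.push o)

theorem pathGate_smul (u : ℤ → Bool → ℝ) (w : ℂ) (c : Crossing n) (a : ℂ)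
    (f : (Fin n → Bool) → ℂ) : pathGate u w c (a • f) = a • pathGate u w c f := by
  rw [pathGate, pathGate, localOp_smul]
  module

theorem braidUnitary_smul (u : ℤ → Bool → ℝ) (k : ℕ) (B : BraidWord n) (a : ℂ)
    (f : (Fin n → Bool) → ℂ) : braidUnitary u k B (a • f) = a • braidUnitary u k B f := by
  induction B generalizing f with
  | nil => rfl
  | cons c B ih => rw [braidUnitary, pathGate_smul, ih, braidUnitary]

/-- Numerators of angles are natural numbers, so (−A)⁻³ is written as 3k + 3 parts of a turn in 4k
rather than as a negative angle. -/
theorem neg_rootA_zpow {k : ℕ} (hk : 3 ≤ k) (c : Crossing n) (o : Fin n → Bool) :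
    (-rootA k) ^ (3 * c.sign o) =
      turn (signPhase k (c.pos == (o c.left == o c.right))) (4 * k) := by
  have h1 : -rootA k = turn (3 * k - 1) (4 * k) := by
    rw [rootA_eq_turn hk, neg_eq_neg_one_mul, ← turn_half (by omega : k ≠ 0), turn_mul]
    congr 1; omega
  have h2 : (-rootA k)⁻¹ = turn (k + 1) (4 * k) := by
    refine inv_eq_of_mul_eq_one_left ?_
    rw [h1, turn_mul, show k + 1 + (3 * k - 1) = 4 * k by omega, turn_self (by omega)]
  have hp : (-rootA k) ^ (3 : ℤ) = turn (9 * k - 3) (4 * k) := by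
    rw [show (3 : ℤ) = ((3 : ℕ) : ℤ) from rfl, zpow_natCast, h1, turn_pow]
    congr 1; omega
  have hm : (-rootA k) ^ (-3 : ℤ) = turn (3 * k + 3) (4 * k) := by
    rw [show (-3 : ℤ) = -((3 : ℕ) : ℤ) from rfl, zpow_neg, zpow_natCast, ← inv_pow, h2, turn_pow]
    congr 1
  unfold Crossing.sign signPhase
  cases c.pos <;> cases o c.left <;> cases o c.right <;> simp [hp, hm]

theorem jonesPlat_eq_aux {k : ℕ} (hk : 3 ≤ k) (B : BraidWord n) (o : Fin n → Bool)
    (f : (Fin n → Bool) → ℂ) :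
    (-rootA k) ^ (3 * writhe B o) • braidOp (rootA k) k B f =
      turn (braidPhase k B o) (4 * k) • braidUnitary (unitVec k) k B f := by
  have hA : -rootA k ≠ 0 := neg_ne_zero.2 (rootA_ne_zero k)
  induction B generalizing o f with
  | nil => simp [writhe, braidOp, braidUnitary, braidPhase, turn]
  | cons c B ih =>
    rw [writhe, braidOp, braidUnitary, braidPhase, mul_add, zpow_add₀ hA, mul_smul, ih,
      crossingOp_eq hk, braidUnitary_smul, smul_smul, smul_smul, neg_rootA_zpow hk, turn_mul,
      turn_mul]
    congr 2
    omega

/-- The unit factors of the writhe and of the crossings are collected into a single phase. What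
remains besides d^{n/2−1} is a matrix element of a norm preserving operator. -/
theorem jonesPlat_eq {k : ℕ} (hk : 3 ≤ k) (hn : Even n) (hn0 : 0 < n) (B : BraidWord n)
    (o : Fin n → Bool) : jonesPlat B o (rootA k) = (dReal k : ℂ) ^ (n / 2 - 1) *
      (turn (braidPhase k B o) (4 * k) *
        braidUnitary (unitVec k) k B (Pi.single (altPath n) 1) (altPath n)) := by
  rw [jonesPlat, platBracket_eq hk hn hn0]
  have := congrFun (jonesPlat_eq_aux hk B o (Pi.single (altPath n) 1)) (altPath n)
  simp only [Pi.smul_apply, smul_eq_mul] at this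
  rw [← this]; ring

end


/-! ## Numerical computation of sines -/

/-- Partial products of the product formula for `sin (π x)`. -/
noncomputable def sinProd (J : ℕ) (x : ℝ) : ℝ :=
  Real.pi * x * ∏ j ∈ Finset.range J, (1 - x ^ 2 / ((j : ℝ) + 1) ^ 2)

theorem sinProd_factor {x : ℝ} (h0 : 0 ≤ x) (h1 : x ≤ 1) (j : ℕ) :
    1 - 1 / ((j : ℝ) + 1) ^ 2 ≤ 1 - x ^ 2 / ((j : ℝ) + 1) ^ 2 ∧
      1 - x ^ 2 / ((j : ℝ) + 1) ^ 2 ≤ 1 ∧ 0 ≤ 1 - 1 / ((j : ℝ) + 1) ^ 2 := by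
  have hx : x ^ 2 ≤ 1 := by nlinarith
  have hj : (1 : ℝ) ≤ ((j : ℝ) + 1) ^ 2 := by
    have : (0 : ℝ) ≤ j := Nat.cast_nonneg j
    nlinarith
  refine ⟨?_, ?_, ?_⟩
  · have := div_le_div_of_nonneg_right hx (by linarith : 0 ≤ ((j : ℝ) + 1) ^ 2)
    linarith
  · have : 0 ≤ x ^ 2 / ((j : ℝ) + 1) ^ 2 := by positivity
    linarith
  · have : 1 / ((j : ℝ) + 1) ^ 2 ≤ 1 := by rw [div_le_one (by linarith)]; exact hj
    linarith

theorem sinProd_nonneg (J : ℕ) {x : ℝ} (h0 : 0 ≤ x) (h1 : x ≤ 1) : 0 ≤ sinProd J x := by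
  refine mul_nonneg (mul_nonneg Real.pi_pos.le h0) (Finset.prod_nonneg fun j _ => ?_)
  have := sinProd_factor h0 h1 j
  linarith

theorem sinProd_succ (J : ℕ) (x : ℝ) :
    sinProd (J + 1) x = sinProd J x * (1 - x ^ 2 / ((J : ℝ) + 1) ^ 2) := by
  rw [sinProd, sinProd, Finset.prod_range_succ]; ring

theorem tendsto_sinProd (x : ℝ) :
    Filter.Tendsto (fun J => sinProd J x) Filter.atTop (nhds (Real.sin (Real.pi * x))) :=
  Real.tendsto_euler_sin_prod x

/-- All factors of the Euler product lie in [0, 1], so the partial products decrease to the sine. -/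
theorem sin_le_sinProd (J : ℕ) {x : ℝ} (h0 : 0 ≤ x) (h1 : x ≤ 1) :
    Real.sin (Real.pi * x) ≤ sinProd J x := by
  have hanti : Antitone fun J => sinProd J x := antitone_nat_of_succ_le fun J => by
    rw [sinProd_succ]
    exact mul_le_of_le_one_right (sinProd_nonneg J h0 h1) (sinProd_factor h0 h1 J).2.1
  exact hanti.le_of_tendsto (tendsto_sinProd x) J

/-- Each omitted factor is at least 1 − 1/(j+1)², independently of x, and the product of these
bounds telescopes. -/
theorem sinProd_le {J : ℕ} (hJ : 0 < J) {x : ℝ} (h0 : 0 ≤ x) (h1 : x ≤ 1) :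
    sinProd J x ≤ (1 + 1 / J) * Real.sin (Real.pi * x) := by
  have hJ' : (0 : ℝ) < J := by exact_mod_cast hJ
  -- The product of 1 − 1/i² over J < i ≤ J + K is J/(J+1) · (1 + 1/(J+K)).
  have key : ∀ K, sinProd J x * (J / (J + 1) * (1 + 1 / ((J + K : ℕ) : ℝ))) ≤ sinProd (J + K) x := by
    intro K
    induction K with
    | zero =>
      have : (J : ℝ) / (J + 1) * (1 + 1 / ((J + 0 : ℕ) : ℝ)) = 1 := by
        push_cast; rw [add_zero]; field_simp
      rw [this, mul_one]; rfl
    | succ K ih =>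
      rw [← add_assoc, sinProd_succ]
      have hf := sinProd_factor h0 h1 (J + K)
      refine le_trans ?_ (mul_le_mul_of_nonneg_left hf.1 (sinProd_nonneg _ h0 h1))
      refine le_trans ?_ (mul_le_mul_of_nonneg_right ih hf.2.2)
      apply le_of_eq
      have : (0 : ℝ) ≤ K := Nat.cast_nonneg K
      push_cast
      field_simp
      ring
  have h2 : ∀ K, sinProd J x * (J / (J + 1)) ≤ sinProd (J + K) x := fun K => by
    refine le_trans ?_ (key K)
    refine mul_le_mul_of_nonneg_left ?_ (sinProd_nonneg J h0 h1)
    exact le_mul_of_one_le_right (by positivity) (le_add_of_nonneg_right (by positivity))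
  have h3 : sinProd J x * (J / (J + 1)) ≤ Real.sin (Real.pi * x) := by
    refine ge_of_tendsto (tendsto_sinProd x) ?_
    filter_upwards [Filter.eventually_ge_atTop J] with K hK
    obtain ⟨i, rfl⟩ := Nat.exists_eq_add_of_le hK
    exact h2 i
  calc sinProd J x = (1 + 1 / J) * (sinProd J x * (J / (J + 1))) := by field_simp
    _ ≤ _ := mul_le_mul_of_nonneg_left h3 (by positivity)

/-- The integers whose quotients approximate quotients of sines. -/
def sineTable (b J a : ℕ) : ℕ := a * ∏ j ∈ Finset.range J, ((j + 1) * (j + 1) * (b * b) - a * a)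

/-- The common factor of the table entries. -/
noncomputable def sineScale (b J : ℕ) : ℝ :=
  b / Real.pi * ∏ j ∈ Finset.range J, ((j : ℝ) + 1) ^ 2 * (b : ℝ) ^ 2

theorem sineScale_pos {b : ℕ} (hb : 0 < b) (J : ℕ) : 0 < sineScale b J := by
  have hb' : (0 : ℝ) < b := by exact_mod_cast hb
  exact mul_pos (div_pos hb' Real.pi_pos) (Finset.prod_pos fun j _ => by positivity)

/-- Clearing denominators in the Euler product leaves integers; π and the denominators form a factor
that does not depend on `a`. Quotients of entries thus approximate quotients of sines without
knowledge of π. For a ≤ b the truncated subtraction is exact. -/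
theorem sineTable_cast {b J a : ℕ} (hb : 0 < b) (ha : a ≤ b) :
    (sineTable b J a : ℝ) = sineScale b J * sinProd J (a / b) := by
  have hb' : (b : ℝ) ≠ 0 := by exact_mod_cast hb.ne'
  have h : ∀ j : ℕ, (((j + 1) * (j + 1) * (b * b) - a * a : ℕ) : ℝ) =
      (((j : ℝ) + 1) ^ 2 * (b : ℝ) ^ 2) * (1 - ((a : ℝ) / b) ^ 2 / ((j : ℝ) + 1) ^ 2) := by
    intro j
    have h1 : a * a ≤ (j + 1) * (j + 1) * (b * b) := by
      have : a * a ≤ b * b := Nat.mul_le_mul ha ha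
      nlinarith [Nat.zero_le (j * b * b), Nat.zero_le (j * j * (b * b)), Nat.zero_le (j * (b * b))]
    have hj : (j : ℝ) + 1 ≠ 0 := by positivity
    rw [Nat.cast_sub h1]
    push_cast
    field_simp
  rw [sineTable, sineScale, sinProd]
  push_cast
  simp only [h, Finset.prod_mul_distrib]
  have := Real.pi_ne_zero
  field_simp

theorem sineTable_bounds {b J a : ℕ} (hb : 0 < b) (hJ : 0 < J) (ha : a ≤ b) :
    sineScale b J * Real.sin (Real.pi * a / b) ≤ sineTable b J a ∧
      (sineTable b J a : ℝ) ≤ (1 + 1 / J) * (sineScale b J * Real.sin (Real.pi * a / b)) := by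
  have hb' : (0 : ℝ) < b := by exact_mod_cast hb
  have h0 : (0 : ℝ) ≤ a / b := by positivity
  have h1 : (a : ℝ) / b ≤ 1 := by rw [div_le_one hb']; exact_mod_cast ha
  have hs := sineScale_pos hb J
  rw [sineTable_cast hb ha, mul_div_assoc]
  refine ⟨mul_le_mul_of_nonneg_left (sin_le_sinProd J h0 h1) hs.le, ?_⟩
  calc _ ≤ sineScale b J * ((1 + 1 / J) * Real.sin (Real.pi * (a / b))) :=
        mul_le_mul_of_nonneg_left (sinProd_le hJ h0 h1) hs.le
    _ = _ := by ring

/-- The result of a linear search: one more than the last `a < N` that satisfies `P`. -/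
def lastTrue (P : ℕ → Bool) : ℕ → ℕ
  | 0 => 0
  | N + 1 => if P N then N + 1 else lastTrue P N

theorem lastTrue_le (P : ℕ → Bool) (N : ℕ) : lastTrue P N ≤ N := by
  induction N with
  | zero => exact le_rfl
  | succ N ih => rw [lastTrue]; split_ifs <;> omega

theorem lastTrue_pred {P : ℕ → Bool} {N a : ℕ} (h : lastTrue P N = a + 1) : P a = true := by
  induction N with
  | zero => simp [lastTrue] at h
  | succ N ih =>
    rw [lastTrue] at h
    split_ifs at h with hP
    · rwa [show a = N by omega]
    · exact ih h

theorem lastTrue_not {P : ℕ → Bool} {N : ℕ} (h : lastTrue P N < N) :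
    P (lastTrue P N) = false := by
  induction N with
  | zero => omega
  | succ N ih =>
    rw [lastTrue] at h ⊢
    split_ifs at h ⊢ with hP
    · omega
    · rcases (lastTrue_le P N).lt_or_eq with h' | h'
      · exact ih h'
      · rw [h']; simpa using hP

/-- The test in the search for the rotation angle at site `z`. -/
def angleTest (F : ℕ → ℕ) (k X z a : ℕ) : Bool :=
  decide (F (2 * k * a) * F (2 * k * a) * F (4 * X) * F (2 * X * z) <
    F (2 * X) * F (2 * X * (z - 1)) * F (k * X) * F (k * X))

/-- The rotation angle at site `z`, in multiples of `π / X`. -/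
def angleNum (k X z : ℕ) : ℕ := lastTrue (angleTest (sineTable (2 * k * X) X) k X z) (X / 2)

theorem angleNum_le (k X z : ℕ) : angleNum k X z ≤ X / 2 := lastTrue_le _ _

/-! ### Accuracy of the rotation angles -/

theorem abs_sin_sq_sub_sin_sq_le (x y : ℝ) : |Real.sin x ^ 2 - Real.sin y ^ 2| ≤ |x - y| := by
  have h : Real.sin x ^ 2 - Real.sin y ^ 2 = Real.sin (x - y) * Real.sin (x + y) := by
    rw [Real.sin_sub, Real.sin_add]
    have h1 := Real.sin_sq_add_cos_sq x
    have h2 := Real.sin_sq_add_cos_sq y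
    linear_combination Real.sin y ^ 2 * h1 - Real.sin x ^ 2 * h2
  rw [h, abs_mul]
  calc _ ≤ |x - y| * 1 := mul_le_mul Real.abs_sin_le_abs (Real.abs_sin_le_one _) (abs_nonneg _)
        (abs_nonneg _)
    _ = _ := mul_one _

-- The test compares sin²(πa/X) λ_2 λ_z with λ_1 λ_{z−1}. The entry at kX, for sin(π/2) = 1, makes
-- both sides of degree four in the table, so that the common scale cancels. As λ_2 = dλ_1, the test
-- locates sin² relative to λ_{z−1}/(dλ_z) up to a factor (1 + 1/X)⁴. The test need not be monotone
-- in `a`: it is enough that it fails at the result and holds just before it, with separate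
-- arguments at the two ends of the range.
set_option maxHeartbeats 800000 in
theorem angleNum_spec {k X z : ℕ} (hk : 3 ≤ k) (hX : 0 < X) (hX2 : Even X) (hz : 1 ≤ z)
    (hzk : z < k) : |Real.sin (Real.pi * angleNum k X z / X) ^ 2 -
      lam k (z - 1) / (dReal k * lam k z)| ≤ 20 / X := by
  have hX' : (0 : ℝ) < X := by exact_mod_cast hX
  have hX1 : (1 : ℝ) ≤ X := by exact_mod_cast hX
  have hk' : (0 : ℝ) < k := by exact_mod_cast (by omega : 0 < k)
  have hd := dReal_pos hk
  set b := 2 * k * X with hb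
  have hb0 : 0 < b := by positivity
  have hC := sineScale_pos hb0 X
  set C := sineScale b X
  set F := sineTable b X
  set ρ : ℝ := 1 + 1 / X with hρ
  have hρ1 : 1 ≤ ρ := by rw [hρ]; exact le_add_of_nonneg_right (by positivity)
  have hlz : 0 < lam k z := lam_pos (by exact_mod_cast hz) (by omega)
  have hl1 : 0 < lam k 1 := lam_pos le_rfl (by omega)
  have hl2 : lam k 2 = dReal k * lam k 1 := by
    have := lam_add_lam k 1
    norm_num at this
    rw [lam_zero, add_zero] at this
    exact this
  have hlm : 0 ≤ lam k (z - 1) := lam_nonneg (by omega) (by omega)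
  have hlp : 0 ≤ lam k (z + 1) := lam_nonneg (by omega) (by omega)
  set τ := lam k (z - 1) / (dReal k * lam k z) with hτ
  have hτ0 : 0 ≤ τ := by positivity
  have hτ1 : τ ≤ 1 := by
    rw [hτ, div_le_one (by positivity), ← lam_add_lam]; linarith
  have hτe : lam k (z - 1) = τ * (dReal k * lam k z) := by rw [hτ]; field_simp
  have bound : ∀ a : ℕ, a ≤ b → ∀ y : ℝ, Real.sin (Real.pi * a / b) = y →
      C * y ≤ F a ∧ (F a : ℝ) ≤ ρ * (C * y) := fun a ha y hy => by
    have := sineTable_bounds (J := X) hb0 hX ha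
    rwa [hy] at this
  have bl : ∀ z' : ℕ, z' ≤ k → C * lam k z' ≤ F (2 * X * z') ∧
      (F (2 * X * z') : ℝ) ≤ ρ * (C * lam k z') := fun z' hz' =>
    bound _ (by rw [hb]; nlinarith) _ (by
      rw [lam, hb]; congr 1; push_cast; field_simp)
  have b1 : C * lam k 1 ≤ F (2 * X) ∧ (F (2 * X) : ℝ) ≤ ρ * (C * lam k 1) := by
    have := bl 1 (by omega); simpa using this
  have b2 : C * lam k 2 ≤ F (4 * X) ∧ (F (4 * X) : ℝ) ≤ ρ * (C * lam k 2) := by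
    have := bl 2 (by omega)
    rw [show 2 * X * 2 = 4 * X by ring] at this
    simpa using this
  have bz := bl z hzk.le
  have bm : C * lam k (z - 1) ≤ F (2 * X * (z - 1)) ∧
      (F (2 * X * (z - 1)) : ℝ) ≤ ρ * (C * lam k (z - 1)) := by
    have := bl (z - 1) (by omega)
    rwa [Nat.cast_sub hz, Nat.cast_one] at this
  have bh : C * 1 ≤ F (k * X) ∧ (F (k * X) : ℝ) ≤ ρ * (C * 1) := by
    refine bound _ (by rw [hb]; nlinarith) _ ?_
    rw [hb, ← Real.sin_pi_div_two]; congr 1; push_cast; field_simp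
  have ba : ∀ a : ℕ, a ≤ X / 2 → C * Real.sin (Real.pi * a / X) ≤ F (2 * k * a) ∧
      (F (2 * k * a) : ℝ) ≤ ρ * (C * Real.sin (Real.pi * a / X)) := fun a ha => by
    refine bound _ (by rw [hb]; exact Nat.mul_le_mul_left _ (by omega)) _ ?_
    rw [hb]; congr 1; push_cast; field_simp
  have hsin : ∀ a : ℕ, a ≤ X / 2 → 0 ≤ Real.sin (Real.pi * a / X) := fun a ha => by
    have h1 : (a : ℝ) ≤ X := by exact_mod_cast (by omega : a ≤ X)
    refine Real.sin_nonneg_of_nonneg_of_le_pi (by positivity) ?_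
    rw [div_le_iff₀ hX']; exact mul_le_mul_of_nonneg_left h1 Real.pi_pos.le
  -- (1 + y)⁴ − 1 = 4y + 6y² + 4y³ + y⁴ ≤ 15y for 0 ≤ y ≤ 1.
  have hρ4 : ρ ^ 4 ≤ 1 + 15 / X := by
    have h1 : 1 / (X : ℝ) ≤ 1 := by rw [div_le_one hX']; exact hX1
    have h0 : 0 ≤ 1 / (X : ℝ) := by positivity
    rw [hρ, show (15 : ℝ) / X = 15 * (1 / X) by ring]
    set y := 1 / (X : ℝ)
    nlinarith [mul_nonneg h0 (sub_nonneg.2 h1), mul_nonneg (mul_nonneg h0 h0) (sub_nonneg.2 h1),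
      mul_nonneg (mul_nonneg (mul_nonneg h0 h0) h0) (sub_nonneg.2 h1)]
  have hdl : 0 < dReal k * lam k 1 * lam k z := by positivity
  have htrue : ∀ a : ℕ, a ≤ X / 2 → angleTest F k X z a = true →
      Real.sin (Real.pi * a / X) ^ 2 ≤ ρ ^ 4 * τ := by
    intro a ha ht
    have ht' := of_decide_eq_true ht
    have ht2 : (F (2 * k * a) : ℝ) * F (2 * k * a) * F (4 * X) * F (2 * X * z) ≤
        F (2 * X) * F (2 * X * (z - 1)) * F (k * X) * F (k * X) := by exact_mod_cast ht'.le
    set s := Real.sin (Real.pi * a / X)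
    have hs0 : 0 ≤ s := hsin a ha
    have l1 : (C * s) * (C * s) * (C * lam k 2) * (C * lam k z) ≤
        (F (2 * k * a) : ℝ) * F (2 * k * a) * F (4 * X) * F (2 * X * z) := by
      have p1 := (ba a ha).1
      have : 0 ≤ lam k 2 := by rw [hl2]; positivity
      gcongr
      · exact b2.1
      · exact bz.1
    have l2 : (F (2 * X) : ℝ) * F (2 * X * (z - 1)) * F (k * X) * F (k * X) ≤
        (ρ * (C * lam k 1)) * (ρ * (C * lam k (z - 1))) * (ρ * (C * 1)) * (ρ * (C * 1)) := by
      gcongr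
      · exact b1.2
      · exact bm.2
      · exact bh.2
      · exact bh.2
    have l3 := l1.trans (ht2.trans l2)
    rw [hτe, hl2] at l3
    have l4 : s ^ 2 * (C ^ 4 * (dReal k * lam k 1 * lam k z)) ≤
        ρ ^ 4 * τ * (C ^ 4 * (dReal k * lam k 1 * lam k z)) := by linarith
    exact le_of_mul_le_mul_right l4 (by positivity)
  have hfalse : ∀ a : ℕ, a ≤ X / 2 → angleTest F k X z a = false →
      τ ≤ ρ ^ 4 * Real.sin (Real.pi * a / X) ^ 2 := by
    intro a ha ht
    have ht' := not_lt.1 (of_decide_eq_false ht)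
    have ht2 : (F (2 * X) : ℝ) * F (2 * X * (z - 1)) * F (k * X) * F (k * X) ≤
        F (2 * k * a) * F (2 * k * a) * F (4 * X) * F (2 * X * z) := by exact_mod_cast ht'
    set s := Real.sin (Real.pi * a / X)
    have hs0 : 0 ≤ s := hsin a ha
    have l1 : (F (2 * k * a) : ℝ) * F (2 * k * a) * F (4 * X) * F (2 * X * z) ≤
        (ρ * (C * s)) * (ρ * (C * s)) * (ρ * (C * lam k 2)) * (ρ * (C * lam k z)) := by
      have p1 := (ba a ha).2
      have : 0 ≤ lam k 2 := by rw [hl2]; positivity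
      gcongr
      · exact b2.2
      · exact bz.2
    have l2 : (C * lam k 1) * (C * lam k (z - 1)) * (C * 1) * (C * 1) ≤
        (F (2 * X) : ℝ) * F (2 * X * (z - 1)) * F (k * X) * F (k * X) := by
      gcongr
      · exact b1.1
      · exact bm.1
      · exact bh.1
      · exact bh.1
    have l3 := l2.trans (ht2.trans l1)
    rw [hτe, hl2] at l3
    have l4 : τ * (C ^ 4 * (dReal k * lam k 1 * lam k z)) ≤
        ρ ^ 4 * s ^ 2 * (C ^ 4 * (dReal k * lam k 1 * lam k z)) := by linarith
    exact le_of_mul_le_mul_right l4 (by positivity)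
  have hA : angleNum k X z = lastTrue (angleTest F k X z) (X / 2) := rfl
  set A := angleNum k X z
  have hAle : A ≤ X / 2 := angleNum_le k X z
  have hs1 : Real.sin (Real.pi * A / X) ^ 2 ≤ 1 := Real.sin_sq_le_one _
  have hlow : τ - 15 / X ≤ Real.sin (Real.pi * A / X) ^ 2 := by
    have hp : 0 ≤ 15 / (X : ℝ) := by positivity
    rcases hAle.lt_or_eq with h | h
    · have h1 := hfalse A hAle (by rw [hA]; exact lastTrue_not (by rw [← hA]; exact h))
      have e1 := mul_le_mul_of_nonneg_right hρ4 (sq_nonneg (Real.sin (Real.pi * A / X)))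
      have e2 := mul_le_mul_of_nonneg_left hs1 hp
      linarith
    -- The search has reached the end of its range; as X is even, the angle is exactly π/2.
    · have : Real.sin (Real.pi * A / X) = 1 := by
        obtain ⟨r, hr⟩ := hX2
        have hAr : A = r := by omega
        have hXr : (X : ℝ) = 2 * A := by rw [hAr, hr]; push_cast; ring
        have hA0 : (A : ℝ) ≠ 0 := fun e => by rw [hXr, e] at hX'; simp at hX'
        rw [hXr, ← Real.sin_pi_div_two]; congr 1; field_simp
      rw [this]; linarith
  have hpi : Real.pi ≤ 4 := Real.pi_le_four
  -- One grid step changes sin² by at most π/X ≤ 4/X, and 15 + 4 ≤ 20.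
  have hup : Real.sin (Real.pi * A / X) ^ 2 ≤ τ + 20 / X := by
    rcases Nat.eq_zero_or_pos A with h | h
    · rw [h]; simp; positivity
    · obtain ⟨a, ha⟩ := Nat.exists_eq_succ_of_ne_zero h.ne'
      have h1 := htrue a (by omega) (lastTrue_pred (N := X / 2) (by rw [← hA, ha]))
      have h2 := (abs_le.1 (abs_sin_sq_sub_sin_sq_le (Real.pi * A / X) (Real.pi * a / X))).2
      have h3 : |Real.pi * A / X - Real.pi * a / X| = Real.pi / X := by
        rw [ha, ← sub_div]; push_cast
        rw [show Real.pi * ((a : ℝ) + 1) - Real.pi * a = Real.pi by ring]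
        exact abs_of_pos (by have := Real.pi_pos; positivity)
      have h4 : Real.pi / X ≤ 4 / X := div_le_div_of_nonneg_right hpi hX'.le
      have h5 : ρ ^ 4 * τ ≤ τ + 15 / X := by
        have hp : 0 ≤ 15 / (X : ℝ) := by positivity
        have e1 := mul_le_mul_of_nonneg_right hρ4 hτ0
        have e2 := mul_le_mul_of_nonneg_left hτ1 hp
        linarith
      have h6 : (20 : ℝ) / X = 15 / X + 4 / X + 1 / X := by ring
      have h7 : 0 ≤ 1 / (X : ℝ) := by positivity
      rw [h3] at h2
      linarith
  rw [abs_le]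
  constructor
  · have : (15 : ℝ) / X ≤ 20 / X := div_le_div_of_nonneg_right (by norm_num) hX'.le
    linarith
  · linarith

/-- The local vectors used by the algorithm. -/
noncomputable def approxVec (k X : ℕ) (z : ℤ) (b : Bool) : ℝ :=
  if 1 ≤ z ∧ z ≤ (k : ℤ) - 1 then QState.rotVec (angleNum k X z.toNat) X b else 0

theorem isUnitFamily_approxVec (k X : ℕ) : IsUnitFamily (approxVec k X) := by
  intro z
  by_cases hz : 1 ≤ z ∧ z ≤ (k : ℤ) - 1
  · right; simp only [approxVec, if_pos hz, QState.rotVec_sq_add]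
  · left; intro b; rw [approxVec, if_neg hz]

/-- For nonnegative numbers (x − y)² ≤ |x² − y²|. This is where accuracy 1/X of the squares becomes
accuracy 1/√X of the vectors, up to constants. -/
theorem abs_sub_le_sqrt {x y e : ℝ} (hx : 0 ≤ x) (hy : 0 ≤ y) (h : |x ^ 2 - y ^ 2| ≤ e) :
    |x - y| ≤ Real.sqrt e := by
  refine Real.le_sqrt_of_sq_le ?_
  rw [sq_abs]
  have := abs_le.1 h
  rcases le_total x y with hxy | hxy <;> nlinarith

/-- The squared components sum to one for both vectors, so the error of the squared sine is, up to
sign, also that of the squared cosine. -/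
theorem abs_approxVec_sub_le {k X : ℕ} (hk : 3 ≤ k) (hX : 0 < X) (hX2 : Even X) (z : ℤ) (b : Bool) :
    |approxVec k X z b - unitVec k z b| ≤ Real.sqrt (20 / X) := by
  by_cases hz : 1 ≤ z ∧ z ≤ (k : ℤ) - 1
  · have hX' : (0 : ℝ) < X := by exact_mod_cast hX
    have hd := dReal_pos hk
    have hl := lam_pos hz.1 hz.2
    obtain ⟨y, rfl⟩ := Int.eq_ofNat_of_zero_le (by omega : 0 ≤ z)
    have hs := angleNum_spec (z := y) hk hX hX2 (by omega) (by omega)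
    have hle := angleNum_le k X y
    set A := angleNum k X y with hA
    have hAX : (A : ℝ) ≤ X / 2 := by
      have : (2 * A : ℝ) ≤ X := by exact_mod_cast (by omega : 2 * A ≤ X)
      linarith
    have hx2 : Real.pi * A / X ≤ Real.pi / 2 := by
      rw [div_le_iff₀ hX']
      have := mul_le_mul_of_nonneg_left hAX Real.pi_pos.le
      linarith
    have hx0 : 0 ≤ Real.pi * A / X := by have := Real.pi_pos; positivity
    have hlm : 0 ≤ lam k (y - 1) := lam_nonneg (by omega) (by omega)
    have hlp : 0 ≤ lam k (y + 1) := lam_nonneg (by omega) (by omega)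
    have hsum := lam_add_lam k y
    have hu : ∀ b, unitVec k y b ^ 2 = lam k (y + stepSign b) / (dReal k * lam k y) := by
      intro b
      rw [unitVec, tlVec, stepWeight, if_pos hz, div_pow, Real.sq_sqrt hd.le, Real.sq_sqrt]
      · field_simp
      · refine div_nonneg ?_ hl.le
        cases b
        · exact hlm
        · exact hlp
    refine abs_sub_le_sqrt ?_ ?_ ?_
    · rw [approxVec, if_pos hz, Int.toNat_natCast, ← hA, QState.rotVec]
      split_ifs
      · exact Real.cos_nonneg_of_mem_Icc ⟨by linarith [Real.pi_pos], hx2⟩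
      · exact Real.sin_nonneg_of_nonneg_of_le_pi hx0 (by linarith [Real.pi_pos])
    · rw [unitVec, tlVec, stepWeight, if_pos hz]; positivity
    · rw [hu, approxVec, if_pos hz, Int.toNat_natCast, ← hA, QState.rotVec]
      cases b
      · simpa [stepSign, sub_eq_add_neg] using hs
      · simp only [if_true, stepSign]
        have : Real.cos (Real.pi * A / X) ^ 2 - lam k (y + 1) / (dReal k * lam k y) =
            -(Real.sin (Real.pi * A / X) ^ 2 - lam k (y - 1) / (dReal k * lam k y)) := by
          rw [Real.cos_sq']
          have : lam k (y + 1) = dReal k * lam k y - lam k (y - 1) := by linarith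
          rw [this]; field_simp; ring
        rw [this, abs_neg]; exact hs
  · rw [approxVec, if_neg hz, unitVec, tlVec, stepWeight, if_neg hz]
    simp
    positivity


/-! ## The classical part of the algorithm -/

instance : Add Expr := ⟨.add⟩
instance : Sub Expr := ⟨.sub⟩
instance : Mul Expr := ⟨.mul⟩
instance (c : ℕ) : OfNat Expr c := ⟨.const c⟩

namespace Expr

theorem val_add (M : Mem) (x y : Expr) : (x + y).val M = x.val M + y.val M := rfl
theorem val_sub (M : Mem) (x y : Expr) : (x - y).val M = x.val M - y.val M := rfl
theorem val_mul (M : Mem) (x y : Expr) : (x * y).val M = x.val M * y.val M := rfl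
theorem val_ofNat (M : Mem) (c : ℕ) :
    (no_index (OfNat.ofNat c : Expr)).val M = (OfNat.ofNat c : ℕ) := rfl
theorem val_var (M : Mem) (a : ℕ) : (var a).val M = M a 0 := rfl
theorem val_read (M : Mem) (a : ℕ) (i : Expr) : (read a i).val M = M a (i.val M) := rfl
theorem val_div (M : Mem) (x y : Expr) : (div x y).val M = x.val M / y.val M := rfl
theorem val_mod (M : Mem) (x y : Expr) : (mod x y).val M = x.val M % y.val M := rfl
theorem val_less (M : Mem) (x y : Expr) : (lt x y).val M = if x.val M < y.val M then 1 else 0 := rfl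
theorem val_equal (M : Mem) (x y : Expr) : (eq x y).val M = if x.val M = y.val M then 1 else 0 := rfl

end Expr

/-- The invariant carries along that unwritten arrays keep their contents, so `I` has to describe
only what the body changes. -/
theorem WP.forFrame {S Y : ℕ} {M₀ : Mem} {ψ : QState} {Q : Mem → QState → Prop} {v : ℕ} {N : Expr}
    {P : Prog} (hS : 1 ≤ S) (I : ℕ → Mem → QState → Prop)
    (Nv : ℕ) (hv : v ∉ P.writes) (hY : Nv ≤ Y) (hNS : Nv < 2 ^ S)
    (hN : ∀ M, (∀ a ∉ v :: P.writes, M a = M₀ a) → N.val M = Nv)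
    (h0 : I 0 (memSet M₀ v 0 0) ψ)
    (hstep : ∀ j < Nv, ∀ M ψ, (∀ a ∉ v :: P.writes, M a = M₀ a) → M v 0 = j → I j M ψ →
      WP S Y P (fun M' ψ' => I (j + 1) (memSet M' v 0 (j + 1)) ψ') M ψ)
    (hQ : ∀ M' ψ', (∀ a ∉ v :: P.writes, M' a = M₀ a) → I Nv M' ψ' → Q M' ψ') :
    WP S Y (.forLoop v N P) Q M₀ ψ := by
  refine WP.forLoop hS (fun j M ψ => (∀ a ∉ v :: P.writes, M a = M₀ a) ∧ I j M ψ) Nv hv hY hNS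
    (fun _ _ _ h => hN _ h.1) ⟨?_, h0⟩ ?_ (fun M' ψ' _ h => hQ M' ψ' h.1 h.2)
  · intro a ha
    exact memSet_of_ne _ _ _ (fun e => ha (by rw [e]; exact List.mem_cons_self))
  · rintro j hj M ψ hvj ⟨hfr, hI⟩
    refine (hstep j hj M ψ hfr hvj hI).mono ?_
    intro M' ψ' hfr' _ hI'
    refine ⟨fun a ha => ?_, hI'⟩
    have h1 : a ≠ v := fun e => ha (by rw [e]; exact List.mem_cons_self)
    have h2 : a ∉ P.writes := fun e => ha (List.mem_cons_of_mem _ e)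
    rw [memSet_of_ne _ _ _ h1, hfr' a h2, hfr a ha]

theorem frame_of_forLoop {M M' : Mem} {v : ℕ} {N : Expr} {P : Prog}
    (h : ∀ a ∉ v :: P.writes, M' a = M a) : ∀ a ∉ (Prog.forLoop v N P).writes, M' a = M a := by
  intro a ha
  refine h a fun hm => ha ?_
  simp only [Prog.forLoop, Prog.set, Prog.writes, List.mem_append, List.mem_cons,
    List.not_mem_nil, or_false] at hm ⊢
  tauto

namespace Jones

/-- The number of strands. -/
def nE : Expr := .read 0 0
/-- The number of crossings. -/
def mE : Expr := .read 0 1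
/-- The parameter `k`. -/
def kE : Expr := .read 0 2
/-- The precision. -/
def xE : Expr := .var 5
/-- The common denominator of the angles in the table. -/
def bE : Expr := .var 6

/-- The parameters in the memory: input, precision and denominator. -/
def Params (n m k X : ℕ) (M : Mem) : Prop :=
  M 0 0 = n ∧ M 0 1 = m ∧ M 0 2 = k ∧ M 5 0 = X ∧ M 6 0 = 2 * k * X

/-- Bounds for the size of the memory entries. -/
structure Bounds (n m k X S Y : ℕ) : Prop where
  hk : 3 ≤ k
  hX : 0 < X
  hY : 20 * (k + 1) * (X + 1) * (n + 1) * (m + 1) ≤ Y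
  hS : 4 * Y ^ 3 + Y ^ 2 + Y + 1 ≤ S

section
variable {n m k X S Y : ℕ}

theorem Bounds.one_le (h : Bounds n m k X S Y) : 1 ≤ S := by have := h.hS; omega

theorem Bounds.lt_of_le (h : Bounds n m k X S Y) {a : ℕ} (ha : a ≤ Y) : a < 2 ^ S :=
  (Nat.lt_two_pow_self (n := a)).trans_le (Nat.pow_le_pow_right (by norm_num)
    (by have := h.hS; omega))

theorem Bounds.le_Y (h : Bounds n m k X S Y) : 20 * (k + 1) * (X + 1) ≤ Y ∧
    20 * (k + 1) * (m + 1) ≤ Y ∧ 20 * (n + 1) ≤ Y ∧ 20 * (X + 1) ≤ Y ∧ 20 * (k + 1) ≤ Y ∧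
    20 * (m + 1) ≤ Y := by
  have h1 : ∀ a b c d : ℕ, 20 * (a + 1) * (b + 1) ≤ 20 * (a + 1) * (b + 1) * (c + 1) * (d + 1) := by
    intro a b c d
    rw [mul_assoc (20 * (a + 1) * (b + 1))]
    exact Nat.le_mul_of_pos_right _ (by positivity)
  have h2 := (h1 k X n m).trans h.hY
  have h3 : 20 * (k + 1) * (m + 1) ≤ Y := by
    refine (h1 k m X n).trans (le_trans (le_of_eq ?_) h.hY); ring
  have h4 : 20 * (n + 1) ≤ 20 * (n + 1) * (k + 1) := Nat.le_mul_of_pos_right _ (by positivity)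
  have h5 : 20 * (n + 1) * (k + 1) ≤ Y := by
    refine (h1 n k X m).trans (le_trans (le_of_eq ?_) h.hY); ring
  have h6 : 20 * (k + 1) ≤ 20 * (k + 1) * (X + 1) := Nat.le_mul_of_pos_right _ (by positivity)
  have h7 : 20 * (X + 1) * (k + 1) = 20 * (k + 1) * (X + 1) := by ring
  have h8 : 20 * (X + 1) ≤ 20 * (X + 1) * (k + 1) := Nat.le_mul_of_pos_right _ (by positivity)
  have h9 : 20 * (m + 1) * (k + 1) = 20 * (k + 1) * (m + 1) := by ring
  have h10 : 20 * (m + 1) ≤ 20 * (m + 1) * (k + 1) := Nat.le_mul_of_pos_right _ (by positivity)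
  omega

theorem Bounds.b_le (h : Bounds n m k X S Y) : 2 * k * X + 1 ≤ Y := by
  have := h.le_Y.1
  nlinarith

theorem four_mul_sq_le (Y : ℕ) : 4 * Y * Y ≤ 4 * Y ^ 3 := by
  rw [mul_assoc, pow_succ, pow_two]
  rcases Nat.eq_zero_or_pos Y with rfl | h
  · simp
  · exact Nat.mul_le_mul_left _ (Nat.le_mul_of_pos_right _ h)

/-- The entry `a` is at most Y < 2^Y, and every factor of the product is at most Y⁴ ≤ 2^{4Y}. -/
theorem Bounds.partial_le (h : Bounds n m k X S Y) {a : ℕ} (ha : a ≤ 2 * k * X) {j : ℕ} (hj : j ≤ X) :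
    sineTable (2 * k * X) j a ≤ 2 ^ (Y + 4 * Y * j) := by
  have hb := h.b_le
  have hlt : Y < 2 ^ Y := Nat.lt_two_pow_self
  have h1 : ∀ i ∈ Finset.range j, (i + 1) * (i + 1) * (2 * k * X * (2 * k * X)) - a * a ≤
      2 ^ (4 * Y) := by
    intro i hi
    have hi' := Finset.mem_range.1 hi
    have hX : i + 1 ≤ Y := by have := h.le_Y; omega
    calc _ ≤ (i + 1) * (i + 1) * (2 * k * X * (2 * k * X)) := Nat.sub_le _ _
      _ ≤ Y * Y * (Y * Y) := by gcongr <;> omega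
      _ = Y ^ 4 := by ring
      _ ≤ (2 ^ Y) ^ 4 := Nat.pow_le_pow_left hlt.le 4
      _ = _ := by rw [← pow_mul, mul_comm]
  calc sineTable (2 * k * X) j a ≤ 2 ^ Y * ∏ _i ∈ Finset.range j, 2 ^ (4 * Y) := by
        unfold sineTable
        exact Nat.mul_le_mul (by omega) (Finset.prod_le_prod' h1)
    _ = _ := by rw [Finset.prod_const, Finset.card_range, ← pow_mul, ← pow_add]

theorem Bounds.sineTable_le (h : Bounds n m k X S Y) {a : ℕ} (ha : a ≤ 2 * k * X) :
    sineTable (2 * k * X) X a ≤ 2 ^ (Y + 4 * Y * Y) := by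
  refine (h.partial_le ha le_rfl).trans (Nat.pow_le_pow_right (by norm_num) ?_)
  have : X ≤ Y := by have := h.le_Y; omega
  nlinarith

theorem Bounds.pow_lt (h : Bounds n m k X S Y) {e : ℕ} (he : e ≤ 4 * Y ^ 3 + Y ^ 2 + Y) :
    2 ^ e < 2 ^ S := Nat.pow_lt_pow_right (by norm_num) (by have := h.hS; omega)

/-- Compute the table of sines. -/
def tableProg : Prog :=
  .forLoop 9 (bE + 1) <| .block [
    .set 8 (.var 9),
    .forLoop 10 xE (.set 8 (.var 8 *
      ((.var 10 + 1) * (.var 10 + 1) * (bE * bE) - .var 9 * .var 9))),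
    .write 7 (.var 9) (.var 8)]

/-- Variable 8 accumulates the product for the entry under construction; the invariant of the inner
loop is the table entry with `j` factors, whose size `Bounds.partial_le` controls. -/
theorem wp_tableProg (h : Bounds n m k X S Y) {M : Mem} {ψ : QState} {Q : Mem → QState → Prop}
    (hM : Params n m k X M)
    (hQ : ∀ M', (∀ a ∉ tableProg.writes, M' a = M a) →
      (∀ a ≤ 2 * k * X, M' 7 a = sineTable (2 * k * X) X a) → Q M' ψ) :
    WP S Y tableProg Q M ψ := by
  have hS := h.one_le
  have hb := h.b_le
  have hX : X ≤ Y := by have := h.le_Y; omega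
  obtain ⟨-, -, -, h5, h6⟩ := hM
  refine WP.forFrame hS (fun j M' ψ' => ψ' = ψ ∧ ∀ a < j, M' 7 a = sineTable (2 * k * X) X a)
    (2 * k * X + 1) (by decide) hb (h.lt_of_le hb) ?_ ⟨rfl, by simp⟩ ?_ ?_
  · intro M' hfr
    rw [Expr.val_add, bE, Expr.val_var, hfr 6 (by decide), h6]; rfl
  · rintro a ha M₁ ψ₁ hfr hv ⟨rfl, hI⟩
    have e5 : M₁ 5 0 = X := by rw [hfr 5 (by decide), h5]
    have e6 : M₁ 6 0 = 2 * k * X := by rw [hfr 6 (by decide), h6]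
    refine WP.block_cons (WP.set hS (h.lt_of_le (by rw [Expr.val_var, hv]; omega)) ?_)
    refine WP.block_cons ?_
    refine WP.forFrame hS (fun j M' ψ' => ψ' = ψ₁ ∧ M' 8 0 = sineTable (2 * k * X) j a) X
      (by decide) hX (h.lt_of_le hX) ?_ ⟨rfl, ?_⟩ ?_ ?_
    · intro M' hfr'
      rw [xE, Expr.val_var, hfr' 5 (by decide), memSet_of_ne _ _ _ (by decide), e5]
    · simp [memSet_apply, sineTable, Expr.val_var, hv]
    · rintro j hj M₂ ψ₂ hfr' hv' ⟨rfl, hI'⟩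
      have e6' : M₂ 6 0 = 2 * k * X := by
        rw [hfr' 6 (by decide), memSet_of_ne _ _ _ (by decide), e6]
      have e9 : M₂ 9 0 = a := by
        rw [hfr' 9 (by decide), memSet_of_ne _ _ _ (by decide), hv]
      have hval : (Expr.var 8 * ((Expr.var 10 + 1) * (Expr.var 10 + 1) * (bE * bE) -
          Expr.var 9 * Expr.var 9)).val M₂ = sineTable (2 * k * X) (j + 1) a := by
        simp only [Expr.val_mul, Expr.val_sub, Expr.val_add, Expr.val_var, Expr.val_ofNat, bE,
          hI', hv', e6', e9]
        rw [sineTable, sineTable, Finset.prod_range_succ]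
        ring
      refine WP.set hS ?_ ⟨rfl, ?_⟩
      · rw [hval]
        refine lt_of_le_of_lt (h.partial_le (by omega) (by omega : j + 1 ≤ X)) (h.pow_lt ?_)
        have : 4 * Y * (j + 1) ≤ 4 * Y * Y := Nat.mul_le_mul_left _ (by omega)
        have h3 := four_mul_sq_le Y
        omega
      · rw [memSet_of_ne _ _ _ (by decide), hval]; simp [memSet_apply]
    · rintro M₂ ψ₂ hfr' ⟨rfl, hI'⟩
      have e9 : M₂ 9 0 = a := by
        rw [hfr' 9 (by decide), memSet_of_ne _ _ _ (by decide), hv]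
      refine WP.block_cons (WP.write hS ?_ (WP.block_nil ⟨rfl, ?_⟩))
      · rw [Expr.val_var, hI']
        refine lt_of_le_of_lt (h.sineTable_le (by omega)) (h.pow_lt ?_)
        have h3 := four_mul_sq_le Y
        omega
      · intro a' ha'
        rw [memSet_of_ne _ _ _ (by decide), Expr.val_var, Expr.val_var, e9, hI', memSet_apply]
        split_ifs with hc
        · rw [hc.2]
        · rw [hfr' 7 (by decide), memSet_of_ne _ _ _ (by decide)]
          exact hI a' (by
            rcases Nat.lt_succ_iff_lt_or_eq.1 ha' with h | h
            · exact h
            · exact absurd ⟨rfl, h⟩ hc)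
  · rintro M' ψ' hfr ⟨rfl, hI⟩
    exact hQ M' (frame_of_forLoop hfr) fun a ha => hI a (by omega)

/-- Compute the rotation angles. -/
def angleProg : Prog :=
  .forLoop 12 kE <| .block [
    .set 16 0,
    .forLoop 13 (.div xE 2) (.ite
      (.lt (.read 7 (2 * kE * .var 13) * .read 7 (2 * kE * .var 13) * .read 7 (4 * xE) *
          .read 7 (2 * xE * .var 12))
        (.read 7 (2 * xE) * .read 7 (2 * xE * (.var 12 - 1)) * .read 7 (kE * xE) *
          .read 7 (kE * xE)))
      (.set 16 (.var 13 + 1)) .skip),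
    .write 11 (.var 12) (.var 16)]

/-- All indices read lie in the range 0, …, 2kX of the table, and the inner loop follows the
recursion of `lastTrue`. -/
theorem wp_angleProg (h : Bounds n m k X S Y) {M : Mem} {ψ : QState} {Q : Mem → QState → Prop}
    (hM : Params n m k X M) (hT : ∀ a ≤ 2 * k * X, M 7 a = sineTable (2 * k * X) X a)
    (hQ : ∀ M', (∀ a ∉ angleProg.writes, M' a = M a) →
      (∀ z < k, M' 11 z = angleNum k X z) → Q M' ψ) :
    WP S Y angleProg Q M ψ := by
  have hS := h.one_le
  have hk := h.hk
  have hXY : X + 1 ≤ Y := by have := h.le_Y; omega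
  have hkY : k ≤ Y := by have := h.le_Y; omega
  obtain ⟨-, -, h2, h5, h6⟩ := hM
  refine WP.forFrame hS (fun j M' ψ' => ψ' = ψ ∧ ∀ z < j, M' 11 z = angleNum k X z)
    k (by decide) hkY (h.lt_of_le hkY) ?_ ⟨rfl, by simp⟩ ?_ ?_
  · intro M' hfr
    rw [kE, Expr.val_read, hfr 0 (by decide)]; exact h2
  · rintro z hz M₁ ψ₁ hfr hv ⟨rfl, hI⟩
    have e2 : M₁ 0 2 = k := by rw [hfr 0 (by decide), h2]
    have e5 : M₁ 5 0 = X := by rw [hfr 5 (by decide), h5]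
    have e7 : M₁ 7 = M 7 := hfr 7 (by decide)
    refine WP.block_cons (WP.set hS (h.lt_of_le (by rw [Expr.val_ofNat]; omega)) ?_)
    refine WP.block_cons ?_
    refine WP.forFrame hS (fun j M' ψ' => ψ' = ψ₁ ∧ M' 16 0 =
      lastTrue (angleTest (sineTable (2 * k * X) X) k X z) j) (X / 2)
      (by decide) (by omega) (h.lt_of_le (by omega)) ?_ ⟨rfl, ?_⟩ ?_ ?_
    · intro M' hfr'
      rw [Expr.val_div, xE, Expr.val_var, hfr' 5 (by decide), memSet_of_ne _ _ _ (by decide), e5,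
        Expr.val_ofNat]
    · simp [memSet_apply, Expr.val_ofNat, lastTrue]
    · rintro a ha M₂ ψ₂ hfr' hv' ⟨rfl, hI'⟩
      have e2' : M₂ 0 2 = k := by rw [hfr' 0 (by decide), memSet_of_ne _ _ _ (by decide), e2]
      have e5' : M₂ 5 0 = X := by rw [hfr' 5 (by decide), memSet_of_ne _ _ _ (by decide), e5]
      have e7' : M₂ 7 = M 7 := by rw [hfr' 7 (by decide), memSet_of_ne _ _ _ (by decide), e7]
      have e12 : M₂ 12 0 = z := by rw [hfr' 12 (by decide), memSet_of_ne _ _ _ (by decide), hv]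
      have i1 : 2 * k * a ≤ 2 * k * X := Nat.mul_le_mul_left _ (by omega)
      have i2 : 4 * X ≤ 2 * k * X := Nat.mul_le_mul_right _ (by omega)
      have i3 : 2 * X * z ≤ 2 * k * X := by
        rw [show 2 * k * X = 2 * X * k by ring]; exact Nat.mul_le_mul_left _ (by omega)
      have i4 : 2 * X ≤ 2 * k * X := Nat.mul_le_mul_right _ (by omega)
      have i5 : 2 * X * (z - 1) ≤ 2 * k * X := by
        rw [show 2 * k * X = 2 * X * k by ring]; exact Nat.mul_le_mul_left _ (by omega)
      have i6 : k * X ≤ 2 * k * X := Nat.mul_le_mul_right _ (by omega)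
      have htest : ((Expr.lt (.read 7 (2 * kE * .var 13) * .read 7 (2 * kE * .var 13) *
          .read 7 (4 * xE) * .read 7 (2 * xE * .var 12))
          (.read 7 (2 * xE) * .read 7 (2 * xE * (.var 12 - 1)) * .read 7 (kE * xE) *
          .read 7 (kE * xE))).val M₂ ≠ 0) ↔
          angleTest (sineTable (2 * k * X) X) k X z a = true := by
        simp only [Expr.val_less, Expr.val_mul, Expr.val_sub, Expr.val_read, Expr.val_var,
          Expr.val_ofNat, kE, xE, hv', e2', e5', e12, e7', hT _ i1, hT _ i2, hT _ i3, hT _ i4,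
          hT _ i5, hT _ i6]
        simp [angleTest]
      refine WP.ite hS (fun hc => WP.set hS ?_ ⟨rfl, ?_⟩) (fun hc => WP.skip ⟨rfl, ?_⟩)
      · rw [Expr.val_add, Expr.val_var, hv', Expr.val_ofNat]
        exact h.lt_of_le (by omega)
      · rw [memSet_of_ne _ _ _ (by decide), lastTrue, if_pos (htest.1 hc), Expr.val_add,
          Expr.val_var, hv', Expr.val_ofNat]
        simp [memSet_apply]
      · rw [memSet_of_ne _ _ _ (by decide), lastTrue, if_neg (fun e => htest.2 e hc)]
        exact hI'
    · rintro M₂ ψ₂ hfr' ⟨rfl, hI'⟩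
      have e12 : M₂ 12 0 = z := by rw [hfr' 12 (by decide), memSet_of_ne _ _ _ (by decide), hv]
      refine WP.block_cons (WP.write hS ?_ (WP.block_nil ⟨rfl, ?_⟩))
      · rw [Expr.val_var, hI']
        have : lastTrue (angleTest (sineTable (2 * k * X) X) k X z) (X / 2) ≤ X / 2 :=
          lastTrue_le _ _
        exact h.lt_of_le (by omega)
      · intro a' ha'
        rw [memSet_of_ne _ _ _ (by decide), Expr.val_var, Expr.val_var, e12, hI', memSet_apply]
        split_ifs with hc
        · rw [hc.2]; rfl
        · rw [hfr' 11 (by decide), memSet_of_ne _ _ _ (by decide)]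
          exact hI a' (by
            rcases Nat.lt_succ_iff_lt_or_eq.1 ha' with h | h
            · exact h
            · exact absurd ⟨rfl, h⟩ hc)
  · rintro M' ψ' hfr ⟨rfl, hI⟩
    exact hQ M' (frame_of_forLoop hfr) hI

end

end Jones


/-! ### The total phase and the output -/

namespace Jones

section
variable {n m k X S Y : ℕ}

/-- Contribution of the crossing number `v` to the total phase. -/
def phaseE : Expr :=
  .read 3 (.var 15) * (3 * kE + 1) + (1 - .read 3 (.var 15)) * (kE - 1) +
    (.eq (.read 3 (.var 15)) (.eq (.read 1 (.var 16)) (.read 1 (.var 16 + 1))) * (9 * kE - 3) +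
    (1 - .eq (.read 3 (.var 15)) (.eq (.read 1 (.var 16)) (.read 1 (.var 16 + 1)))) * (3 * kE + 3))

/-- Compute the total phase, following the directions of the strands through the braid. -/
def phaseProg : Prog :=
  .block [.set 14 0, .forLoop 15 mE <| .block [
    .set 16 (.read 2 (.var 15)),
    .set 14 (.var 14 + phaseE),
    .set 17 (.read 1 (.var 16)),
    .write 1 (.var 16) (.read 1 (.var 16 + 1)),
    .write 1 (.var 16 + 1) (.var 17)]]

/-- A crossing contributes at most 3k + 1 ≤ 4k by itself and at most 9k through the writhe. -/
theorem braidPhase_le (hk : 3 ≤ k) (B : BraidWord n) (o : Fin n → Bool) :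
    braidPhase k B o ≤ 13 * k * B.length := by
  induction B generalizing o with
  | nil => simp [braidPhase]
  | cons c B ih =>
    have h := ih (c.push o)
    have h1 : crossingPhase k c.pos ≤ 3 * k + 1 := by unfold crossingPhase; split_ifs <;> omega
    have h2 : signPhase k (c.pos == (o c.left == o c.right)) ≤ 9 * k := by
      unfold signPhase; split_ifs <;> omega
    rw [braidPhase, List.length_cons, mul_add]
    omega

/-- The braid in the memory. -/
def BraidIn (B : BraidWord n) (M : Mem) : Prop :=
  (∀ (j : ℕ) (hj : j < B.length), M 2 j = B[j].i) ∧
    ∀ (j : ℕ) (hj : j < B.length), M 3 j = B[j].pos.toNat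

/-- The directions in array 1 are permuted while the word is read. The phase found so far plus the
phase of the remaining word, under the current directions, stays constant. -/
theorem wp_phaseProg {B : BraidWord n} (h : Bounds n B.length k X S Y) {M : Mem} {ψ : QState}
    {Q : Mem → QState → Prop} (hM : Params n B.length k X M) (hB : BraidIn B M) {o : Fin n → Bool}
    (ho : ∀ i : Fin n, M 1 i = (o i).toNat)
    (hQ : ∀ M', (∀ a ∉ phaseProg.writes, M' a = M a) → M' 14 0 = braidPhase k B o → Q M' ψ) :
    WP S Y phaseProg Q M ψ := by
  have hS := h.one_le
  have hk := h.hk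
  have hmY : B.length ≤ Y := by have := h.le_Y; omega
  have hnY : n ≤ Y := by have := h.le_Y; omega
  have hPY : braidPhase k B o ≤ Y := by
    have h1 := braidPhase_le hk B o
    have h2 := h.le_Y.2.1
    nlinarith
  obtain ⟨-, h1, h2, -, -⟩ := hM
  refine WP.block_cons (WP.set hS (h.lt_of_le (by rw [Expr.val_ofNat]; omega)) ?_)
  refine WP.block_cons ?_
  refine WP.forFrame hS (fun j M' ψ' => ψ' = ψ ∧ ∃ o' : Fin n → Bool,
    (∀ i : Fin n, M' 1 i = (o' i).toNat) ∧
      M' 14 0 + braidPhase k (B.drop j) o' = braidPhase k B o)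
    B.length (by decide) hmY (h.lt_of_le hmY) ?_ ⟨rfl, o, ?_, ?_⟩ ?_ ?_
  · intro M' hfr
    rw [mE, Expr.val_read, hfr 0 (by decide), memSet_of_ne _ _ _ (by decide)]; exact h1
  · intro i
    rw [memSet_of_ne _ _ _ (by decide), memSet_of_ne _ _ _ (by decide)]; exact ho i
  · rw [memSet_of_ne _ _ _ (by decide), Expr.val_ofNat]
    simp [memSet_apply]
  · rintro j hj M₁ ψ₁ hfr hv ⟨rfl, o', ho', hP⟩
    have e2 : M₁ 0 2 = k := by rw [hfr 0 (by decide), memSet_of_ne _ _ _ (by decide), h2]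
    have ei : M₁ 2 j = B[j].i := by
      rw [hfr 2 (by decide), memSet_of_ne _ _ _ (by decide), hB.1 j hj]
    have ep : M₁ 3 j = B[j].pos.toNat := by
      rw [hfr 3 (by decide), memSet_of_ne _ _ _ (by decide), hB.2 j hj]
    rw [List.drop_eq_getElem_cons hj, braidPhase] at hP
    set c := B[j] with hc
    have hci := c.hi
    have ol : M₁ 1 c.i = (o' c.left).toNat := ho' c.left
    have or : M₁ 1 (c.i + 1) = (o' c.right).toNat := ho' c.right
    have hb : ∀ b : Bool, b.toNat ≤ Y := fun b => by
      have := Bool.toNat_le b; omega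
    refine WP.block_cons (WP.set hS ?_ ?_)
    · rw [Expr.val_read, Expr.val_var, hv, ei]; exact h.lt_of_le (by omega)
    rw [Expr.val_read, Expr.val_var, hv, ei]
    have hph : phaseE.val (memSet M₁ 16 0 c.i) = crossingPhase k c.pos +
        signPhase k (c.pos == (o' c.left == o' c.right)) := by
      simp only [phaseE, kE, Expr.val_add, Expr.val_mul, Expr.val_sub, Expr.val_read, Expr.val_var,
        Expr.val_equal, Expr.val_ofNat, memSet_apply, hv, e2]
      simp only [Nat.reduceEqDiff, false_and, if_false, and_self, if_true, ep, ol, or]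
      unfold crossingPhase signPhase
      cases c.pos <;> cases o' c.left <;> cases o' c.right <;> simp
    have hval : (Expr.var 14 + phaseE).val (memSet M₁ 16 0 c.i) = M₁ 14 0 +
        (crossingPhase k c.pos + signPhase k (c.pos == (o' c.left == o' c.right))) := by
      rw [Expr.val_add, hph, Expr.val_var, memSet_of_ne _ _ _ (by decide)]
    refine WP.block_cons (WP.set hS ?_ ?_)
    · rw [hval]; exact h.lt_of_le (by omega)
    rw [hval]
    refine WP.block_cons (WP.set hS ?_ ?_)
    · simp only [Expr.val_read, Expr.val_var, memSet_apply]
      simp only [Nat.reduceEqDiff, false_and, if_false, and_self, if_true, ol]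
      exact h.lt_of_le (hb _)
    refine WP.block_cons (WP.write hS ?_ ?_)
    · simp only [Expr.val_read, Expr.val_var, Expr.val_add, Expr.val_ofNat, memSet_apply]
      simp only [Nat.reduceEqDiff, false_and, if_false, and_self, if_true, or]
      exact h.lt_of_le (hb _)
    refine WP.block_cons (WP.write hS ?_ (WP.block_nil ⟨rfl, c.push o', ?_, ?_⟩))
    · simp only [Expr.val_read, Expr.val_var, Expr.val_add, Expr.val_ofNat, memSet_apply]
      simp only [Nat.reduceEqDiff, false_and, if_false, and_self, if_true, ol]
      exact h.lt_of_le (hb _)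
    · intro i
      simp only [Expr.val_read, Expr.val_var, Expr.val_add, Expr.val_ofNat, memSet_apply]
      simp only [Nat.reduceEqDiff, false_and, if_false, and_self, if_true, true_and, ol, or]
      simp only [Crossing.push, Function.comp_apply]
      by_cases e1 : i = c.right
      · subst e1
        rw [if_pos (show c.right.val = c.i + 1 from rfl), Equiv.swap_apply_right]
      · have e1' : i.val ≠ c.i + 1 := fun e => e1 (Fin.ext e)
        rw [if_neg e1']
        by_cases e0 : i = c.left
        · subst e0
          rw [if_pos (show c.left.val = c.i from rfl), Equiv.swap_apply_left]
        · have e0' : i.val ≠ c.i := fun e => e0 (Fin.ext e)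
          rw [if_neg e0', Equiv.swap_apply_of_ne_of_ne e0 e1]
          exact ho' i
    · simp only [memSet_apply]
      simp only [Nat.reduceEqDiff, false_and, if_false, and_self, if_true]
      omega
  · rintro M' ψ' hfr ⟨rfl, o', -, hP⟩
    refine WP.block_nil (hQ M' (fun a ha => ?_) ?_)
    · rw [frame_of_forLoop (N := mE) hfr a (fun e => ha ?_), memSet_of_ne _ _ _ (fun e => ha ?_)]
      · rw [e]; decide
      · simp only [phaseProg, Prog.block, Prog.writes] at e ⊢
        simp only [List.mem_append] at e ⊢
        tauto
    · rw [List.drop_length, braidPhase, add_zero] at hP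
      exact hP

/-- Write the output. -/
def outputProg : Prog :=
  .block [.set 24 1, .set 25 1, .forLoop 26 (.div nE 2 - 1) <| .block [
    .set 24 (.var 24 * .read 7 (4 * xE)),
    .set 25 (.var 25 * .read 7 (2 * xE))],
    .write 4 0 (xE * .var 24),
    .write 4 1 (2 * .read 23 0 * .var 24),
    .write 4 2 (xE * .var 24),
    .write 4 3 (2 * .read 23 1 * .var 24),
    .write 4 4 (xE * .var 25)]

/-- The table entry at `2 X e`, which represents `sin (π e / k)`. -/
def sineOf (k X e : ℕ) : ℕ := sineTable (2 * k * X) X (2 * X * e)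

/-- d = λ_2/λ_1 is approximated by a quotient of table entries, so its power is output as a quotient
of integers. The output format takes differences of naturals, which allows X − 2c to be negative. -/
theorem wp_outputProg (h : Bounds n m k X S Y) {M : Mem} {ψ : QState}
    {Q : Mem → QState → Prop} (hM : Params n m k X M)
    (hT : ∀ a ≤ 2 * k * X, M 7 a = sineTable (2 * k * X) X a) {c₀ c₁ : ℕ} (hc₀ : M 23 0 = c₀)
    (hc₁ : M 23 1 = c₁) (hc₀' : c₀ ≤ X) (hc₁' : c₁ ≤ X)
    (hQ : ∀ M', M' 4 0 = X * sineOf k X 2 ^ (n / 2 - 1) → M' 4 2 = X * sineOf k X 2 ^ (n / 2 - 1) →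
      M' 4 1 = 2 * c₀ * sineOf k X 2 ^ (n / 2 - 1) → M' 4 3 = 2 * c₁ * sineOf k X 2 ^ (n / 2 - 1) →
      M' 4 4 = X * sineOf k X 1 ^ (n / 2 - 1) → Q M' ψ) :
    WP S Y outputProg Q M ψ := by
  have hS := h.one_le
  have hk := h.hk
  have hXY : 2 * X ≤ Y := by have := h.le_Y; omega
  have hnY : n ≤ Y := by have := h.le_Y; omega
  have hY1 : 1 ≤ Y := by have := h.le_Y; omega
  obtain ⟨h0, -, -, h5, -⟩ := hM
  -- A table entry has about 4Y² + Y bits and is raised to a power of at most Y; this is the origin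
  -- of the cubic term in `Bounds.hS`.
  have hpow : ∀ e ≤ 2, ∀ i ≤ Y, sineOf k X e ^ i ≤ 2 ^ (4 * Y ^ 3 + Y ^ 2) := by
    intro e he i hi
    have h1 : sineOf k X e ≤ 2 ^ (Y + 4 * Y * Y) := h.sineTable_le (by
      rw [show 2 * k * X = 2 * X * k by ring]; exact Nat.mul_le_mul_left _ (by omega))
    calc _ ≤ (2 ^ (Y + 4 * Y * Y)) ^ i := Nat.pow_le_pow_left h1 i
      _ = 2 ^ ((Y + 4 * Y * Y) * i) := by rw [← pow_mul]
      _ ≤ _ := Nat.pow_le_pow_right (by norm_num) (by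
        calc (Y + 4 * Y * Y) * i ≤ (Y + 4 * Y * Y) * Y := Nat.mul_le_mul_left _ hi
          _ = _ := by ring)
  have hpow1 : ∀ e ≤ 2, ∀ i ≤ Y, sineOf k X e ^ i < 2 ^ S := fun e he i hi =>
    lt_of_le_of_lt (hpow e he i hi) (h.pow_lt (by omega))
  have hpow2 : ∀ e ≤ 2, ∀ i ≤ Y, ∀ r ≤ Y, r * sineOf k X e ^ i < 2 ^ S := by
    intro e he i hi r hr
    have hr' : r ≤ 2 ^ Y := (hr.trans_lt Nat.lt_two_pow_self).le
    refine lt_of_le_of_lt (Nat.mul_le_mul hr' (hpow e he i hi)) ?_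
    rw [← pow_add]; exact h.pow_lt (by omega)
  refine WP.block_cons (WP.set hS (h.lt_of_le (by rw [Expr.val_ofNat]; omega)) ?_)
  refine WP.block_cons (WP.set hS (h.lt_of_le (by rw [Expr.val_ofNat]; omega)) ?_)
  refine WP.block_cons ?_
  refine WP.forFrame hS (fun j M' ψ' => ψ' = ψ ∧ M' 24 0 = sineOf k X 2 ^ j ∧
    M' 25 0 = sineOf k X 1 ^ j) (n / 2 - 1) (by decide) (by omega) (h.lt_of_le (by omega))
    ?_ ⟨rfl, ?_, ?_⟩ ?_ ?_
  · intro M' hfr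
    rw [Expr.val_sub, Expr.val_div, nE, Expr.val_read, hfr 0 (by decide),
      memSet_of_ne _ _ _ (by decide), memSet_of_ne _ _ _ (by decide), Expr.val_ofNat,
      Expr.val_ofNat, Expr.val_ofNat]
    rw [show M 0 (OfNat.ofNat 0) = n from h0]
  · simp [memSet_apply, Expr.val_ofNat]
  · simp [memSet_apply, Expr.val_ofNat]
  · rintro j hj M₁ ψ₁ hfr hv ⟨rfl, hI1, hI2⟩
    have e5 : M₁ 5 0 = X := by
      rw [hfr 5 (by decide), memSet_of_ne _ _ _ (by decide), memSet_of_ne _ _ _ (by decide), h5]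
    have e7 : M₁ 7 = M 7 := by
      rw [hfr 7 (by decide), memSet_of_ne _ _ _ (by decide), memSet_of_ne _ _ _ (by decide)]
    have t2 : M 7 (4 * X) = sineOf k X 2 := by
      rw [hT _ (Nat.mul_le_mul_right _ (by omega)), sineOf]; congr 1; ring
    have t1 : M 7 (2 * X) = sineOf k X 1 := by
      rw [hT _ (Nat.mul_le_mul_right _ (by omega)), sineOf]; congr 1; ring
    have v1 : (Expr.var 24 * .read 7 (4 * xE)).val M₁ = sineOf k X 2 ^ (j + 1) := by
      simp only [Expr.val_mul, Expr.val_read, xE, Expr.val_var, Expr.val_ofNat, e5, e7, hI1, t2]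
      rw [pow_succ]
    refine WP.block_cons (WP.set hS ?_ ?_)
    · rw [v1]; exact hpow1 2 le_rfl _ (by omega)
    rw [v1]
    have v2 : (Expr.var 25 * .read 7 (2 * xE)).val (memSet M₁ 24 0 (sineOf k X 2 ^ (j + 1))) =
        sineOf k X 1 ^ (j + 1) := by
      simp only [Expr.val_mul, Expr.val_read, xE, Expr.val_var, Expr.val_ofNat, memSet_apply]
      simp only [Nat.reduceEqDiff, false_and, if_false, e5, e7, hI2, t1]
      rw [pow_succ]
    refine WP.block_cons (WP.set hS ?_ ?_)
    · rw [v2]; exact hpow1 1 (by norm_num) _ (by omega)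
    rw [v2]
    refine WP.block_nil ⟨rfl, ?_, ?_⟩
    · simp [memSet_apply]
    · simp [memSet_apply]
  · rintro M₁ ψ₁ hfr ⟨rfl, hI1, hI2⟩
    have e5 : M₁ 5 0 = X := by
      rw [hfr 5 (by decide), memSet_of_ne _ _ _ (by decide), memSet_of_ne _ _ _ (by decide), h5]
    have e23 : M₁ 23 = M 23 := by
      rw [hfr 23 (by decide), memSet_of_ne _ _ _ (by decide), memSet_of_ne _ _ _ (by decide)]
    have hp2 := hpow2 2 le_rfl (n / 2 - 1) (by omega)
    have hp1 := hpow2 1 (by norm_num) (n / 2 - 1) (by omega)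
    refine WP.block_cons (WP.write hS ?_ (WP.block_cons (WP.write hS ?_
      (WP.block_cons (WP.write hS ?_ (WP.block_cons (WP.write hS ?_
      (WP.block_cons (WP.write hS ?_ (WP.block_nil (hQ _ ?_ ?_ ?_ ?_ ?_)))))))))))
    all_goals simp only [Expr.val_mul, Expr.val_read, xE, Expr.val_var, Expr.val_ofNat, memSet_apply]
    all_goals simp only [Nat.reduceEqDiff, OfNat.ofNat_ne_zero, OfNat.ofNat_ne_one,
      OfNat.zero_ne_ofNat, OfNat.one_ne_ofNat, one_ne_zero, zero_ne_one,
      false_and, and_false, if_false, and_self, if_true, e5, e23, hI1, hI2, hc₀, hc₁]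
    · exact hp2 X (by omega)
    · exact hp2 (2 * c₀) (by omega)
    · exact hp2 X (by omega)
    · exact hp2 (2 * c₁) (by omega)
    · exact hp1 X (by omega)

end

end Jones


/-! ## One trial of the Hadamard test -/

open QState

section
variable {n k t : ℕ}

/-- Amplitudes after the controlled path operator. -/
noncomputable def crossAct (u : ℤ → Bool → ℝ) (w : ℂ) (c : Crossing n)
    (g : Bool × (Fin n → Bool) → ℂ) (x : Bool × (Fin n → Bool)) : ℂ :=
  if x.1 = true then pathGate u w c (fun p => g (true, p)) x.2 else g x

/-- The local vectors up to site `J`. -/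
noncomputable def cutVec (u : ℤ → Bool → ℝ) (J : ℤ) (z : ℤ) (b : Bool) : ℝ :=
  if z ≤ J then u z b else 0

/-- Gates at different sites act on disjoint pairs of walks, so the gate at J + 1 extends the
operator built from the sites up to J by one block. -/
theorem siteAct_crossAct (u : ℤ → Bool → ℝ) (w : ℂ) (c : Crossing n)
    (g : Bool × (Fin n → Bool) → ℂ) (J : ℤ) :
    siteAct c (J + 1) (u (J + 1)) w (crossAct (cutVec u J) w c g) =
      crossAct (cutVec u (J + 1)) w c g := by
  funext ⟨b, p⟩
  cases b
  · simp [siteAct, crossAct]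
  · have hs : siteAfter (flipPath c p) c.left.val = siteAfter p c.left.val :=
      siteAfter_flipPath c p (by change c.i ≠ c.i + 1; omega)
    simp only [siteAct, crossAct, if_true, true_and, pathGate, Pi.add_apply, Pi.smul_apply,
      smul_eq_mul, localOp, flipPath_left, flipPath_right, hs, cutVec]
    by_cases hz : siteAfter p c.left.val = J + 1
    · have h1 : ¬ (J + 1 ≤ J) := by omega
      simp only [hz, h1, if_false, le_refl, if_true, true_and]
      by_cases hp : p c.left = p c.right
      · simp [hp]
      · simp [hp]
    · have h1 : (siteAfter p c.left.val ≤ J) ↔ siteAfter p c.left.val ≤ J + 1 := by omega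
      simp only [hz, false_and, if_false, h1]

theorem crossAct_of_zero {u : ℤ → Bool → ℝ} (hu : ∀ z b, u z b = 0) (w : ℂ) (c : Crossing n)
    (g : Bool × (Fin n → Bool) → ℂ) : crossAct u w c g = g := by
  funext ⟨b, p⟩
  cases b
  · simp [crossAct]
  · simp [crossAct, pathGate, localOp, hu]

/-- The final amplitudes of the Hadamard test. -/
noncomputable def testAmp (f : (Fin n → Bool) → ℂ) (x : Bool × (Fin n → Bool)) : ℂ :=
  ((Pi.single (altPath n) 1 : (Fin n → Bool) → ℂ) x.2 + (if x.1 then -1 else 1) * f x.2) / 2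

/-- Expanding |(δ ± f)/2|² leaves 1 + ‖f‖² = 2 and twice a real part, in which δ selects the entry
at `altPath`. -/
theorem sum_testAmp {f : (Fin n → Bool) → ℂ} (hf : l2 f = 1) (b : Bool) :
    ∑ p, ‖testAmp f (b, p)‖ ^ 2 = (1 + (if b then -1 else 1) * (f (altPath n)).re) / 2 := by
  have h1 := l2_sq f
  rw [hf] at h1
  have key : ∀ p, ‖testAmp f (b, p)‖ ^ 2 = (‖(Pi.single (altPath n) 1 : (Fin n → Bool) → ℂ) p‖ ^ 2 +
      ‖f p‖ ^ 2 + 2 * (if b then -1 else 1) *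
        (if p = altPath n then (f (altPath n)).re else 0)) / 4 := by
    intro p
    by_cases hp : p = altPath n
    · subst hp
      rw [testAmp]
      simp only [Pi.single_eq_same, Complex.sq_norm, Complex.normSq_div, if_true]
      cases b <;> simp [Complex.normSq_apply] <;> ring
    · rw [testAmp, Pi.single_eq_of_ne hp, if_neg hp]
      cases b <;> simp [div_pow] <;> ring
  have h2 : ∑ p, ‖(Pi.single (altPath n) 1 : (Fin n → Bool) → ℂ) p‖ ^ 2 = 1 := by
    rw [← l2_sq, l2_single]; norm_num
  rw [Finset.sum_congr rfl fun p _ => key p, ← Finset.sum_div, Finset.sum_add_distrib,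
    Finset.sum_add_distrib, ← Finset.mul_sum, h2, ← h1]
  cases b <;> simp <;> ring

end

/-! ### The gate programs of one trial -/

namespace Jones

/-- Apply the two-level gate at one site. -/
def siteGateProg (c₁ c₂ c a b f₁ f₂ f₃ x X y Z : Expr) : Prog :=
  .block [.toffoli c₁ c₂ f₁, .toffoli f₁ c f₂, .cnot b a,
    .phase b 1 4, .hadamard b, .phase b (X - x) X, .hadamard b,
    .toffoli f₂ b f₃, .phase f₃ y Z, .toffoli f₂ b f₃,
    .hadamard b, .phase b x X, .hadamard b, .phase b 3 4,
    .cnot b a, .toffoli f₁ c f₂, .toffoli c₁ c₂ f₁]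

section
variable {n m k X S Y t : ℕ}

theorem wp_siteGateProg (hS : 1 ≤ S) {c₁ c₂ c a b f₁ f₂ f₃ x X y Z : Expr} {M : Mem} {ψ : QState}
    {Q : Mem → QState → Prop}
    (hQ : Q M (siteGate (c₁.val M) (c₂.val M) (c.val M) (a.val M) (b.val M) (f₁.val M) (f₂.val M)
      (f₃.val M) (x.val M) (X.val M) (y.val M) (Z.val M) ψ)) :
    WP S Y (siteGateProg c₁ c₂ c a b f₁ f₂ f₃ x X y Z) Q M ψ := by
  refine WP.block_cons (WP.toffoli hS (WP.block_cons (WP.toffoli hS (WP.block_cons (WP.cnot hS ?_)))))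
  refine WP.block_cons (WP.phase hS (WP.block_cons (WP.hadamard hS ?_)))
  refine WP.block_cons (WP.phase hS (WP.block_cons (WP.hadamard hS ?_)))
  refine WP.block_cons (WP.toffoli hS (WP.block_cons (WP.phase hS (WP.block_cons
    (WP.toffoli hS ?_)))))
  refine WP.block_cons (WP.hadamard hS (WP.block_cons (WP.phase hS ?_)))
  refine WP.block_cons (WP.hadamard hS (WP.block_cons (WP.phase hS ?_)))
  refine WP.block_cons (WP.cnot hS (WP.block_cons (WP.toffoli hS (WP.block_cons (WP.toffoli hS ?_)))))
  exact WP.block_nil hQ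

/-- The qubit `y` of step `j` in the current trial. -/
def qubitE (j y : Expr) : Expr := (.var 18 * (nE + 2) + j) * (2 * nE + kE + 4) + y

/-- The control qubit of the current trial. -/
def ctrlE : Expr := qubitE (nE + 1) 0

/-- Put the path qubits into the initial state. -/
def prepareProg : Prog :=
  .forLoop 19 (nE + 1) <| .block [
    .hadamard (qubitE (.var 19) (1 + .mod (.var 19) 2 + nE)),
    .phase (qubitE (.var 19) (1 + .mod (.var 19) 2 + nE)) 1 2,
    .hadamard (qubitE (.var 19) (1 + .mod (.var 19) 2 + nE))]

/-- Apply the controlled operator of the braid. -/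
def braidProg : Prog :=
  .forLoop 20 mE <| .forLoop 21 (kE - 1) <| siteGateProg
    (qubitE (.read 2 (.var 20)) (.var 21 + 1 + nE))
    (qubitE (.read 2 (.var 20) + 2) (.var 21 + 1 + nE)) ctrlE
    (qubitE (.read 2 (.var 20) + 1) (.var 21 + nE))
    (qubitE (.read 2 (.var 20) + 1) (.var 21 + 2 + nE))
    (qubitE (nE + 1) 1) (qubitE (nE + 1) 2) (qubitE (nE + 1) 3)
    (.read 11 (.var 21 + 1)) xE
    (.read 3 (.var 20) * (kE - 2) + (1 - .read 3 (.var 20)) * (kE + 2)) (2 * kE)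

/-- The gates of one trial. -/
def trialGates : Prog :=
  .block [prepareProg, .hadamard ctrlE,
    .phase ctrlE (.var 14 + 3 * kE * .mod (.var 18) 2) (4 * kE), braidProg, .hadamard ctrlE]

theorem qubitE_val {M : Mem} (h0 : M 0 0 = n) (h2 : M 0 2 = k) (ht : M 18 0 = t) (j y : Expr) :
    (qubitE j y).val M = qubit n k t (j.val M) (y.val M) := by
  simp only [qubitE, nE, kE, Expr.val_add, Expr.val_mul, Expr.val_read, Expr.val_var,
    Expr.val_ofNat, ht]
  rw [show M 0 (OfNat.ofNat 0) = n from h0, show M 0 (OfNat.ofNat 2) = k from h2]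
  rfl

theorem ctrlE_val {M : Mem} (h0 : M 0 0 = n) (h2 : M 0 2 = k) (ht : M 18 0 = t) :
    ctrlE.val M = ctrlQubit n k t := by
  rw [ctrlE, qubitE_val h0 h2 ht]
  change qubit n k t (M 0 0 + 1) 0 = _
  rw [h0]; rfl

theorem siteIdx_altPath {j : ℕ} (hj : j ≤ n) : siteIdx (altPath n) j = 1 + j % 2 + n := by
  have h1 := (siteIdx_cast (altPath n) j).1
  rw [siteAfter_altPath hj] at h1
  push_cast at h1
  omega

/-- The initial walk occupies one qubit for each position. Each of them is switched on by a
Hadamard, a sign and a Hadamard gate, which make up `notGate`. -/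
theorem wp_prepareProg (h : Bounds n m k X S Y) {M : Mem} {χ : QState} {Q : Mem → QState → Prop}
    (hM : Params n m k X M) (ht : M 18 0 = t) (hχ : StateBelow n k t χ)
    (hQ : ∀ M', (∀ a ∉ prepareProg.writes, M' a = M a) →
      Q M' (pathState n k t χ (Pi.single (false, altPath n) 1))) :
    WP S Y prepareProg Q M χ := by
  have hS := h.one_le
  have hn : n + 1 ≤ Y := by have := h.le_Y; omega
  obtain ⟨h0, -, h2, -, -⟩ := hM
  refine WP.forFrame hS (fun j _ ψ' => ψ' = setQubits χ ((Finset.range j).image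
    fun j => qubit n k t j (siteIdx (altPath n) j))) (n + 1) (by decide) hn (h.lt_of_le hn) ?_ ?_
    ?_ ?_
  · intro M' hfr
    rw [Expr.val_add, nE, Expr.val_read, hfr 0 (by decide)]
    rw [Expr.val_ofNat, Expr.val_ofNat, show M 0 (OfNat.ofNat 0) = n from h0]
  · rw [Finset.range_zero, Finset.image_empty, setQubits_empty]
  · rintro j hj M₁ ψ₁ hfr hv rfl
    have e0 : M₁ 0 0 = n := by rw [hfr 0 (by decide), h0]
    have e2 : M₁ 0 2 = k := by rw [hfr 0 (by decide), h2]
    have et : M₁ 18 0 = t := by rw [hfr 18 (by decide), ht]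
    have hq : (qubitE (.var 19) (1 + .mod (.var 19) 2 + nE)).val M₁ =
        qubit n k t j (siteIdx (altPath n) j) := by
      rw [qubitE_val e0 e2 et, siteIdx_altPath (by omega)]
      simp only [Expr.val_add, Expr.val_mod, Expr.val_var, Expr.val_ofNat, nE, Expr.val_read, hv]
      rw [show M₁ 0 (OfNat.ofNat 0) = n from e0]
    refine WP.block_cons (WP.hadamard hS (WP.block_cons (WP.phase hS (WP.block_cons
      (WP.hadamard hS (WP.block_nil ?_))))))
    rw [hq, Finset.range_add_one, Finset.image_insert]
    refine notGate_setQubits ?_ fun s hs => (hχ s hs).notMem _ _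
    intro hmem
    obtain ⟨i, hi, e⟩ := Finset.mem_image.1 hmem
    have := (qubit_eq_iff (siteIdx_lt k _ _) (siteIdx_lt k _ _)).1 e
    have := Finset.mem_range.1 hi
    omega
  · rintro M' ψ' hfr rfl
    rw [setQubits_eq_pathState]
    exact hQ M' (frame_of_forLoop hfr)

/-- Amplitudes with the control off never change. With the control on, the rest of the braid applied
to the current amplitudes always equals the whole braid applied to the initial ones; the loop over
sites assembles one crossing. -/
theorem wp_braidProg {B : BraidWord n} (h : Bounds n B.length k X S Y) {M : Mem} {χ : QState}
    {Q : Mem → QState → Prop} {g : Bool × (Fin n → Bool) → ℂ}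
    (hM : Params n B.length k X M) (hB : BraidIn B M) (hA : ∀ z < k, M 11 z = angleNum k X z)
    (ht : M 18 0 = t) (hχ : StateBelow n k t χ)
    (hQ : ∀ M', (∀ a ∉ braidProg.writes, M' a = M a) →
      Q M' (pathState n k t χ fun x => if x.1 = true then
        braidUnitary (approxVec k X) k B (fun p => g (true, p)) x.2 else g x)) :
    WP S Y braidProg Q M (pathState n k t χ g) := by
  have hS := h.one_le
  have hk := h.hk
  have hm : B.length ≤ Y := by have := h.le_Y; omega
  have hkY : k ≤ Y := by have := h.le_Y; omega
  obtain ⟨h0, h1, h2, h5, -⟩ := hM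
  refine WP.forFrame hS (fun l _ ψ' => ∃ g' : Bool × (Fin n → Bool) → ℂ,
    ψ' = pathState n k t χ g' ∧ (∀ p, g' (false, p) = g (false, p)) ∧
    braidUnitary (approxVec k X) k (B.drop l) (fun p => g' (true, p)) =
      braidUnitary (approxVec k X) k B (fun p => g (true, p)))
    B.length (by decide) hm (h.lt_of_le hm) ?_ ⟨g, rfl, fun _ => rfl, rfl⟩ ?_ ?_
  · intro M' hfr
    rw [mE, Expr.val_read, hfr 0 (by decide)]; exact h1
  · rintro l hl M₁ ψ₁ hfr hv ⟨g', rfl, hg', hU⟩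
    have e0 : M₁ 0 0 = n := by rw [hfr 0 (by decide), h0]
    have e2 : M₁ 0 2 = k := by rw [hfr 0 (by decide), h2]
    have e5 : M₁ 5 0 = X := by rw [hfr 5 (by decide), h5]
    have et : M₁ 18 0 = t := by rw [hfr 18 (by decide), ht]
    have ei : M₁ 2 l = B[l].i := by rw [hfr 2 (by decide), hB.1 l hl]
    have ep : M₁ 3 l = B[l].pos.toNat := by rw [hfr 3 (by decide), hB.2 l hl]
    have ea : M₁ 11 = M 11 := hfr 11 (by decide)
    rw [List.drop_eq_getElem_cons hl, braidUnitary] at hU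
    set c := B[l] with hc
    set w := crossingTurn k c.pos - 1 with hw
    refine WP.forFrame hS (fun J _ ψ' => ψ' = pathState n k t χ
      (crossAct (cutVec (approxVec k X) J) w c g')) (k - 1) (by decide) (by omega)
      (h.lt_of_le (by omega)) ?_ ?_ ?_ ?_
    · intro M' hfr'
      rw [Expr.val_sub, kE, Expr.val_read, hfr' 0 (by decide), Expr.val_ofNat, Expr.val_ofNat]
      rw [show M₁ 0 (OfNat.ofNat 2) = k from e2]
    · rw [crossAct_of_zero]
      intro z b
      rw [cutVec]
      split_ifs with hz
      · rw [approxVec, if_neg (by push_cast at hz; omega)]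
      · rfl
    · rintro J hJ M₂ ψ₂ hfr' hv' rfl
      have e0' : M₂ 0 0 = n := by rw [hfr' 0 (by decide), e0]
      have e2' : M₂ 0 2 = k := by rw [hfr' 0 (by decide), e2]
      have e5' : M₂ 5 0 = X := by rw [hfr' 5 (by decide), e5]
      have et' : M₂ 18 0 = t := by rw [hfr' 18 (by decide), et]
      have ev' : M₂ 20 0 = l := by rw [hfr' 20 (by decide), hv]
      have ei' : M₂ 2 l = c.i := by rw [hfr' 2 (by decide), ei]
      have ep' : M₂ 3 l = c.pos.toNat := by rw [hfr' 3 (by decide), ep]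
      have ea' : M₂ 11 (J + 1) = angleNum k X (J + 1) := by
        rw [hfr' 11 (by decide), ea, hA _ (by omega)]
      have e0'' : M₂ 0 (OfNat.ofNat 0) = n := e0'
      have e2'' : M₂ 0 (OfNat.ofNat 2) = k := e2'
      refine wp_siteGateProg hS ?_
      simp only [qubitE_val e0' e2' et', ctrlE_val e0' e2' et', Expr.val_add, Expr.val_sub,
        Expr.val_mul, Expr.val_read, Expr.val_var, Expr.val_ofNat, nE, kE, xE, e0'', e2'', e5',
        ev', ei', ep', hv', ea']
      have hact := siteGate_pathState hχ c (z := J + 1) (x := angleNum k X (J + 1)) (X := X)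
        (y := c.pos.toNat * (k - 2) + (1 - c.pos.toNat) * (k + 2)) (Z := 2 * k) (by omega)
        (by omega) (by have := angleNum_le k X (J + 1); omega) h.hX
        (crossAct (cutVec (approxVec k X) J) w c g')
      rw [Nat.add_sub_cancel] at hact
      refine hact.trans ?_
      have hturn : turn (c.pos.toNat * (k - 2) + (1 - c.pos.toNat) * (k + 2)) (2 * k) - 1 = w := by
        rw [hw, crossingTurn]
        cases c.pos <;> simp
      have hvec : rotVec (angleNum k X (J + 1)) X = approxVec k X ((J : ℤ) + 1) := by
        funext b
        rw [approxVec, if_pos (by omega)]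
        congr 1
      rw [hturn, hvec]
      push_cast
      rw [siteAct_crossAct]
    · rintro M' ψ' hfr' rfl
      refine ⟨_, rfl, fun p => ?_, ?_⟩
      · rw [crossAct, if_neg (by simp), hg']
      · rw [← hU]
        congr 1
        funext p
        rw [crossAct, if_pos rfl]
        congr 1
        -- The local vectors vanish beyond site k − 1, so cutting them off there changes nothing.
        funext z b
        rw [cutVec]
        split_ifs with hz
        · rfl
        · rw [approxVec, if_neg (by omega)]
  · rintro M' ψ' hfr ⟨g', rfl, hg', hU⟩
    have := hQ M' (frame_of_forLoop hfr)
    rw [List.drop_length, braidUnitary] at hU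
    convert this using 2
    funext ⟨b, p⟩
    cases b
    · rw [hg']; simp
    · simp only [if_true]
      exact congrFun hU p

/-- The vector whose overlap with the initial state is estimated in trial `t`. -/
noncomputable def testVec (k X t : ℕ) (B : BraidWord n) (o : Fin n → Bool) : (Fin n → Bool) → ℂ :=
  turn (braidPhase k B o + 3 * k * (t % 2)) (4 * k) •
    braidUnitary (approxVec k X) k B (Pi.single (altPath n) 1)

theorem l2_smul_turn (a b : ℕ) (f : (Fin n → Bool) → ℂ) : l2 (turn a b • f) = l2 f := by
  unfold l2
  rw [WithLp.toLp_smul, norm_smul, norm_turn, one_mul]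

theorem l2_testVec (k X t : ℕ) (B : BraidWord n) (o : Fin n → Bool) :
    l2 (testVec k X t B o) = 1 := by
  rw [testVec, l2_smul_turn, l2_braidUnitary (isUnitFamily_approxVec k X), l2_single]

/-- A Hadamard test for the braid operator. The phase gate on the control supplies the total phase
of the diagram and, in odd trials, a factor −i that exchanges the imaginary part for the real part.
-/
theorem wp_trialGates {B : BraidWord n} (h : Bounds n B.length k X S Y) {M : Mem} {χ : QState}
    {Q : Mem → QState → Prop} {o : Fin n → Bool}
    (hM : Params n B.length k X M) (hB : BraidIn B M) (hA : ∀ z < k, M 11 z = angleNum k X z)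
    (hP : M 14 0 = braidPhase k B o) (ht : M 18 0 = t) (hχ : StateBelow n k t χ)
    (hQ : ∀ M', (∀ a ∉ [19, 20, 21], M' a = M a) →
      Q M' (pathState n k t χ (testAmp (testVec k X t B o)))) :
    WP S Y trialGates Q M χ := by
  have hS := h.one_le
  have hw1 : ∀ a ∉ [19, 20, 21], a ∉ prepareProg.writes := by
    intro a ha hm
    have : prepareProg.writes = [19, 19] := by decide
    rw [this] at hm; simp at ha hm; omega
  have hw2 : ∀ a ∉ [19, 20, 21], a ∉ braidProg.writes := by
    intro a ha hm
    have : braidProg.writes = [20, 21, 21, 20] := by decide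
    rw [this] at hm; simp at ha hm; omega
  refine WP.block_cons (wp_prepareProg h hM ht hχ fun M₁ hfr₁ => ?_)
  have f1 : ∀ a ∉ [19, 20, 21], M₁ a = M a := fun a ha => hfr₁ a (hw1 a ha)
  obtain ⟨h0, h1, h2, h5, h6⟩ := hM
  have e0 : M₁ 0 0 = n := by rw [f1 0 (by decide), h0]
  have e1 : M₁ 0 1 = B.length := by rw [f1 0 (by decide), h1]
  have e2 : M₁ 0 2 = k := by rw [f1 0 (by decide), h2]
  have e5 : M₁ 5 0 = X := by rw [f1 5 (by decide), h5]
  have e6 : M₁ 6 0 = 2 * k * X := by rw [f1 6 (by decide), h6]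
  have et : M₁ 18 0 = t := by rw [f1 18 (by decide), ht]
  have e14 : M₁ 14 0 = braidPhase k B o := by rw [f1 14 (by decide), hP]
  refine WP.block_cons (WP.hadamard hS (WP.block_cons (WP.phase hS (WP.block_cons ?_))))
  rw [ctrlE_val e0 e2 et]
  have hy : (Expr.var 14 + 3 * kE * .mod (.var 18) 2).val M₁ =
      braidPhase k B o + 3 * k * (t % 2) := by
    simp only [Expr.val_add, Expr.val_mul, Expr.val_mod, Expr.val_var, Expr.val_ofNat, kE,
      Expr.val_read, e14, et]
    rw [show M₁ 0 (OfNat.ofNat 2) = k from e2]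
  have hZ : (4 * kE).val M₁ = 4 * k := by
    rw [Expr.val_mul, kE, Expr.val_read, Expr.val_ofNat, Expr.val_ofNat,
      show M₁ 0 (OfNat.ofNat 2) = k from e2]
  rw [hy, hZ, hadamard_eq, phase_eq, hadamardₗ_eq_gateOne, phaseₗ_eq_gateOne,
    gateOne_pathState hχ, gateOne_pathState hχ]
  refine wp_braidProg h ⟨e0, e1, e2, e5, e6⟩ ?_ ?_ et hχ fun M₂ hfr₂ => ?_
  · constructor
    · intro j hj; rw [f1 2 (by decide)]; exact hB.1 j hj
    · intro j hj; rw [f1 3 (by decide)]; exact hB.2 j hj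
  · intro z hz; rw [f1 11 (by decide)]; exact hA z hz
  have f2 : ∀ a ∉ [19, 20, 21], M₂ a = M a := fun a ha => by rw [hfr₂ a (hw2 a ha), f1 a ha]
  refine WP.block_cons (WP.hadamard hS (WP.block_nil ?_))
  rw [ctrlE_val (by rw [f2 0 (by decide), h0]) (by rw [f2 0 (by decide), h2])
    (by rw [f2 18 (by decide), ht]), hadamard_eq, hadamardₗ_eq_gateOne, gateOne_pathState hχ]
  convert hQ M₂ f2 using 2
  funext ⟨b, p⟩
  have hr := inv_sqrt_two_mul_self
  set y := braidPhase k B o + 3 * k * (t % 2)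
  have hs : ∀ (q : Fin n → Bool) (a : Bool), (Pi.single (false, altPath n) 1 :
      Bool × (Fin n → Bool) → ℂ) (a, q) =
      if a then 0 else (Pi.single (altPath n) 1 : (Fin n → Bool) → ℂ) q := by
    intro q a
    simp only [Pi.single_apply, Prod.mk.injEq]
    cases a <;> simp
  simp only [hs, if_true, Bool.false_eq_true, if_false, diagMatrix, hadamardMatrix,
    Bool.true_eq_false, Bool.and_false, Bool.and_true, mul_zero, add_zero, zero_mul, mul_one, one_mul,
    zero_add]
  have hsm : (fun p => turn y (4 * k) * ((Real.sqrt 2 : ℂ)⁻¹ *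
      (Pi.single (altPath n) 1 : (Fin n → Bool) → ℂ) p)) =
      (turn y (4 * k) * (Real.sqrt 2 : ℂ)⁻¹) • (Pi.single (altPath n) 1 : (Fin n → Bool) → ℂ) := by
    funext p; simp only [Pi.smul_apply, smul_eq_mul]; ring
  simp only [hsm, braidUnitary_smul, Pi.smul_apply, smul_eq_mul, testAmp, testVec]
  generalize braidUnitary (approxVec k X) k B (Pi.single (altPath n) 1) p = F
  generalize (Pi.single (altPath n) 1 : (Fin n → Bool) → ℂ) p = D
  generalize (Real.sqrt 2 : ℂ)⁻¹ = r at hr ⊢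
  cases b
  · simp only [Bool.false_eq_true, if_false]
    linear_combination (D + turn y (4 * k) * F) * hr
  · simp only [if_true]
    linear_combination (D - turn y (4 * k) * F) * hr

end

end Jones


/-! ## Repeated trials -/

open QState

theorem Exec.seq_single {P P' : Prog} {c c₁ : Config} {L : List Config} (h : Exec P c [c₁])
    (h' : Exec P' c₁ L) : Exec (.seq P P') c L := by
  have := Exec.seq P P' c [c₁] (fun _ => L) h (by
    intro c' hc; rw [List.mem_singleton.1 hc]; exact h')
  simpa using this

/-- The continuation is a function of the configuration, so the two branches must be distinct to be
continued separately. -/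
theorem Exec.seq_pair {P P' : Prog} {c c₁ c₂ : Config} {L₁ L₂ : List Config} (h : Exec P c [c₁, c₂])
    (hne : c₁ ≠ c₂) (h₁ : Exec P' c₁ L₁) (h₂ : Exec P' c₂ L₂) :
    Exec (.seq P P') c (L₁ ++ L₂) := by
  classical
  have := Exec.seq P P' c [c₁, c₂] (fun x => if x = c₁ then L₁ else L₂) h (by
    intro c' hc
    simp only [List.mem_cons, List.not_mem_nil, or_false] at hc
    rcases hc with rfl | rfl
    · rw [if_pos rfl]; exact h₁
    · rw [if_neg (Ne.symm hne)]; exact h₂)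
  simpa [Ne.symm hne] using this

theorem Exec.loop_pair {x : Expr} {P : Prog} {c c₁ c₂ : Config} {L₁ L₂ : List Config}
    (hx : c.val x ≠ 0) (h : Exec P (c.tick (1 + c.cost x)) [c₁, c₂])
    (hne : c₁ ≠ c₂) (h₁ : Exec (.loop x P) c₁ L₁) (h₂ : Exec (.loop x P) c₂ L₂) :
    Exec (.loop x P) c (L₁ ++ L₂) := by
  classical
  have := Exec.loop_step x P c [c₁, c₂] (fun x => if x = c₁ then L₁ else L₂) hx h (by
    intro c' hc
    simp only [List.mem_cons, List.not_mem_nil, or_false] at hc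
    rcases hc with rfl | rfl
    · rw [if_pos rfl]; exact h₁
    · rw [if_neg (Ne.symm hne)]; exact h₂)
  simpa [Ne.symm hne] using this

namespace Jones

/-- One trial: the gates, the measurement, and the update of the counters. -/
def trialProg : Prog :=
  .seq trialGates (.seq (.measure ctrlE 22 0) (.block [
    .write 23 (.mod (.var 18) 2) (.read 23 (.mod (.var 18) 2) + .var 22),
    .set 18 (.var 18 + 1)]))

/-- The loop over all trials. -/
def trialLoop : Prog := .loop (.lt (.var 18) (2 * xE)) trialProg

/-- What the classical precomputation has put into the memory. -/
structure Prepared {n : ℕ} (B : BraidWord n) (o : Fin n → Bool) (k X : ℕ) (M : Mem) : Prop where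
  params : Params n B.length k X M
  braid : BraidIn B M
  angles : ∀ z < k, M 11 z = angleNum k X z
  phase : M 14 0 = braidPhase k B o
  table : ∀ a ≤ 2 * k * X, M 7 a = sineTable (2 * k * X) X a

section
variable {n k X S Y t : ℕ} {B : BraidWord n} {o : Fin n → Bool}

theorem Prepared.frame {M M' : Mem} (h : Prepared B o k X M)
    (hfr : ∀ a ∈ [0, 2, 3, 5, 6, 7, 11, 14], M' a = M a) : Prepared B o k X M' := by
  obtain ⟨⟨h0, h1, h2, h5, h6⟩, hb, ha, hp, ht⟩ := h
  refine ⟨⟨?_, ?_, ?_, ?_, ?_⟩, ⟨fun j hj => ?_, fun j hj => ?_⟩, fun z hz => ?_, ?_,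
    fun a ha => ?_⟩
  · rw [hfr 0 (by decide), h0]
  · rw [hfr 0 (by decide), h1]
  · rw [hfr 0 (by decide), h2]
  · rw [hfr 5 (by decide), h5]
  · rw [hfr 6 (by decide), h6]
  · rw [hfr 2 (by decide), hb.1 j hj]
  · rw [hfr 3 (by decide), hb.2 j hj]
  · rw [hfr 11 (by decide), ha z hz]
  · rw [hfr 14 (by decide), hp]
  · rw [hfr 7 (by decide), ht a ha]

/-- The situation before trial `t`. -/
structure TrialInv (B : BraidWord n) (o : Fin n → Bool) (k X S t : ℕ) (M : Mem) (ψ : QState) :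
    Prop where
  bound : MemBd S M
  prepared : Prepared B o k X M
  index : M 18 0 = t
  below : StateBelow n k t ψ
  count_zero : M 23 0 ≤ (t + 1) / 2
  count_one : M 23 1 ≤ t / 2

/-- The probability of the outcome `1` in trial `t`. -/
noncomputable def trialProb (B : BraidWord n) (o : Fin n → Bool) (k X t : ℕ) : ℝ :=
  (1 - (testVec k X t B o (altPath n)).re) / 2

theorem trialProb_mem (B : BraidWord n) (o : Fin n → Bool) (k X t : ℕ) :
    0 ≤ trialProb B o k X t ∧ trialProb B o k X t ≤ 1 := by
  have h1 := norm_le_l2 (testVec k X t B o) (altPath n)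
  rw [l2_testVec] at h1
  have h2 := abs_le.1 ((Complex.abs_re_le_norm _).trans h1)
  unfold trialProb
  constructor <;> linarith

theorem normSq_project_testAmp {χ : QState} (hχ : StateBelow n k t χ) {f : (Fin n → Bool) → ℂ}
    (hf : l2 f = 1) (b : Bool) :
    normSq (project (ctrlQubit n k t) b (pathState n k t χ (testAmp f))) =
      normSq χ * ((1 + (if b then -1 else 1) * (f (altPath n)).re) / 2) := by
  rw [project_pathState hχ, normSq_pathState hχ, ← sum_testAmp hf b, Fintype.sum_prod_type]
  congr 1
  cases b <;> simp

/-- The stored outcome keeps the two branches distinct. Their weights are squared norms of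
projections, which factor into the weight of the parent and the probability of the outcome. -/
theorem exec_trialProg (h : Bounds n B.length k X S Y) {M : Mem} {ψ : QState} (T : ℕ)
    (hI : TrialInv B o k X S t M ψ) (ht : t < 2 * X) :
    ∃ c : Bool → Config, c false ≠ c true ∧ Exec trialProg ⟨M, ψ, T⟩ [c false, c true] ∧
      ∀ b, TrialInv B o k X S (t + 1) (c b).mem (c b).qstate ∧
        (c b).time ≤ T + trialProg.timeBound S Y ∧
        (c b).weight = normSq ψ *
          (if b then trialProb B o k X t else 1 - trialProb B o k X t) ∧
        (c b).mem 23 0 = M 23 0 + (if t % 2 = 0 then b.toNat else 0) ∧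
        (c b).mem 23 1 = M 23 1 + (if t % 2 = 1 then b.toNat else 0) := by
  have hS := h.one_le
  have hXY : 2 * X + 2 ≤ Y := by have := h.le_Y; omega
  have hw : WP S Y trialGates (fun M' ψ' => (∀ a ∉ [19, 20, 21], M' a = M a) ∧
      ψ' = pathState n k t ψ (testAmp (testVec k X t B o))) M ψ :=
    wp_trialGates h hI.prepared.params hI.prepared.braid hI.prepared.angles hI.prepared.phase
      hI.index hI.below fun M' hfr => ⟨hfr, rfl⟩
  obtain ⟨M₁, ψ₁, T₁, hex, hT₁, hbd₁, -, hfr, rfl⟩ := hw hI.bound T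
  set f := testVec k X t B o
  have hctrl : ctrlE.val M₁ = ctrlQubit n k t := ctrlE_val
    (by rw [hfr 0 (by decide)]; exact hI.prepared.params.1)
    (by rw [hfr 0 (by decide)]; exact hI.prepared.params.2.2.1)
    (by rw [hfr 18 (by decide)]; exact hI.index)
  have e18 : M₁ 18 0 = t := by rw [hfr 18 (by decide)]; exact hI.index
  have e23 : M₁ 23 = M 23 := hfr 23 (by decide)
  have hm := Exec.measure ctrlE 22 0 ⟨M₁, pathState n k t ψ (testAmp f), T₁⟩
  set τ := 1 + ctrlE.cost M₁ + (0 : Expr).cost M₁ with hτ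
  have hτb : τ ≤ (Prog.measure ctrlE 22 0).timeBound S Y := by
    have h1 := ctrlE.cost_le hS hbd₁
    have h2 := (0 : Expr).cost_le hS hbd₁
    simp only [Prog.timeBound]
    omega
  set W := Prog.block [.write 23 (.mod (.var 18) 2) (.read 23 (.mod (.var 18) 2) + .var 22),
    .set 18 (.var 18 + 1)] with hW
  have hbr : ∀ b : Bool, ∃ M' T', Exec W ⟨memSet M₁ 22 0 b.toNat,
        project (ctrlQubit n k t) b (pathState n k t ψ (testAmp f)), T₁ + τ⟩
        [⟨M', project (ctrlQubit n k t) b (pathState n k t ψ (testAmp f)), T'⟩] ∧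
      T' ≤ T₁ + τ + W.timeBound S Y ∧ MemBd S M' ∧
      M' = memSet (memSet (memSet M₁ 22 0 b.toNat) 23 (t % 2) (M 23 (t % 2) + b.toNat))
        18 0 (t + 1) := by
    intro b
    have hb : b.toNat ≤ 1 := Bool.toNat_le b
    have hcnt : M 23 (t % 2) ≤ t := by
      rcases Nat.mod_two_eq_zero_or_one t with e | e
      · rw [e]; have := hI.count_zero; omega
      · rw [e]; have := hI.count_one; omega
    have v0 : (Expr.mod (.var 18) 2).val (memSet M₁ 22 0 b.toNat) = t % 2 := by
      rw [Expr.val_mod, Expr.val_var, Expr.val_ofNat, memSet_of_ne _ _ _ (by decide), e18]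
    have v1 : (Expr.read 23 (.mod (.var 18) 2) + .var 22).val (memSet M₁ 22 0 b.toNat) =
        M 23 (t % 2) + b.toNat := by
      rw [Expr.val_add, Expr.val_read, v0, Expr.val_var, memSet_of_ne _ _ _ (by decide), e23]
      simp [memSet_apply]
    have v2 : (Expr.var 18 + 1).val (memSet (memSet M₁ 22 0 b.toNat) 23 (t % 2)
        (M 23 (t % 2) + b.toNat)) = t + 1 := by
      rw [Expr.val_add, Expr.val_var, Expr.val_ofNat, memSet_of_ne _ _ _ (by decide),
        memSet_of_ne _ _ _ (by decide), e18]
    have hWP : WP S Y W (fun M' ψ' => ψ' = project (ctrlQubit n k t) b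
        (pathState n k t ψ (testAmp f)) ∧ M' = memSet (memSet (memSet M₁ 22 0 b.toNat) 23 (t % 2)
          (M 23 (t % 2) + b.toNat)) 18 0 (t + 1)) (memSet M₁ 22 0 b.toNat)
        (project (ctrlQubit n k t) b (pathState n k t ψ (testAmp f))) := by
      refine WP.block_cons (WP.write hS ?_ (WP.block_cons (WP.set hS ?_ (WP.block_nil ⟨rfl, ?_⟩))))
      · rw [v1]; exact h.lt_of_le (by omega)
      · rw [v0, v1, v2]; exact h.lt_of_le (by omega)
      · rw [v0, v1, v2]
    obtain ⟨M', ψ', T', k1, k2, k3, -, rfl, k5⟩ := hWP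
      (hbd₁.memSet 22 0 (h.lt_of_le (by omega))) (T₁ + τ)
    exact ⟨M', T', k1, k2, k3, k5⟩
  choose M' T' hW1 hW2 hW3 hW4 using hbr
  refine ⟨fun b => ⟨M' b, project (ctrlQubit n k t) b (pathState n k t ψ (testAmp f)), T' b⟩,
    ?_, ?_, fun b => ⟨?_, ?_, ?_, ?_, ?_⟩⟩
  · intro e
    have e1 := congrArg (fun c : Config => c.mem 22 0) e
    simp only [hW4, memSet_apply] at e1
    simp at e1
  · refine Exec.seq_single hex (Exec.seq_pair (L₁ := [_]) (L₂ := [_]) hm ?_ ?_ ?_)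
    · intro e
      have e1 := congrArg (fun c : Config => c.mem 22 0) e
      simp [Config.outcome, Config.store, Config.gate, Config.tick, Config.val, Expr.val_ofNat]
        at e1
    · have := hW1 false
      rw [← hctrl] at this ⊢
      exact this
    · have := hW1 true
      rw [← hctrl] at this ⊢
      exact this
  · have hfr' : ∀ a ∉ [18, 19, 20, 21, 22, 23], M' b a = M a := by
      intro a ha
      simp only [List.mem_cons, List.not_mem_nil, or_false, not_or] at ha
      rw [hW4, memSet_of_ne _ _ _ ha.1, memSet_of_ne _ _ _ ha.2.2.2.2.2,
        memSet_of_ne _ _ _ ha.2.2.2.2.1]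
      exact hfr a (by simp; exact ⟨ha.2.1, ha.2.2.1, ha.2.2.2.1⟩)
    have hb : b.toNat ≤ 1 := Bool.toNat_le b
    have hc0 := hI.count_zero
    have hc1 := hI.count_one
    refine ⟨hW3 b, hI.prepared.frame fun a ha => hfr' a ?_, ?_, ?_, ?_, ?_⟩
    · intro hm
      simp only [List.mem_cons, List.not_mem_nil, or_false] at ha hm
      omega
    · simp only [hW4, memSet_apply]; simp
    · dsimp only
      rw [project_pathState hI.below]
      exact hI.below.pathState _
    · simp only [hW4, memSet_apply, e23]
      simp only [Nat.reduceEqDiff, false_and, if_false, true_and]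
      split_ifs with e
      · rw [← e]; omega
      · omega
    · simp only [hW4, memSet_apply, e23]
      simp only [Nat.reduceEqDiff, false_and, if_false, true_and]
      split_ifs with e
      · rw [← e]; omega
      · omega
  · have := hW2 b
    have htb : trialProg.timeBound S Y = trialGates.timeBound S Y +
        ((Prog.measure ctrlE 22 0).timeBound S Y + W.timeBound S Y) := rfl
    dsimp only
    omega
  · change normSq _ = _
    rw [normSq_project_testAmp hI.below (l2_testVec k X t B o)]
    congr 1
    unfold trialProb
    cases b <;> simp <;> ring
  · simp only [hW4, memSet_apply, e23]
    simp only [Nat.reduceEqDiff, false_and, if_false, true_and]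
    by_cases e : t % 2 = 0
    · rw [if_pos e.symm, if_pos e, e]
    · rw [if_neg (Ne.symm e), if_neg e, add_zero]
  · simp only [hW4, memSet_apply, e23]
    simp only [Nat.reduceEqDiff, false_and, if_false, true_and]
    by_cases e : t % 2 = 1
    · rw [if_pos e.symm, if_pos e, e]
    · rw [if_neg (Ne.symm e), if_neg e, add_zero]

/-- `Φ` is a supermartingale along the trials, as a function of time and of the two counters. -/
def IsSuper (B : BraidWord n) (o : Fin n → Bool) (k X : ℕ) (Φ : ℕ → ℕ → ℕ → ℝ) : Prop :=
  ∀ t < 2 * X, ∀ a b, (1 - trialProb B o k X t) * Φ (t + 1) a b +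
    trialProb B o k X t * Φ (t + 1) (a + if t % 2 = 0 then 1 else 0)
      (b + if t % 2 = 1 then 1 else 0) ≤ Φ t a b

theorem normSq_nonneg (ψ : QState) : 0 ≤ normSq ψ :=
  Finset.sum_nonneg fun _ _ => sq_nonneg _

/-- Each branching distributes the weight according to the outcome probabilities, so the weighted
sum of Φ over the branches cannot grow. Having this for all Φ at once reduces every later statement
about probabilities to a choice of Φ. -/
theorem exec_trialLoop (h : Bounds n B.length k X S Y) (r : ℕ) :
    ∀ t M ψ T, t + r = 2 * X → TrialInv B o k X S t M ψ →
    ∃ L, Exec trialLoop ⟨M, ψ, T⟩ L ∧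
      (∀ c ∈ L, TrialInv B o k X S (2 * X) c.mem c.qstate ∧ c.time ≤ T + (r + 1) *
        (1 + (Expr.lt (.var 18) (2 * xE)).costFactor * S + trialProg.timeBound S Y)) ∧
      ∀ Φ, IsSuper B o k X Φ →
        (L.map fun c => c.weight * Φ (2 * X) (c.mem 23 0) (c.mem 23 1)).sum ≤
          normSq ψ * Φ t (M 23 0) (M 23 1) := by
  have hS := h.one_le
  have hval : ∀ t M ψ, TrialInv B o k X S t M ψ →
      (Expr.lt (.var 18) (2 * xE)).val M = if t < 2 * X then 1 else 0 := by
    intro t M ψ hI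
    rw [Expr.val_less, Expr.val_var, hI.index, Expr.val_mul, xE, Expr.val_var,
      hI.prepared.params.2.2.2.1, Expr.val_ofNat]
  induction r with
  | zero =>
    intro t M ψ T htr hI
    rw [add_zero] at htr
    subst htr
    refine ⟨_, Exec.loop_stop _ _ ⟨M, ψ, T⟩ ?_, ?_, fun Φ _ => ?_⟩
    · rw [Config.val, hval _ M ψ hI, if_neg (lt_irrefl _)]
    · intro c hc
      rw [List.mem_singleton.1 hc]
      refine ⟨hI, ?_⟩
      have := (Expr.lt (.var 18) (2 * xE)).cost_le hS hI.bound
      simp only [Config.tick, Config.cost]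
      omega
    · simp [Config.tick, Config.weight]
  | succ r ih =>
    intro t M ψ T htr hI
    set C := 1 + (Expr.lt (.var 18) (2 * xE)).costFactor * S + trialProg.timeBound S Y
    obtain ⟨c, hne, hex, hc⟩ := exec_trialProg h
      (T + (1 + (Expr.lt (.var 18) (2 * xE)).cost M)) hI (by omega)
    obtain ⟨L₀, hL₀, hL₀', hΦ₀⟩ := ih (t + 1) (c false).mem (c false).qstate (c false).time
      (by omega) (hc false).1
    obtain ⟨L₁, hL₁, hL₁', hΦ₁⟩ := ih (t + 1) (c true).mem (c true).qstate (c true).time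
      (by omega) (hc true).1
    have hcost := (Expr.lt (.var 18) (2 * xE)).cost_le hS hI.bound
    have htime : ∀ b, (c b).time ≤ T + C := fun b => by
      have := (hc b).2.1; omega
    refine ⟨L₀ ++ L₁, Exec.loop_pair ?_ hex hne hL₀ hL₁, ?_, fun Φ hΦ => ?_⟩
    · rw [Config.val, hval _ M ψ hI, if_pos (by omega)]; norm_num
    · intro c' hc'
      have e : (r + 1 + 1) * C = C + (r + 1) * C := by ring
      rcases List.mem_append.1 hc' with h' | h'
      · have := hL₀' c' h'
        have := htime false
        exact ⟨(hL₀' c' h').1, by omega⟩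
      · have := hL₁' c' h'
        have := htime true
        exact ⟨(hL₁' c' h').1, by omega⟩
    · rw [List.map_append, List.sum_append]
      refine (add_le_add (hΦ₀ Φ hΦ) (hΦ₁ Φ hΦ)).trans ?_
      have w0 : normSq (c false).qstate = _ := (hc false).2.2.1
      have w1 : normSq (c true).qstate = _ := (hc true).2.2.1
      rw [w0, w1, (hc false).2.2.2.1, (hc false).2.2.2.2, (hc true).2.2.2.1, (hc true).2.2.2.2]
      have := mul_le_mul_of_nonneg_left (hΦ t (by omega) (M 23 0) (M 23 1)) (normSq_nonneg ψ)
      refine le_trans (le_of_eq ?_) this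
      simp only [Bool.toNat_false, Bool.toNat_true, ite_self, add_zero, Bool.false_eq_true,
        if_false, if_true]
      ring

end

end Jones


/-! ## Concentration -/

open QState

theorem exp_le_one_add_add_sq {x : ℝ} (hx : |x| ≤ 1) : Real.exp x ≤ 1 + x + x ^ 2 := by
  have := (abs_le.1 (Real.abs_exp_sub_one_sub_id_le hx)).2
  linarith

/-- Bounding e^l by 1 + l + l² and using p ≤ 1 gives 1 + lp + l², which is at most its exponential
form. -/
theorem mgf_le {p l : ℝ} (h0 : 0 ≤ p) (h1 : p ≤ 1) (hl : |l| ≤ 1) :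
    (1 - p) + p * Real.exp l ≤ Real.exp (l * p + l ^ 2) := by
  have h2 := mul_le_mul_of_nonneg_left (exp_le_one_add_add_sq hl) h0
  have h3 := Real.add_one_le_exp (l * p + l ^ 2)
  have h4 := mul_le_mul_of_nonneg_right h1 (sq_nonneg l)
  linarith

namespace Jones

section
variable {n k X S Y t : ℕ} {B : BraidWord n} {o : Fin n → Bool}

theorem trialProb_mod (B : BraidWord n) (o : Fin n → Bool) (k X t : ℕ) :
    trialProb B o k X t = trialProb B o k X (t % 2) := by
  unfold trialProb testVec; rw [Nat.mod_mod]

/-- The exponential of the counter is compensated by the bound of `mgf_le` for each of the X −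
(t+1)/2 even trials still to come; odd trials change nothing. The constant s only normalizes. -/
theorem isSuper_zero {l : ℝ} (hl : |l| ≤ 1) (s : ℝ) :
    IsSuper B o k X fun t a _ => Real.exp (l * a - s +
      (l * trialProb B o k X 0 + l ^ 2) * ((X - (t + 1) / 2 : ℕ) : ℝ)) := by
  intro t ht a b
  by_cases e : t % 2 = 0
  · simp only [e, if_true]
    rw [trialProb_mod B o k X t, e]
    set p := trialProb B o k X 0
    obtain ⟨h0, h1⟩ := trialProb_mem B o k X 0
    have er : X - (t + 1) / 2 = (X - (t + 1 + 1) / 2) + 1 := by omega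
    rw [er]
    push_cast
    set R : ℝ := ((X - (t + 1 + 1) / 2 : ℕ) : ℝ)
    have hm := mul_le_mul_of_nonneg_left (mgf_le h0 h1 hl)
      (Real.exp_pos (l * a - s + (l * p + l ^ 2) * R)).le
    have e1 : Real.exp (l * (a + 1) - s + (l * p + l ^ 2) * R) =
        Real.exp (l * a - s + (l * p + l ^ 2) * R) * Real.exp l := by
      rw [← Real.exp_add]; ring_nf
    have e2 : Real.exp (l * a - s + (l * p + l ^ 2) * (R + 1)) =
        Real.exp (l * a - s + (l * p + l ^ 2) * R) * Real.exp (l * p + l ^ 2) := by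
      rw [← Real.exp_add]; ring_nf
    rw [e1, e2]
    refine le_trans (le_of_eq ?_) hm
    ring
  · have er : X - (t + 1 + 1) / 2 = X - (t + 1) / 2 := by omega
    simp only [e, if_false, add_zero, er]
    apply le_of_eq; ring

/-- As for the even trials; X − t/2 odd ones are still to come before trial t. -/
theorem isSuper_one {l : ℝ} (hl : |l| ≤ 1) (s : ℝ) :
    IsSuper B o k X fun t _ b => Real.exp (l * b - s +
      (l * trialProb B o k X 1 + l ^ 2) * ((X - t / 2 : ℕ) : ℝ)) := by
  intro t ht a b
  by_cases e : t % 2 = 1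
  · simp only [e, if_true]
    rw [trialProb_mod B o k X t, e]
    set p := trialProb B o k X 1
    obtain ⟨h0, h1⟩ := trialProb_mem B o k X 1
    have er : X - t / 2 = (X - (t + 1) / 2) + 1 := by omega
    rw [er]
    push_cast
    set R : ℝ := ((X - (t + 1) / 2 : ℕ) : ℝ)
    have hm := mul_le_mul_of_nonneg_left (mgf_le h0 h1 hl)
      (Real.exp_pos (l * b - s + (l * p + l ^ 2) * R)).le
    have e1 : Real.exp (l * (b + 1) - s + (l * p + l ^ 2) * R) =
        Real.exp (l * b - s + (l * p + l ^ 2) * R) * Real.exp l := by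
      rw [← Real.exp_add]; ring_nf
    have e2 : Real.exp (l * b - s + (l * p + l ^ 2) * (R + 1)) =
        Real.exp (l * b - s + (l * p + l ^ 2) * R) * Real.exp (l * p + l ^ 2) := by
      rw [← Real.exp_add]; ring_nf
    rw [e1, e2]
    refine le_trans (le_of_eq ?_) hm
    ring
  · have er : X - (t + 1) / 2 = X - t / 2 := by omega
    simp only [e, if_false, add_zero, er]
    apply le_of_eq; ring

/-- Both relative frequencies are close to the probabilities. -/
def GoodCounts (B : BraidWord n) (o : Fin n → Bool) (k X : ℕ) (η : ℝ) (M : Mem) : Prop :=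
  |(M 23 0 : ℝ) - X * trialProb B o k X 0| ≤ X * η ∧
    |(M 23 1 : ℝ) - X * trialProb B o k X 1| ≤ X * η

/-- Chernoff bounds with l = ±η/2 for both counters: at the threshold the exponent is X(−η²/2 +
η²/4) = −Xη²/4. The union bound over the four tails is an inequality on each branch. -/
theorem sum_goodCounts {L : List Config} {η : ℝ} (hη : 0 ≤ η) (hη1 : η ≤ 1)
    (hL : ∀ Φ, IsSuper B o k X Φ →
      (L.map fun c => c.weight * Φ (2 * X) (c.mem 23 0) (c.mem 23 1)).sum ≤ Φ 0 0 0) :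
    1 - 4 * Real.exp (-(X * η ^ 2 / 4)) ≤
      (L.map (Set.indicator {c | GoodCounts B o k X η c.mem} Config.weight)).sum := by
  classical
  have hl : |η / 2| ≤ 1 := by rw [abs_le]; constructor <;> linarith
  have hl' : |-(η / 2)| ≤ 1 := by rw [abs_neg]; exact hl
  set p₀ := trialProb B o k X 0
  set p₁ := trialProb B o k X 1
  set E := Real.exp (-(X * η ^ 2 / 4))
  have hc0 : X - (2 * X + 1) / 2 = 0 := by omega
  have hc1 : X - 2 * X / 2 = 0 := by omega
  have hz : (0 + 1) / 2 = 0 := rfl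
  have t1 := hL _ (isSuper_zero hl (η / 2 * (X * (p₀ + η))))
  have t2 := hL _ (isSuper_zero hl' (-(η / 2) * (X * (p₀ - η))))
  have t3 := hL _ (isSuper_one hl (η / 2 * (X * (p₁ + η))))
  have t4 := hL _ (isSuper_one hl' (-(η / 2) * (X * (p₁ - η))))
  -- The constant −1 yields that the total weight of the branches is at least one.
  have t5 := hL (fun _ _ _ => -1) (fun t _ a b => by apply le_of_eq; ring)
  simp only [hc0, hc1, hz, Nat.cast_zero, mul_zero, add_zero, Nat.sub_zero,
    zero_sub] at t1 t2 t3 t4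
  have b1 : Real.exp (-(η / 2 * (X * (p₀ + η))) + (η / 2 * p₀ + (η / 2) ^ 2) * X) = E := by
    simp only [E]; congr 1; ring
  have b2 : Real.exp (-(-(η / 2) * (X * (p₀ - η))) + (-(η / 2) * p₀ + (-(η / 2)) ^ 2) * X) = E := by
    simp only [E]; congr 1; ring
  have b3 : Real.exp (-(η / 2 * (X * (p₁ + η))) + (η / 2 * p₁ + (η / 2) ^ 2) * X) = E := by
    simp only [E]; congr 1; ring
  have b4 : Real.exp (-(-(η / 2) * (X * (p₁ - η))) + (-(η / 2) * p₁ + (-(η / 2)) ^ 2) * X) = E := by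
    simp only [E]; congr 1; ring
  rw [b1] at t1
  rw [b2] at t2
  rw [b3] at t3
  rw [b4] at t4
  -- On a good branch the negative weight appears on both sides; on a bad one some exponential is at
  -- least 1 and pays for it.
  have key : ∀ c : Config, -(Set.indicator {c | GoodCounts B o k X η c.mem} Config.weight c) ≤
      c.weight * (-1) +
      c.weight * Real.exp (η / 2 * (c.mem 23 0 : ℕ) - η / 2 * (X * (p₀ + η))) +
      c.weight * Real.exp (-(η / 2) * (c.mem 23 0 : ℕ) - -(η / 2) * (X * (p₀ - η))) +
      c.weight * Real.exp (η / 2 * (c.mem 23 1 : ℕ) - η / 2 * (X * (p₁ + η))) +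
      c.weight * Real.exp (-(η / 2) * (c.mem 23 1 : ℕ) - -(η / 2) * (X * (p₁ - η))) := by
    intro c
    have hw : 0 ≤ c.weight := normSq_nonneg _
    have g : ∀ y : ℝ, 0 ≤ c.weight * Real.exp y := fun y => mul_nonneg hw (Real.exp_pos y).le
    have g1 : ∀ y : ℝ, 0 ≤ y → c.weight ≤ c.weight * Real.exp y := fun y hy =>
      le_mul_of_one_le_right hw (Real.one_le_exp hy)
    have g2 := g (η / 2 * (c.mem 23 0 : ℕ) - η / 2 * (X * (p₀ + η)))
    have g3 := g (-(η / 2) * (c.mem 23 0 : ℕ) - -(η / 2) * (X * (p₀ - η)))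
    have g4 := g (η / 2 * (c.mem 23 1 : ℕ) - η / 2 * (X * (p₁ + η)))
    have g5 := g (-(η / 2) * (c.mem 23 1 : ℕ) - -(η / 2) * (X * (p₁ - η)))
    by_cases hg : GoodCounts B o k X η c.mem
    · rw [Set.indicator_of_mem (by exact hg)]
      linarith
    · rw [Set.indicator_of_notMem (by exact hg)]
      have h2 : 0 ≤ η / 2 := by linarith
      rw [GoodCounts, not_and_or, not_le, not_le, lt_abs, lt_abs] at hg
      rcases hg with (h | h) | (h | h)
      · have := g1 (η / 2 * (c.mem 23 0 : ℕ) - η / 2 * (X * (p₀ + η))) (by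
          have := mul_nonneg h2 (by linarith : 0 ≤ (c.mem 23 0 : ℝ) - X * (p₀ + η))
          linarith)
        linarith
      · have := g1 (-(η / 2) * (c.mem 23 0 : ℕ) - -(η / 2) * (X * (p₀ - η))) (by
          have := mul_nonneg h2 (by linarith : 0 ≤ X * (p₀ - η) - (c.mem 23 0 : ℝ))
          linarith)
        linarith
      · have := g1 (η / 2 * (c.mem 23 1 : ℕ) - η / 2 * (X * (p₁ + η))) (by
          have := mul_nonneg h2 (by linarith : 0 ≤ (c.mem 23 1 : ℝ) - X * (p₁ + η))
          linarith)
        linarith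
      · have := g1 (-(η / 2) * (c.mem 23 1 : ℕ) - -(η / 2) * (X * (p₁ - η))) (by
          have := mul_nonneg h2 (by linarith : 0 ≤ X * (p₁ - η) - (c.mem 23 1 : ℝ))
          linarith)
        linarith
  have hsum := List.sum_le_sum (l := L) fun c _ => key c
  rw [List.sum_map_add, List.sum_map_add, List.sum_map_add, List.sum_map_add] at hsum
  have hneg : ∀ (f : Config → ℝ) (L : List Config),
      (L.map fun c => -f c).sum = -(L.map f).sum := fun f L => by
    induction L with
    | nil => simp
    | cons c L ih => simp only [List.map_cons, List.sum_cons, ih, neg_add]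
  rw [hneg] at hsum
  linarith

/-! ## Accuracy -/

/-- The amplitude that determines the Jones polynomial. -/
noncomputable def exactAmp (k : ℕ) (B : BraidWord n) (o : Fin n → Bool) : ℂ :=
  turn (braidPhase k B o) (4 * k) *
    braidUnitary (unitVec k) k B (Pi.single (altPath n) 1) (altPath n)

/-- The amplitude that the algorithm estimates. -/
noncomputable def approxAmp (k X : ℕ) (B : BraidWord n) (o : Fin n → Bool) : ℂ :=
  turn (braidPhase k B o) (4 * k) *
    braidUnitary (approxVec k X) k B (Pi.single (altPath n) 1) (altPath n)

theorem norm_exactAmp_le (hk : 3 ≤ k) (B : BraidWord n) (o : Fin n → Bool) :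
    ‖exactAmp k B o‖ ≤ 1 := by
  rw [exactAmp, norm_mul, norm_turn, one_mul]
  refine (norm_le_l2 _ _).trans ?_
  rw [l2_braidUnitary (isUnitFamily_unitVec hk), l2_single]

theorem norm_approxAmp_sub_le (hk : 3 ≤ k) (hX : 0 < X) (hX2 : Even X) (B : BraidWord n)
    (o : Fin n → Bool) :
    ‖approxAmp k X B o - exactAmp k B o‖ ≤ 8 * Real.sqrt (20 / X) * B.length := by
  rw [exactAmp, approxAmp, ← mul_sub, norm_mul, norm_turn, one_mul]
  refine (norm_le_l2 (braidUnitary (approxVec k X) k B (Pi.single (altPath n) 1) -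
    braidUnitary (unitVec k) k B (Pi.single (altPath n) 1)) (altPath n)).trans ?_
  have := l2_braidUnitary_sub_le (isUnitFamily_approxVec k X) (isUnitFamily_unitVec hk)
    (abs_approxVec_sub_le hk hX hX2) k B (Pi.single (altPath n) 1)
  rwa [l2_single, mul_one] at this

theorem trialProb_zero (B : BraidWord n) (o : Fin n → Bool) (k X : ℕ) :
    trialProb B o k X 0 = (1 - (approxAmp k X B o).re) / 2 := by
  simp [trialProb, testVec, approxAmp]

theorem trialProb_one (hk : k ≠ 0) (B : BraidWord n) (o : Fin n → Bool) (X : ℕ) :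
    trialProb B o k X 1 = (1 - (approxAmp k X B o).im) / 2 := by
  have h : turn (3 * k) (4 * k) = -Complex.I := by
    rw [mul_comm 3, mul_comm 4, turn_mul_mul hk, turn_three_four]
  rw [trialProb, testVec, Nat.one_mod, mul_one, ← turn_mul, h, approxAmp]
  simp only [Pi.smul_apply, smul_eq_mul]
  rw [mul_assoc, mul_comm (-Complex.I) (braidUnitary _ _ _ _ _), ← mul_assoc]
  generalize turn (braidPhase k B o) (4 * k) * _ = z
  simp

/-- The estimate obtained from the counters. -/
noncomputable def estimate (X c₀ c₁ : ℕ) : ℂ :=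
  ((1 - 2 * (c₀ : ℝ) / X : ℝ) : ℂ) + ((1 - 2 * (c₁ : ℝ) / X : ℝ) : ℂ) * Complex.I

/-- An outcome probability is (1 − y)/2, so a deviation η of the frequency becomes 2η in the real
and in the imaginary part. -/
theorem norm_estimate_sub_le (hk : k ≠ 0) (hX : 0 < X) {η : ℝ} {M : Mem}
    (hM : GoodCounts B o k X η M) :
    ‖estimate X (M 23 0) (M 23 1) - approxAmp k X B o‖ ≤ 4 * η := by
  have hX' : (0 : ℝ) < X := by exact_mod_cast hX
  obtain ⟨h0, h1⟩ := hM
  rw [trialProb_zero] at h0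
  rw [trialProb_one hk] at h1
  set z := approxAmp k X B o
  have key : ∀ {c : ℕ} {y : ℝ}, |(c : ℝ) - X * ((1 - y) / 2)| ≤ X * η →
      |1 - 2 * (c : ℝ) / X - y| ≤ 2 * η := by
    intro c y h
    have e : 1 - 2 * (c : ℝ) / X - y = -(2 / X) * ((c : ℝ) - X * ((1 - y) / 2)) := by
      field_simp; ring
    rw [e, abs_mul, abs_neg, abs_of_pos (by positivity : (0 : ℝ) < 2 / X)]
    calc _ ≤ 2 / X * (X * η) := mul_le_mul_of_nonneg_left h (by positivity)
      _ = 2 * η := by field_simp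
  have k0 := key h0
  have k1 := key h1
  refine (Complex.norm_le_abs_re_add_abs_im _).trans ?_
  have e0 : (estimate X (M 23 0) (M 23 1) - z).re = 1 - 2 * (M 23 0 : ℝ) / X - z.re := by
    simp only [estimate, Complex.sub_re, Complex.add_re, Complex.re_ofReal_mul, Complex.ofReal_re,
      Complex.I_re, mul_zero, add_zero]
  have e1 : (estimate X (M 23 0) (M 23 1) - z).im = 1 - 2 * (M 23 1 : ℝ) / X - z.im := by
    simp only [estimate, Complex.sub_im, Complex.add_im, Complex.im_ofReal_mul, Complex.ofReal_im,
      Complex.I_im, mul_one, zero_add]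
  rw [e0, e1]
  linarith

/-- Table entries overestimate λ_1 and λ_2, relative to the common scale, by a factor between 1 and
1 + 1/X. Their quotient is therefore within that factor of d on both sides. -/
theorem sineOf_bounds (hk : 3 ≤ k) (hX : 0 < X) :
    0 < (sineOf k X 1 : ℝ) ∧ 0 < (sineOf k X 2 : ℝ) ∧
    (sineOf k X 2 : ℝ) / sineOf k X 1 ≤ dReal k * (1 + 1 / X) ∧
    dReal k ≤ (1 + 1 / X) * ((sineOf k X 2 : ℝ) / sineOf k X 1) := by
  have hX' : (0 : ℝ) < X := by exact_mod_cast hX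
  have hk' : (0 : ℝ) < k := by exact_mod_cast (by omega : 0 < k)
  have hb0 : 0 < 2 * k * X := by positivity
  have hC := sineScale_pos hb0 X
  have hd := dReal_pos hk
  have bl : ∀ z' : ℕ, z' ≤ k → sineScale (2 * k * X) X * lam k z' ≤ sineOf k X z' ∧
      (sineOf k X z' : ℝ) ≤ (1 + 1 / X) * (sineScale (2 * k * X) X * lam k z') := fun z' hz' => by
    have h1 := sineTable_bounds (J := X) (a := 2 * X * z') hb0 hX (by
      rw [show 2 * k * X = 2 * X * k by ring]; exact Nat.mul_le_mul_left _ hz')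
    have h2 : Real.sin (Real.pi * (2 * X * z' : ℕ) / (2 * k * X : ℕ)) = lam k z' := by
      rw [lam]; congr 1; push_cast; field_simp
    rwa [h2] at h1
  have hl1 : 0 < lam k 1 := lam_pos le_rfl (by omega)
  have hl2 : lam k 2 = dReal k * lam k 1 := by
    have := lam_add_lam k 1
    norm_num at this
    rw [lam_zero, add_zero] at this
    exact this
  have b1 := bl 1 (by omega)
  have b2 := bl 2 (by omega)
  rw [Nat.cast_one] at b1
  rw [Nat.cast_ofNat, hl2] at b2
  have p1 : 0 < (sineOf k X 1 : ℝ) := lt_of_lt_of_le (mul_pos hC hl1) b1.1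
  have p2 : 0 < (sineOf k X 2 : ℝ) := lt_of_lt_of_le (by positivity) b2.1
  refine ⟨p1, p2, ?_, ?_⟩
  · rw [div_le_iff₀ p1]
    have := mul_le_mul_of_nonneg_left b1.1 (by positivity : 0 ≤ dReal k * (1 + 1 / (X : ℝ)))
    linarith [b2.2]
  · rw [← mul_div_assoc, le_div_iff₀ p1]
    have h1 := mul_le_mul_of_nonneg_left b1.2 hd.le
    have h2 := mul_le_mul_of_nonneg_left b2.1 (by positivity : 0 ≤ 1 + 1 / (X : ℝ))
    linarith

/-- The upper bound is immediate; the lower one uses 1/ρ^e ≥ 2 − ρ^e. -/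
theorem pow_ratio_bounds {d R ρ : ℝ} (hd : 0 < d) (hR : 0 < R) (h1 : R ≤ d * ρ)
    (h2 : d ≤ ρ * R) (hρ : 1 ≤ ρ) (e : ℕ) :
    R ^ e ≤ d ^ e * ρ ^ e ∧ |R ^ e - d ^ e| ≤ d ^ e * (ρ ^ e - 1) := by
  have hp : 1 ≤ ρ ^ e := one_le_pow₀ hρ
  have hde : 0 < d ^ e := pow_pos hd e
  have k1 : R ^ e ≤ d ^ e * ρ ^ e := by
    rw [← mul_pow]; exact pow_le_pow_left₀ hR.le h1 e
  have k2 : d ^ e ≤ ρ ^ e * R ^ e := by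
    rw [← mul_pow]; exact pow_le_pow_left₀ hd.le h2 e
  refine ⟨k1, abs_le.2 ⟨?_, by linarith⟩⟩
  by_contra hcon
  rw [not_le] at hcon
  have k3 : R ^ e < d ^ e * (2 - ρ ^ e) := by linarith
  have k4 := mul_lt_mul_of_pos_left k3 (lt_of_lt_of_le one_pos hp)
  nlinarith [mul_nonneg hde.le (sq_nonneg (ρ ^ e - 1))]

theorem one_add_inv_pow_le (hX : 0 < X) {e : ℕ} (he : 2 * e ≤ X) :
    (1 + 1 / (X : ℝ)) ^ e ≤ 1 + 2 * e / X := by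
  have hX' : (0 : ℝ) < X := by exact_mod_cast hX
  have he' : 2 * (e : ℝ) ≤ X := by exact_mod_cast he
  have h1 : (e : ℝ) / X ≤ 1 := by
    rw [div_le_one hX']
    have : (0 : ℝ) ≤ e := Nat.cast_nonneg e
    linarith
  have h0 : 0 ≤ (e : ℝ) / X := by positivity
  calc (1 + 1 / (X : ℝ)) ^ e ≤ (Real.exp (1 / X)) ^ e :=
        pow_le_pow_left₀ (by positivity) (by have := Real.add_one_le_exp (1 / (X : ℝ)); linarith) e
    _ = Real.exp (e / X) := by rw [← Real.exp_nat_mul]; congr 1; ring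
    _ ≤ 1 + e / X + (e / X) ^ 2 := exp_le_one_add_add_sq (by rw [abs_of_nonneg h0]; exact h1)
    _ ≤ 1 + 2 * e / X := by
      have : ((e : ℝ) / X) ^ 2 ≤ e / X := by nlinarith
      have e2 : 2 * (e : ℝ) / X = e / X + e / X := by ring
      linarith

/-- The error splits into that of the amplitude, multiplied by R^e ≤ 2d^e, and that of the power of
d, multiplied by an exact amplitude of modulus at most one. -/
theorem norm_output_sub_le (hk : 3 ≤ k) (hX : 0 < X) (hX2 : Even X) (hn : Even n) (hn0 : 0 < n)
    (hnX : n ≤ X) {η : ℝ} {M : Mem} (hM : GoodCounts B o k X η M) :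
    ‖((sineOf k X 2 : ℝ) / sineOf k X 1 : ℝ) ^ (n / 2 - 1) * estimate X (M 23 0) (M 23 1) -
      jonesPlat B o (rootA k)‖ ≤ dReal k ^ (n / 2 - 1) *
        (2 * (4 * η + 8 * Real.sqrt (20 / X) * B.length) + n / X) := by
  obtain ⟨p1, p2, r1, r2⟩ := sineOf_bounds hk hX
  have hX' : (0 : ℝ) < X := by exact_mod_cast hX
  have hd := dReal_pos hk
  set R : ℝ := (sineOf k X 2 : ℝ) / sineOf k X 1
  have hR : 0 < R := div_pos p2 p1
  set e := n / 2 - 1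
  have he : 2 * e ≤ n := by omega
  have he' : 2 * (e : ℝ) ≤ n := by exact_mod_cast he
  have hρ := one_add_inv_pow_le hX (he.trans hnX)
  have hnX' : (n : ℝ) / X ≤ 1 := by rw [div_le_one hX']; exact_mod_cast hnX
  have he2 : 2 * (e : ℝ) / X ≤ n / X := div_le_div_of_nonneg_right he' hX'.le
  obtain ⟨q1, q2⟩ := pow_ratio_bounds hd hR r1 r2 (le_add_of_nonneg_right (by positivity)) e
  have hde : 0 < dReal k ^ e := pow_pos hd e
  have q1' : R ^ e ≤ dReal k ^ e * 2 := q1.trans (mul_le_mul_of_nonneg_left (by linarith) hde.le)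
  have q2' : |R ^ e - dReal k ^ e| ≤ dReal k ^ e * (n / X) :=
    q2.trans (mul_le_mul_of_nonneg_left (by linarith) hde.le)
  rw [jonesPlat_eq hk hn hn0]
  change ‖((R : ℝ) : ℂ) ^ e * estimate X (M 23 0) (M 23 1) - (dReal k : ℂ) ^ e * exactAmp k B o‖ ≤ _
  set s := estimate X (M 23 0) (M 23 1)
  have hs : ‖s - exactAmp k B o‖ ≤ 4 * η + 8 * Real.sqrt (20 / X) * B.length := by
    have h1 := norm_estimate_sub_le (by omega) hX hM
    have h2 := norm_approxAmp_sub_le hk hX hX2 B o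
    have h3 := norm_add_le (s - approxAmp k X B o) (approxAmp k X B o - exactAmp k B o)
    rw [sub_add_sub_cancel] at h3
    linarith
  have hsplit : ((R : ℝ) : ℂ) ^ e * s - (dReal k : ℂ) ^ e * exactAmp k B o =
      ((R ^ e : ℝ) : ℂ) * (s - exactAmp k B o) +
        ((R ^ e - dReal k ^ e : ℝ) : ℂ) * exactAmp k B o := by push_cast; ring
  rw [hsplit]
  refine (norm_add_le _ _).trans ?_
  rw [norm_mul, norm_mul, Complex.norm_real, Complex.norm_real, Real.norm_eq_abs, Real.norm_eq_abs,
    abs_of_pos (pow_pos hR e)]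
  have f1 : R ^ e * ‖s - exactAmp k B o‖ ≤ dReal k ^ e * 2 *
      (4 * η + 8 * Real.sqrt (20 / X) * B.length) :=
    mul_le_mul q1' hs (norm_nonneg _) (by positivity)
  have f2 : |R ^ e - dReal k ^ e| * ‖exactAmp k B o‖ ≤ dReal k ^ e * (n / X) * 1 :=
    mul_le_mul q2' (norm_exactAmp_le hk B o) (norm_nonneg _) (by positivity)
  linarith

end

end Jones


/-! ## The algorithm -/

open QState

namespace Jones

/-- The classical precomputation; `e` computes the precision. -/
def setupProg (e : Expr) : Prog :=
  .block [.set 5 e, .set 6 (2 * kE * xE), tableProg, angleProg, phaseProg]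

/-- The whole algorithm; `e` computes the precision. -/
def mainProg (e : Expr) : Prog := .seq (setupProg e) (.seq trialLoop outputProg)

section
variable {n k X S Y : ℕ} {B : BraidWord n} {o : Fin n → Bool}

/-- Later stages only reuse scratch variables of the earlier ones and leave their results intact. -/
theorem wp_setupProg (h : Bounds n B.length k X S Y) {e : Expr} {M : Mem} {ψ : QState}
    {Q : Mem → QState → Prop} (he : e.val M = X) (h0 : M 0 0 = n) (h1 : M 0 1 = B.length)
    (h2 : M 0 2 = k) (hB : BraidIn B M) (ho : ∀ i : Fin n, M 1 i = (o i).toNat)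
    (hQ : ∀ M', (∀ a ∈ [18, 23], M' a = M a) → Prepared B o k X M' → Q M' ψ) :
    WP S Y (setupProg e) Q M ψ := by
  have hS := h.one_le
  have hXY : X ≤ Y := by have := h.le_Y; omega
  have hb := h.b_le
  set M₁ := memSet M 5 0 X with hM₁
  set M₂ := memSet M₁ 6 0 (2 * k * X) with hM₂
  have e6 : (2 * kE * xE : Expr).val M₁ = 2 * k * X := by
    rw [Expr.val_mul, Expr.val_mul, Expr.val_ofNat, kE, Expr.val_read, Expr.val_ofNat, xE,
      Expr.val_var, hM₁, memSet_of_ne _ _ _ (by decide), h2, memSet_apply, if_pos ⟨rfl, rfl⟩]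
  have hf : ∀ a, a ≠ 5 → a ≠ 6 → M₂ a = M a := fun a h5 h6 => by
    rw [hM₂, memSet_of_ne _ _ _ h6, hM₁, memSet_of_ne _ _ _ h5]
  have hP : Params n B.length k X M₂ := by
    refine ⟨?_, ?_, ?_, ?_, ?_⟩
    · rw [hf 0 (by decide) (by decide), h0]
    · rw [hf 0 (by decide) (by decide), h1]
    · rw [hf 0 (by decide) (by decide), h2]
    · rw [hM₂, memSet_of_ne _ _ _ (by decide), hM₁, memSet_apply, if_pos ⟨rfl, rfl⟩]
    · rw [hM₂, memSet_apply, if_pos ⟨rfl, rfl⟩]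
  have hPf : ∀ M' : Mem, M' 0 = M₂ 0 → M' 5 = M₂ 5 → M' 6 = M₂ 6 →
      Params n B.length k X M' := fun M' a b c => by
    obtain ⟨q0, q1, q2, q3, q4⟩ := hP
    exact ⟨by rw [a, q0], by rw [a, q1], by rw [a, q2], by rw [b, q3], by rw [c, q4]⟩
  refine WP.block_cons (WP.set hS (by rw [he]; exact h.lt_of_le hXY) ?_)
  rw [he]
  refine WP.block_cons (WP.set hS (by rw [e6]; exact h.lt_of_le (by omega)) ?_)
  rw [e6]
  refine WP.block_cons (wp_tableProg h hP fun M₃ f₃ t₃ => ?_)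
  have hP₃ := hPf M₃ (f₃ 0 (by decide)) (f₃ 5 (by decide)) (f₃ 6 (by decide))
  refine WP.block_cons (wp_angleProg h hP₃ t₃ fun M₄ f₄ t₄ => ?_)
  have hP₄ := hPf M₄ ((f₄ 0 (by decide)).trans (f₃ 0 (by decide)))
    ((f₄ 5 (by decide)).trans (f₃ 5 (by decide))) ((f₄ 6 (by decide)).trans (f₃ 6 (by decide)))
  have f₄' : ∀ a ∈ [1, 2, 3, 18, 23], M₄ a = M a := fun a ha => by
    refine (f₄ a (by revert a; decide)).trans ((f₃ a (by revert a; decide)).trans (hf a ?_ ?_)) <;>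
      (rintro rfl; revert ha; decide)
  refine WP.block_cons (wp_phaseProg (o := o) h hP₄ ⟨fun j hj => ?_, fun j hj => ?_⟩ (fun i => ?_)
    fun M₅ f₅ t₅ => WP.block_nil (hQ M₅ (fun a ha => ?_) ⟨?_, ⟨fun j hj => ?_, fun j hj => ?_⟩,
      fun z hz => ?_, t₅, fun a ha => ?_⟩))
  · rw [f₄' 2 (by decide), hB.1 j hj]
  · rw [f₄' 3 (by decide), hB.2 j hj]
  · rw [f₄' 1 (by decide), ho]
  · rw [f₅ a (by revert a; decide), f₄' a (by revert a; decide)]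
  · exact hPf M₅ ((f₅ 0 (by decide)).trans ((f₄ 0 (by decide)).trans (f₃ 0 (by decide))))
      ((f₅ 5 (by decide)).trans ((f₄ 5 (by decide)).trans (f₃ 5 (by decide))))
      ((f₅ 6 (by decide)).trans ((f₄ 6 (by decide)).trans (f₃ 6 (by decide))))
  · rw [f₅ 2 (by decide), f₄' 2 (by decide), hB.1 j hj]
  · rw [f₅ 3 (by decide), f₄' 3 (by decide), hB.2 j hj]
  · rw [f₅ 11 (by decide), t₄ z hz]
  · rw [f₅ 7 (by decide), f₄ 7 (by decide), t₃ a ha]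

/-! ### The initial configuration -/

theorem init_mem_one (i : Fin n) : (Config.init B o k).mem 1 i = (o i).toNat := by
  simp [Config.init, List.getD]

theorem braidIn_init : BraidIn B (Config.init B o k).mem := by
  constructor <;> intro j hj <;> simp [Config.init, List.getD, hj]

theorem memBd_init (h : Bounds n B.length k X S Y) : MemBd S (Config.init B o k).mem := by
  obtain ⟨-, -, hn, -, hk, hm⟩ := h.le_Y
  have getD_le : ∀ (l : List ℕ) (i : ℕ), (∀ a ∈ l, a ≤ Y) → l.getD i 0 ≤ Y := fun l i hl => by
    rw [List.getD_eq_getElem?_getD]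
    rcases lt_or_ge i l.length with hi | hi
    · simpa [hi] using hl _ (List.getElem_mem hi)
    · simp [hi]
  have hb : ∀ b : Bool, b.toNat ≤ Y := fun b => by have := Bool.toNat_le b; omega
  intro a i
  refine h.lt_of_le ?_
  rcases a with _ | _ | _ | _ | a
  · refine getD_le _ _ fun a ha => ?_
    simp only [List.mem_cons, List.not_mem_nil, or_false] at ha
    omega
  · refine getD_le _ _ fun a ha => ?_
    obtain ⟨p, rfl⟩ := (List.mem_ofFn' _ _).1 ha
    exact hb _
  · refine getD_le _ _ fun a ha => ?_
    obtain ⟨c, -, rfl⟩ := List.mem_map.1 ha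
    have := c.hi
    omega
  · refine getD_le _ _ fun a ha => ?_
    obtain ⟨c, -, rfl⟩ := List.mem_map.1 ha
    exact hb _
  · exact Nat.zero_le _

/-! ### Correctness -/

theorem output_eq {c : Config} {D D' c₀ c₁ : ℕ} (hX : 0 < X) (h0 : c.mem 4 0 = X * D)
    (h2 : c.mem 4 2 = X * D) (h1 : c.mem 4 1 = 2 * c₀ * D) (h3 : c.mem 4 3 = 2 * c₁ * D)
    (h4 : c.mem 4 4 = X * D') : c.output = (D : ℂ) / D' * estimate X c₀ c₁ := by
  have hX' : (X : ℂ) ≠ 0 := by exact_mod_cast hX.ne'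
  rw [Config.output, h0, h1, h2, h3, h4, estimate]
  push_cast
  rcases eq_or_ne (D' : ℂ) 0 with h | h
  · simp [h]
  · field_simp

/-- The running time of the algorithm and the distribution of its output. -/
theorem exec_mainProg (h : Bounds n B.length k X S Y) {e : Expr} {η : ℝ} (hη : 0 ≤ η) (hη1 : η ≤ 1)
    (he : e.val (Config.init B o k).mem = X) (G : Config → Prop)
    (hG : ∀ (c : Config) (M : Mem), GoodCounts B o k X η M →
      c.output = (((sineOf k X 2 : ℝ) / sineOf k X 1 : ℝ) : ℂ) ^ (n / 2 - 1) *
        estimate X (M 23 0) (M 23 1) → G c) :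
    ∃ L, Exec (mainProg e) (Config.init B o k) L ∧
      (∀ c ∈ L, c.time ≤ (mainProg e).timeBound S Y) ∧
      1 - 4 * Real.exp (-(X * η ^ 2 / 4)) ≤ branchProb L G := by
  have hw := wp_setupProg h (ψ := (Config.init B o k).qstate)
    (Q := fun M' ψ' => ψ' = Finsupp.single ∅ 1 ∧ M' 18 0 = 0 ∧ M' 23 0 = 0 ∧ M' 23 1 = 0 ∧
      Prepared B o k X M') he rfl rfl rfl braidIn_init init_mem_one
    fun M' f hM' => ⟨rfl, by rw [f 18 (by decide)]; rfl, by rw [f 23 (by decide)]; rfl,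
      by rw [f 23 (by decide)]; rfl, hM'⟩
  obtain ⟨M₁, ψ₁, T₁, hex, hT₁, hbd, -, rfl, h18, h230, h231, hprep⟩ := hw (memBd_init h) 0
  have hI : TrialInv B o k X S 0 M₁ (Finsupp.single ∅ 1) :=
    ⟨hbd, hprep, h18, fun s hs => by
      have := Finsupp.support_single_subset hs
      rw [Finset.mem_singleton.1 this]
      intro q hq
      exact absurd hq (Finset.notMem_empty q), by omega, by omega⟩
  obtain ⟨L, hL, hL', hΦ⟩ := exec_trialLoop h (2 * X) 0 M₁ (Finsupp.single ∅ 1) T₁ (by omega) hI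
  have hout : ∀ c ∈ L, ∃ c' : Config, Exec outputProg c [c'] ∧
      c'.time ≤ c.time + outputProg.timeBound S Y ∧ c'.qstate = c.qstate ∧
      c'.output = (((sineOf k X 2 : ℝ) / sineOf k X 1 : ℝ) : ℂ) ^ (n / 2 - 1) *
        estimate X (c.mem 23 0) (c.mem 23 1) := by
    intro c hc
    have hi := (hL' c hc).1
    have hw := wp_outputProg h (M := c.mem) (ψ := c.qstate) (Q := fun M' ψ' => ψ' = c.qstate ∧
      ∀ τ, Config.output ⟨M', ψ', τ⟩ = (((sineOf k X 2 : ℝ) / sineOf k X 1 : ℝ) : ℂ) ^ (n / 2 - 1) *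
        estimate X (c.mem 23 0) (c.mem 23 1)) hi.prepared.params hi.prepared.table rfl rfl
      (by have := hi.count_zero; omega) (by have := hi.count_one; omega)
      fun M' a0 a2 a1 a3 a4 => ⟨rfl, fun τ => by
        rw [output_eq h.hX (c := ⟨M', c.qstate, τ⟩) a0 a2 a1 a3 a4]
        push_cast
        rw [div_pow]⟩
    obtain ⟨M', ψ', T', k1, k2, -, -, k3, k4⟩ := hw hi.bound c.time
    exact ⟨⟨M', ψ', T'⟩, k1, k2, k3, k4 T'⟩
  classical
  choose! g hg using hout
  refine ⟨_, Exec.seq_single hex (Exec.seq _ _ _ L (fun c => [g c]) hL fun c hc => (hg c hc).1),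
    fun c' hc' => ?_, ?_⟩
  · obtain ⟨c, hc, hc'⟩ := List.mem_flatMap.1 hc'
    rw [List.mem_singleton.1 hc']
    have t1 := (hg c hc).2.1
    have t2 := (hL' c hc).2
    have t3 : (2 * X + 1) * (1 + (Expr.lt (.var 18) (2 * xE)).costFactor * S +
        trialProg.timeBound S Y) ≤ trialLoop.timeBound S Y :=
      Nat.mul_le_mul_right _ (by have := h.le_Y; omega)
    have t4 : (mainProg e).timeBound S Y = (setupProg e).timeBound S Y +
      (trialLoop.timeBound S Y + outputProg.timeBound S Y) := rfl
    omega
  · have hnorm : normSq (Finsupp.single ∅ 1 : QState) = 1 := by simp [normSq]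
    -- The output stage has one branch per trial branch and keeps the quantum state, hence the
    -- weight, so the bound for good counts passes to good outputs.
    refine (sum_goodCounts (B := B) (o := o) (k := k) (L := L) hη hη1 fun Φ hs => ?_).trans ?_
    · have := hΦ Φ hs
      rwa [hnorm, one_mul, h230, h231] at this
    · rw [branchProb, List.map_flatMap]
      simp only [List.map_cons, List.map_nil]
      rw [← List.map_eq_flatMap]
      refine List.sum_le_sum fun c hc => ?_
      have hwt : (g c).weight = c.weight := by rw [Config.weight, (hg c hc).2.2.1, Config.weight]
      by_cases hgood : GoodCounts B o k X η c.mem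
      · rw [Set.indicator_of_mem (by exact hgood),
          Set.indicator_of_mem (by exact hG _ _ hgood (hg c hc).2.2.2), hwt]
      · rw [Set.indicator_of_notMem (by exact hgood)]
        exact Set.indicator_nonneg (fun _ _ => normSq_nonneg _) _

end

/-! ### Choice of the precision -/

theorem four_mul_exp_neg_le (p : ℕ) : 4 * Real.exp (-((p : ℝ) + 2)) ≤ (1 / 2) ^ p := by
  have h2 : Real.exp (-1) ≤ 1 / 2 := by
    rw [Real.exp_neg, one_div]
    exact inv_anti₀ (by norm_num) (by linarith [Real.add_one_le_exp (1 : ℝ)])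
  have h3 : Real.exp (-((p : ℝ) + 2)) = Real.exp (-1) ^ (p + 2) := by
    rw [← Real.exp_nat_mul]; congr 1; push_cast; ring
  rw [h3]
  have := pow_le_pow_left₀ (Real.exp_pos (-1)).le h2 (p + 2)
  rw [pow_add (1 / 2 : ℝ)] at this
  linarith

/-- Counting errors, angle errors and the error of the power of d contribute at most 1/(4q) each.
The constant 100000 exceeds 20 · 64², as needed for the square root. -/
theorem error_lt {n m q X : ℝ} (hn : 0 ≤ n) (hm : 0 ≤ m) (hq : 1 ≤ q)
    (hX : 100000 * q ^ 2 * (m + 1) ^ 2 * (n + 1) ≤ X) :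
    2 * (4 * (1 / (32 * q)) + 8 * Real.sqrt (20 / X) * m) + n / X < 1 / q := by
  have hq0 : 0 < q := by linarith
  have hX1 : 100000 * q ^ 2 * (m + 1) ^ 2 ≤ X :=
    le_trans (le_mul_of_one_le_right (by positivity) (by linarith)) hX
  have hX0 : 0 < X := lt_of_lt_of_le (by positivity) hX1
  have s1 : Real.sqrt (20 / X) ≤ 1 / (64 * q * (m + 1)) := by
    rw [Real.sqrt_le_left (by positivity), div_le_iff₀ hX0]
    have : 20 ≤ (1 / (64 * q * (m + 1))) ^ 2 * (100000 * q ^ 2 * (m + 1) ^ 2) := by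
      rw [show (1 / (64 * q * (m + 1))) ^ 2 * (100000 * q ^ 2 * (m + 1) ^ 2) = 100000 / 4096 by
        field_simp; norm_num]
      norm_num
    exact this.trans (mul_le_mul_of_nonneg_left hX1 (by positivity))
  have s2 : Real.sqrt (20 / X) * m ≤ 1 / (64 * q) := by
    refine (mul_le_mul_of_nonneg_right s1 hm).trans ?_
    rw [div_mul_eq_mul_div, one_mul, div_le_div_iff₀ (by positivity) (by positivity)]
    nlinarith
  have s3 : n / X ≤ 1 / (4 * q) := by
    rw [div_le_div_iff₀ hX0 (by positivity)]
    have hmm : 1 ≤ (m + 1) ^ 2 := by nlinarith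
    have hqq : q ≤ q ^ 2 := by nlinarith
    have : 100000 * q * 1 * (n + 1) ≤ X := le_trans (by gcongr) hX
    nlinarith [mul_nonneg hn hq0.le]
  have e1 : 1 / (32 * q) = (1 / q) / 32 := by field_simp
  have e2 : 1 / (64 * q) = (1 / q) / 64 := by field_simp
  have e3 : 1 / (4 * q) = (1 / q) / 4 := by field_simp
  have : 0 < 1 / q := by positivity
  rw [e1]
  rw [e2] at s2
  rw [e3] at s3
  linarith

/-- By `normN_eq` the right side is d^{n/2}/sin(π/k), and d ≥ 1 ≥ sin(π/k). -/
theorem dReal_pow_le {n k : ℕ} (hn : Even n) (hn0 : 0 < n) (hk : 3 ≤ k) :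
    dReal k ^ (n / 2 - 1) ≤ dReal k ^ (3 * n / 2) / normN n k := by
  have hk' : (3 : ℝ) ≤ k := by exact_mod_cast hk
  have hd := dReal_pos hk
  have hs : 0 < Real.sin (Real.pi / k) := Real.sin_pos_of_pos_of_lt_pi (by positivity)
    (div_lt_self Real.pi_pos (by linarith))
  obtain ⟨r, rfl⟩ := hn
  rw [normN_eq (by omega), show 3 * (r + r) / 2 = (r + r) + r by omega,
    show (r + r) / 2 - 1 = r - 1 by omega, pow_add, mul_div_mul_left _ _ (by positivity),
    le_div_iff₀ hs]
  calc dReal k ^ (r - 1) * Real.sin (Real.pi / k) ≤ dReal k ^ (r - 1) * 1 :=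
        mul_le_mul_of_nonneg_left (Real.sin_le_one _) (by positivity)
    _ ≤ dReal k ^ r := by
        rw [mul_one]; exact pow_le_pow_right₀ (one_le_dReal hk) (by omega)

end Jones

open Jones MvPolynomial in
theorem theorem2 (ε : ℕ → ℕ → ℕ → ℝ) (hε : IsInversePolynomial ε)
    (p : MvPolynomial (Fin 3) ℕ) :
    ∃ (P : Prog) (T : MvPolynomial (Fin 3) ℕ),
      ∀ (n k : ℕ), Even n → 0 < n → 3 ≤ k →
      ∀ (B : BraidWord n) (o : Fin n → Bool), IsPlatOrientation B o →
      ∃ L : List Config, Exec P (Config.init B o k) L ∧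
        (∀ c ∈ L, c.time ≤ polyAt T n B.length k) ∧
        1 - (1 / 2 : ℝ) ^ polyAt p n B.length k ≤
          branchProb L (fun c =>
            ‖c.output - jonesPlat B o (rootA k)‖ <
              ε n B.length k * dReal k ^ (3 * n / 2) / normN n k) := by
  obtain ⟨q, hq⟩ := hε
  -- The precision X: quadratic in 1/ε because of sampling and of the square root in the angles,
  -- (m+1)² for the angle errors accumulated over the crossings, n + 1 for the power of d, and p + 2
  -- for the failure probability. The factor 100000 also makes it even, as the angle search
  -- requires.
  set x : MvPolynomial (Fin 3) ℕ :=
    C 100000 * (q + 1) ^ 2 * (X 1 + 1) ^ 2 * (X 0 + 1) * (p + C 2) with hx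
  -- `y` bounds the loop lengths and `s` the bit lengths, in the form demanded by `Bounds`.
  set y : MvPolynomial (Fin 3) ℕ := C 20 * (X 2 + 1) * (x + 1) * (X 0 + 1) * (X 1 + 1) with hy
  set s : MvPolynomial (Fin 3) ℕ := C 4 * y ^ 3 + y ^ 2 + y + 1 with hs
  obtain ⟨e, he⟩ := exists_expr_polyAt x
  obtain ⟨T, hT⟩ := exists_polyAt_timeBound (mainProg e) s y
  refine ⟨mainProg e, T, fun n k hn hn0 hk B o _ => ?_⟩
  set m := B.length
  set N := polyAt x n m k with hN
  set Q := polyAt q n m k + 1 with hQ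
  have hNe : N = 100000 * Q ^ 2 * (m + 1) ^ 2 * (n + 1) * (polyAt p n m k + 2) := by
    simp only [hN, hx, hQ, polyAt_mul, polyAt_add, polyAt_pow, polyAt_C, polyAt_one, polyAt_X_zero,
      polyAt_X_one]
  have hye : polyAt y n m k = 20 * (k + 1) * (N + 1) * (n + 1) * (m + 1) := by
    simp only [hy, hN, polyAt_mul, polyAt_add, polyAt_C, polyAt_one, polyAt_X_zero,
      polyAt_X_one, polyAt_X_two]
  have hse : polyAt s n m k = 4 * polyAt y n m k ^ 3 + polyAt y n m k ^ 2 + polyAt y n m k + 1 := by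
    simp only [hs, polyAt_mul, polyAt_add, polyAt_pow, polyAt_C, polyAt_one]
  have hN0 : 0 < N := by rw [hNe]; positivity
  have hN2 : Even N := by
    rw [hNe]
    exact ((((even_iff_two_dvd.2 (by norm_num)).mul_right _).mul_right _).mul_right _).mul_right _
  have hnN : n ≤ N := by
    have h1 : 1 ≤ 100000 * Q ^ 2 * (m + 1) ^ 2 := Nat.succ_le_of_lt (by positivity)
    have h2 := Nat.mul_le_mul h1 (Nat.le_succ n)
    have h3 := Nat.mul_le_mul h2 (by omega : 1 ≤ polyAt p n m k + 2)
    rw [hNe]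
    linarith
  have hb : Bounds n m k N (polyAt s n m k) (polyAt y n m k) := ⟨hk, hN0, hye.ge, hse.ge⟩
  have hQ1 : (1 : ℝ) ≤ Q := by rw [hQ]; push_cast; linarith [(polyAt q n m k).cast_nonneg (α := ℝ)]
  have hNr : (N : ℝ) = 100000 * (Q : ℝ) ^ 2 * ((m : ℝ) + 1) ^ 2 * ((n : ℝ) + 1) *
      ((polyAt p n m k : ℝ) + 2) := by rw [hNe]; push_cast; ring
  have hp0 : (0 : ℝ) ≤ polyAt p n m k := Nat.cast_nonneg _
  -- The admissible deviation η = 1/(32Q) of the frequencies is the one for which `error_lt` leaves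
  -- room for the other errors.
  obtain ⟨L, h1, h2, h3⟩ := exec_mainProg (o := o) hb (η := 1 / (32 * Q)) (by positivity)
    (by rw [div_le_one (by positivity)]; linarith) (he _)
    (fun c => ‖c.output - jonesPlat B o (rootA k)‖ <
      ε n m k * dReal k ^ (3 * n / 2) / normN n k) (fun c M hM hc => by
      rw [hc]
      refine (norm_output_sub_le hk hN0 hN2 hn hn0 hnN hM).trans_lt ?_
      have hε' := hq n m k hn0 (by omega)
      have hd := dReal_pos hk
      have hlt := error_lt (n := n) (m := m) (q := Q) (X := N) (Nat.cast_nonneg _)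
        (Nat.cast_nonneg _) hQ1 (by
          rw [hNr]; exact le_mul_of_one_le_right (by positivity) (by linarith))
      have hQε : 1 / (Q : ℝ) ≤ ε n m k := by rw [hQ]; push_cast; exact hε'
      have hQ0 : 0 < 1 / (Q : ℝ) := by positivity
      calc _ < dReal k ^ (n / 2 - 1) * (1 / Q) := mul_lt_mul_of_pos_left hlt (by positivity)
        _ ≤ dReal k ^ (3 * n / 2) / normN n k * ε n m k :=
          mul_le_mul (dReal_pow_le hn hn0 hk) hQε hQ0.le
            ((pow_pos hd _).le.trans (dReal_pow_le hn hn0 hk))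
        _ = _ := by ring)
  refine ⟨L, h1, fun c hc => (h2 c hc).trans (hT n m k).le, le_trans ?_ h3⟩
  -- With 4 · 32² = 4096, the exponent Xη²/4 is at least (100000/4096)(p + 2), and
  -- `four_mul_exp_neg_le` absorbs the factor 4 of the union bound.
  have hexp : Real.exp (-(N * (1 / (32 * (Q : ℝ))) ^ 2 / 4)) ≤
      Real.exp (-((polyAt p n m k : ℝ) + 2)) := by
    rw [Real.exp_le_exp, neg_le_neg_iff]
    have hQ0 : (0 : ℝ) < Q := by linarith
    rw [hNr, show 100000 * (Q : ℝ) ^ 2 * ((m : ℝ) + 1) ^ 2 * ((n : ℝ) + 1) *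
      ((polyAt p n m k : ℝ) + 2) * (1 / (32 * Q)) ^ 2 / 4 = (100000 / 4096) *
      (((m : ℝ) + 1) ^ 2 * ((n : ℝ) + 1)) * ((polyAt p n m k : ℝ) + 2) by field_simp; norm_num]
    refine le_mul_of_one_le_left (by positivity) ?_
    have : (1 : ℝ) ≤ ((m : ℝ) + 1) ^ 2 * ((n : ℝ) + 1) :=
      one_le_mul_of_one_le_of_one_le (one_le_pow₀ (by simp)) (by simp)
    linarith
  linarith [four_mul_exp_neg_le (polyAt p n m k)]
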